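/- A binary tree in an undirected graph $G$ is a connected acyclic subgraph (with at least one vertex) all of whose vertices have degree at most $3$ in the subgraph; a maximum-sized binary tree is one with the maximum number of vertices. A tree decomposition of $G$ is a tree $\mathcal T$ with a set (bag) $X_i\subseteq V(G)$ for every tree node $i$, such that every vertex of $G$ lies in a bag, the two ends of every edge of $G$ lie in a common bag, and a vertex that lies in $X_i$ and $X_j$ lies in $X_k$ for all tree nodes $k$ on the path between $i$ and $j$; its width is $\max_i |X_i|-1$. Theorem. There is an algorithm that, given a finite simple undirected graph $G$ with $n\ge 1$ vertices (as a list of its edges) and a tree decomposition of $G$ of width $w$ with $N$ tree nodes (as the list of the edges of the tree and the list of the bags), finds a maximum-sized binary tree in $G$ in time $w^{O(w)}\cdot\max(n,N)$; that is, in time $w^{O(w)}\,n$ if, as is usual, the tree decomposition has $O(n)$ tree nodes. Precisely, there are a program $P$ for a random access machine (registers, a memory with random access that is zero outside the input at the start, unit cost for every arithmetic operation, comparison and register or memory access) and a constant $c\in\mathbb N$ such that for every such input, with $B=c\,(w+1)^{c w}\max(n,N)$, the program $P$ halts after at most $B$ steps, all numbers and addresses that occur in the run are at most $B$ (so words of $\log_2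 B+O(1)$ bits suffice), and at the end the memory holds the lists of the vertices and of the edges of a maximum-sized binary tree in $G$. -/

import Mathlib

/-! ## Binary trees in graphs and tree decompositions -/

namespace BinTree

/-- A subgraph `T` of `G` is a binary tree: connected (in particular nonempty), acyclic, and every
vertex of `T` has degree at most `3` in `T`. -/
def IsBinaryTree {V : Type*} {G : SimpleGraph V} (T : G.Subgraph) : Prop :=
  T.Connected ∧ T.coe.IsAcyclic ∧ ∀ v ∈ T.verts, (T.neighborSet v).ncard ≤ 3

/-- A binary tree in `G` with the maximum number of vertices. -/
def IsMaximumBinaryTree {V : Type*} {G : SimpleGraph V} (T : G.Subgraph) : Prop :=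
  IsBinaryTree T ∧ ∀ T' : G.Subgraph, IsBinaryTree T' → T'.verts.ncard ≤ T.verts.ncard

/-- A tree decomposition of `G` whose tree has node set `ι`. -/
structure TreeDecomposition {V : Type*} (G : SimpleGraph V) (ι : Type*) where
  /-- the tree -/
  tree : SimpleGraph ι
  isTree : tree.IsTree
  /-- the bag of a tree node -/
  bag : ι → Finset V
  /-- every vertex lies in some bag -/
  vertex_mem : ∀ v : V, ∃ i, v ∈ bag i
  /-- the two ends of every edge lie in a common bag -/
  edge_mem : ∀ u v : V, G.Adj u v → ∃ i, u ∈ bag i ∧ v ∈ bag i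
  /-- a vertex in two bags lies in all the bags on the path between them -/
  path_mem : ∀ (v : V) (i j : ι) (p : tree.Walk i j), p.IsPath → v ∈ bag i → v ∈ bag j →
    ∀ k ∈ p.support, v ∈ bag k

/-- The width: the maximum size of a bag, minus one. (The subtraction is a true one as soon as
`G` has a vertex.) -/
def TreeDecomposition.width {V ι : Type*} {G : SimpleGraph V} [Fintype ι]
    (D : TreeDecomposition G ι) : ℕ :=
  (Finset.univ.sup fun i => (D.bag i).card) - 1

end BinTree

/-! ## A random access machine

The machine has registers `r₀, r₁, …`, of which a program uses finitely many, and a memory with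
random access. All cells hold natural numbers. Programs have structured control flow. Every
operation that is carried out takes one unit of time. The machine has bounded words: a run on the
machine with word bound `B` may never compute, load or store a number, or use an address, that is
larger than `B`; a program that tries to do so has no run. -/

namespace RAM

/-- The contents of the registers and of the memory. -/
structure State where
  reg : ℕ → ℕ
  mem : ℕ → ℕ

/-- Arithmetic expressions over constants, registers and the memory. -/
inductive Exp where
  | const (k : ℕ)
  | reg (r : ℕ)
  | load (addr : Exp)
  | add (a b : Exp)
  | sub (a b : Exp)
  | mul (a b : Exp)
  | div (a b : Exp)
  | lt (a b : Exp)

/-- The value of an expression. Subtraction is truncated at zero, division is integer division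
(with value zero if the divisor is zero), and a comparison has the value `1` or `0`. -/
def Exp.eval (s : State) : Exp → ℕ
  | .const k => k
  | .reg r => s.reg r
  | .load a => s.mem (a.eval s)
  | .add a b => a.eval s + b.eval s
  | .sub a b => a.eval s - b.eval s
  | .mul a b => a.eval s * b.eval s
  | .div a b => a.eval s / b.eval s
  | .lt a b => if a.eval s < b.eval s then 1 else 0

/-- The time to evaluate an expression: the number of its constants, register accesses, memory
accesses and arithmetic operations. -/
def Exp.cost : Exp → ℕ
  | .const _ => 1
  | .reg _ => 1
  | .load a => a.cost + 1
  | .add a b => a.cost + b.cost + 1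
  | .sub a b => a.cost + b.cost + 1
  | .mul a b => a.cost + b.cost + 1
  | .div a b => a.cost + b.cost + 1
  | .lt a b => a.cost + b.cost + 1

/-- All the numbers that occur in the evaluation of the expression, the addresses of memory
accesses included, are at most `B`. -/
def Exp.Fits (B : ℕ) (s : State) : Exp → Prop
  | .const k => k ≤ B
  | .reg r => s.reg r ≤ B
  | .load a => a.Fits B s ∧ s.mem (a.eval s) ≤ B
  | .add a b => a.Fits B s ∧ b.Fits B s ∧ a.eval s + b.eval s ≤ B
  | .sub a b => a.Fits B s ∧ b.Fits B s
  | .mul a b => a.Fits B s ∧ b.Fits B s ∧ a.eval s * b.eval s ≤ B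
  | .div a b => a.Fits B s ∧ b.Fits B s
  | .lt a b => a.Fits B s ∧ b.Fits B s ∧ 1 ≤ B

/-- Programs. -/
inductive Prog where
  | skip
  /-- assign the value of `e` to the register `r` -/
  | set (r : ℕ) (e : Exp)
  /-- write the value of `e` to the memory cell whose address is the value of `addr` -/
  | store (addr e : Exp)
  /-- first `p`, then `q` -/
  | seq (p q : Prog)
  /-- if the value of `e` is not zero then `p`, else `q` -/
  | cond (e : Exp) (p q : Prog)
  /-- while the value of `e` is not zero, repeat `p` -/
  | loop (e : Exp) (p : Prog)

/-- `Exec B p s t s'`: on the machine with word bound `B`, the program `p`, started in state `s`,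
halts after exactly `t` time units in state `s'`. -/
inductive Exec (B : ℕ) : Prog → State → ℕ → State → Prop
  | skip (s : State) : Exec B .skip s 1 s
  | set (r : ℕ) (e : Exp) (s : State) (he : e.Fits B s) :
      Exec B (.set r e) s (e.cost + 1) { s with reg := Function.update s.reg r (e.eval s) }
  | store (a e : Exp) (s : State) (ha : a.Fits B s) (he : e.Fits B s) :
      Exec B (.store a e) s (a.cost + e.cost + 1)
        { s with mem := Function.update s.mem (a.eval s) (e.eval s) }
  | seq {p q : Prog} {s s' s'' : State} {t t' : ℕ} (hp : Exec B p s t s')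
      (hq : Exec B q s' t' s'') : Exec B (.seq p q) s (t + t') s''
  | cond_true {e : Exp} {p q : Prog} {s s' : State} {t : ℕ} (he : e.Fits B s) (h : e.eval s ≠ 0)
      (hp : Exec B p s t s') : Exec B (.cond e p q) s (e.cost + 1 + t) s'
  | cond_false {e : Exp} {p q : Prog} {s s' : State} {t : ℕ} (he : e.Fits B s) (h : e.eval s = 0)
      (hq : Exec B q s t s') : Exec B (.cond e p q) s (e.cost + 1 + t) s'
  | loop_done {e : Exp} {p : Prog} {s : State} (he : e.Fits B s) (h : e.eval s = 0) :
      Exec B (.loop e p) s (e.cost + 1) s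
  | loop_step {e : Exp} {p : Prog} {s s' s'' : State} {t t' : ℕ} (he : e.Fits B s)
      (h : e.eval s ≠ 0) (hp : Exec B p s t s') (hl : Exec B (.loop e p) s' t' s'') :
      Exec B (.loop e p) s (e.cost + 1 + t + t') s''

/-- The initial state on the input `x`: the memory holds `x` from address `0` on, everything else
is zero. -/
def State.init (x : List ℕ) : State where
  reg := fun _ => 0
  mem := fun i => x.getD i 0

/-- The memory holds the output `y` from address `0` on. -/
def State.HasOutput (s : State) (y : List ℕ) : Prop :=
  ∀ (i : ℕ) (h : i < y.length), s.mem i = y[i]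

end RAM

/-! ## Input and output as sequences of numbers -/

namespace BinTree

/-- `L` lists every element of the set `S` exactly once and nothing else. -/
def Lists {α : Type*} (L : List α) (S : Set α) : Prop :=
  L.Nodup ∧ ∀ a, a ∈ L ↔ a ∈ S

/-- `E` lists every edge of the edge set `S` exactly once, as a pair of its ends in any order. -/
def ListsEdges {α : Type*} (E : List (α × α)) (S : Set (Sym2 α)) : Prop :=
  Lists (E.map fun e => s(e.1, e.2)) S

/-- The word sequence of a list of vertices. -/
def vertexWords {n : ℕ} (L : List (Fin n)) : List ℕ :=
  L.map fun v => (v : ℕ)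

/-- The word sequence of a list of pairs. -/
def pairWords {n : ℕ} (E : List (Fin n × Fin n)) : List ℕ :=
  E.flatMap fun e => [(e.1 : ℕ), (e.2 : ℕ)]

/-- `x` is an encoding of the graph `G` with its tree decomposition `D`: the numbers of vertices, of
edges and of tree nodes, the edges of `G`, the edges of the tree, and the bags of the tree nodes
`0, 1, …, N - 1`, each as its size followed by its elements. All lists may be in any order. -/
def IsInput {n N : ℕ} (G : SimpleGraph (Fin n)) (D : TreeDecomposition G (Fin N))
    (x : List ℕ) : Prop :=
  ∃ (E : List (Fin n × Fin n)) (F : List (Fin N × Fin N)) (X : Fin N → List (Fin n)),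
    ListsEdges E G.edgeSet ∧ ListsEdges F D.tree.edgeSet ∧
    (∀ i, Lists (X i) (D.bag i : Set (Fin n))) ∧
    x = [n, E.length, N] ++ pairWords E ++ pairWords F ++
      (List.finRange N).flatMap fun i => (X i).length :: vertexWords (X i)

/-- `y` is an encoding of the subgraph `T`: the number of its vertices, its vertices, the number of
its edges, its edges. -/
def IsOutput {n : ℕ} {G : SimpleGraph (Fin n)} (T : G.Subgraph) (y : List ℕ) : Prop :=
  ∃ (L : List (Fin n)) (E : List (Fin n × Fin n)),
    Lists L T.verts ∧ ListsEdges E T.edgeSet ∧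
    y = L.length :: vertexWords L ++ E.length :: pairWords E

end BinTree

/-! The algorithm is a dynamic program over the tree decomposition, with three devices that keep it
simple.

An apex is added to every bag and joined to every vertex. The apex may have degree at most one, so a
chosen set of edges contains a single apex edge, and this edge marks a root. A set `F` of edges is
feasible if it is nonempty, respects the degree caps and has every edge connected to the apex
(`Layout.Feasible`). Without the apex it is a connected subgraph of `G` in which all degrees are at
most three (`toSubgraph_connected`, `toSubgraph_degree`).

Every edge of `G` and every apex edge becomes a further leaf node of the decomposition tree. A node
then contributes at most one edge, and the only operation is to merge the table of a node into that
of its parent, from the last node down to the first.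

Acyclicity is never tested. The objective is the number of unpicked edges plus twice the number of
used vertices. A feasible set whose subgraph has `V` vertices and `E` edges has gain `m + n - (E +
1) + 2 V`. A binary tree attains `m + n + V`, because it has a vertex of degree at most two at which
the apex edge fits (`exists_feasible`). If an optimal subgraph had a cycle, a spanning tree of it
would have larger gain; so an optimal set is a tree, and its gain measures its vertices
(`isMaximumBinaryTree_of_optimal`).

A state of a node stores, for each of `K = w + 3` bag positions, a degree at most three and a
component label below `K`, so there are `S = (4 K) ^ K` states. The state of a merge describes the
union of two edge sets (`Exact.merge`), since a vertex that occurs on both sides lies in both bags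
(`sep_part`). Hence every feasible set is followed by states with nonzero entries (`exists_states`),
backtracking yields a set whose gain is the value of the entry (`reached`), and the best root entry
is optimal (`optimal`).

To root the tree in linear time without adjacency lists, leaves are removed one after the other; for
each node its degree and the sum of its neighbours modulo `N` are kept, so that the neighbour of a
leaf is the sum itself (`Remaining.neighbour`). The reversed order of removal is a rooted numbering
with the running intersection property (`Rooted.of_elimOrder`), from which the layout is built
(`LaidOut.valid`).

The program is written in a small language of bounded loops, verified with loop invariants
(`spec_for`), and compiled to the machine (`Cmd.comp_spec`). Loops whose limit is linear in the
graph are never nested (`depth_large`), and all other limits are at most `S`. So the time is at most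
a constant times `M * S ^ d`, where `M` is the number of nodes (`time_le`). Since every edge lies in
a bag, `M` is at most `4 (w + 1) ^ 2 max n N` (`length_edges_le`), and `mul_pow_le` brings the
product into the form of the theorem. -/

set_option linter.constructorNameAsVariable false
set_option linter.unusedSectionVars false
set_option linter.unusedSimpArgs false

/-! ## Merging the tables of a rooted tree of bags -/

namespace BinTree

/-- A tree of bags on the nodes `0, …, M - 1` with parents `par`. The bag of `a` consists of the
nonzero codes among `slot a 0, …, slot a (K - 1)`; the code `1` is the apex. A node `a` with
`ty a ≠ 0` is an edge, between the codes in its positions `ty a - 1` and `ty a`. -/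
structure Layout where
  M : ℕ
  K : ℕ
  par : ℕ → ℕ
  slot : ℕ → ℕ → ℕ
  ty : ℕ → ℕ
  top : ℕ → ℕ

namespace Layout

variable (I : Layout)

/-- `v` is in the bag of `a`. -/
def InBag (a v : ℕ) : Prop := v ≠ 0 ∧ ∃ j < I.K, I.slot a j = v

/-- The numbering respects the rooted tree, `top v` is the highest node whose bag contains `v`, and
`par_mem` is the running intersection property. The apex occupies position `0` of every bag, and the
root bag holds nothing else, so every vertex is forgotten at some merge. -/
structure Valid : Prop where
  M_pos : 0 < I.M
  K_pos : 0 < I.K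
  par_lt : ∀ c, 0 < c → c < I.M → I.par c < c
  slot_inj : ∀ a < I.M, ∀ j < I.K, ∀ j' < I.K, I.slot a j ≠ 0 → I.slot a j = I.slot a j' → j = j'
  slot_zero : ∀ a < I.M, I.slot a 0 = 1
  top_le : ∀ a < I.M, ∀ v, I.InBag a v → I.top v ≤ a
  par_mem : ∀ a < I.M, ∀ v, I.InBag a v → I.top v ≠ a → 0 < a ∧ I.InBag (I.par a) v
  root : ∀ v, I.InBag 0 v → v = 1
  ty_lt : ∀ a < I.M, I.ty a ≠ 0 → I.ty a < I.K ∧ I.slot a (I.ty a - 1) ≠ 0 ∧ I.slot a (I.ty a) ≠ 0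

/-- One end of an edge node. -/
def ea (a : ℕ) : ℕ := I.slot a (I.ty a - 1)
/-- The other end of an edge node. -/
def eb (a : ℕ) : ℕ := I.slot a (I.ty a)

/-- Connectedness by the edges in `F`. -/
def Conn (F : Finset ℕ) (x y : ℕ) : Prop :=
  Relation.EqvGen (fun x y => ∃ a ∈ F, I.ea a = x ∧ I.eb a = y) x y

def deg (F : Finset ℕ) (v : ℕ) : ℕ := (F.filter fun a => I.ea a = v ∨ I.eb a = v).card

/-- The ancestor of `a` that is smaller than `t`. -/
def own (t : ℕ) (a : ℕ) : ℕ :=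
  -- The test on `I.par a` only secures termination. In a valid layout it succeeds for every node
  -- `a` with `0 < a < I.M`, so for `0 < t` the default `0` is never used there.
  if a < t then a else if _ : I.par a < a then own t (I.par a) else 0
termination_by a

/-- Degree entry of the position `j` in the state `s`. -/
def dg (s j : ℕ) : ℕ := s / (4 * I.K) ^ j % (4 * I.K) / I.K
/-- Label of the position `j` in the state `s`. -/
def lb (s j : ℕ) : ℕ := s / (4 * I.K) ^ j % (4 * I.K) % I.K
/-- The number of states. -/
def S : ℕ := (4 * I.K) ^ I.K

/-- Position `j` of `c` and position `x` of `p` hold the same code. -/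
def Matched (p c j x : ℕ) : Prop := I.slot c j ≠ 0 ∧ I.slot p x = I.slot c j

/-- The cap one at the apex forces a single root. -/
def cap (v : ℕ) : ℕ := if v = 1 then 1 else 3

/-- A used vertex that disappears must leave a component that still reaches the bag of `p`;
otherwise that component could never be connected to the apex. -/
structure MergeOK (p c s1 s2 : ℕ) : Prop where
  forget : ∀ j < I.K, I.slot c j ≠ 0 → (∀ x < I.K, ¬ I.Matched p c j x) → I.dg s2 j ≠ 0 →
    ∃ j2 < I.K, (∃ x < I.K, I.Matched p c j2 x) ∧ I.lb s2 j2 = I.lb s2 j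
  cap_le : ∀ j < I.K, ∀ x < I.K, I.Matched p c j x → I.dg s1 x + I.dg s2 j ≤ cap (I.slot p x)

/-- The generating relation for the labels of a merged state. -/
def LabRel (p c s1 s2 x y : ℕ) : Prop :=
  x < I.K ∧ y < I.K ∧ (I.lb s1 x = I.lb s1 y ∨
    ∃ j < I.K, ∃ j2 < I.K, I.Matched p c j x ∧ I.Matched p c j2 y ∧ I.lb s2 j = I.lb s2 j2)

/-- The labels matter only up to renaming, so one merge may be described by several states; any one
of them serves. -/
structure MergeRes (p c s1 s2 s : ℕ) : Prop where
  lt : s < I.S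
  dg_matched : ∀ j < I.K, ∀ x < I.K, I.Matched p c j x → I.dg s x = I.dg s1 x + I.dg s2 j
  dg_other : ∀ x < I.K, (∀ j < I.K, ¬ I.Matched p c j x) → I.dg s x = I.dg s1 x
  lb_iff : ∀ x < I.K, ∀ y < I.K,
    I.lb s x = I.lb s y ↔ Relation.EqvGen (I.LabRel p c s1 s2) x y

open Classical in
/-- The positions of `c` that are used and do not occur in the bag of `p`. -/
noncomputable def forgotten (p c s2 : ℕ) : Finset ℕ :=
  (Finset.range I.K).filter fun j => I.slot c j ≠ 0 ∧ (∀ x < I.K, ¬ I.Matched p c j x) ∧ I.dg s2 j ≠ 0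

/-- The table of `par c` before (`T`) and after (`T'`) the merge of `c`, with the choices
`C₁ c`, `C₂ c`. -/
structure Step (c : ℕ) (T T' : ℕ → ℕ → ℕ) (C₁ C₂ : ℕ → ℕ → ℕ) : Prop where
  other : ∀ i < c, i ≠ I.par c → ∀ s < I.S, T' i s = T i s
  sound : ∀ s < I.S, T' (I.par c) s ≠ 0 → C₁ c s < I.S ∧ C₂ c s < I.S ∧
    T (I.par c) (C₁ c s) ≠ 0 ∧ T c (C₂ c s) ≠ 0 ∧ I.MergeOK (I.par c) c (C₁ c s) (C₂ c s) ∧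
    I.MergeRes (I.par c) c (C₁ c s) (C₂ c s) s ∧
    -- Entries are shifted by one: zero marks a state that is not attained, and `k + 1` stands for
    -- the value `k`.
    T' (I.par c) s - 1 = (T (I.par c) (C₁ c s) - 1) + (T c (C₂ c s) - 1) +
      2 * (I.forgotten (I.par c) c (C₂ c s)).card
  complete : ∀ s1 < I.S, ∀ s2 < I.S, T (I.par c) s1 ≠ 0 → T c s2 ≠ 0 →
    I.MergeOK (I.par c) c s1 s2 → ∃ s, I.MergeRes (I.par c) c s1 s2 s ∧ T' (I.par c) s ≠ 0 ∧
    (T (I.par c) s1 - 1) + (T c s2 - 1) + 2 * (I.forgotten (I.par c) c s2).card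
      ≤ T' (I.par c) s - 1

/-- `z t` is the state of a chosen edge node of type `t > 0`, and `z 0` that of a node without
edges. -/
structure Codes (z : ℕ → ℕ) : Prop where
  lt : ∀ t, t < I.K → z t < I.S
  dg_zero : ∀ x < I.K, I.dg (z 0) x = 0
  lb_zero : ∀ x < I.K, I.lb (z 0) x = x
  dg_pos : ∀ t, 0 < t → t < I.K → ∀ x < I.K, I.dg (z t) x = if x = t - 1 ∨ x = t then 1 else 0
  lb_pos : ∀ t, 0 < t → t < I.K → ∀ x < I.K, I.lb (z t) x = if x = t then t - 1 else x

/-- The tables before all merges. -/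
def initTable (z : ℕ → ℕ) (a s : ℕ) : ℕ :=
  -- With the shift by one, an edge node that is not picked has value one and a picked one has value
  -- zero.
  if s = z 0 then (if I.ty a = 0 then 1 else 2)
  else if I.ty a ≠ 0 ∧ s = z (I.ty a) then 1 else 0

/-- A set of edge nodes is feasible. -/
structure Feasible (F : Finset ℕ) : Prop where
  edge : ∀ a ∈ F, a < I.M ∧ I.ty a ≠ 0
  deg_le : ∀ v, v ≠ 0 → I.deg F v ≤ cap v
  conn : ∀ a ∈ F, I.Conn F (I.ea a) 1
  nonempty : F.Nonempty

def used (F : Finset ℕ) : Finset ℕ := F.image I.ea ∪ F.image I.eb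

def unpicked (F : Finset ℕ) : Finset ℕ := (Finset.range I.M).filter fun a => I.ty a ≠ 0 ∧ a ∉ F

/-- A vertex is worth two and an edge costs one, so adding a vertex by a tree edge gains one, while
an edge that closes a cycle loses one. Maximising the gain therefore excludes cycles. -/
def gain (F : Finset ℕ) : ℕ := (I.unpicked F).card + 2 * ((I.used F).erase 1).card

/-! ### Owners of nodes in the course of the merges -/

variable {I}

theorem own_of_lt {t a : ℕ} (h : a < t) : I.own t a = a := by
  rw [own, if_pos h]

theorem own_of_le (hI : I.Valid) {t a : ℕ} (ht : 0 < t) (h : t ≤ a) (ha : a < I.M) :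
    I.own t a = I.own t (I.par a) := by
  rw [own, if_neg (by omega), dif_pos (hI.par_lt a (by omega) ha)]

theorem own_lt (hI : I.Valid) {t : ℕ} (ht : 0 < t) (a : ℕ) (ha : a < I.M) : I.own t a < t := by
  induction a using Nat.strong_induction_on with
  | _ a ih =>
    by_cases h : a < t
    · rwa [own_of_lt h]
    · have := hI.par_lt a (by omega) ha
      rw [own_of_le hI ht (by omega) ha]
      exact ih _ this (by omega)

/-- Merging `t` passes everything that `t` owns to its parent and changes no other owner. -/
theorem own_step (hI : I.Valid) {t : ℕ} (ht : 0 < t) (a : ℕ) (ha : a < I.M) :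
    I.own t a = if I.own (t + 1) a = t then I.par t else I.own (t + 1) a := by
  induction a using Nat.strong_induction_on with
  | _ a ih =>
    by_cases h : a < t
    · rw [own_of_lt h, own_of_lt (by omega), if_neg (by omega)]
    · have h1 := hI.par_lt a (by omega) ha
      rw [own_of_le hI ht (by omega) ha]
      rcases Nat.lt_or_ge t a with h2 | h2
      · rw [own_of_le hI (t := t + 1) (by omega) (by omega) ha]
        exact ih _ h1 (by omega)
      · obtain rfl : a = t := by omega
        rw [own_of_lt (t := a + 1) (by omega), if_pos rfl, own_of_lt h1]

/-- While the walk towards the root is at a node `≥ t > top v`, it has not reached the top of `v`,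
so the running intersection property keeps `v` in the bag. -/
theorem own_mem (hI : I.Valid) {t v : ℕ} (hv : I.top v < t) (a : ℕ) (ha : a < I.M)
    (h : I.InBag a v) : I.InBag (I.own t a) v := by
  induction a using Nat.strong_induction_on with
  | _ a ih =>
    by_cases hat : a < t
    · rwa [own_of_lt hat]
    · obtain ⟨h1, h2⟩ := hI.par_mem a ha v h (by omega)
      have h3 := hI.par_lt a h1 ha
      rw [own_of_le hI (by omega) (by omega) ha]
      exact ih _ h3 (by omega) h2

/-- The nodes containing `v` form a subtree with highest node `top v`. As long as this node has not
been merged away, climbing from any of them passes through it. -/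
theorem own_top (hI : I.Valid) {t v : ℕ} (ht : 0 < t) (hv : t ≤ I.top v + 1) (a : ℕ)
    (ha : a < I.M) (h : I.InBag a v) : I.own t a = I.own t (I.top v) := by
  induction a using Nat.strong_induction_on with
  | _ a ih =>
    by_cases hat : I.top v = a
    · rw [hat]
    · have h0 := hI.top_le a ha v h
      obtain ⟨h1, h2⟩ := hI.par_mem a ha v h hat
      have h3 := hI.par_lt a h1 ha
      rw [own_of_le hI ht (by omega) ha]
      exact ih _ h3 (by omega) h2

theorem inBag_apex (hI : I.Valid) {a : ℕ} (ha : a < I.M) : I.InBag a 1 :=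
  ⟨by norm_num, 0, hI.K_pos, hI.slot_zero a ha⟩

/-- If the top were the root, `own_mem` would carry `v` into the root bag, which holds the apex
alone. -/
theorem top_pos (hI : I.Valid) {a v : ℕ} (ha : a < I.M) (h : I.InBag a v) (hv : v ≠ 1) :
    0 < I.top v := by
  by_contra h0
  have := own_mem hI (t := 1) (by omega) a ha h
  have h1 := own_lt hI (t := 1) (by omega) a ha
  have : I.InBag 0 v := by
    have h2 : I.own 1 a = 0 := by omega
    rwa [h2] at this
  exact hv (hI.root v this)

theorem inBag_ea (hI : I.Valid) {a : ℕ} (ha : a < I.M) (h : I.ty a ≠ 0) : I.InBag a (I.ea a) := by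
  obtain ⟨h1, h2, h3⟩ := hI.ty_lt a ha h
  exact ⟨h2, I.ty a - 1, by omega, rfl⟩

theorem inBag_eb (hI : I.Valid) {a : ℕ} (ha : a < I.M) (h : I.ty a ≠ 0) : I.InBag a (I.eb a) := by
  obtain ⟨h1, h2, h3⟩ := hI.ty_lt a ha h
  exact ⟨h3, I.ty a, by omega, rfl⟩

/-! ### Connectedness -/

theorem eqvGen_le {α : Type*} {r : α → α → Prop} {P : α → α → Prop} (hP : Equivalence P)
    (h : ∀ x y, r x y → P x y) {x y : α} (hxy : Relation.EqvGen r x y) : P x y := by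
  induction hxy with
  | rel x y h' => exact h x y h'
  | refl => exact hP.refl _
  | symm _ _ _ ih => exact hP.symm ih
  | trans _ _ _ _ _ ih ih' => exact hP.trans ih ih'

theorem Conn.refl (F : Finset ℕ) (x : ℕ) : I.Conn F x x := Relation.EqvGen.refl x
theorem Conn.symm {F : Finset ℕ} {x y : ℕ} (h : I.Conn F x y) : I.Conn F y x :=
  Relation.EqvGen.symm _ _ h
theorem Conn.trans {F : Finset ℕ} {x y z : ℕ} (h : I.Conn F x y) (h' : I.Conn F y z) :
    I.Conn F x z := Relation.EqvGen.trans _ _ _ h h'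
theorem Conn.edge {F : Finset ℕ} {a : ℕ} (h : a ∈ F) : I.Conn F (I.ea a) (I.eb a) :=
  Relation.EqvGen.rel _ _ ⟨a, h, rfl, rfl⟩
theorem Conn.mono {F F' : Finset ℕ} (hF : F ⊆ F') {x y : ℕ} (h : I.Conn F x y) : I.Conn F' x y :=
  eqvGen_le (Relation.EqvGen.is_equivalence _)
    (fun _ _ ⟨a, ha, h⟩ => Relation.EqvGen.rel _ _ ⟨a, hF ha, h⟩) h

/-- Induction along a walk. -/
theorem Conn.induction {F : Finset ℕ} {x y : ℕ} (h : I.Conn F x y) {P : ℕ → Prop} (hx : P x)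
    (hab : ∀ a ∈ F, P (I.ea a) → P (I.eb a)) (hba : ∀ a ∈ F, P (I.eb a) → P (I.ea a)) : P y := by
  have : ∀ x y, I.Conn F x y → (P x ↔ P y) := by
    intro x y h
    induction h with
    | rel x y h =>
      obtain ⟨a, ha, rfl, rfl⟩ := h
      exact ⟨hab a ha, hba a ha⟩
    | refl => rfl
    | symm _ _ _ ih => exact ih.symm
    | trans _ _ _ _ _ ih ih' => exact ih.trans ih'
  exact (this x y h).1 hx

/-! ### States -/

/-- The state `s` of the node `i` describes the edge set `A`. -/
structure Exact (A : Finset ℕ) (i s : ℕ) : Prop where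
  dg : ∀ x < I.K, I.slot i x ≠ 0 → I.dg s x = I.deg A (I.slot i x)
  lb : ∀ x < I.K, ∀ y < I.K, I.lb s x = I.lb s y ↔
    (x = y ∨ (I.slot i x ≠ 0 ∧ I.slot i y ≠ 0 ∧ I.Conn A (I.slot i x) (I.slot i y)))

/-- `v` occurs in the bag of `i` or in an edge of `A`. -/
def Near (A : Finset ℕ) (i v : ℕ) : Prop :=
  I.InBag i v ∨ ∃ a ∈ A, I.ea a = v ∨ I.eb a = v

theorem deg_eq_zero {A : Finset ℕ} {v : ℕ} : I.deg A v = 0 ↔ ∀ a ∈ A, ¬ (I.ea a = v ∨ I.eb a = v) := by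
  rw [deg, Finset.card_eq_zero, Finset.filter_eq_empty_iff]

theorem deg_union {A B : Finset ℕ} (h : Disjoint A B) (v : ℕ) :
    I.deg (A ∪ B) v = I.deg A v + I.deg B v := by
  rw [deg, Finset.filter_union, Finset.card_union_of_disjoint]
  · rfl
  · exact Finset.disjoint_filter_filter h

theorem deg_mono {A B : Finset ℕ} (h : A ⊆ B) (v : ℕ) : I.deg A v ≤ I.deg B v :=
  Finset.card_le_card (Finset.filter_subset_filter _ h)

/-- The separation property of two edge sets at the two ends of a tree edge. -/
def Sep (A₁ A₂ : Finset ℕ) (p c : ℕ) : Prop :=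
  ∀ v, I.Near A₁ p v → I.Near A₂ c v → I.InBag p v ∧ I.InBag c v

/-- Induction along a walk in the union. The walk splits into stretches within one side, and by
separation it can change sides only at a vertex of both bags. What is kept is a position `y` of `p`,
equivalent to `x`, that is connected to the current vertex within one side. -/
theorem conn_union_aux {p c s1 s2 : ℕ} {A₁ A₂ : Finset ℕ}
    (h1 : I.Exact A₁ p s1) (h2 : I.Exact A₂ c s2) (hs : I.Sep A₁ A₂ p c)
    {x : ℕ} (hx : x < I.K) (hx0 : I.slot p x ≠ 0) {z : ℕ} (hz : I.Conn (A₁ ∪ A₂) (I.slot p x) z) :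
    ∃ y < I.K, I.slot p y ≠ 0 ∧ Relation.EqvGen (I.LabRel p c s1 s2) x y ∧
      ((I.Near A₁ p z ∧ I.Conn A₁ (I.slot p y) z) ∨
       (I.Near A₂ c z ∧ I.Conn A₂ (I.slot p y) z ∧ ∃ j < I.K, I.Matched p c j y)) := by
  have edge1 : ∀ a ∈ A₁, ∀ z z', (I.Conn A₁ z z') → (I.ea a = z ∨ I.eb a = z) →
      (I.ea a = z' ∨ I.eb a = z') →
      (∃ y < I.K, I.slot p y ≠ 0 ∧ Relation.EqvGen (I.LabRel p c s1 s2) x y ∧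
      ((I.Near A₁ p z ∧ I.Conn A₁ (I.slot p y) z) ∨
       (I.Near A₂ c z ∧ I.Conn A₂ (I.slot p y) z ∧ ∃ j < I.K, I.Matched p c j y))) →
      (∃ y < I.K, I.slot p y ≠ 0 ∧ Relation.EqvGen (I.LabRel p c s1 s2) x y ∧
      ((I.Near A₁ p z' ∧ I.Conn A₁ (I.slot p y) z') ∨
       (I.Near A₂ c z' ∧ I.Conn A₂ (I.slot p y) z' ∧ ∃ j < I.K, I.Matched p c j y))) := by
    rintro a ha z z' hzz' haz haz' ⟨y, hy, hy0, hxy, ⟨hn, hc⟩ | ⟨hn, hc, j, hj, hm⟩⟩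
    · exact ⟨y, hy, hy0, hxy, Or.inl ⟨Or.inr ⟨a, ha, haz'⟩, hc.trans hzz'⟩⟩
    -- The walk leaves the side of `A₂` at `z`. Being near both sides, `z` has a position `y'` in
    -- `p`, which replaces `y`; the labels of `s2` witness the equivalence of the two.
    · obtain ⟨⟨hz0, y', hy', hpy'⟩, ⟨_, j', hj', hcj'⟩⟩ := hs z (Or.inr ⟨a, ha, haz⟩) hn
      have hlab : I.lb s2 j = I.lb s2 j' := by
        rw [h2.lb j hj j' hj']
        refine Or.inr ⟨hm.1, hcj' ▸ hz0, ?_⟩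
        rw [hcj', ← hm.2]; exact hc
      refine ⟨y', hy', hpy' ▸ hz0, hxy.trans _ _ _ (Relation.EqvGen.rel _ _ ⟨hy, hy', Or.inr
        ⟨j, hj, j', hj', hm, ⟨hcj' ▸ hz0, hpy'.trans hcj'.symm⟩, hlab⟩⟩), Or.inl
        ⟨Or.inr ⟨a, ha, haz'⟩, ?_⟩⟩
      rw [hpy']; exact hzz'
  have edge2 : ∀ a ∈ A₂, ∀ z z', (I.Conn A₂ z z') → (I.ea a = z ∨ I.eb a = z) →
      (I.ea a = z' ∨ I.eb a = z') →
      (∃ y < I.K, I.slot p y ≠ 0 ∧ Relation.EqvGen (I.LabRel p c s1 s2) x y ∧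
      ((I.Near A₁ p z ∧ I.Conn A₁ (I.slot p y) z) ∨
       (I.Near A₂ c z ∧ I.Conn A₂ (I.slot p y) z ∧ ∃ j < I.K, I.Matched p c j y))) →
      (∃ y < I.K, I.slot p y ≠ 0 ∧ Relation.EqvGen (I.LabRel p c s1 s2) x y ∧
      ((I.Near A₁ p z' ∧ I.Conn A₁ (I.slot p y) z') ∨
       (I.Near A₂ c z' ∧ I.Conn A₂ (I.slot p y) z' ∧ ∃ j < I.K, I.Matched p c j y))) := by
    rintro a ha z z' hzz' haz haz' ⟨y, hy, hy0, hxy, ⟨hn, hc⟩ | ⟨hn, hc, hm⟩⟩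
    · obtain ⟨⟨hz0, y', hy', hpy'⟩, ⟨_, j', hj', hcj'⟩⟩ := hs z hn (Or.inr ⟨a, ha, haz⟩)
      have hlab : I.lb s1 y = I.lb s1 y' := by
        rw [h1.lb y hy y' hy']
        refine Or.inr ⟨hy0, hpy' ▸ hz0, ?_⟩
        rw [hpy']; exact hc
      refine ⟨y', hy', hpy' ▸ hz0, hxy.trans _ _ _ (Relation.EqvGen.rel _ _ ⟨hy, hy', Or.inl
        hlab⟩), Or.inr ⟨Or.inr ⟨a, ha, haz'⟩, ?_, j', hj', hcj' ▸ hz0, hpy'.trans hcj'.symm⟩⟩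
      rw [hpy']; exact hzz'
    · exact ⟨y, hy, hy0, hxy, Or.inr ⟨Or.inr ⟨a, ha, haz'⟩, hc.trans hzz', hm⟩⟩
  refine hz.induction (P := fun z =>
    ∃ y < I.K, I.slot p y ≠ 0 ∧ Relation.EqvGen (I.LabRel p c s1 s2) x y ∧
      ((I.Near A₁ p z ∧ I.Conn A₁ (I.slot p y) z) ∨
       (I.Near A₂ c z ∧ I.Conn A₂ (I.slot p y) z ∧ ∃ j < I.K, I.Matched p c j y))) ?_ ?_ ?_
  · exact ⟨x, hx, hx0, Relation.EqvGen.refl x, Or.inl ⟨Or.inl ⟨hx0, x, hx, rfl⟩, Conn.refl _ _⟩⟩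
  · intro a ha
    rcases Finset.mem_union.1 ha with ha | ha
    · exact edge1 a ha _ _ (Conn.edge ha) (Or.inl rfl) (Or.inr rfl)
    · exact edge2 a ha _ _ (Conn.edge ha) (Or.inl rfl) (Or.inr rfl)
  · intro a ha
    rcases Finset.mem_union.1 ha with ha | ha
    · exact edge1 a ha _ _ (Conn.edge ha).symm (Or.inr rfl) (Or.inl rfl)
    · exact edge2 a ha _ _ (Conn.edge ha).symm (Or.inr rfl) (Or.inl rfl)

/-- Degrees add because the edge sets are disjoint, and a position without a match cannot touch `A₂`
by separation. For the labels one direction embeds each side in the union, and the other is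
`conn_union_aux`. -/
theorem Exact.merge {p c s1 s2 s : ℕ} {A₁ A₂ : Finset ℕ}
    (h1 : I.Exact A₁ p s1) (h2 : I.Exact A₂ c s2) (hs : I.Sep A₁ A₂ p c) (hd : Disjoint A₁ A₂)
    (h : I.MergeRes p c s1 s2 s) : I.Exact (A₁ ∪ A₂) p s := by
  constructor
  · intro x hx hx0
    rw [deg_union hd]
    by_cases hm : ∃ j < I.K, I.Matched p c j x
    · obtain ⟨j, hj, hm⟩ := hm
      rw [h.dg_matched j hj x hx hm, h1.dg x hx hx0, h2.dg j hj hm.1, hm.2]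
    · push Not at hm
      rw [h.dg_other x hx hm, h1.dg x hx hx0]
      have : I.deg A₂ (I.slot p x) = 0 := by
        rw [deg_eq_zero]
        intro a ha hav
        obtain ⟨_, ⟨_, j, hj, hj'⟩⟩ := hs (I.slot p x) (Or.inl ⟨hx0, x, hx, rfl⟩) (Or.inr ⟨a, ha, hav⟩)
        exact hm j hj ⟨hj' ▸ hx0, hj'.symm⟩
      omega
  · intro x hx y hy
    rw [h.lb_iff x hx y hy]
    constructor
    · intro he
      let P : ℕ → ℕ → Prop := fun x y => x = y ∨
        (I.slot p x ≠ 0 ∧ I.slot p y ≠ 0 ∧ I.Conn (A₁ ∪ A₂) (I.slot p x) (I.slot p y))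
      have hP : Equivalence P := by
        refine ⟨fun x => Or.inl rfl, ?_, ?_⟩
        · rintro x y (rfl | ⟨h, h', h''⟩)
          · exact Or.inl rfl
          · exact Or.inr ⟨h', h, h''.symm⟩
        · rintro x y z (rfl | ⟨h, h', h''⟩) (rfl | ⟨k, k', k''⟩)
          · exact Or.inl rfl
          · exact Or.inr ⟨k, k', k''⟩
          · exact Or.inr ⟨h, h', h''⟩
          · exact Or.inr ⟨h, k', h''.trans k''⟩
      refine eqvGen_le hP ?_ he
      rintro x y ⟨hx, hy, hl | ⟨j, hj, j2, hj2, hm, hm2, hl⟩⟩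
      · rcases (h1.lb x hx y hy).1 hl with rfl | ⟨a, b, c⟩
        · exact Or.inl rfl
        · exact Or.inr ⟨a, b, c.mono Finset.subset_union_left⟩
      · right
        refine ⟨hm.2 ▸ hm.1, hm2.2 ▸ hm2.1, ?_⟩
        rw [hm.2, hm2.2]
        rcases (h2.lb j hj j2 hj2).1 hl with rfl | ⟨a, b, c⟩
        · exact Conn.refl _ _
        · exact c.mono Finset.subset_union_right
    · rintro (rfl | ⟨hx0, hy0, hc⟩)
      · exact Relation.EqvGen.refl _
      · obtain ⟨z, hz, hz0, hxz, ⟨_, hc'⟩ | ⟨hn, hc', j, hj, hm⟩⟩ :=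
          conn_union_aux h1 h2 hs hx hx0 hc
        · exact hxz.trans _ _ _ (Relation.EqvGen.rel _ _ ⟨hz, hy, Or.inl
            ((h1.lb z hz y hy).2 (Or.inr ⟨hz0, hy0, hc'⟩))⟩)
        · obtain ⟨_, ⟨_, j', hj', hcj'⟩⟩ := hs _ (Or.inl ⟨hy0, y, hy, rfl⟩) hn
          refine hxz.trans _ _ _ (Relation.EqvGen.rel _ _ ⟨hz, hy, Or.inr
            ⟨j, hj, j', hj', hm, ⟨hcj' ▸ hy0, hcj'.symm⟩, ?_⟩⟩)
          refine (h2.lb j hj j' hj').2 (Or.inr ⟨hm.1, hcj' ▸ hy0, ?_⟩)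
          rw [← hm.2, hcj']; exact hc'

/-- The part of `F` that is owned by `i` at the time `t`. -/
def part (F : Finset ℕ) (t i : ℕ) : Finset ℕ := F.filter fun a => I.own t a = i

theorem part_subset (F : Finset ℕ) (t i : ℕ) : I.part F t i ⊆ F := Finset.filter_subset _ _

theorem part_step_other (hI : I.Valid) {F : Finset ℕ} (hF : ∀ a ∈ F, a < I.M ∧ I.ty a ≠ 0)
    {c i : ℕ} (hc : 0 < c) (hi : i ≠ I.par c) (hic : i ≠ c) :
    I.part F c i = I.part F (c + 1) i := by
  ext a
  simp only [part, Finset.mem_filter]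
  refine and_congr_right fun ha => ?_
  rw [own_step hI hc a (hF a ha).1]
  split_ifs with h
  · rw [h]; exact ⟨fun h' => absurd h'.symm hi, fun h' => absurd h'.symm hic⟩
  · rfl

theorem part_step_par (hI : I.Valid) {F : Finset ℕ} (hF : ∀ a ∈ F, a < I.M ∧ I.ty a ≠ 0)
    {c : ℕ} (hc : 0 < c) (hcM : c < I.M) :
    I.part F c (I.par c) = I.part F (c + 1) (I.par c) ∪ I.part F (c + 1) c := by
  ext a
  simp only [part, Finset.mem_filter, Finset.mem_union]
  have := hI.par_lt c hc hcM
  constructor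
  · rintro ⟨ha, h⟩
    rw [own_step hI hc a (hF a ha).1] at h
    split_ifs at h with h'
    · exact Or.inr ⟨ha, h'⟩
    · exact Or.inl ⟨ha, h⟩
  · rintro (⟨ha, h⟩ | ⟨ha, h⟩) <;> refine ⟨ha, ?_⟩ <;> rw [own_step hI hc a (hF a ha).1]
    · rw [if_neg (by omega), h]
    · rw [if_pos h]

theorem part_disjoint (F : Finset ℕ) {t i j : ℕ} (h : i ≠ j) :
    Disjoint (I.part F t i) (I.part F t j) := by
  rw [Finset.disjoint_left]
  intro a ha hb
  simp only [part, Finset.mem_filter] at ha hb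
  exact h (ha.2.symm.trans hb.2)

theorem near_part (hI : I.Valid) {F : Finset ℕ} (hF : ∀ a ∈ F, a < I.M ∧ I.ty a ≠ 0)
    {t i v : ℕ} (hi : i < t) (hiM : i < I.M) (h : I.Near (I.part F t i) i v) :
    ∃ a < I.M, I.InBag a v ∧ I.own t a = i := by
  rcases h with h | ⟨a, ha, h⟩
  · exact ⟨i, hiM, h, own_of_lt hi⟩
  · simp only [part, Finset.mem_filter] at ha
    have := hF a ha.1
    refine ⟨a, this.1, ?_, ha.2⟩
    rcases h with h | h
    · exact h ▸ inBag_ea hI this.1 this.2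
    · exact h ▸ inBag_eb hI this.1 this.2

/-- If the top of `v` were larger than `c`, all nodes containing `v` would have the same owner by
`own_top`. So the top is at most `c`, and `own_mem` puts `v` into the bags of both owners. -/
theorem sep_part (hI : I.Valid) {F : Finset ℕ} (hF : ∀ a ∈ F, a < I.M ∧ I.ty a ≠ 0)
    {c : ℕ} (hc : 0 < c) (hcM : c < I.M) :
    I.Sep (I.part F (c + 1) (I.par c)) (I.part F (c + 1) c) (I.par c) c := by
  intro v h1 h2
  have hp := hI.par_lt c hc hcM
  obtain ⟨a, ha, hav, hao⟩ := near_part hI hF (by omega) (by omega) h1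
  obtain ⟨b, hb, hbv, hbo⟩ := near_part hI hF (by omega) (by omega) h2
  by_cases ht : I.top v < c + 1
  · exact ⟨hao ▸ own_mem hI ht a ha hav, hbo ▸ own_mem hI ht b hb hbv⟩
  · have := own_top hI (t := c + 1) (by omega) (by omega) a ha hav
    rw [← own_top hI (t := c + 1) (by omega) (by omega) b hb hbv] at this
    omega

/-- A code of the bag of `c` that is not in the bag of the parent has its top at `c`. -/
theorem top_eq (hI : I.Valid) {c v : ℕ} (hcM : c < I.M) (h : I.InBag c v)
    (h' : ¬ I.InBag (I.par c) v) : I.top v = c := by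
  by_contra ht
  exact h' (hI.par_mem c hcM v h ht).2

theorem not_inBag_par (hI : I.Valid) {c v : ℕ} (hc : 0 < c) (hcM : c < I.M) (h : I.top v = c) :
    ¬ I.InBag (I.par c) v := by
  intro h'
  have hp := hI.par_lt c hc hcM
  have := hI.top_le _ (by omega) v h'
  omega

theorem inBag_of_matched {p c j x : ℕ} (hx : x < I.K) (h : I.Matched p c j x) :
    I.InBag p (I.slot c j) := ⟨h.1, x, hx, h.2⟩

theorem not_inBag_iff {p c j : ℕ} (hj : I.slot c j ≠ 0) :
    (∀ x < I.K, ¬ I.Matched p c j x) ↔ ¬ I.InBag p (I.slot c j) := by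
  constructor
  · rintro h ⟨_, x, hx, hm⟩
    exact h x hx ⟨hj, hm⟩
  · intro h x hx hm
    exact h (inBag_of_matched hx hm)

/-- All edges at `v` lie below its top node, so when this node is about to be merged, its part
already contains them all and the degree of `v` is final. -/
theorem deg_part_top (hI : I.Valid) {F : Finset ℕ} (hF : ∀ a ∈ F, a < I.M ∧ I.ty a ≠ 0)
    {c v : ℕ} (hc : I.top v = c) : I.deg (I.part F (c + 1) c) v = I.deg F v := by
  refine le_antisymm (deg_mono (part_subset _ _ _) v) (Finset.card_le_card ?_)
  intro a ha
  simp only [part, Finset.mem_filter] at ha ⊢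
  refine ⟨⟨ha.1, ?_⟩, ha.2⟩
  have := hF a ha.1
  have hb : I.InBag a v := by
    rcases ha.2 with h | h
    · exact h ▸ inBag_ea hI this.1 this.2
    · exact h ▸ inBag_eb hI this.1 this.2
  rw [own_top hI (by omega) (by omega) a this.1 hb, hc, own_of_lt (by omega)]

theorem mem_used {F : Finset ℕ} {v : ℕ} : v ∈ I.used F ↔ ∃ a ∈ F, I.ea a = v ∨ I.eb a = v := by
  simp only [used, Finset.mem_union, Finset.mem_image]
  constructor
  · rintro (⟨a, ha, h⟩ | ⟨a, ha, h⟩)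
    · exact ⟨a, ha, Or.inl h⟩
    · exact ⟨a, ha, Or.inr h⟩
  · rintro ⟨a, ha, h | h⟩
    · exact Or.inl ⟨a, ha, h⟩
    · exact Or.inr ⟨a, ha, h⟩

theorem mem_used_iff_deg {F : Finset ℕ} {v : ℕ} : v ∈ I.used F ↔ I.deg F v ≠ 0 := by
  rw [Ne, deg_eq_zero, mem_used]; push Not; rfl

/-- The gain at time `t`. -/
def gainAt (F : Finset ℕ) (t : ℕ) : ℕ :=
  (I.unpicked F).card + 2 * ((I.used F).filter fun v => t ≤ I.top v).card

/-- A vertex is forgotten exactly when its top node is merged, and its degree is final by then; so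
each used vertex is counted once in all merges together. -/
theorem card_forgotten (hI : I.Valid) {F : Finset ℕ} (hF : ∀ a ∈ F, a < I.M ∧ I.ty a ≠ 0)
    {c s2 : ℕ} (hc : 0 < c) (hcM : c < I.M) (h : I.Exact (I.part F (c + 1) c) c s2) :
    (I.forgotten (I.par c) c s2).card = ((I.used F).filter fun v => I.top v = c).card := by
  refine Finset.card_bij (fun j _ => I.slot c j) ?_ ?_ ?_
  · intro j hj
    simp only [forgotten, Finset.mem_filter, Finset.mem_range] at hj
    obtain ⟨hj, hj0, hm, hd⟩ := hj
    have ht : I.top (I.slot c j) = c :=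
      top_eq hI hcM ⟨hj0, j, hj, rfl⟩ ((not_inBag_iff hj0).1 hm)
    rw [Finset.mem_filter, mem_used_iff_deg, ← deg_part_top hI hF ht, ← h.dg j hj hj0]
    exact ⟨hd, ht⟩
  · intro j hj j' hj' he
    simp only [forgotten, Finset.mem_filter, Finset.mem_range] at hj hj'
    exact hI.slot_inj c hcM j hj.1 j' hj'.1 hj.2.1 he
  · intro v hv
    rw [Finset.mem_filter, mem_used] at hv
    obtain ⟨⟨a, ha, hav⟩, ht⟩ := hv
    have haM := hF a ha
    have hb : I.InBag a v := by
      rcases hav with h | h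
      · exact h ▸ inBag_ea hI haM.1 haM.2
      · exact h ▸ inBag_eb hI haM.1 haM.2
    have ho : I.own (c + 1) a = c := by
      rw [own_top hI (by omega) (by omega) a haM.1 hb, ht, own_of_lt (by omega)]
    obtain ⟨hv0, j, hj, rfl⟩ := ho ▸ own_mem hI (t := c + 1) (by omega) a haM.1 hb
    refine ⟨j, ?_, rfl⟩
    simp only [forgotten, Finset.mem_filter, Finset.mem_range]
    refine ⟨hj, hv0, (not_inBag_iff hv0).2 (not_inBag_par hI hc hcM ht), ?_⟩
    rw [h.dg j hj hv0, ← mem_used_iff_deg, mem_used]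
    refine ⟨a, ?_, hav⟩
    simp [part, ha, ho]

theorem gainAt_step (hI : I.Valid) {F : Finset ℕ} (hF : ∀ a ∈ F, a < I.M ∧ I.ty a ≠ 0)
    {c s2 : ℕ} (hc : 0 < c) (hcM : c < I.M) (h : I.Exact (I.part F (c + 1) c) c s2) :
    I.gainAt F c = I.gainAt F (c + 1) + 2 * (I.forgotten (I.par c) c s2).card := by
  rw [card_forgotten hI hF hc hcM h, gainAt, gainAt]
  have : ((I.used F).filter fun v => c ≤ I.top v).card =
      ((I.used F).filter fun v => c + 1 ≤ I.top v).card +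
      ((I.used F).filter fun v => I.top v = c).card := by
    rw [← Finset.card_union_of_disjoint]
    · congr 1
      ext v
      simp only [Finset.mem_filter, Finset.mem_union, ← and_or_left]
      refine and_congr_right fun _ => ?_
      omega
    · rw [Finset.disjoint_filter]
      intro v _ h h'
      omega
  omega

theorem inBag_of_used (hI : I.Valid) {F : Finset ℕ} (hF : ∀ a ∈ F, a < I.M ∧ I.ty a ≠ 0)
    {v : ℕ} (hv : v ∈ I.used F) : ∃ a ∈ F, a < I.M ∧ I.InBag a v := by
  obtain ⟨a, ha, h⟩ := mem_used.1 hv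
  have := hF a ha
  refine ⟨a, ha, this.1, ?_⟩
  rcases h with h | h
  · exact h ▸ inBag_ea hI this.1 this.2
  · exact h ▸ inBag_eb hI this.1 this.2

theorem gainAt_one (hI : I.Valid) {F : Finset ℕ} (hF : ∀ a ∈ F, a < I.M ∧ I.ty a ≠ 0) :
    I.gainAt F 1 = I.gain F := by
  rw [gainAt, gain]
  congr 3
  ext v
  simp only [Finset.mem_filter, Finset.mem_erase]
  constructor
  · rintro ⟨hv, ht⟩
    refine ⟨?_, hv⟩
    rintro rfl
    have := hI.top_le 0 hI.M_pos 1 (inBag_apex hI hI.M_pos)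
    omega
  · rintro ⟨h1, hv⟩
    obtain ⟨a, _, ha, hb⟩ := inBag_of_used hI hF hv
    exact ⟨hv, top_pos hI ha hb h1⟩

theorem gainAt_M (hI : I.Valid) {F : Finset ℕ} (hF : ∀ a ∈ F, a < I.M ∧ I.ty a ≠ 0) :
    I.gainAt F I.M = (I.unpicked F).card := by
  suffices h : (I.used F).filter (fun v => I.M ≤ I.top v) = ∅ by simp [gainAt, h]
  rw [Finset.filter_eq_empty_iff]
  intro v hv
  obtain ⟨a, _, ha, hb⟩ := inBag_of_used hI hF hv
  have := hI.top_le a ha v hb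
  omega

end Layout
end BinTree

/-! ### Completeness of the tables, soundness and optimality of backtracking -/

namespace BinTree
namespace Layout
variable {I : Layout}

/-- The accounting of one merge, in which the entry at `c` moves to `p` with a surplus `k`. It
serves the values of states as well as the budgets that bound the table entries. -/
theorem sum_merge {f g : ℕ → ℕ} {p c k : ℕ} (hp : p < c) (h : ∀ i < c, i ≠ p → g i = f i)
    (hg : g p = f p + f c + k) :
    ∑ i ∈ Finset.range c, g i = ∑ i ∈ Finset.range (c + 1), f i + k := by
  have hm := Finset.mem_range.2 hp
  rw [Finset.sum_range_succ, ← Finset.add_sum_erase _ g hm, ← Finset.add_sum_erase _ f hm, hg]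
  have : ∑ x ∈ (Finset.range c).erase p, g x = ∑ x ∈ (Finset.range c).erase p, f x := by
    refine Finset.sum_congr rfl fun i hi => ?_
    rw [Finset.mem_erase, Finset.mem_range] at hi
    exact h i hi.2 hi.1
  omega

theorem conn_used {F : Finset ℕ} {x y : ℕ} (h : I.Conn F x y) : y = x ∨ y ∈ I.used F := by
  refine h.induction (P := fun y => y = x ∨ y ∈ I.used F) (Or.inl rfl) ?_ ?_
  · exact fun a ha _ => Or.inr (mem_used.2 ⟨a, ha, Or.inr rfl⟩)
  · exact fun a ha _ => Or.inr (mem_used.2 ⟨a, ha, Or.inl rfl⟩)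

theorem part_M {F : Finset ℕ} (hF : ∀ a ∈ F, a < I.M ∧ I.ty a ≠ 0) (i : ℕ) :
    I.part F I.M i = if i ∈ F then {i} else ∅ := by
  ext a
  simp only [part, Finset.mem_filter]
  split_ifs with h
  · rw [Finset.mem_singleton]
    constructor
    · rintro ⟨ha, ho⟩
      rwa [own_of_lt (hF a ha).1] at ho
    · rintro rfl
      exact ⟨h, own_of_lt (hF a h).1⟩
  · simp only [Finset.notMem_empty, iff_false]
    rintro ⟨ha, ho⟩
    rw [own_of_lt (hF a ha).1] at ho
    exact h (ho ▸ ha)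

theorem part_one (hI : I.Valid) {F : Finset ℕ} (hF : ∀ a ∈ F, a < I.M ∧ I.ty a ≠ 0) :
    I.part F 1 0 = F := by
  refine Finset.filter_true_of_mem fun a ha => ?_
  have := own_lt hI (t := 1) (by omega) a (hF a ha).1
  omega

theorem conn_empty {x y : ℕ} (h : I.Conn ∅ x y) : x = y := by
  refine eqvGen_le eq_equivalence ?_ h
  rintro x y ⟨a, ha, _⟩
  simp at ha

theorem conn_singleton {a x y : ℕ} (h : I.Conn {a} x y) :
    x = y ∨ ((x = I.ea a ∨ x = I.eb a) ∧ (y = I.ea a ∨ y = I.eb a)) := by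
  have hP : Equivalence fun x y => x = y ∨ ((x = I.ea a ∨ x = I.eb a) ∧ (y = I.ea a ∨ y = I.eb a)) := by
    refine ⟨fun x => Or.inl rfl, ?_, ?_⟩
    · rintro x y (h | ⟨h, h'⟩)
      · exact Or.inl h.symm
      · exact Or.inr ⟨h', h⟩
    · rintro x y w (rfl | ⟨h, h'⟩) (rfl | ⟨k, k'⟩)
      · exact Or.inl rfl
      · exact Or.inr ⟨k, k'⟩
      · exact Or.inr ⟨h, h'⟩
      · exact Or.inr ⟨h, k'⟩
  refine eqvGen_le hP ?_ h
  rintro x y ⟨b, hb, rfl, rfl⟩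
  rw [Finset.mem_singleton] at hb
  subst hb
  exact Or.inr ⟨Or.inl rfl, Or.inr rfl⟩

theorem exact_empty (hI : I.Valid) {z : ℕ → ℕ} (hz : I.Codes z) {i : ℕ} (hi : i < I.M) : I.Exact ∅ i (z 0) := by
  constructor
  · intro x hx _
    simp [hz.dg_zero x hx, deg]
  · intro x hx y hy
    rw [hz.lb_zero x hx, hz.lb_zero y hy]
    constructor
    · exact Or.inl
    · rintro (h | ⟨h0, _, h⟩)
      · exact h
      · exact hI.slot_inj i hi x hx y hy h0 (conn_empty h)

theorem exact_singleton (hI : I.Valid) {z : ℕ → ℕ} (hz : I.Codes z) {i : ℕ} (hi : i < I.M)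
    (ht : I.ty i ≠ 0) : I.Exact {i} i (z (I.ty i)) := by
  obtain ⟨h1, h2, h3⟩ := hI.ty_lt i hi ht
  have key : ∀ x < I.K, I.slot i x ≠ 0 → ((I.slot i x = I.ea i ∨ I.slot i x = I.eb i) ↔
      (x = I.ty i - 1 ∨ x = I.ty i)) := by
    intro x hx hx0
    constructor
    · rintro (h | h)
      · exact Or.inl (hI.slot_inj i hi x hx _ (by omega) hx0 h)
      · exact Or.inr (hI.slot_inj i hi x hx _ (by omega) hx0 h)
    · rintro (rfl | rfl)
      · exact Or.inl rfl
      · exact Or.inr rfl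
  constructor
  · intro x hx hx0
    rw [hz.dg_pos _ (by omega) h1 x hx, deg, Finset.filter_singleton]
    have := key x hx hx0
    rw [eq_comm, @eq_comm _ _ (I.eb i)] at this
    by_cases hc : x = I.ty i - 1 ∨ x = I.ty i
    · rw [if_pos hc, if_pos (this.2 hc), Finset.card_singleton]
    · rw [if_neg hc, if_neg (fun h => hc (this.1 h)), Finset.card_empty]
  · intro x hx y hy
    rw [hz.lb_pos _ (by omega) h1 x hx, hz.lb_pos _ (by omega) h1 y hy]
    constructor
    · intro h
      by_cases hxy : x = y
      · exact Or.inl hxy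
      right
      have hc : I.Conn {i} (I.slot i (I.ty i - 1)) (I.slot i (I.ty i)) :=
        Conn.edge (Finset.mem_singleton_self i)
      split_ifs at h with h4 h5 h5
      · omega
      · subst h4 h; exact ⟨h3, h2, hc.symm⟩
      · subst h5 h; exact ⟨h2, h3, hc⟩
      · omega
    · rintro (rfl | ⟨hx0, hy0, h⟩)
      · rfl
      rcases conn_singleton h with h | ⟨h, h'⟩
      · rw [hI.slot_inj i hi x hx y hy hx0 h]
      · rw [key x hx hx0] at h
        rw [key y hy hy0] at h'
        split_ifs <;> omega

theorem Codes.ne {z : ℕ → ℕ} (hz : I.Codes z) {t : ℕ} (ht : t ≠ 0) (h : t < I.K) : z t ≠ z 0 := by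
  intro he
  have := hz.dg_pos t (by omega) h t h
  rw [he, hz.dg_zero t h] at this
  simp at this

/-- A walk in `F` from a forgotten vertex to the apex has to leave the subtree of `c`, and it can do
so only through a vertex common to the bags of `c` and its parent. The caps hold because the two
parts are disjoint subsets of `F`. -/
theorem mergeOK_of_feasible (hI : I.Valid) {F : Finset ℕ} (hF : I.Feasible F) {c s1 s2 : ℕ}
    (hc : 0 < c) (hcM : c < I.M) (h1 : I.Exact (I.part F (c + 1) (I.par c)) (I.par c) s1)
    (h2 : I.Exact (I.part F (c + 1) c) c s2) : I.MergeOK (I.par c) c s1 s2 := by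
  have hp := hI.par_lt c hc hcM
  constructor
  · intro j hj hj0 hm hd
    rw [h2.dg j hj hj0] at hd
    rw [← mem_used_iff_deg, mem_used] at hd
    obtain ⟨a, ha, hav⟩ := hd
    have haF := part_subset _ _ _ ha
    have hconn : I.Conn F (I.slot c j) 1 := by
      rcases hav with h | h
      · exact h ▸ hF.conn a haF
      · exact h ▸ (Conn.edge haF).symm.trans (hF.conn a haF)
    have ht : I.top (I.slot c j) = c := top_eq hI hcM ⟨hj0, j, hj, rfl⟩ ((not_inBag_iff hj0).1 hm)
    -- The invariant of the walk: either the part of `c` already connects the start to a matched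
    -- position, or the current vertex is connected to the start within this part and its top lies
    -- in the subtree of `c`. The second alternative fails at the apex, whose top is the root.
    have hstep : ∀ a ∈ F, ∀ x y, I.InBag a x → I.InBag a y → I.Conn {a} x y →
        ((∃ j2 < I.K, (∃ x < I.K, I.Matched (I.par c) c j2 x) ∧
          I.Conn (I.part F (c + 1) c) (I.slot c j) (I.slot c j2)) ∨
        (I.Conn (I.part F (c + 1) c) (I.slot c j) x ∧ c ≤ I.top x ∧ I.own (c + 1) (I.top x) = c)) →
        ((∃ j2 < I.K, (∃ x < I.K, I.Matched (I.par c) c j2 x) ∧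
          I.Conn (I.part F (c + 1) c) (I.slot c j) (I.slot c j2)) ∨
        (I.Conn (I.part F (c + 1) c) (I.slot c j) y ∧ c ≤ I.top y ∧ I.own (c + 1) (I.top y) = c)) := by
      rintro a ha x y hax hay hcon (h | ⟨h, hx, hx'⟩)
      · exact Or.inl h
      have haM := hF.edge a ha
      have hao : I.own (c + 1) a = c := by
        rw [own_top hI (by omega) (by omega) a haM.1 hax, hx']
      have hap : a ∈ I.part F (c + 1) c := by simp [part, ha, hao]
      have hy : I.Conn (I.part F (c + 1) c) (I.slot c j) y :=
        h.trans (hcon.mono (by simpa using hap))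
      by_cases hty : c ≤ I.top y
      · refine Or.inr ⟨hy, hty, ?_⟩
        rw [← own_top hI (by omega) (by omega) a haM.1 hay, hao]
      · left
        have hyc : I.InBag c y := hao ▸ own_mem hI (t := c + 1) (by omega) a haM.1 hay
        obtain ⟨hy0, x', hx', hx''⟩ := (hI.par_mem c hcM y hyc (by omega)).2
        obtain ⟨_, j2, hj2, rfl⟩ := hyc
        exact ⟨j2, hj2, ⟨x', hx', hy0, hx''⟩, hy⟩
    have := hconn.induction (P := fun x =>
      (∃ j2 < I.K, (∃ x < I.K, I.Matched (I.par c) c j2 x) ∧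
          I.Conn (I.part F (c + 1) c) (I.slot c j) (I.slot c j2)) ∨
        (I.Conn (I.part F (c + 1) c) (I.slot c j) x ∧ c ≤ I.top x ∧ I.own (c + 1) (I.top x) = c))
      (Or.inr ⟨Conn.refl _ _, ht.ge, by rw [ht, own_of_lt (by omega)]⟩)
      (fun a ha => hstep a ha _ _ (inBag_ea hI (hF.edge a ha).1 (hF.edge a ha).2)
        (inBag_eb hI (hF.edge a ha).1 (hF.edge a ha).2) (Conn.edge (Finset.mem_singleton_self a)))
      (fun a ha => hstep a ha _ _ (inBag_eb hI (hF.edge a ha).1 (hF.edge a ha).2)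
        (inBag_ea hI (hF.edge a ha).1 (hF.edge a ha).2)
        (Conn.edge (Finset.mem_singleton_self a)).symm)
    rcases this with ⟨j2, hj2, hm2, hc2⟩ | ⟨h, h', _⟩
    · refine ⟨j2, hj2, hm2, ?_⟩
      obtain ⟨x, hx, hm2⟩ := hm2
      exact (h2.lb j2 hj2 j hj).2 (Or.inr ⟨hm2.1, hj0, hc2.symm⟩)
    · have := hI.top_le 0 hI.M_pos 1 (inBag_apex hI hI.M_pos)
      omega
  · intro j hj x hx hm
    rw [h1.dg x hx (hm.2 ▸ hm.1), h2.dg j hj hm.1, ← hm.2,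
      ← deg_union (part_disjoint F (by omega)), ← part_step_par hI hF.edge hc hcM]
    exact (deg_mono (part_subset _ _ _) _).trans (hF.deg_le _ (hm.2 ▸ hm.1))

variable {z : ℕ → ℕ} {T : ℕ → ℕ → ℕ → ℕ} {C₁ C₂ : ℕ → ℕ → ℕ}

/-- Completeness. Follow a feasible set through the merges: each node holds a state describing
exactly the edges it owns. The tables keep maxima, so their values sum to at least the gain
accounted for so far. -/
theorem exists_states (hI : I.Valid) (hz : I.Codes z)
    (hinit : ∀ a < I.M, ∀ s < I.S, T I.M a s = I.initTable z a s)
    (hT : ∀ c, 0 < c → c < I.M → I.Step c (T (c + 1)) (T c) C₁ C₂)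
    {F : Finset ℕ} (hF : I.Feasible F) {t : ℕ} (ht : 0 < t) (htM : t ≤ I.M) :
    ∃ cur : ℕ → ℕ, (∀ i < t, cur i < I.S ∧ I.Exact (I.part F t i) i (cur i) ∧ T t i (cur i) ≠ 0) ∧
      I.gainAt F t ≤ ∑ i ∈ Finset.range t, (T t i (cur i) - 1) := by
  induction htM using Nat.decreasingInduction with
  | self =>
    -- Before all merges a node owns itself only, so its state is determined by whether it is
    -- picked.
    refine ⟨fun i => if i ∈ F then z (I.ty i) else z 0, ?_, ?_⟩
    · intro i hi
      rw [part_M hF.edge]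
      dsimp only
      split_ifs with h
      · have h1 := hI.ty_lt i hi (hF.edge i h).2
        refine ⟨hz.lt _ h1.1, exact_singleton hI hz hi (hF.edge i h).2, ?_⟩
        rw [hinit i hi _ (hz.lt _ h1.1), initTable, if_neg (hz.ne (hF.edge i h).2 h1.1)]
        simp [(hF.edge i h).2]
      · refine ⟨hz.lt _ hI.K_pos, exact_empty hI hz hi, ?_⟩
        rw [hinit i hi _ (hz.lt _ hI.K_pos), initTable, if_pos rfl]
        split_ifs <;> simp
    · rw [gainAt_M hI hF.edge, unpicked, Finset.card_filter]
      refine Finset.sum_le_sum fun i hi => ?_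
      rw [Finset.mem_range] at hi
      split_ifs with h
      · dsimp only
        rw [if_neg h.2, hinit i hi _ (hz.lt _ hI.K_pos), initTable, if_pos rfl, if_neg h.1]
      · exact Nat.zero_le _
  | of_succ c hcM ih =>
    obtain ⟨cur, hcur, hg⟩ := ih (by omega)
    have hc : 0 < c := by omega
    have hp := hI.par_lt c hc hcM
    have hS := hT c hc hcM
    obtain ⟨hp1, hp2, hp3⟩ := hcur (I.par c) (by omega)
    obtain ⟨hc1, hc2, hc3⟩ := hcur c (by omega)
    obtain ⟨s, hs, hs0, hsg⟩ := hS.complete _ hp1 _ hc1 hp3 hc3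
      (mergeOK_of_feasible hI hF hc hcM hp2 hc2)
    refine ⟨Function.update cur (I.par c) s, ?_, ?_⟩
    · intro i hi
      by_cases hip : i = I.par c
      · subst hip
        rw [Function.update_self, part_step_par hI hF.edge hc hcM]
        exact ⟨hs.lt, hp2.merge hc2 (sep_part hI hF.edge hc hcM)
          (part_disjoint F (by omega)) hs, hs0⟩
      · obtain ⟨h1, h2, h3⟩ := hcur i (by omega)
        rw [Function.update_of_ne hip, part_step_other hI hF.edge hc hip (by omega),
          hS.other i hi hip _ h1]
        exact ⟨h1, h2, h3⟩
    · rw [gainAt_step hI hF.edge hc hcM hc2]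
      refine (Nat.add_le_add_right hg _).trans ?_
      rw [← sum_merge (g := fun i => if i = I.par c then (T (c + 1) (I.par c) (cur (I.par c)) - 1) +
        (T (c + 1) c (cur c) - 1) + 2 * (I.forgotten (I.par c) c (cur c)).card else
        T (c + 1) i (cur i) - 1) hp (fun i _ hi => if_neg hi) (if_pos rfl)]
      refine Finset.sum_le_sum fun i hi => ?_
      rw [Finset.mem_range] at hi
      split_ifs with h
      · subst h
        rw [Function.update_self]
        exact hsg
      · rw [Function.update_of_ne h, hS.other i hi h _ (hcur i (by omega)).1]

/-- The invariant of a family of states reached by backtracking. -/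
structure Reached (F : Finset ℕ) (t : ℕ) (cur : ℕ → ℕ) : Prop where
  exact : ∀ i < t, I.Exact (I.part F t i) i (cur i)
  deg_le : ∀ i < t, ∀ v, v ≠ 0 → I.deg (I.part F t i) v ≤ cap v
  conn : ∀ i < t, ∀ a ∈ I.part F t i, ∃ y, I.InBag i y ∧ I.Conn (I.part F t i) (I.ea a) y

/-- The edge nodes chosen by a family of states. -/
def picks (I : Layout) (z cur : ℕ → ℕ) : Finset ℕ :=
  (Finset.range I.M).filter fun a => I.ty a ≠ 0 ∧ cur a ≠ z 0

theorem one_le_cap (v : ℕ) : 1 ≤ cap v := by unfold cap; split_ifs <;> omega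

/-- Soundness. The picked set is read off from the states at time `I.M`. Going down in `t` then
repeats the merges on it, and the recorded choices make degrees, connections and values agree with
the states found by backtracking. -/
theorem reached (hI : I.Valid) (hz : I.Codes z)
    (hinit : ∀ a < I.M, ∀ s < I.S, T I.M a s = I.initTable z a s)
    (hT : ∀ c, 0 < c → c < I.M → I.Step c (T (c + 1)) (T c) C₁ C₂)
    {cu : ℕ → ℕ → ℕ}
    (hp : ∀ c, 0 < c → c < I.M → cu (c + 1) (I.par c) = C₁ c (cu c (I.par c)))
    (hc : ∀ c, 0 < c → c < I.M → cu (c + 1) c = C₂ c (cu c (I.par c)))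
    (ho : ∀ c, 0 < c → c < I.M → ∀ i < c, i ≠ I.par c → cu (c + 1) i = cu c i)
    (hpos : ∀ t, 0 < t → t ≤ I.M → ∀ i < t, cu t i < I.S ∧ T t i (cu t i) ≠ 0)
    {t : ℕ} (ht : 0 < t) (htM : t ≤ I.M) :
    I.Reached (I.picks z (cu I.M)) t (cu t) ∧
      ∑ i ∈ Finset.range t, (T t i (cu t i) - 1) = I.gainAt (I.picks z (cu I.M)) t := by
  have hF : ∀ a ∈ I.picks z (cu I.M), a < I.M ∧ I.ty a ≠ 0 := by
    intro a ha
    simp only [picks, Finset.mem_filter, Finset.mem_range] at ha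
    exact ⟨ha.1, ha.2.1⟩
  set F := I.picks z (cu I.M) with hFdef
  induction htM using Nat.decreasingInduction with
  | self =>
    -- A nonzero initial entry belongs either to the state without edges or to the state of the edge
    -- of the node.
    have hval : ∀ i < I.M, cu I.M i = if i ∈ F then z (I.ty i) else z 0 := by
      intro i hi
      obtain ⟨h1, h2⟩ := hpos I.M hI.M_pos le_rfl i hi
      rw [hinit i hi _ h1, initTable] at h2
      by_cases h3 : cu I.M i = z 0
      · rw [if_neg]
        · exact h3
        · simp [hFdef, picks, h3]
      · rw [if_neg h3] at h2
        have h4 : I.ty i ≠ 0 ∧ cu I.M i = z (I.ty i) := by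
          by_contra h5
          rw [if_neg h5] at h2
          exact h2 rfl
        rw [if_pos]
        · exact h4.2
        · simp [hFdef, picks, h3, h4.1, hi]
    refine ⟨⟨?_, ?_, ?_⟩, ?_⟩
    · intro i hi
      rw [part_M hF, hval i hi]
      split_ifs with h
      · exact exact_singleton hI hz hi (hF i h).2
      · exact exact_empty hI hz hi
    · intro i hi v _
      rw [part_M hF]
      refine le_trans ?_ (one_le_cap v)
      refine (Finset.card_filter_le _ _).trans ?_
      split_ifs <;> simp
    · intro i hi a ha
      rw [part_M hF] at ha
      split_ifs at ha with h
      · rw [Finset.mem_singleton] at ha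
        subst ha
        exact ⟨_, inBag_ea hI hi (hF a h).2, Conn.refl _ _⟩
      · simp at ha
    · rw [gainAt_M hI hF, unpicked, Finset.card_filter]
      refine Finset.sum_congr rfl fun i hi => ?_
      rw [Finset.mem_range] at hi
      rw [hinit i hi _ (hpos I.M hI.M_pos le_rfl i hi).1, initTable, hval i hi]
      by_cases h : i ∈ F
      · have h1 := hF i h
        have h2 := hz.ne h1.2 (hI.ty_lt i hi h1.2).1
        simp [h, h1.2, h2]
      · by_cases h1 : I.ty i = 0
        · simp [h, h1]
        · simp [h, h1]
  | of_succ c hcM ih =>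
    obtain ⟨hR, hg⟩ := ih (by omega)
    have hc0 : 0 < c := by omega
    have hpl := hI.par_lt c hc0 hcM
    have hS := hT c hc0 hcM
    obtain ⟨hs1, hs2⟩ := hpos c hc0 hcM.le (I.par c) hpl
    obtain ⟨-, -, -, -, hok, hres, hval⟩ := hS.sound _ hs1 hs2
    rw [← hp c hc0 hcM, ← hc c hc0 hcM] at hok hres hval
    have e1 := hR.exact (I.par c) (by omega)
    have e2 := hR.exact c (by omega)
    refine ⟨⟨?_, ?_, ?_⟩, ?_⟩
    · intro i hi
      by_cases hip : i = I.par c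
      · subst hip
        rw [part_step_par hI hF hc0 hcM]
        exact e1.merge e2 (sep_part hI hF hc0 hcM) (part_disjoint F (by omega)) hres
      · rw [part_step_other hI hF hc0 hip (by omega), ← ho c hc0 hcM i hi hip]
        exact hR.exact i (by omega)
    · intro i hi v hv
      by_cases hip : i = I.par c
      · subst hip
        rw [part_step_par hI hF hc0 hcM]
        rw [deg_union (part_disjoint F (by omega))]
        have b1 := hR.deg_le (I.par c) (by omega) v hv
        have b2 := hR.deg_le c (by omega) v hv
        -- If both parts touch `v`, then `v` lies in both bags and `cap_le` has tested the sum;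
        -- otherwise one summand vanishes.
        by_cases h1 : I.deg (I.part F (c + 1) (I.par c)) v = 0
        · omega
        by_cases h2 : I.deg (I.part F (c + 1) c) v = 0
        · omega
        rw [← Ne, ← mem_used_iff_deg, mem_used] at h1 h2
        obtain ⟨⟨_, x, hx, hx'⟩, ⟨_, j, hj, hj'⟩⟩ := sep_part hI hF hc0 hcM v (Or.inr h1) (Or.inr h2)
        have := hok.cap_le j hj x hx ⟨hj' ▸ hv, hx'.trans hj'.symm⟩
        rwa [e1.dg x hx (hx' ▸ hv), e2.dg j hj (hj' ▸ hv), hx', hj'] at this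
      · rw [part_step_other hI hF hc0 hip (by omega)]
        exact hR.deg_le i (by omega) v hv
    · intro i hi a ha
      by_cases hip : i = I.par c
      · subst hip
        rw [part_step_par hI hF hc0 hcM] at ha ⊢
        rcases Finset.mem_union.1 ha with ha | ha
        · obtain ⟨y, hy, hy'⟩ := hR.conn (I.par c) (by omega) a ha
          exact ⟨y, hy, hy'.mono Finset.subset_union_left⟩
        · obtain ⟨y, hy, hy'⟩ := hR.conn c (by omega) a ha
          by_cases hyp : I.InBag (I.par c) y
          · exact ⟨y, hyp, hy'.mono Finset.subset_union_right⟩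
          -- The boundary vertex `y` is forgotten in this merge; the condition `forget` provides
          -- another one in the same component that stays in the bag of the parent.
          obtain ⟨hy0, j, hj, rfl⟩ := hy
          have hused : I.slot c j ∈ I.used (I.part F (c + 1) c) := by
            rcases conn_used hy' with h | h
            · rw [h]; exact mem_used.2 ⟨a, ha, Or.inl rfl⟩
            · exact h
          rw [mem_used_iff_deg, ← e2.dg j hj hy0] at hused
          obtain ⟨j2, hj2, ⟨x, hx, hm⟩, hl⟩ := hok.forget j hj hy0 ((not_inBag_iff hy0).2 hyp) hused
          refine ⟨_, inBag_of_matched hx hm, (hy'.trans ?_).mono Finset.subset_union_right⟩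
          rcases (e2.lb j2 hj2 j hj).1 hl with rfl | ⟨_, _, h⟩
          · exact Conn.refl _ _
          · exact h.symm
      · rw [part_step_other hI hF hc0 hip (by omega)] at ha ⊢
        exact hR.conn i (by omega) a ha
    · rw [gainAt_step hI hF hc0 hcM e2, ← hg]
      refine sum_merge hpl ?_ hval
      intro i hi hip
      rw [ho c hc0 hcM i hi hip, hS.other i hi hip]
      rw [← ho c hc0 hcM i hi hip]
      exact (hpos (c + 1) (by omega) (by omega) i (by omega)).1

/-- Backtracking from a best state of the root yields a feasible set of maximum gain. -/
theorem optimal (hI : I.Valid) (hz : I.Codes z)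
    (hinit : ∀ a < I.M, ∀ s < I.S, T I.M a s = I.initTable z a s)
    (hT : ∀ c, 0 < c → c < I.M → I.Step c (T (c + 1)) (T c) C₁ C₂)
    {cu : ℕ → ℕ → ℕ}
    (hp : ∀ c, 0 < c → c < I.M → cu (c + 1) (I.par c) = C₁ c (cu c (I.par c)))
    (hc : ∀ c, 0 < c → c < I.M → cu (c + 1) c = C₂ c (cu c (I.par c)))
    (ho : ∀ c, 0 < c → c < I.M → ∀ i < c, i ≠ I.par c → cu (c + 1) i = cu c i)
    (hS : cu 1 0 < I.S)
    (hbest : ∀ s < I.S, T 1 0 s ≠ 0 → I.dg s 0 ≠ 0 →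
      I.dg (cu 1 0) 0 ≠ 0 ∧ T 1 0 s ≤ T 1 0 (cu 1 0))
    (hex : ∃ F, I.Feasible F) :
    I.Feasible (I.picks z (cu I.M)) ∧
      ∀ F, I.Feasible F → I.gain F ≤ I.gain (I.picks z (cu I.M)) := by
  have hbest' : ∀ F, I.Feasible F → T 1 0 (cu 1 0) ≠ 0 ∧ I.dg (cu 1 0) 0 ≠ 0 ∧
      I.gain F ≤ T 1 0 (cu 1 0) - 1 := by
    intro F hF
    obtain ⟨cur, hcur, hg⟩ := exists_states hI hz hinit hT hF (t := 1) (by omega) hI.M_pos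
    obtain ⟨h1, h2, h3⟩ := hcur 0 (by omega)
    rw [part_one hI hF.edge] at h2
    -- Position `0` is the apex, which a nonempty feasible set must use. This is why only root
    -- states with nonzero degree there compete.
    have h4 : I.dg (cur 0) 0 ≠ 0 := by
      have h0 := hI.slot_zero 0 hI.M_pos
      rw [h2.dg 0 hI.K_pos (by omega), h0, ← mem_used_iff_deg]
      obtain ⟨a, ha⟩ := hF.nonempty
      rcases conn_used (hF.conn a ha) with h | h
      · exact mem_used.2 ⟨a, ha, Or.inl h.symm⟩
      · exact h
    obtain ⟨h5, h6⟩ := hbest _ h1 h3 h4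
    rw [gainAt_one hI hF.edge] at hg
    simp only [Finset.range_one, Finset.sum_singleton] at hg
    exact ⟨by omega, h5, by omega⟩
  obtain ⟨F₀, hF₀⟩ := hex
  obtain ⟨hT0, hd0, -⟩ := hbest' F₀ hF₀
  -- Nonzero entries propagate backwards, because the two choices recorded for a nonzero entry are
  -- nonzero entries themselves.
  have hpos : ∀ t, 0 < t → t ≤ I.M → ∀ i < t, cu t i < I.S ∧ T t i (cu t i) ≠ 0 := by
    intro t ht
    induction t, ht using Nat.le_induction with
    | base =>
      intro _ i hi
      obtain rfl : i = 0 := by omega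
      exact ⟨hS, hT0⟩
    | succ c hc1 ih =>
      intro hcM i hi
      have hpl := hI.par_lt c (by omega) (by omega)
      obtain ⟨h1, h2⟩ := ih (by omega) (I.par c) hpl
      obtain ⟨k1, k2, k3, k4, -⟩ := (hT c (by omega) (by omega)).sound _ h1 h2
      rw [← hp c (by omega) (by omega)] at k1 k3
      rw [← hc c (by omega) (by omega)] at k2 k4
      by_cases hic : i = c
      · subst hic; exact ⟨k2, k4⟩
      by_cases hip : i = I.par c
      · subst hip; exact ⟨k1, k3⟩
      obtain ⟨h3, h4⟩ := ih (by omega) i (by omega)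
      rw [ho c (by omega) (by omega) i (by omega) hip]
      exact ⟨h3, by rwa [← (hT c (by omega) (by omega)).other i (by omega) hip _ h3]⟩
  have hF : ∀ a ∈ I.picks z (cu I.M), a < I.M ∧ I.ty a ≠ 0 := by
    intro a ha
    simp only [picks, Finset.mem_filter, Finset.mem_range] at ha
    exact ⟨ha.1, ha.2.1⟩
  obtain ⟨hR, hg⟩ := reached hI hz hinit hT hp hc ho hpos (t := 1) (by omega) hI.M_pos
  have h1 := hR.exact 0 (by omega)
  have h2 := hR.deg_le 0 (by omega)
  have h3 := hR.conn 0 (by omega)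
  rw [part_one hI hF] at h1 h2 h3
  rw [gainAt_one hI hF] at hg
  simp only [Finset.range_one, Finset.sum_singleton] at hg
  refine ⟨⟨hF, h2, ?_, ?_⟩, ?_⟩
  · intro a ha
    obtain ⟨y, hy, hc⟩ := h3 a ha
    rwa [hI.root y hy] at hc
  · have h0 := hI.slot_zero 0 hI.M_pos
    rw [h1.dg 0 hI.K_pos (by omega), h0, ← mem_used_iff_deg, mem_used] at hd0
    obtain ⟨a, ha, _⟩ := hd0
    exact ⟨a, ha⟩
  · intro F hF'
    rw [← hg]
    exact (hbest' F hF').2.2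

end Layout
end BinTree

/-! ## Feasible edge sets and binary trees -/

namespace BinTree
namespace Layout

/-- The edge nodes of `I` are the edges of `G`, listed in `E`, and an edge from the apex to every
vertex. The code of the vertex `v` is `v + 2`. -/
structure Represents (I : Layout) {n : ℕ} (G : SimpleGraph (Fin n)) (E : List (Fin n × Fin n))
    (N : ℕ) : Prop where
  edges : ListsEdges E G.edgeSet
  M_eq : I.M = N + 1 + E.length + n
  ty_node : ∀ a, a < N + 1 → I.ty a = 0
  ty_edge : ∀ e : Fin E.length, I.ty (N + 1 + e) ≠ 0
  ea_edge : ∀ e : Fin E.length, I.ea (N + 1 + e) = E[e].1 + 2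
  eb_edge : ∀ e : Fin E.length, I.eb (N + 1 + e) = E[e].2 + 2
  ty_star : ∀ v : Fin n, I.ty (N + 1 + E.length + v) ≠ 0
  ea_star : ∀ v : Fin n, I.ea (N + 1 + E.length + v) = 1
  eb_star : ∀ v : Fin n, I.eb (N + 1 + E.length + v) = v + 2

variable {I : Layout} {n : ℕ} {G : SimpleGraph (Fin n)} {E : List (Fin n × Fin n)} {N : ℕ}

theorem edge_inj (hE : ListsEdges E G.edgeSet) {e e' : Fin E.length}
    (h : s(E[e].1, E[e].2) = s(E[e'].1, E[e'].2)) : e = e' := by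
  have hn := hE.1
  rw [List.nodup_iff_injective_get] at hn
  have := @hn ⟨e, by simp⟩ ⟨e', by simp⟩ (by simpa using h)
  simpa [Fin.ext_iff] using this

theorem edge_adj (hE : ListsEdges E G.edgeSet) (e : Fin E.length) : G.Adj E[e].1 E[e].2 := by
  have := (hE.2 s(E[e].1, E[e].2)).1 (List.mem_map.2 ⟨E[e], List.getElem_mem _, rfl⟩)
  simpa using this

theorem exists_edge (hE : ListsEdges E G.edgeSet) {u v : Fin n} (h : G.Adj u v) :
    ∃ e : Fin E.length, s(E[e].1, E[e].2) = s(u, v) := by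
  obtain ⟨x, hx, hxe⟩ := List.mem_map.1 ((hE.2 s(u, v)).2 (by simpa using h))
  obtain ⟨i, hi, rfl⟩ := List.getElem_of_mem hx
  exact ⟨⟨i, hi⟩, hxe⟩

/-- The chosen edges of `G`. -/
def chosenEdges (E : List (Fin n × Fin n)) (N : ℕ) (F : Finset ℕ) : Finset (Fin E.length) :=
  Finset.univ.filter fun e => N + 1 + e ∈ F

/-- The chosen edges at the apex. -/
def chosenRoots (E : List (Fin n × Fin n)) (N : ℕ) (F : Finset ℕ) : Finset (Fin n) :=
  Finset.univ.filter fun v => N + 1 + E.length + v ∈ F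

theorem mem_cases (hR : I.Represents G E N) {a : ℕ} (ha : a < I.M ∧ I.ty a ≠ 0) :
    (∃ e : Fin E.length, a = N + 1 + e) ∨ ∃ v : Fin n, a = N + 1 + E.length + v := by
  have h1 := hR.M_eq
  have h2 := hR.ty_node a
  by_cases h3 : a < N + 1
  · exact absurd (h2 h3) ha.2
  by_cases h4 : a < N + 1 + E.length
  · exact Or.inl ⟨⟨a - (N + 1), by omega⟩, by simp; omega⟩
  · exact Or.inr ⟨⟨a - (N + 1 + E.length), by omega⟩, by simp; omega⟩

theorem card_eq (hR : I.Represents G E N) {F : Finset ℕ} (hF : ∀ a ∈ F, a < I.M ∧ I.ty a ≠ 0) :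
    F.card = (chosenEdges E N F).card + (chosenRoots E N F).card := by
  have h1 : F = (chosenEdges E N F).image (fun e : Fin E.length => N + 1 + (e : ℕ)) ∪
      (chosenRoots E N F).image (fun v : Fin n => N + 1 + E.length + (v : ℕ)) := by
    ext a
    simp only [Finset.mem_union, Finset.mem_image, chosenEdges, chosenRoots, Finset.mem_filter,
      Finset.mem_univ, true_and]
    constructor
    · intro ha
      rcases mem_cases hR (hF a ha) with ⟨e, rfl⟩ | ⟨v, rfl⟩
      · exact Or.inl ⟨e, ha, rfl⟩
      · exact Or.inr ⟨v, ha, rfl⟩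
    · rintro (⟨e, he, rfl⟩ | ⟨v, hv, rfl⟩) <;> assumption
  conv_lhs => rw [h1]
  rw [Finset.card_union_of_disjoint, Finset.card_image_of_injective, Finset.card_image_of_injective]
  · intro a b h; ext; simpa using h
  · intro a b h; ext; simpa using h
  · rw [Finset.disjoint_left]
    intro a ha hb
    simp only [Finset.mem_image] at ha hb
    obtain ⟨e, _, rfl⟩ := ha
    obtain ⟨v, _, hv⟩ := hb
    have := e.2
    omega

theorem card_unpicked (hR : I.Represents G E N) {F : Finset ℕ}
    (hF : ∀ a ∈ F, a < I.M ∧ I.ty a ≠ 0) : (I.unpicked F).card + F.card = E.length + n := by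
  have h1 : (I.unpicked F).card + F.card = ((Finset.range I.M).filter fun a => I.ty a ≠ 0).card := by
    rw [← Finset.card_union_of_disjoint]
    · congr 1
      ext a
      simp only [unpicked, Finset.mem_union, Finset.mem_filter, Finset.mem_range]
      constructor
      · rintro (h | h)
        · exact ⟨h.1, h.2.1⟩
        · exact hF a h
      · intro h
        by_cases ha : a ∈ F
        · exact Or.inr ha
        · exact Or.inl ⟨h.1, h.2, ha⟩
    · rw [Finset.disjoint_left]
      intro a ha hb
      simp only [unpicked, Finset.mem_filter] at ha
      exact ha.2.2 hb
  have h2 : ∀ a ∈ (Finset.range I.M).filter (fun a => I.ty a ≠ 0), a < I.M ∧ I.ty a ≠ 0 := by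
    intro a ha
    simpa using ha
  rw [h1, card_eq hR h2]
  have h3 := hR.M_eq
  congr 1
  · rw [chosenEdges, Finset.filter_true_of_mem]
    · simp
    · intro e _
      simp only [Finset.mem_filter, Finset.mem_range]
      exact ⟨by have := e.2; omega, hR.ty_edge e⟩
  · rw [chosenRoots, Finset.filter_true_of_mem]
    · simp
    · intro e _
      simp only [Finset.mem_filter, Finset.mem_range]
      exact ⟨by have := e.2; omega, hR.ty_star e⟩

theorem deg_apex (hR : I.Represents G E N) {F : Finset ℕ} (hF : ∀ a ∈ F, a < I.M ∧ I.ty a ≠ 0) :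
    I.deg F 1 = (chosenRoots E N F).card := by
  symm
  refine Finset.card_bij (fun v _ => N + 1 + E.length + (v : ℕ)) ?_ ?_ ?_
  · intro v hv
    simp only [chosenRoots, Finset.mem_filter, Finset.mem_univ, true_and] at hv
    exact Finset.mem_filter.2 ⟨hv, Or.inl (hR.ea_star v)⟩
  · intro a _ b _ h; ext; simpa using h
  · intro a ha
    rw [Finset.mem_filter] at ha
    rcases mem_cases hR (hF a ha.1) with ⟨e, rfl⟩ | ⟨v, rfl⟩
    · rw [hR.ea_edge, hR.eb_edge] at ha
      omega
    · exact ⟨v, by simpa [chosenRoots] using ha.1, rfl⟩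

/-- The subgraph of the chosen edges. -/
def toSubgraph (I : Layout) {E : List (Fin n × Fin n)} (hE : ListsEdges E G.edgeSet) (N : ℕ)
    (hR : I.Represents G E N) (F : Finset ℕ) : G.Subgraph where
  verts := {v | (v : ℕ) + 2 ∈ I.used F}
  Adj u v := ∃ e ∈ chosenEdges E N F, s(E[e].1, E[e].2) = s(u, v)
  adj_sub := by
    rintro u v ⟨e, _, he⟩
    have := edge_adj hE e
    rw [← SimpleGraph.mem_edgeSet] at this ⊢
    rwa [← he]
  edge_vert := by
    rintro u v ⟨e, he, h⟩
    simp only [chosenEdges, Finset.mem_filter, Finset.mem_univ, true_and] at he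
    refine mem_used.2 ⟨_, he, ?_⟩
    rw [hR.ea_edge, hR.eb_edge]
    rw [Sym2.eq_iff] at h
    rcases h with ⟨h, _⟩ | ⟨_, h⟩
    · exact Or.inl (by rw [h])
    · exact Or.inr (by rw [h])
  symm := ⟨by
    rintro u v ⟨e, he, h⟩
    exact ⟨e, he, by rw [h, Sym2.eq_swap]⟩⟩

/-- Every edge is connected to the apex and there is at least one, so the apex has positive degree;
its cap is one. -/
theorem exists_root (hR : I.Represents G E N) {F : Finset ℕ} (hF : I.Feasible F) :
    ∃ r, chosenRoots E N F = {r} := by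
  rw [← Finset.card_eq_one, ← deg_apex hR hF.edge]
  have h1 := hF.deg_le 1 (by norm_num)
  rw [cap, if_pos rfl] at h1
  have : I.deg F 1 ≠ 0 := by
    rw [← mem_used_iff_deg]
    obtain ⟨a, ha⟩ := hF.nonempty
    rcases conn_used (hF.conn a ha) with h | h
    · exact mem_used.2 ⟨a, ha, Or.inl h.symm⟩
    · exact h
  omega

section
variable (hR : I.Represents G E N) {F : Finset ℕ} (hF : I.Feasible F)
include hR hF

/-- A walk in `F` enters and leaves the apex by its only edge, which returns it to the root `r`. So
whatever is reached from `r` in `F` is reached without the apex. -/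
theorem toSubgraph_connected : (I.toSubgraph hR.edges N hR F).Connected := by
  obtain ⟨r, hr⟩ := exists_root hR hF
  have hrF : N + 1 + E.length + (r : ℕ) ∈ F := by
    have : r ∈ chosenRoots E N F := by rw [hr]; simp
    simpa [chosenRoots] using this
  have hrv : r ∈ (I.toSubgraph hR.edges N hR F).verts :=
    mem_used.2 ⟨_, hrF, Or.inr (hR.eb_star r)⟩
  set T := I.toSubgraph hR.edges N hR F with hT
  have key : ∀ x, I.Conn F (r + 2) x → (x = 1 ∨ ∃ v : Fin n, x = v + 2 ∧ ∃ hv : v ∈ T.verts,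
      T.coe.Reachable ⟨r, hrv⟩ ⟨v, hv⟩) := by
    intro x hx
    have hadj : ∀ e : Fin E.length, N + 1 + (e : ℕ) ∈ F → T.Adj E[e].1 E[e].2 :=
      fun e he => ⟨e, by simpa [chosenEdges] using he, rfl⟩
    have step : ∀ u v : Fin n, T.Adj u v → ((u : ℕ) + 2 = 1 ∨ ∃ w : Fin n, (u : ℕ) + 2 = w + 2 ∧
        ∃ hv : w ∈ T.verts, T.coe.Reachable ⟨r, hrv⟩ ⟨w, hv⟩) →
        ((v : ℕ) + 2 = 1 ∨ ∃ w : Fin n, (v : ℕ) + 2 = w + 2 ∧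
        ∃ hv : w ∈ T.verts, T.coe.Reachable ⟨r, hrv⟩ ⟨w, hv⟩) := by
      rintro u v huv (h | ⟨w, h, hw, hw'⟩)
      · omega
      · obtain rfl : u = w := by ext; omega
        refine Or.inr ⟨v, rfl, T.edge_vert huv.symm, hw'.trans (SimpleGraph.Adj.reachable ?_)⟩
        exact huv
    refine hx.induction (P := fun x => x = 1 ∨ ∃ v : Fin n, x = v + 2 ∧ ∃ hv : v ∈ T.verts,
      T.coe.Reachable ⟨r, hrv⟩ ⟨v, hv⟩) ?_ ?_ ?_
    · exact Or.inr ⟨r, rfl, hrv, SimpleGraph.Reachable.refl _⟩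
    · intro a ha h
      rcases mem_cases hR (hF.edge a ha) with ⟨e, rfl⟩ | ⟨v, rfl⟩
      · rw [hR.ea_edge] at h
        rw [hR.eb_edge]
        exact step _ _ (hadj e ha) h
      · have : v ∈ chosenRoots E N F := by simpa [chosenRoots] using ha
        rw [hr, Finset.mem_singleton] at this
        subst this
        rw [hR.eb_star]
        exact Or.inr ⟨v, rfl, hrv, SimpleGraph.Reachable.refl _⟩
    · intro a ha h
      rcases mem_cases hR (hF.edge a ha) with ⟨e, rfl⟩ | ⟨v, rfl⟩
      · rw [hR.eb_edge] at h
        rw [hR.ea_edge]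
        exact step _ _ (hadj e ha).symm h
      · exact Or.inl (hR.ea_star v)
  have hrc : I.Conn F (r + 2) 1 := by
    have := Conn.edge (I := I) hrF
    rw [hR.ea_star, hR.eb_star] at this
    exact this.symm
  have hreach : ∀ v (hv : v ∈ T.verts), T.coe.Reachable ⟨r, hrv⟩ ⟨v, hv⟩ := by
    intro v hv
    obtain ⟨a, ha, hav⟩ := mem_used.1 hv
    have : I.Conn F (r + 2) (v + 2) := by
      rcases hav with h | h
      · exact h ▸ hrc.trans (hF.conn a ha).symm
      · exact h ▸ (hrc.trans (hF.conn a ha).symm).trans (Conn.edge ha)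
    rcases key _ this with h | ⟨w, h, hw, hw'⟩
    · omega
    · obtain rfl : v = w := by ext; omega
      exact hw'
  refine ⟨?_⟩
  rw [SimpleGraph.connected_iff]
  exact ⟨fun u v => (hreach u.1 u.2).symm.trans (hreach v.1 v.2), ⟨⟨r, hrv⟩⟩⟩

/-- Distinct neighbours of `v` come from distinct edge nodes at `v`. -/
theorem toSubgraph_degree (v : Fin n) :
    ((I.toSubgraph hR.edges N hR F).neighborSet v).ncard ≤ 3 := by
  have h3 := hF.deg_le (v + 2) (by omega)
  rw [cap, if_neg (by omega)] at h3
  refine le_trans ?_ h3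
  have hch : ∀ u : Fin n, ∃ a, u ∈ (I.toSubgraph hR.edges N hR F).neighborSet v →
      a ∈ F.filter (fun a => I.ea a = v + 2 ∨ I.eb a = v + 2) ∧
      ∃ e : Fin E.length, a = N + 1 + e ∧ s(E[e].1, E[e].2) = s(v, u) := by
    intro u
    by_cases hu : u ∈ (I.toSubgraph hR.edges N hR F).neighborSet v
    · obtain ⟨e, he, h⟩ := hu
      refine ⟨N + 1 + e, fun _ => ⟨?_, e, rfl, h⟩⟩
      rw [Finset.mem_filter]
      refine ⟨by simpa [chosenEdges] using he, ?_⟩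
      rw [hR.ea_edge, hR.eb_edge]
      rw [Sym2.eq_iff] at h
      rcases h with ⟨h, _⟩ | ⟨_, h⟩
      · exact Or.inl (by rw [h])
      · exact Or.inr (by rw [h])
    · exact ⟨0, fun h => absurd h hu⟩
  choose f hf using hch
  rw [deg, ← Set.ncard_coe_finset]
  refine Set.ncard_le_ncard_of_injOn f (fun u hu => (hf u hu).1) ?_ (Finset.finite_toSet _)
  intro u hu u' hu' h
  obtain ⟨-, e, he, h1⟩ := hf u hu
  obtain ⟨-, e', he', h2⟩ := hf u' hu'
  obtain rfl : e = e' := by ext; omega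
  exact Sym2.congr_right.1 (h1.symm.trans h2)

/-- The additional one is the apex edge. -/
theorem toSubgraph_card : ((I.toSubgraph hR.edges N hR F).edgeSet).ncard + 1 = F.card := by
  obtain ⟨r, hr⟩ := exists_root hR hF
  rw [card_eq hR hF.edge, hr, Finset.card_singleton]
  congr 1
  have : (I.toSubgraph hR.edges N hR F).edgeSet =
      (fun e : Fin E.length => s(E[e].1, E[e].2)) '' (chosenEdges E N F) := by
    ext x
    induction x using Sym2.ind with
    | _ u v =>
      rw [SimpleGraph.Subgraph.mem_edgeSet]
      constructor
      · rintro ⟨e, he, h⟩; exact ⟨e, he, h⟩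
      · rintro ⟨e, he, h⟩; exact ⟨e, he, h⟩
  rw [this, Set.ncard_image_of_injective _ (fun e e' h => edge_inj hR.edges h), Set.ncard_coe_finset]

theorem toSubgraph_verts : ((I.toSubgraph hR.edges N hR F).verts).ncard = ((I.used F).erase 1).card := by
  rw [← Set.ncard_image_of_injective _ (f := fun v : Fin n => (v : ℕ) + 2)
    (fun a b h => by ext; simpa using h), ← Set.ncard_coe_finset]
  congr 1
  ext x
  simp only [Set.mem_image, Finset.coe_erase, Set.mem_sdiff, Finset.mem_coe, Set.mem_singleton_iff]
  constructor
  · rintro ⟨v, hv, rfl⟩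
    exact ⟨hv, by omega⟩
  · rintro ⟨hx, hx1⟩
    suffices h : ∃ v : Fin n, (v : ℕ) + 2 = x by
      obtain ⟨v, rfl⟩ := h
      exact ⟨v, hx, rfl⟩
    obtain ⟨a, ha, h⟩ := mem_used.1 hx
    rcases mem_cases hR (hF.edge a ha) with ⟨e, rfl⟩ | ⟨v, rfl⟩
    · rw [hR.ea_edge, hR.eb_edge] at h
      rcases h with h | h
      · exact ⟨_, h⟩
      · exact ⟨_, h⟩
    · rw [hR.ea_star, hR.eb_star] at h
      rcases h with h | h
      · exact absurd h.symm hx1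
      · exact ⟨_, h⟩

end

/-! ### From binary trees to feasible edge sets -/

theorem isTree_coe_of_isBinaryTree {T : G.Subgraph} (h : IsBinaryTree T) : T.coe.IsTree :=
  ⟨h.1.coe, h.2.1⟩

theorem ncard_edgeSet_coe (T : G.Subgraph) : T.edgeSet.ncard = Nat.card T.coe.edgeSet := by
  rw [← SimpleGraph.Subgraph.image_coe_edgeSet_coe, Set.ncard_image_of_injective _
    (Sym2.map.injective Subtype.val_injective)]
  rfl

theorem ncard_edgeSet_of_isTree {T : G.Subgraph} (h : T.coe.IsTree) :
    T.edgeSet.ncard + 1 = T.verts.ncard := by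
  rw [SimpleGraph.isTree_iff_connected_and_card] at h
  rw [ncard_edgeSet_coe, h.2]
  rfl

theorem ncard_neighborSet_coe (T : G.Subgraph) (v : T.verts) :
    (T.coe.neighborSet v).ncard = (T.neighborSet v).ncard := by
  rw [← Set.ncard_image_of_injective _ Subtype.val_injective]
  congr 1
  ext u
  simp only [Set.mem_image, SimpleGraph.mem_neighborSet, SimpleGraph.Subgraph.coe_adj,
    SimpleGraph.Subgraph.mem_neighborSet, Subtype.exists, exists_and_right, exists_eq_right]
  constructor
  · rintro ⟨_, h⟩; exact h
  · intro h; exact ⟨T.edge_vert h.symm, h⟩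

/-- A tree has a vertex of degree at most two. -/
theorem exists_degree_le_two {T : G.Subgraph} (h : T.coe.IsTree) :
    ∃ r ∈ T.verts, (T.neighborSet r).ncard ≤ 2 := by
  classical
  have := h.1.nonempty
  rcases subsingleton_or_nontrivial T.verts with hs | hs
  · obtain ⟨r⟩ := h.1.nonempty
    refine ⟨r, r.2, ?_⟩
    rw [← ncard_neighborSet_coe]
    have : T.coe.neighborSet r = ∅ := by
      ext u
      simp only [SimpleGraph.mem_neighborSet, Set.mem_empty_iff_false, iff_false]
      intro hu
      exact hu.ne (Subsingleton.elim _ _)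
    rw [this]; simp
  · obtain ⟨r, hr⟩ := h.exists_vert_degree_one_of_nontrivial
    refine ⟨r, r.2, ?_⟩
    rw [← ncard_neighborSet_coe, Set.ncard_eq_toFinset_card', ← SimpleGraph.neighborFinset_def,
      SimpleGraph.card_neighborFinset_eq_degree]
    exact le_of_eq_of_le (by convert hr) one_le_two

/-- A connected subgraph contains a spanning tree. -/
theorem exists_spanning_tree {T : G.Subgraph} (h : T.Connected)
    (hd : ∀ v, (T.neighborSet v).ncard ≤ 3) :
    ∃ T' : G.Subgraph, IsBinaryTree T' ∧ T'.verts = T.verts := by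
  obtain ⟨H, hH, hHt⟩ := h.coe.exists_isTree_le
  let T' : G.Subgraph :=
    { verts := T.verts
      Adj := fun u v => ∃ (hu : u ∈ T.verts) (hv : v ∈ T.verts), H.Adj ⟨u, hu⟩ ⟨v, hv⟩
      adj_sub := fun ⟨_, _, h⟩ => T.adj_sub (hH h)
      edge_vert := fun ⟨hu, _, _⟩ => hu
      symm := ⟨fun _ _ ⟨hu, hv, h⟩ => ⟨hv, hu, h.symm⟩⟩ }
  have hc : T'.coe = H := by
    ext u v
    constructor
    · rintro ⟨_, _, h⟩; exact h
    · intro h; exact ⟨u.2, v.2, h⟩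
  refine ⟨T', ⟨⟨hc ▸ hHt.1⟩, hc ▸ hHt.2, fun v _ => ?_⟩, rfl⟩
  refine (Set.ncard_le_ncard ?_ (Set.toFinite _)).trans (hd v)
  rintro u ⟨hv, hu, h⟩
  exact hH h

open Classical in
/-- The edge nodes of a subgraph with a root. -/
noncomputable def ofSubgraph (E : List (Fin n × Fin n)) (N : ℕ) (T : G.Subgraph) (r : Fin n) :
    Finset ℕ :=
  (Finset.univ.filter fun e : Fin E.length => s(E[e].1, E[e].2) ∈ T.edgeSet).image
    (fun e : Fin E.length => N + 1 + (e : ℕ)) ∪ {N + 1 + E.length + (r : ℕ)}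

theorem mem_ofSubgraph {T : G.Subgraph} {r : Fin n} {a : ℕ} :
    a ∈ ofSubgraph E N T r ↔ (∃ e : Fin E.length, a = N + 1 + e ∧ T.Adj E[e].1 E[e].2) ∨
      a = N + 1 + E.length + r := by
  simp only [ofSubgraph, Finset.mem_union, Finset.mem_image, Finset.mem_filter, Finset.mem_univ,
    true_and, SimpleGraph.Subgraph.mem_edgeSet, Finset.mem_singleton]
  constructor
  · rintro (⟨e, h, rfl⟩ | h)
    · exact Or.inl ⟨e, rfl, h⟩
    · exact Or.inr h
  · rintro (⟨e, rfl, h⟩ | h)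
    · exact Or.inl ⟨e, h, rfl⟩
    · exact Or.inr h

section
variable (hR : I.Represents G E N) {T : G.Subgraph} {r : Fin n}
include hR

theorem ofSubgraph_edge : ∀ a ∈ ofSubgraph E N T r, a < I.M ∧ I.ty a ≠ 0 := by
  intro a ha
  have := hR.M_eq
  rcases mem_ofSubgraph.1 ha with ⟨e, rfl, _⟩ | rfl
  · exact ⟨by omega, hR.ty_edge e⟩
  · exact ⟨by omega, hR.ty_star r⟩

theorem ofSubgraph_conn (hT : T.Connected) (hr : r ∈ T.verts) {v : Fin n} (hv : v ∈ T.verts) :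
    I.Conn (ofSubgraph E N T r) (v + 2) 1 := by
  have hstar : I.Conn (ofSubgraph E N T r) (r + 2) 1 := by
    have := Conn.edge (I := I) (mem_ofSubgraph (E := E) (N := N) (T := T) (r := r).2 (Or.inr rfl))
    rw [hR.ea_star, hR.eb_star] at this
    exact this.symm
  obtain ⟨p⟩ := hT.coe.preconnected ⟨v, hv⟩ ⟨r, hr⟩
  have : ∀ (x y : T.verts) (p : T.coe.Walk x y),
      I.Conn (ofSubgraph E N T r) ((x : Fin n) + 2) ((y : Fin n) + 2) := by
    intro x y p
    induction p with
    | nil => exact Conn.refl _ _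
    | @cons u v w h p ih =>
      refine Conn.trans ?_ ih
      have h' : T.Adj u v := h
      obtain ⟨e, he⟩ := exists_edge hR.edges (T.adj_sub h')
      have hmem : N + 1 + (e : ℕ) ∈ ofSubgraph E N T r := by
        refine mem_ofSubgraph.2 (Or.inl ⟨e, rfl, ?_⟩)
        rw [← SimpleGraph.Subgraph.mem_edgeSet, he]
        exact h'
      have hc := Conn.edge (I := I) hmem
      rw [hR.ea_edge, hR.eb_edge] at hc
      rw [Sym2.eq_iff] at he
      rcases he with ⟨h1, h2⟩ | ⟨h1, h2⟩
      · rwa [h1, h2] at hc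
      · rw [h1, h2] at hc
        exact hc.symm
  exact (this _ _ p).trans hstar

/-- Only the root receives an edge beyond those of `T`, and it has degree at most two in `T`. -/
theorem ofSubgraph_deg (h3 : ∀ v ∈ T.verts, (T.neighborSet v).ncard ≤ 3)
    (h2 : (T.neighborSet r).ncard ≤ 2) (v : ℕ) : I.deg (ofSubgraph E N T r) v ≤ cap v := by
  classical
  by_cases h1 : v = 1
  · subst h1
    rw [deg_apex hR (ofSubgraph_edge hR), cap, if_pos rfl]
    have : chosenRoots E N (ofSubgraph E N T r) ⊆ {r} := by
      intro x hx
      simp only [chosenRoots, Finset.mem_filter, Finset.mem_univ, true_and, mem_ofSubgraph] at hx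
      rcases hx with ⟨e, he, _⟩ | h
      · have := e.2; omega
      · rw [Finset.mem_singleton]; ext; omega
    exact (Finset.card_le_card this).trans (by simp)
  rw [cap, if_neg h1]
  by_cases hv : ∃ u : Fin n, v = u + 2
  · obtain ⟨u, rfl⟩ := hv
    have hsub : (ofSubgraph E N T r).filter (fun a => I.ea a = u + 2 ∨ I.eb a = u + 2) ⊆
        ((Finset.univ.filter fun e : Fin E.length => T.Adj E[e].1 E[e].2 ∧
          (E[e].1 = u ∨ E[e].2 = u)).image (fun e : Fin E.length => N + 1 + (e : ℕ))) ∪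
        (if u = r then {N + 1 + E.length + (r : ℕ)} else ∅) := by
      intro a ha
      rw [Finset.mem_filter, mem_ofSubgraph] at ha
      obtain ⟨⟨e, rfl, hT⟩ | rfl, ha⟩ := ha
      · rw [hR.ea_edge, hR.eb_edge] at ha
        refine Finset.mem_union_left _ (Finset.mem_image.2 ⟨e, ?_, rfl⟩)
        simp only [Finset.mem_filter, Finset.mem_univ, true_and]
        refine ⟨hT, ?_⟩
        rcases ha with h | h
        · left; ext; omega
        · right; ext; omega
      · rw [hR.ea_star, hR.eb_star] at ha
        have : u = r := by ext; omega
        rw [if_pos this]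
        exact Finset.mem_union_right _ (Finset.mem_singleton_self _)
    have hcard : (Finset.univ.filter fun e : Fin E.length => T.Adj E[e].1 E[e].2 ∧
          (E[e].1 = u ∨ E[e].2 = u)).card ≤ (T.neighborSet u).ncard := by
      rw [← Set.ncard_coe_finset]
      have hother : ∀ e : Fin E.length, (E[e].1 = u ∨ E[e].2 = u) →
          s(E[e].1, E[e].2) = s(u, if E[e].1 = u then E[e].2 else E[e].1) := by
        intro e he
        split_ifs with h
        · rw [h]
        · rw [he.resolve_left h, Sym2.eq_swap]
      refine Set.ncard_le_ncard_of_injOn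
        (fun e : Fin E.length => if E[e].1 = u then E[e].2 else E[e].1) ?_ ?_ (Set.toFinite _)
      · intro e he
        simp only [Finset.coe_filter, Finset.mem_univ, true_and, Set.mem_ofPred_eq] at he
        have := hother e he.2
        rw [SimpleGraph.Subgraph.mem_neighborSet, ← SimpleGraph.Subgraph.mem_edgeSet, ← this]
        exact he.1
      · intro e he e' he' h
        simp only [Finset.coe_filter, Finset.mem_univ, true_and, Set.mem_ofPred_eq] at he he'
        apply edge_inj hR.edges
        rw [hother e he.2, hother e' he'.2]
        dsimp only at h
        rw [h]
    refine (Finset.card_le_card hsub).trans ((Finset.card_union_le _ _).trans ?_)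
    have h4 := Finset.card_image_le (s := Finset.univ.filter fun e : Fin E.length =>
      T.Adj E[e].1 E[e].2 ∧ (E[e].1 = u ∨ E[e].2 = u)) (f := fun e : Fin E.length => N + 1 + (e : ℕ))
    by_cases hur : u = r
    · subst hur
      rw [if_pos rfl, Finset.card_singleton]
      omega
    · rw [if_neg hur, Finset.card_empty]
      by_cases hu : u ∈ T.verts
      · have := h3 u hu
        omega
      · have : (T.neighborSet u).ncard = 0 := by
          rw [Set.ncard_eq_zero]
          ext w
          simp only [SimpleGraph.Subgraph.mem_neighborSet, Set.mem_empty_iff_false, iff_false]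
          exact fun h => hu (T.edge_vert h)
        omega
  · have : I.deg (ofSubgraph E N T r) v = 0 := by
      rw [deg_eq_zero]
      rintro a ha h
      rcases mem_ofSubgraph.1 ha with ⟨e, rfl, _⟩ | rfl
      · rw [hR.ea_edge, hR.eb_edge] at h
        rcases h with h | h
        · exact hv ⟨_, h.symm⟩
        · exact hv ⟨_, h.symm⟩
      · rw [hR.ea_star, hR.eb_star] at h
        rcases h with h | h
        · exact h1 h.symm
        · exact hv ⟨_, h.symm⟩
    omega

/-- The edge set of a binary tree. -/
theorem exists_feasible (hT : IsBinaryTree T) :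
    ∃ F, I.Feasible F ∧ I.gain F = E.length + n + T.verts.ncard := by
  classical
  obtain ⟨r, hr, h2⟩ := exists_degree_le_two (isTree_coe_of_isBinaryTree hT)
  have hedge := ofSubgraph_edge (E := E) (N := N) (T := T) (r := r) hR
  have hfeas : I.Feasible (ofSubgraph E N T r) := by
    refine ⟨hedge, fun v _ => ofSubgraph_deg hR hT.2.2 h2 v, ?_, ⟨_, mem_ofSubgraph.2 (Or.inr rfl)⟩⟩
    intro a ha
    rcases mem_ofSubgraph.1 ha with ⟨e, rfl, h⟩ | rfl
    · rw [hR.ea_edge]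
      exact ofSubgraph_conn hR hT.1 hr (T.edge_vert h)
    · rw [hR.ea_star]
      exact Conn.refl _ _
  refine ⟨_, hfeas, ?_⟩
  have hverts : (I.toSubgraph hR.edges N hR (ofSubgraph E N T r)).verts = T.verts := by
    ext v
    refine Iff.trans (mem_used (F := ofSubgraph E N T r) (v := v + 2)) ?_
    constructor
    · rintro ⟨a, ha, h⟩
      rcases mem_ofSubgraph.1 ha with ⟨e, rfl, hadj⟩ | rfl
      · rw [hR.ea_edge, hR.eb_edge] at h
        rcases h with h | h
        · have : E[e].1 = v := by ext; omega
          exact this ▸ T.edge_vert hadj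
        · have : E[e].2 = v := by ext; omega
          exact this ▸ T.edge_vert hadj.symm
      · rw [hR.ea_star, hR.eb_star] at h
        have : r = v := by ext; omega
        exact this ▸ hr
    · intro hv
      rcases conn_used (ofSubgraph_conn hR hT.1 hr hv).symm with h | h
      · omega
      · exact mem_used.1 h
  have hedges : (I.toSubgraph hR.edges N hR (ofSubgraph E N T r)).edgeSet = T.edgeSet := by
    ext x
    induction x using Sym2.ind with
    | _ u v =>
      rw [SimpleGraph.Subgraph.mem_edgeSet, SimpleGraph.Subgraph.mem_edgeSet]
      constructor
      · rintro ⟨e, he, h⟩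
        simp only [chosenEdges, Finset.mem_filter, Finset.mem_univ, true_and, mem_ofSubgraph] at he
        rcases he with ⟨e', he', hadj⟩ | h'
        · obtain rfl : e = e' := by ext; omega
          rwa [← SimpleGraph.Subgraph.mem_edgeSet, h, SimpleGraph.Subgraph.mem_edgeSet] at hadj
        · have := e.2; omega
      · intro h
        obtain ⟨e, he⟩ := exists_edge hR.edges (T.adj_sub h)
        refine ⟨e, ?_, he⟩
        simp only [chosenEdges, Finset.mem_filter, Finset.mem_univ, true_and, mem_ofSubgraph]
        refine Or.inl ⟨e, rfl, ?_⟩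
        rwa [← SimpleGraph.Subgraph.mem_edgeSet, he]
  -- The set consists of `|V| - 1` tree edges and the apex edge. So the unpicked edges contribute `m
  -- + n - |V|`, and the vertices contribute `2 |V|`.
  have h1 := card_unpicked hR hedge
  have h3 := toSubgraph_card hR hfeas
  have h4 := toSubgraph_verts hR hfeas
  have h5 := ncard_edgeSet_of_isTree (isTree_coe_of_isBinaryTree hT)
  rw [hedges] at h3
  rw [hverts] at h4
  rw [gain]
  omega

end

/-- A feasible edge set of maximum gain is a maximum binary tree. -/
theorem isMaximumBinaryTree_of_optimal (hR : I.Represents G E N) {F : Finset ℕ} (hF : I.Feasible F)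
    (hmax : ∀ F', I.Feasible F' → I.gain F' ≤ I.gain F) :
    IsMaximumBinaryTree (I.toSubgraph hR.edges N hR F) := by
  have hc := toSubgraph_connected hR hF
  have hd := toSubgraph_degree hR hF
  have h1 := card_unpicked hR hF.edge
  have h2 := toSubgraph_card hR hF
  have h3 := toSubgraph_verts hR hF
  have h4 : ∀ T' : G.Subgraph, IsBinaryTree T' → E.length + n + T'.verts.ncard ≤ I.gain F := by
    intro T' hT'
    obtain ⟨F', hF', hg⟩ := exists_feasible hR hT'
    exact hg ▸ hmax F' hF'
  -- Comparison with a spanning tree on the same vertices: optimality of `F` gives `|E| + 1 ≤ |V|`,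
  -- connectedness gives the opposite inequality, and so the subgraph is a tree.
  obtain ⟨T₁, hT₁, hv⟩ := exists_spanning_tree hc hd
  have h5 := h4 T₁ hT₁
  rw [gain] at h4 h5
  rw [hv] at h5
  have h6 := hc.coe.card_vert_le_card_edgeSet_add_one
  rw [← ncard_edgeSet_coe] at h6
  have h7 : Nat.card (I.toSubgraph hR.edges N hR F).verts =
    (I.toSubgraph hR.edges N hR F).verts.ncard := rfl
  have ht : (I.toSubgraph hR.edges N hR F).coe.IsTree := by
    rw [SimpleGraph.isTree_iff_connected_and_card]
    refine ⟨hc.coe, ?_⟩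
    rw [← ncard_edgeSet_coe]
    omega
  refine ⟨⟨hc, ht.2, fun v _ => hd v⟩, fun T' hT' => ?_⟩
  have := h4 T' hT'
  omega

theorem feasible_exists (hR : I.Represents G E N) (hn : 0 < n) : ∃ F, I.Feasible F := by
  have : IsBinaryTree (G.singletonSubgraph ⟨0, hn⟩) := by
    refine ⟨SimpleGraph.Subgraph.singletonSubgraph_connected,
      (SimpleGraph.IsTree.coe_singletonSubgraph G _).2, fun v _ => ?_⟩
    rw [(Set.ncard_eq_zero (Set.toFinite _)).2]
    · omega
    · ext w; simp
  obtain ⟨F, hF, _⟩ := exists_feasible hR this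
  exact ⟨F, hF⟩

end Layout
end BinTree

/-! ## A language of bounded loops over variables and arrays, and its compilation -/

namespace RAM

/-- Names of variables. -/
inductive Var
  | n | m | N | N1 | K | D | S | M | M1 | kmax | pos | tail
  | i | j | j2 | l | h | e | s1 | s2 | t
  | c | p | u | v | w | x | y | z | a | b | g | ok | f | s | val | best | q | cnt
deriving DecidableEq

/-- Names of arrays. -/
inductive Arr
  | BP | DEG | SUM | QU | PR | ORD | PAR | SL | TOP | TY | CODE | T | TMP | C1 | C2
  | D1 | L1 | D2 | L2 | TR | CUR | MARK | OUT
deriving DecidableEq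

/-- Expressions over variables, arrays and the input. -/
inductive Ex
  | c (k : ℕ)
  | v (x : Var)
  | ld (a : Arr) (e : Ex)
  | inp (e : Ex)
  | add (a b : Ex)
  | sub (a b : Ex)
  | mul (a b : Ex)
  | div (a b : Ex)
  | mod (a b : Ex)
  | lt (a b : Ex)
  | eq (a b : Ex)

instance : Add Ex := ⟨.add⟩
instance : Sub Ex := ⟨.sub⟩
instance : Mul Ex := ⟨.mul⟩
instance : Div Ex := ⟨.div⟩
instance : Mod Ex := ⟨.mod⟩
instance : Coe Var Ex := ⟨.v⟩

/-- Commands. `for_ x l p` repeats `p` for `x = 0, 1, …, l - 1`. -/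
inductive Cmd
  | skip
  | set (x : Var) (e : Ex)
  | st (a : Arr) (i e : Ex)
  | seq (p q : Cmd)
  | ite (e : Ex) (p q : Cmd)
  | for_ (x l : Var) (p : Cmd)

infixr:67 " ;; " => Cmd.seq

/-- Contents of the variables and arrays. -/
structure St where
  v : Var → ℕ
  a : Arr → ℕ → ℕ

def St.setv (s : St) (x : Var) (k : ℕ) : St := { s with v := Function.update s.v x k }

def St.seta (s : St) (a : Arr) (i k : ℕ) : St :=
  { s with a := Function.update s.a a (Function.update (s.a a) i k) }

@[simp] theorem St.setv_v (s : St) (x y : Var) (k : ℕ) :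
    (s.setv x k).v y = if y = x then k else s.v y := Function.update_apply ..
@[simp] theorem St.setv_a (s : St) (x : Var) (k : ℕ) : (s.setv x k).a = s.a := rfl
@[simp] theorem St.seta_v (s : St) (a : Arr) (i k : ℕ) : (s.seta a i k).v = s.v := rfl
@[simp] theorem St.seta_a (s : St) (a b : Arr) (i k : ℕ) :
    (s.seta a i k).a b = if b = a then Function.update (s.a a) i k else s.a b :=
  Function.update_apply ..

/-- The input, its length, the bound for all numbers, and bounds for the loop limits. -/
structure Env where
  inp : ℕ → ℕ
  len : ℕ
  B : ℕ
  lim : Var → ℕ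

namespace Ex

def ev (I : ℕ → ℕ) (s : St) : Ex → ℕ
  | c k => k
  | v x => s.v x
  | ld a e => s.a a (e.ev I s)
  | inp e => I (e.ev I s)
  | add a b => a.ev I s + b.ev I s
  | sub a b => a.ev I s - b.ev I s
  | mul a b => a.ev I s * b.ev I s
  | div a b => a.ev I s / b.ev I s
  | mod a b => a.ev I s % b.ev I s
  | lt a b => if a.ev I s < b.ev I s then 1 else 0
  | eq a b => if a.ev I s = b.ev I s then 1 else 0

/-- No overflow in the evaluation, provided that the contents of the state are in bounds. -/
def Ok (E : Env) (s : St) : Ex → Prop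
  | c k => k ≤ E.B
  | v _ => True
  | ld _ e => e.Ok E s
  | inp e => e.Ok E s ∧ e.ev E.inp s < E.len
  | add a b => a.Ok E s ∧ b.Ok E s ∧ a.ev E.inp s + b.ev E.inp s ≤ E.B
  | mul a b => a.Ok E s ∧ b.Ok E s ∧ a.ev E.inp s * b.ev E.inp s ≤ E.B
  | sub a b => a.Ok E s ∧ b.Ok E s
  | div a b => a.Ok E s ∧ b.Ok E s
  | mod a b => a.Ok E s ∧ b.Ok E s
  | lt a b => a.Ok E s ∧ b.Ok E s
  | eq a b => a.Ok E s ∧ b.Ok E s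

section
variable (I : ℕ → ℕ) (E : Env) (s : St) (a b : Ex)
@[simp] theorem ev_c (k : ℕ) : (c k).ev I s = k := rfl
@[simp] theorem ev_v (x : Var) : (v x).ev I s = s.v x := rfl
@[simp] theorem ev_ld (x : Arr) : (ld x a).ev I s = s.a x (a.ev I s) := rfl
@[simp] theorem ev_inp : (inp a).ev I s = I (a.ev I s) := rfl
@[simp] theorem ev_add : (a + b).ev I s = a.ev I s + b.ev I s := rfl
@[simp] theorem ev_sub : (a - b).ev I s = a.ev I s - b.ev I s := rfl
@[simp] theorem ev_mul : (a * b).ev I s = a.ev I s * b.ev I s := rfl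
@[simp] theorem ev_div : (a / b).ev I s = a.ev I s / b.ev I s := rfl
@[simp] theorem ev_mod : (a % b).ev I s = a.ev I s % b.ev I s := rfl
@[simp] theorem ev_lt : (lt a b).ev I s = if a.ev I s < b.ev I s then 1 else 0 := rfl
@[simp] theorem ev_eq : (eq a b).ev I s = if a.ev I s = b.ev I s then 1 else 0 := rfl
@[simp] theorem ok_c (k : ℕ) : (c k).Ok E s ↔ k ≤ E.B := Iff.rfl
@[simp] theorem ok_v (x : Var) : (v x).Ok E s ↔ True := Iff.rfl
@[simp] theorem ok_ld (x : Arr) : (ld x a).Ok E s ↔ a.Ok E s := Iff.rfl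
@[simp] theorem ok_inp : (inp a).Ok E s ↔ a.Ok E s ∧ a.ev E.inp s < E.len := Iff.rfl
@[simp] theorem ok_add : (a + b).Ok E s ↔ a.Ok E s ∧ b.Ok E s ∧ a.ev E.inp s + b.ev E.inp s ≤ E.B :=
  Iff.rfl
@[simp] theorem ok_mul : (a * b).Ok E s ↔ a.Ok E s ∧ b.Ok E s ∧ a.ev E.inp s * b.ev E.inp s ≤ E.B :=
  Iff.rfl
@[simp] theorem ok_sub : (a - b).Ok E s ↔ a.Ok E s ∧ b.Ok E s := Iff.rfl
@[simp] theorem ok_div : (a / b).Ok E s ↔ a.Ok E s ∧ b.Ok E s := Iff.rfl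
@[simp] theorem ok_mod : (a % b).Ok E s ↔ a.Ok E s ∧ b.Ok E s := Iff.rfl
@[simp] theorem ok_lt : (lt a b).Ok E s ↔ a.Ok E s ∧ b.Ok E s := Iff.rfl
@[simp] theorem ok_eq : (eq a b).Ok E s ↔ a.Ok E s ∧ b.Ok E s := Iff.rfl
end

end Ex

namespace Cmd

/-- The state at the head of the loop after `i` rounds, with the counter already set. The condition
`wf` forbids the body to change the counter or the limit, so counting up to the initial limit agrees
with testing it in every round. -/
def iter (f : St → St) (x : Var) (s : St) : ℕ → St
  | 0 => s.setv x 0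
  | i + 1 => (f (iter f x s i)).setv x (i + 1)

/-- The state after a command. -/
def run (I : ℕ → ℕ) : Cmd → St → St
  | skip, s => s
  | set x e, s => s.setv x (e.ev I s)
  | st a i e, s => s.seta a (i.ev I s) (e.ev I s)
  | seq p q, s => q.run I (p.run I s)
  | ite e p q, s => if e.ev I s = 0 then q.run I s else p.run I s
  | for_ x l p, s => iter (p.run I) x s (s.v l)

/-- Is the variable changed? -/
def mods : Cmd → Var → Bool
  | skip, _ => false
  -- Names are compared by their indices, so that frame conditions are settled by evaluation.
  | set x _, y => x.ctorIdx == y.ctorIdx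
  | st _ _ _, _ => false
  | seq p q, y => p.mods y || q.mods y
  | ite _ p q, y => p.mods y || q.mods y
  | for_ x _ p, y => x.ctorIdx == y.ctorIdx || p.mods y

/-- Is the array changed? -/
def modsA : Cmd → Arr → Bool
  | skip, _ => false
  | set _ _, _ => false
  | st a _ _, b => a.ctorIdx == b.ctorIdx
  | seq p q, y => p.modsA y || q.modsA y
  | ite _ p q, y => p.modsA y || q.modsA y
  | for_ _ _ p, y => p.modsA y

/-- The loops keep their counters and limits. -/
def wf : Cmd → Bool
  | seq p q => p.wf && q.wf
  | ite _ p q => p.wf && q.wf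
  | for_ x l p => p.wf && !(x.ctorIdx == l.ctorIdx) && !(p.mods x) && !(p.mods l)
  | _ => true

/-- No overflow in the run, and the loop limits are in bounds. -/
def Ok (E : Env) : Cmd → St → Prop
  | skip, _ => True
  | set _ e, s => e.Ok E s
  | st _ i e, s => i.Ok E s ∧ e.Ok E s
  | seq p q, s => p.Ok E s ∧ q.Ok E (p.run E.inp s)
  | ite e p q, s => e.Ok E s ∧ if e.ev E.inp s = 0 then q.Ok E s else p.Ok E s
  | for_ x l p, s => s.v l ≤ E.lim l ∧ ∀ i < s.v l, p.Ok E (iter (p.run E.inp) x s i)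

/-- What is unchanged by a command. -/
structure Frame (p : Cmd) (s s' : St) : Prop where
  v : ∀ y, p.mods y = false → s'.v y = s.v y
  a : ∀ y, p.modsA y = false → s'.a y = s.a y

theorem frame (I : ℕ → ℕ) (p : Cmd) (s : St) : p.Frame s (p.run I s) := by
  induction p generalizing s with
  | skip => exact ⟨fun _ _ => rfl, fun _ _ => rfl⟩
  | set x e =>
    refine ⟨fun y hy => ?_, fun _ _ => rfl⟩
    have : y ≠ x := by rintro rfl; simp [mods] at hy
    simp [run, this]
  | st a i e =>
    refine ⟨fun _ _ => rfl, fun y hy => ?_⟩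
    have : y ≠ a := by rintro rfl; simp [modsA] at hy
    simp [run, this]
  | seq p q hp hq =>
    refine ⟨fun y hy => ?_, fun y hy => ?_⟩
    · simp only [mods, Bool.or_eq_false_iff] at hy
      rw [run, (hq _).v y hy.2, (hp _).v y hy.1]
    · simp only [modsA, Bool.or_eq_false_iff] at hy
      rw [run, (hq _).a y hy.2, (hp _).a y hy.1]
  | ite e p q hp hq =>
    refine ⟨fun y hy => ?_, fun y hy => ?_⟩
    · simp only [mods, Bool.or_eq_false_iff] at hy
      rw [run]; split_ifs
      · exact (hq _).v y hy.2
      · exact (hp _).v y hy.1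
    · simp only [modsA, Bool.or_eq_false_iff] at hy
      rw [run]; split_ifs
      · exact (hq _).a y hy.2
      · exact (hp _).a y hy.1
  | for_ x l p hp =>
    have key : ∀ i, (∀ y, (for_ x l p).mods y = false → (iter (p.run I) x s i).v y = s.v y) ∧
        ∀ y, p.modsA y = false → (iter (p.run I) x s i).a y = s.a y := by
      intro i
      induction i with
      | zero =>
        refine ⟨fun y hy => ?_, fun _ _ => rfl⟩
        have : y ≠ x := by rintro rfl; simp [mods] at hy
        simp [iter, this]
      | succ i ih =>
        refine ⟨fun y hy => ?_, fun y hy => ?_⟩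
        · have h1 : y ≠ x := by rintro rfl; simp [mods] at hy
          have h2 : p.mods y = false := by simp only [mods, Bool.or_eq_false_iff] at hy; exact hy.2
          rw [iter, St.setv_v, if_neg h1, (hp _).v y h2, ih.1 y hy]
        · rw [iter, St.setv_a, (hp _).a y hy, ih.2 y hy]
    exact ⟨(key _).1, (key _).2⟩

/-- Started in `s` the command has no overflow and ends in a state with `Q`. -/
def Spec (E : Env) (p : Cmd) (s : St) (Q : St → Prop) : Prop := p.Ok E s ∧ Q (p.run E.inp s)

/-! ### Proof rules for specifications -/

variable {E : Env} {s : St} {Q : St → Prop}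

theorem Spec.mono {p : Cmd} {R : St → Prop} (h : Spec E p s R)
    (hQ : ∀ s', p.Frame s s' → R s' → Q s') : Spec E p s Q :=
  ⟨h.1, hQ _ (frame _ _ _) h.2⟩

@[simp] theorem spec_skip : Spec E skip s Q ↔ Q s := by simp [Spec, Ok, run]
@[simp] theorem spec_set {x : Var} {e : Ex} :
    Spec E (set x e) s Q ↔ e.Ok E s ∧ Q (s.setv x (e.ev E.inp s)) := Iff.rfl
@[simp] theorem spec_st {a : Arr} {i e : Ex} : Spec E (st a i e) s Q ↔
    (i.Ok E s ∧ e.Ok E s) ∧ Q (s.seta a (i.ev E.inp s) (e.ev E.inp s)) := Iff.rfl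
theorem spec_seq {p q : Cmd} : Spec E (p ;; q) s Q ↔ Spec E p s fun s' => Spec E q s' Q :=
  and_assoc
@[simp] theorem spec_set_seq {x : Var} {e : Ex} {q : Cmd} : Spec E (set x e ;; q) s Q ↔
    e.Ok E s ∧ Spec E q (s.setv x (e.ev E.inp s)) Q := spec_seq
@[simp] theorem spec_st_seq {a : Arr} {i e : Ex} {q : Cmd} : Spec E (st a i e ;; q) s Q ↔
    (i.Ok E s ∧ e.Ok E s) ∧ Spec E q (s.seta a (i.ev E.inp s) (e.ev E.inp s)) Q := spec_seq
theorem spec_ite {e : Ex} {p q : Cmd} : Spec E (ite e p q) s Q ↔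
    e.Ok E s ∧ if e.ev E.inp s = 0 then Spec E q s Q else Spec E p s Q := by
  rw [Spec, Ok, run, and_assoc]
  refine and_congr_right fun _ => ?_
  split_ifs <;> rfl

theorem Spec.seq {p q : Cmd} {R : St → Prop} (h : Spec E p s R)
    (hq : ∀ s', p.Frame s s' → R s' → Spec E q s' Q) : Spec E (p ;; q) s Q :=
  spec_seq.2 (h.mono hq)

/-- The invariant rule. Each round also receives the frame of the whole loop, so invariants need to
mention only what the body changes. -/
theorem spec_for {x l : Var} {p : Cmd} (Inv : ℕ → St → Prop) (hwf : (for_ x l p).wf = true)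
    (hlim : s.v l ≤ E.lim l) (h0 : Inv 0 (s.setv x 0))
    (hstep : ∀ i < s.v l, ∀ s', (for_ x l p).Frame s s' → s'.v x = i → Inv i s' →
      Spec E p s' fun s'' => Inv (i + 1) (s''.setv x (i + 1)))
    (hQ : ∀ s', (for_ x l p).Frame s s' → s'.v x = s.v l → Inv (s.v l) s' → Q s') :
    Spec E (for_ x l p) s Q := by
  simp only [wf, Bool.and_eq_true, Bool.not_eq_true', beq_eq_false_iff_ne] at hwf
  obtain ⟨⟨⟨-, hxl⟩, hx⟩, hl⟩ := hwf
  have key : ∀ i ≤ s.v l, ((∀ j < i, p.Ok E (iter (p.run E.inp) x s j)) ∧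
      (for_ x l p).Frame s (iter (p.run E.inp) x s i)) ∧
      (iter (p.run E.inp) x s i).v x = i ∧ Inv i (iter (p.run E.inp) x s i) := by
    intro i
    induction i with
    | zero =>
      intro _
      refine ⟨⟨by simp, ⟨fun y hy => ?_, fun _ _ => rfl⟩⟩, by simp [iter], h0⟩
      have : y ≠ x := by rintro rfl; simp [mods] at hy
      simp [iter, this]
    | succ i ih =>
      intro hi
      obtain ⟨⟨h1, h2⟩, h3, h4⟩ := ih (by omega)
      obtain ⟨h5, h6⟩ := hstep i (by omega) _ h2 h3 h4
      have hfr := frame E.inp p (iter (p.run E.inp) x s i)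
      refine ⟨⟨fun j hj => ?_, ⟨fun y hy => ?_, fun y hy => ?_⟩⟩, by simp [iter], h6⟩
      · rcases Nat.lt_succ_iff_lt_or_eq.1 hj with hj | rfl
        · exact h1 j hj
        · exact h5
      · have h7 : y ≠ x := by rintro rfl; simp [mods] at hy
        have h8 : p.mods y = false := by simp only [mods, Bool.or_eq_false_iff] at hy; exact hy.2
        rw [iter, St.setv_v, if_neg h7, hfr.v y h8, h2.v y hy]
      · rw [iter, St.setv_a, hfr.a y hy, h2.a y hy]
  obtain ⟨⟨h1, h2⟩, h3, h4⟩ := key _ le_rfl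
  exact ⟨⟨hlim, h1⟩, hQ _ h2 h3 h4⟩

end Cmd

/-! ### Compilation -/

/-- The number of arrays. -/
def arrays : ℕ := 23

theorem ctorIdx_lt (a : Arr) : a.ctorIdx < arrays := by cases a <;> decide

theorem Arr.ctorIdx_injective : Function.Injective Arr.ctorIdx := fun a b h => by
  rw [← Arr.ofNat_ctorIdx a, h, Arr.ofNat_ctorIdx]

theorem Var.ctorIdx_injective : Function.Injective Var.ctorIdx := fun a b h => by
  rw [← Var.ofNat_ctorIdx a, h, Var.ofNat_ctorIdx]

/-- The address of the cell `e` of the array `a`. The register `0` holds the length of the input. -/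
def addr (a : Arr) (e : Exp) : Exp :=
  .add (.reg 0) (.add (.mul e (.const arrays)) (.const a.ctorIdx))

def Ex.comp : Ex → Exp
  | c k => .const k
  | v x => .reg (x.ctorIdx + 1)
  | ld a e => .load (addr a e.comp)
  | inp e => .load e.comp
  | add a b => .add a.comp b.comp
  | sub a b => .sub a.comp b.comp
  | mul a b => .mul a.comp b.comp
  | div a b => .div a.comp b.comp
  | mod a b => .sub a.comp (.mul (.div a.comp b.comp) b.comp)
  | lt a b => .lt a.comp b.comp
  -- Equality is the failure of both strict comparisons.
  | eq a b => .sub (.sub (.const 1) (.lt a.comp b.comp)) (.lt b.comp a.comp)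

def Cmd.comp : Cmd → Prog
  | skip => .skip
  | set x e => .set (x.ctorIdx + 1) e.comp
  | st a i e => .store (addr a i.comp) e.comp
  | seq p q => .seq p.comp q.comp
  | ite e p q => .cond e.comp p.comp q.comp
  | for_ x l p => .seq (.set (x.ctorIdx + 1) (.const 0))
      (.loop (.lt (.reg (x.ctorIdx + 1)) (.reg (l.ctorIdx + 1)))
        (.seq p.comp (.set (x.ctorIdx + 1) (.add (.reg (x.ctorIdx + 1)) (.const 1)))))

/-- A bound for the running time, if the loop limits are bounded by `lim`. -/
def Cmd.time (lim : Var → ℕ) : Cmd → ℕ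
  | skip => 1
  | set _ e => e.comp.cost + 1
  | st a i e => (addr a i.comp).cost + e.comp.cost + 1
  | seq p q => p.time lim + q.time lim
  | ite e p q => e.comp.cost + 1 + (p.time lim + q.time lim)
  -- A round costs four for the test and four for the increment of the counter; the initialisation
  -- costs two and the last test four.
  | for_ _ l p => lim l * (p.time lim + 8) + 6

/-- The machine state `r` holds the variables and arrays of `s`. -/
structure Rel (E : Env) (s : St) (r : State) : Prop where
  off : r.reg 0 = E.len
  v : ∀ x : Var, r.reg (x.ctorIdx + 1) = s.v x
  inp : ∀ i < E.len, r.mem i = E.inp i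
  a : ∀ (a : Arr) i, r.mem (E.len + (i * arrays + a.ctorIdx)) = s.a a i

/-- All contents are in bounds. -/
structure Bounded (E : Env) (s : St) : Prop where
  v : ∀ x, s.v x ≤ E.B
  a : ∀ a i, s.a a i ≤ E.B

section
-- Cells have indices at most `E.B`, and the arrays are interleaved behind the input, so `hB` covers
-- every address.
variable {E : Env} {s : St} {r : State} {B : ℕ} (hB : E.len + (E.B * arrays + arrays) ≤ B)
  (hin : ∀ i < E.len, E.inp i ≤ E.B) (h1 : 1 ≤ E.B)
include hB hin h1

theorem bound_le : E.B ≤ B := by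
  have : E.B ≤ E.B * arrays := Nat.le_mul_of_pos_right _ (by decide)
  omega

theorem Ex.comp_spec (hr : Rel E s r) (hs : Bounded E s) (e : Ex) (he : e.Ok E s) :
    e.comp.eval r = e.ev E.inp s ∧ e.ev E.inp s ≤ E.B ∧ e.comp.Fits B r := by
  have hBB := bound_le hB hin h1
  have har : 0 < arrays := by decide
  induction e with
  | c k => exact ⟨rfl, he, le_trans he hBB⟩
  | v x => exact ⟨hr.v x, hs.v x, by rw [comp, Exp.Fits, hr.v]; exact (hs.v x).trans hBB⟩
  | ld a e ih =>
    obtain ⟨i1, i2, i3⟩ := ih he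
    have ha := ctorIdx_lt a
    have hm := Nat.mul_le_mul_right arrays i2
    have hev : (addr a e.comp).eval r = E.len + (e.ev E.inp s * arrays + a.ctorIdx) := by
      simp [addr, Exp.eval, i1, hr.off]
    refine ⟨?_, hs.a _ _, ?_, ?_⟩
    · rw [comp, Exp.eval, hev, hr.a]; rfl
    · simp only [addr, Exp.Fits, Exp.eval, i1, hr.off]
      refine ⟨?_, ⟨⟨i3, ?_, ?_⟩, ?_, ?_⟩, ?_⟩ <;> omega
    · rw [hev, hr.a]; exact (hs.a _ _).trans hBB
  | inp e ih =>
    obtain ⟨i1, i2, i3⟩ := ih he.1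
    refine ⟨?_, hin _ he.2, i3, ?_⟩
    · rw [comp, Exp.eval, i1, hr.inp _ he.2]; rfl
    · rw [i1, hr.inp _ he.2]; exact (hin _ he.2).trans hBB
  | add a b iha ihb =>
    obtain ⟨a1, a2, a3⟩ := iha he.1
    obtain ⟨b1, b2, b3⟩ := ihb he.2.1
    refine ⟨by rw [comp, Exp.eval, a1, b1]; rfl, he.2.2, a3, b3, ?_⟩
    rw [a1, b1]; exact he.2.2.trans hBB
  | mul a b iha ihb =>
    obtain ⟨a1, a2, a3⟩ := iha he.1
    obtain ⟨b1, b2, b3⟩ := ihb he.2.1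
    refine ⟨by rw [comp, Exp.eval, a1, b1]; rfl, he.2.2, a3, b3, ?_⟩
    rw [a1, b1]; exact he.2.2.trans hBB
  | sub a b iha ihb =>
    obtain ⟨a1, a2, a3⟩ := iha he.1
    obtain ⟨b1, b2, b3⟩ := ihb he.2
    exact ⟨by rw [comp, Exp.eval, a1, b1]; rfl, (Nat.sub_le _ _).trans a2, a3, b3⟩
  | div a b iha ihb =>
    obtain ⟨a1, a2, a3⟩ := iha he.1
    obtain ⟨b1, b2, b3⟩ := ihb he.2
    exact ⟨by rw [comp, Exp.eval, a1, b1]; rfl, (Nat.div_le_self _ _).trans a2, a3, b3⟩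
  | mod a b iha ihb =>
    obtain ⟨a1, a2, a3⟩ := iha he.1
    obtain ⟨b1, b2, b3⟩ := ihb he.2
    refine ⟨?_, (Nat.mod_le _ _).trans a2, a3, ⟨a3, b3⟩, b3, ?_⟩
    · simp only [comp, Exp.eval, a1, b1, ev]
      rw [Nat.mod_eq_sub_div_mul]
    · simp only [Exp.eval, a1, b1]
      exact (Nat.div_mul_le_self _ _).trans (a2.trans hBB)
  | lt a b iha ihb =>
    obtain ⟨a1, a2, a3⟩ := iha he.1
    obtain ⟨b1, b2, b3⟩ := ihb he.2
    refine ⟨by rw [comp, Exp.eval, a1, b1]; rfl, ?_, a3, b3, h1.trans hBB⟩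
    rw [ev]; split_ifs <;> omega
  | eq a b iha ihb =>
    obtain ⟨a1, a2, a3⟩ := iha he.1
    obtain ⟨b1, b2, b3⟩ := ihb he.2
    refine ⟨?_, ?_, ⟨h1.trans hBB, a3, b3, h1.trans hBB⟩, b3, a3, h1.trans hBB⟩
    · simp only [comp, Exp.eval, a1, b1, ev]
      split_ifs <;> omega
    · rw [ev]; split_ifs <;> omega

theorem Rel.setv (hr : Rel E s r) (x : Var) (k : ℕ) :
    Rel E (s.setv x k) { r with reg := Function.update r.reg (x.ctorIdx + 1) k } := by
  refine ⟨?_, fun y => ?_, hr.inp, hr.a⟩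
  · dsimp only
    rw [Function.update_of_ne (by omega)]; exact hr.off
  · dsimp only
    rw [St.setv_v, Function.update_apply]
    by_cases h : y = x
    · rw [if_pos h, if_pos (by rw [h])]
    · rw [if_neg h, if_neg, hr.v]
      intro h'
      exact h (Var.ctorIdx_injective (by omega))

/-- Addresses of distinct cells differ: behind the input, the remainder modulo `arrays` identifies
the array and the quotient the index. The input lies below all of them and is never overwritten. -/
theorem Rel.seta (hr : Rel E s r) (a : Arr) (i k : ℕ) :
    Rel E (s.seta a i k)
      { r with mem := Function.update r.mem (E.len + (i * arrays + a.ctorIdx)) k } := by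
  refine ⟨hr.off, hr.v, fun j hj => ?_, fun b j => ?_⟩
  · dsimp only
    rw [Function.update_of_ne (by omega)]; exact hr.inp j hj
  · dsimp only
    rw [St.seta_a, Function.update_apply]
    have ha := ctorIdx_lt a
    have hb := ctorIdx_lt b
    by_cases h : b = a
    · subst h
      rw [if_pos rfl, Function.update_apply]
      by_cases hij : j = i
      · rw [if_pos (by rw [hij]), if_pos hij]
      · rw [if_neg, if_neg hij, hr.a]
        intro h
        exact hij (Nat.eq_of_mul_eq_mul_right (show 0 < arrays by decide) (by omega))
    · rw [if_neg h, if_neg, hr.a]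
      intro h'
      apply h
      apply Arr.ctorIdx_injective
      have h2 : (j * arrays + b.ctorIdx) % arrays = (i * arrays + a.ctorIdx) % arrays := by
        congr 1; omega
      rwa [Nat.mul_add_mod_self_right, Nat.mul_add_mod_self_right, Nat.mod_eq_of_lt hb,
        Nat.mod_eq_of_lt ha] at h2

/-- The compiled program does what the command does. -/
theorem Cmd.comp_spec (p : Cmd) (hwf : p.wf = true) (hr : Rel E s r) (hs : Bounded E s)
    (hp : p.Ok E s) : ∃ t r', Exec B p.comp r t r' ∧ t ≤ p.time E.lim ∧
      Rel E (p.run E.inp s) r' ∧ Bounded E (p.run E.inp s) := by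
  have hBB := bound_le hB hin h1
  induction p generalizing s r with
  | skip => exact ⟨1, r, .skip r, le_rfl, hr, hs⟩
  | set x e =>
    obtain ⟨e1, e2, e3⟩ := e.comp_spec hB hin h1 hr hs hp
    refine ⟨_, _, .set _ _ _ e3, le_rfl, ?_, ⟨fun y => ?_, hs.a⟩⟩
    · rw [e1]; exact hr.setv hB hin h1 x _
    · rw [run, St.setv_v]; split_ifs
      · exact e2
      · exact hs.v y
  | st a i e =>
    obtain ⟨i1, i2, i3⟩ := i.comp_spec hB hin h1 hr hs hp.1
    obtain ⟨e1, e2, e3⟩ := e.comp_spec hB hin h1 hr hs hp.2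
    have hev : (addr a i.comp).eval r = E.len + (i.ev E.inp s * arrays + a.ctorIdx) := by
      simp [addr, Exp.eval, i1, hr.off]
    have hfit : (addr a i.comp).Fits B r := by
      have ha := ctorIdx_lt a
      have hm := Nat.mul_le_mul_right arrays i2
      have har : 0 < arrays := by decide
      simp only [addr, Exp.Fits, Exp.eval, i1, hr.off]
      refine ⟨?_, ⟨⟨i3, ?_, ?_⟩, ?_, ?_⟩, ?_⟩ <;> omega
    refine ⟨_, _, .store _ _ _ hfit e3, le_rfl, ?_, ⟨hs.v, fun b j => ?_⟩⟩
    · rw [e1, hev]; exact hr.seta hB hin h1 a _ _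
    · rw [run, St.seta_a]
      by_cases h : b = a
      · rw [if_pos h, Function.update_apply]
        split_ifs
        · exact e2
        · exact hs.a _ _
      · rw [if_neg h]; exact hs.a _ _
  | seq p q ihp ihq =>
    rw [wf, Bool.and_eq_true] at hwf
    obtain ⟨t, r', a1, a2, a3, a4⟩ := ihp hwf.1 hr hs hp.1
    obtain ⟨t', r'', b1, b2, b3, b4⟩ := ihq hwf.2 a3 a4 hp.2
    exact ⟨t + t', r'', .seq a1 b1, Nat.add_le_add a2 b2, b3, b4⟩
  | ite e p q ihp ihq =>
    rw [wf, Bool.and_eq_true] at hwf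
    obtain ⟨e1, e2, e3⟩ := e.comp_spec hB hin h1 hr hs hp.1
    have hp2 := hp.2
    by_cases h : e.ev E.inp s = 0
    · rw [if_pos h] at hp2
      obtain ⟨t', r'', b1, b2, b3, b4⟩ := ihq hwf.2 hr hs hp2
      refine ⟨_, r'', .cond_false e3 (e1.trans h) b1, ?_, ?_, ?_⟩
      · rw [time]; omega
      · rwa [run, if_pos h]
      · rwa [run, if_pos h]
    · rw [if_neg h] at hp2
      obtain ⟨t', r'', b1, b2, b3, b4⟩ := ihp hwf.1 hr hs hp2
      refine ⟨_, r'', .cond_true e3 (e1 ▸ h) b1, ?_, ?_, ?_⟩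
      · rw [time]; omega
      · rwa [run, if_neg h]
      · rwa [run, if_neg h]
  | for_ x l p ih =>
    simp only [wf, Bool.and_eq_true, Bool.not_eq_true', beq_eq_false_iff_ne] at hwf
    obtain ⟨⟨⟨hw, hxl⟩, hx⟩, hl⟩ := hwf
    have hxl' : l ≠ x := fun h => hxl (by rw [h])
    obtain ⟨hlim, hok⟩ := hp
    have hlB := hs.v l
    -- Induction on the number `d` of rounds that are left.
    have key : ∀ d i, i + d = s.v l → ∀ r, Rel E (iter (p.run E.inp) x s i) r →
        Bounded E (iter (p.run E.inp) x s i) → (iter (p.run E.inp) x s i).v x = i →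
        (iter (p.run E.inp) x s i).v l = s.v l →
        ∃ t r', Exec B (.loop (.lt (.reg (x.ctorIdx + 1)) (.reg (l.ctorIdx + 1)))
          (.seq p.comp (.set (x.ctorIdx + 1) (.add (.reg (x.ctorIdx + 1)) (.const 1))))) r t r' ∧
          t ≤ d * (p.time E.lim + 8) + 4 ∧ Rel E (iter (p.run E.inp) x s (s.v l)) r' ∧
          Bounded E (iter (p.run E.inp) x s (s.v l)) := by
      intro d
      induction d with
      | zero =>
        intro i hi r hr hs' hxi hli
        have : i = s.v l := by omega
        subst this
        refine ⟨_, r, .loop_done ?_ ?_, ?_, hr, hs'⟩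
        · simp only [Exp.Fits, hr.v, hxi, hli]; omega
        · simp [Exp.eval, hr.v, hxi, hli]
        · simp [Exp.cost]
      | succ d ihd =>
        intro i hi r hr hs' hxi hli
        obtain ⟨t, r', a1, a2, a3, a4⟩ := ih hw hr hs' (hok i (by omega))
        have hfr := frame E.inp p (iter (p.run E.inp) x s i)
        have hx' : r'.reg (x.ctorIdx + 1) = i := by rw [a3.v, hfr.v x hx, hxi]
        have hr2 := a3.setv hB hin h1 x (i + 1)
        have hs2 : Bounded E ((p.run E.inp (iter (p.run E.inp) x s i)).setv x (i + 1)) := by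
          refine ⟨fun y => ?_, a4.a⟩
          rw [St.setv_v]; split_ifs
          · omega
          · exact a4.v y
        obtain ⟨t', r'', b1, b2, b3, b4⟩ := ihd (i + 1) (by omega) _ hr2 hs2
          (by simp [iter]) (by simp [iter, hxl', hfr.v l hl, hli])
        have hinc : Exec B (.set (x.ctorIdx + 1) (.add (.reg (x.ctorIdx + 1)) (.const 1))) r' 4
            { r' with reg := Function.update r'.reg (x.ctorIdx + 1) (i + 1) } := by
          have := Exec.set (B := B) (x.ctorIdx + 1) (.add (.reg (x.ctorIdx + 1)) (.const 1)) r'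
            (by simp only [Exp.Fits, Exp.eval, hx']; omega)
          simpa only [Exp.eval, hx', Exp.cost] using this
        refine ⟨_, r'', .loop_step ?_ ?_ (.seq a1 hinc) b1, ?_, b3, b4⟩
        · simp only [Exp.Fits, hr.v, hxi, hli]; omega
        · simp only [Exp.eval, hr.v, hxi, hli]; rw [if_pos (by omega)]; omega
        · simp only [Exp.cost]; rw [Nat.succ_mul]; omega
    have hset : Exec B (.set (x.ctorIdx + 1) (.const 0)) r 2
        { r with reg := Function.update r.reg (x.ctorIdx + 1) 0 } :=
      Exec.set (x.ctorIdx + 1) (.const 0) r (Nat.zero_le B)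
    have hs0 : Bounded E (s.setv x 0) := by
      refine ⟨fun y => ?_, hs.a⟩
      rw [St.setv_v]; split_ifs
      · omega
      · exact hs.v y
    obtain ⟨t, r', a1, a2, a3, a4⟩ := key (s.v l) 0 (by omega) _ (hr.setv hB hin h1 x 0) hs0
      (by simp [iter]) (by simp [iter, hxl'])
    refine ⟨_, r', .seq hset a1, ?_, a3, a4⟩
    have := Nat.mul_le_mul_right (p.time E.lim + 8) hlim
    rw [time]; omega

end

/-! ### Running times -/

namespace Cmd

def coef : Cmd → ℕ
  | skip => 1
  | set _ e => e.comp.cost + 1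
  | st a i e => (addr a i.comp).cost + e.comp.cost + 1
  | seq p q => p.coef + q.coef
  | ite e p q => e.comp.cost + 1 + (p.coef + q.coef)
  | for_ _ _ p => p.coef + 14

/-- The nesting depth of the loops whose limits satisfy `k`. -/
def depth (k : Var → Bool) : Cmd → ℕ
  | seq p q => max (p.depth k) (q.depth k)
  | ite _ p q => max (p.depth k) (q.depth k)
  | for_ _ l p => p.depth k + if k l then 1 else 0
  | _ => 0

/-- Each loop multiplies the time by its limit, which is `X` or `Y` according to `k`; its overhead
of eight per round and six in all is absorbed by the additional `14` in `coef`. -/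
theorem time_le (k : Var → Bool) {X Y : ℕ} (hX : 0 < X) (hY : 0 < Y) (p : Cmd) :
    p.time (fun x => if k x then X else Y) ≤
      p.coef * (X ^ p.depth k * Y ^ p.depth fun x => !k x) := by
  have pos : ∀ a b : ℕ, 0 < X ^ a * Y ^ b := fun a b => by positivity
  have mono : ∀ a b a' b' : ℕ, a ≤ a' → b ≤ b' → X ^ a * Y ^ b ≤ X ^ a' * Y ^ b' :=
    fun a b a' b' h h' => Nat.mul_le_mul (Nat.pow_le_pow_right hX h) (Nat.pow_le_pow_right hY h')
  induction p with
  | skip => exact Nat.le_mul_of_pos_right _ (pos _ _)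
  | set x e => exact Nat.le_mul_of_pos_right _ (pos _ _)
  | st a i e => exact Nat.le_mul_of_pos_right _ (pos _ _)
  | seq p q hp hq =>
    rw [time, coef, add_mul, depth, depth]
    exact Nat.add_le_add
      (hp.trans (Nat.mul_le_mul_left _ (mono _ _ _ _ (le_max_left _ _) (le_max_left _ _))))
      (hq.trans (Nat.mul_le_mul_left _ (mono _ _ _ _ (le_max_right _ _) (le_max_right _ _))))
  | ite e p q hp hq =>
    rw [time, coef, add_mul, add_mul (p.coef), depth, depth]
    exact Nat.add_le_add (Nat.le_mul_of_pos_right _ (pos _ _)) (Nat.add_le_add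
      (hp.trans (Nat.mul_le_mul_left _ (mono _ _ _ _ (le_max_left _ _) (le_max_left _ _))))
      (hq.trans (Nat.mul_le_mul_left _ (mono _ _ _ _ (le_max_right _ _) (le_max_right _ _)))))
  | for_ x l p hp =>
    rw [time, coef, depth, depth]
    have h0 := pos (p.depth k) (p.depth fun x => !k x)
    set Z := X ^ p.depth k * Y ^ p.depth fun x => !k x with hZ
    have h2 : (if k l then X else Y) * Z =
        X ^ (p.depth k + if k l then 1 else 0) *
          Y ^ ((p.depth fun x => !k x) + if !k l then 1 else 0) := by
      cases k l <;> simp [hZ, pow_succ] <;> ring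
    rw [← h2]
    have h3 : 0 < if k l then X else Y := by split_ifs <;> assumption
    set L := if k l then X else Y
    calc L * (p.time (fun x => if k x then X else Y) + 8) + 6
        ≤ L * (p.coef * Z + 8 * Z) + 6 * (L * Z) := by
          have : 0 < L * Z := by positivity
          have : p.time (fun x => if k x then X else Y) + 8 ≤ p.coef * Z + 8 * Z := by omega
          have := Nat.mul_le_mul_left L this
          omega
      _ = (p.coef + 14) * (L * Z) := by ring

end Cmd
end RAM

/-! ## Input and output -/

namespace BinTree

theorem getElem?_flatten (Ls : List (List ℕ)) (i j : ℕ) (hi : i < Ls.length)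
    (hj : j < (Ls[i]).length) :
    Ls.flatten[(Ls.take i).flatten.length + j]? = some (Ls[i][j]) := by
  have h : Ls = Ls.take i ++ Ls[i] :: Ls.drop (i + 1) := by
    rw [List.getElem_cons_drop, List.take_append_drop]
  conv_lhs => rw [h]
  have h2 : ((Ls.take i ++ Ls[i] :: Ls.drop (i + 1)).take i) = Ls.take i := by
    rw [← h]
  rw [List.flatten_append, List.flatten_cons, List.getElem?_append_right (by simp), h2,
    Nat.add_sub_cancel_left, List.getElem?_append_left hj, List.getElem?_eq_getElem hj]

theorem vertexWords_eq {n : ℕ} (L : List (Fin n)) : vertexWords L = L.map Fin.val := by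
  induction L with
  | nil => rfl
  | cons v L ih => simp_all [vertexWords]

theorem length_pairWords {n : ℕ} (E : List (Fin n × Fin n)) : (pairWords E).length = 2 * E.length := by
  induction E with
  | nil => rfl
  | cons e E ih =>
    rw [pairWords, List.flatMap_cons, List.length_append, ← pairWords, ih]
    simp; ring

theorem getElem?_pairWords {n : ℕ} (E : List (Fin n × Fin n)) (e : ℕ) (he : e < E.length) :
    (pairWords E)[2 * e]? = some (E[e].1 : ℕ) ∧ (pairWords E)[2 * e + 1]? = some (E[e].2 : ℕ) := by
  have h0 : pairWords E = (E.map fun e => [(e.1 : ℕ), (e.2 : ℕ)]).flatten := rfl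
  have h1 : (((E.map fun e => [(e.1 : ℕ), (e.2 : ℕ)]).take e).flatten).length = 2 * e := by
    rw [← List.map_take]
    have := length_pairWords (E.take e)
    rw [pairWords, List.flatMap_def] at this
    rw [this, List.length_take, Nat.min_eq_left he.le]
  have h2 := getElem?_flatten (E.map fun e => [(e.1 : ℕ), (e.2 : ℕ)]) e 0 (by simpa) (by simp)
  have h3 := getElem?_flatten (E.map fun e => [(e.1 : ℕ), (e.2 : ℕ)]) e 1 (by simpa) (by simp)
  rw [h1] at h2 h3
  rw [h0]
  exact ⟨by simpa using h2, by simpa using h3⟩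

/-- The positions of the parts of the input. -/
structure InputView (inp : ℕ → ℕ) (len : ℕ) {n N : ℕ} (E : List (Fin n × Fin n))
    (F : List (Fin N × Fin N)) (X : Fin N → List (Fin n)) (bp : ℕ → ℕ) : Prop where
  n_eq : inp 0 = n
  m_eq : inp 1 = E.length
  N_eq : inp 2 = N
  E_fst : ∀ e : Fin E.length, inp (3 + 2 * e) = E[e].1
  E_snd : ∀ e : Fin E.length, inp (3 + 2 * e + 1) = E[e].2
  F_fst : ∀ f : Fin F.length, inp (3 + 2 * E.length + 2 * f) = F[f].1
  F_snd : ∀ f : Fin F.length, inp (3 + 2 * E.length + 2 * f + 1) = F[f].2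
  bp_zero : bp 0 = 3 + 2 * E.length + 2 * F.length
  bp_succ : ∀ i : Fin N, bp (i + 1) = bp i + 1 + (X i).length
  bp_last : bp N = len
  size : ∀ i : Fin N, inp (bp i) = (X i).length
  elt : ∀ (i : Fin N) (j : Fin (X i).length), inp (bp i + 1 + j) = (X i)[j]

theorem inputView {n N : ℕ} (E : List (Fin n × Fin n)) (F : List (Fin N × Fin N))
    (X : Fin N → List (Fin n)) (x : List ℕ)
    (hx : x = [n, E.length, N] ++ pairWords E ++ pairWords F ++
      (List.finRange N).flatMap fun i => (X i).length :: vertexWords (X i)) :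
    ∃ bp, InputView (fun i => x.getD i 0) x.length E F X bp := by
  set Ls : List (List ℕ) := (List.finRange N).map fun i => (X i).length :: vertexWords (X i) with hLs
  have hLl : Ls.length = N := by simp [hLs]
  have hLi : ∀ i : Fin N, ∀ h : (i : ℕ) < Ls.length, Ls[(i : ℕ)] = (X i).length :: vertexWords (X i) := by
    intro i h; simp [hLs]
  have hx' : x = ([n, E.length, N] ++ (pairWords E ++ pairWords F)) ++ Ls.flatten := by
    rw [hx, hLs, List.flatMap_def]; simp
  have lE := length_pairWords E
  have lF := length_pairWords F
  have key : ∀ (i : Fin N) j, (hj : j < ((X i).length :: vertexWords (X i)).length) →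
      x.getD (3 + 2 * E.length + 2 * F.length + (Ls.take i).flatten.length + j) 0 =
      ((X i).length :: vertexWords (X i))[j] := by
    intro i j hj
    rw [List.getD_eq_getElem?_getD, hx', List.getElem?_append_right (by simp [lE, lF]; omega)]
    have := getElem?_flatten Ls i j (by omega) (by rwa [hLi])
    have e1 : 3 + 2 * E.length + 2 * F.length + (Ls.take i).flatten.length + j -
        ([n, E.length, N] ++ (pairWords E ++ pairWords F)).length =
        (Ls.take i).flatten.length + j := by
      simp only [List.length_append, lE, lF, List.length_cons, List.length_nil]; omega
    rw [e1, this]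
    simp [hLs]
  refine ⟨fun i => 3 + 2 * E.length + 2 * F.length + (Ls.take i).flatten.length, ?_, ?_, ?_, ?_, ?_,
    ?_, ?_, ?_, ?_, ?_, ?_, ?_⟩
  · simp [hx']
  · simp [hx']
  · simp [hx']
  · intro e
    have := (getElem?_pairWords E e e.2).1
    have e1 : 3 + 2 * (e : ℕ) - [n, E.length, N].length = 2 * e := by simp
    rw [List.getD_eq_getElem?_getD, hx', List.append_assoc, List.getElem?_append_right (by simp), e1,
      List.append_assoc, List.getElem?_append_left (by omega), this]
    rfl
  · intro e
    have := (getElem?_pairWords E e e.2).2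
    have e1 : 3 + 2 * (e : ℕ) + 1 - [n, E.length, N].length = 2 * e + 1 := by simp; omega
    rw [List.getD_eq_getElem?_getD, hx', List.append_assoc, List.getElem?_append_right (by simp; omega),
      e1, List.append_assoc, List.getElem?_append_left (by omega), this]
    rfl
  · intro f
    have := (getElem?_pairWords F f f.2).1
    have e1 : 3 + 2 * E.length + 2 * (f : ℕ) - [n, E.length, N].length - (pairWords E).length
      = 2 * f := by simp only [lE, List.length_cons, List.length_nil]; omega
    rw [List.getD_eq_getElem?_getD, hx', List.append_assoc, List.getElem?_append_right (by simp; omega),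
      List.append_assoc, List.getElem?_append_right (by simp only [lE, List.length_cons, List.length_nil]; omega),
      e1, List.getElem?_append_left (by omega), this]
    rfl
  · intro f
    have := (getElem?_pairWords F f f.2).2
    have e1 : 3 + 2 * E.length + 2 * (f : ℕ) + 1 - [n, E.length, N].length - (pairWords E).length
      = 2 * f + 1 := by simp only [lE, List.length_cons, List.length_nil]; omega
    rw [List.getD_eq_getElem?_getD, hx', List.append_assoc, List.getElem?_append_right (by simp; omega),
      List.append_assoc, List.getElem?_append_right (by simp only [lE, List.length_cons, List.length_nil]; omega),
      e1, List.getElem?_append_left (by omega), this]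
    rfl
  · simp
  · intro i
    have h1 : (i : ℕ) < Ls.length := by omega
    rw [List.take_add_one, List.getElem?_eq_getElem h1, hLi]
    simp [vertexWords_eq]; omega
  · rw [List.take_of_length_le hLl.le, hx']
    simp only [List.length_append, lE, lF, List.length_cons, List.length_nil]; omega
  · intro i
    exact key i 0 (by simp)
  · intro i j
    have := key i (j + 1) (by simp [vertexWords_eq])
    rw [show 3 + 2 * E.length + 2 * F.length + (Ls.take i).flatten.length + 1 + (j : ℕ) =
      3 + 2 * E.length + 2 * F.length + (Ls.take i).flatten.length + (j + 1) by omega, this]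
    simp [vertexWords_eq]

end BinTree

/-! ### The length of the input, and the transport of the output -/

namespace RAM

/-- Computes the length of the input in the register `0`. -/
def scan : Prog :=
  .seq (.set 0 (.add (.const 3) (.add (.mul (.const 2) (.load (.const 1)))
    (.mul (.const 2) (.sub (.load (.const 2)) (.const 1))))))
  (.seq (.set 100 (.load (.const 2)))
    (.loop (.reg 100) (.seq (.set 0 (.add (.reg 0) (.add (.const 1) (.load (.reg 0)))))
      (.set 100 (.sub (.reg 100) (.const 1))))))

/-- Copies the array `OUT` to the addresses from `0` on; the variable `cnt` holds its length. -/
def copyOut : Prog :=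
  .seq (.set 100 (.const 0))
    (.loop (.lt (.reg 100) (.reg (Var.cnt.ctorIdx + 1)))
      (.seq (.store (.reg 100) (.load (addr .OUT (.reg 100))))
        (.set 100 (.add (.reg 100) (.const 1)))))

/-- A command as a program with input and output. -/
def program (p : Cmd) : Prog := .seq scan (.seq p.comp copyOut)

-- The length is not part of the input, but the arrays are placed right behind it. It is found by
-- skipping the edges, of which the tree has `N - 1`, and then hopping from bag to bag by their
-- sizes.
open BinTree in
theorem scan_spec {n N : ℕ} {E : List (Fin n × Fin n)} {F : List (Fin N × Fin N)}
    {X : Fin N → List (Fin n)} {bp : ℕ → ℕ} {x : List ℕ} {B : ℕ}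
    (hv : InputView (fun i => x.getD i 0) x.length E F X bp) (hF : F.length = N - 1) (hN : 0 < N)
    (hB : x.length + N + 3 ≤ B) :
    ∃ t s, Exec B scan (State.init x) t s ∧ t ≤ 20 + 20 * N ∧ s.mem = (State.init x).mem ∧
      s.reg 0 = x.length ∧ ∀ r, r ≠ 0 → r ≠ 100 → s.reg r = 0 := by
  have hmono : ∀ i ≤ N, bp 0 + i ≤ bp i := by
    intro i
    induction i with
    | zero => intro _; omega
    | succ i ih =>
      intro hi
      have := hv.bp_succ ⟨i, by omega⟩
      have := ih (by omega)
      simp only at *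
      omega
  have hmono2 : ∀ d i, i + d = N → bp i + d ≤ x.length := by
    intro d
    induction d with
    | zero =>
      intro i hi
      have : i = N := by omega
      rw [this, hv.bp_last]; omega
    | succ d ih =>
      intro i hi
      have h1 := hv.bp_succ ⟨i, by omega⟩
      have h2 := ih (i + 1) (by omega)
      simp only at *
      omega
  have hb0 := hv.bp_zero
  have hb1 := hmono2 N 0 (by omega)
  have loop : ∀ d i, i + d = N → ∀ s : State, s.mem = (State.init x).mem → s.reg 0 = bp i →
      s.reg 100 = d → (∀ r, r ≠ 0 → r ≠ 100 → s.reg r = 0) →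
      ∃ t s', Exec B (.loop (.reg 100) (.seq (.set 0 (.add (.reg 0) (.add (.const 1) (.load (.reg 0)))))
      (.set 100 (.sub (.reg 100) (.const 1))))) s t s' ∧ t ≤ 2 + 20 * d ∧
      s'.mem = (State.init x).mem ∧ s'.reg 0 = x.length ∧ ∀ r, r ≠ 0 → r ≠ 100 → s'.reg r = 0 := by
    intro d
    induction d with
    | zero =>
      intro i hi s hm h0 h1 hr
      have : i = N := by omega
      refine ⟨_, s, .loop_done ?_ ?_, ?_, hm, ?_, hr⟩
      · simp [Exp.Fits, h1]
      · simp [Exp.eval, h1]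
      · simp [Exp.cost]
      · rw [h0, this, hv.bp_last]
    | succ d ih =>
      intro i hi s hm h0 h1 hr
      have hs := hv.bp_succ ⟨i, by omega⟩
      have hsz := hv.size ⟨i, by omega⟩
      simp only at hs hsz
      have h2 := hmono2 d (i + 1) (by omega)
      have hmem : s.mem (bp i) = (X ⟨i, by omega⟩).length := by
        rw [hm]; exact hsz
      have e1 : Exec B (.set 0 (.add (.reg 0) (.add (.const 1) (.load (.reg 0))))) s 7
          { s with reg := Function.update s.reg 0 (bp (i + 1)) } := by
        have := Exec.set (B := B) 0 (.add (.reg 0) (.add (.const 1) (.load (.reg 0)))) s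
          (by simp only [Exp.Fits, Exp.eval, h0, hmem]; omega)
        simp only [Exp.eval, h0, hmem, Exp.cost] at this
        rwa [hs, add_assoc]
      have e2 : Exec B (.set 100 (.sub (.reg 100) (.const 1)))
          { s with reg := Function.update s.reg 0 (bp (i + 1)) } 4
          { s with reg := Function.update (Function.update s.reg 0 (bp (i + 1))) 100 d } := by
        have := Exec.set (B := B) 100 (.sub (.reg 100) (.const 1))
          { s with reg := Function.update s.reg 0 (bp (i + 1)) }
          (by simp [Exp.Fits, h1]; omega)
        simpa [Exp.eval, h1, Exp.cost] using this
      obtain ⟨t, s', a1, a2, a3, a4, a5⟩ := ih (i + 1) (by omega)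
        { s with reg := Function.update (Function.update s.reg 0 (bp (i + 1))) 100 d } hm (by simp)
        (by simp) (by intro r hr0 hr1; simp [hr0, hr1, hr])
      refine ⟨_, s', .loop_step ?_ ?_ (.seq e1 e2) a1, ?_, a3, a4, a5⟩
      · simp only [Exp.Fits, h1]; omega
      · simp [Exp.eval, h1]
      · simp only [Exp.cost]; omega
  have m1 : (State.init x).mem 1 = E.length := hv.m_eq
  have m2 : (State.init x).mem 2 = N := hv.N_eq
  have e1 : Exec B (.set 0 (.add (.const 3) (.add (.mul (.const 2) (.load (.const 1)))
      (.mul (.const 2) (.sub (.load (.const 2)) (.const 1)))))) (State.init x) 14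
      { State.init x with reg := Function.update (State.init x).reg 0 (bp 0) } := by
    have := Exec.set (B := B) 0 (.add (.const 3) (.add (.mul (.const 2) (.load (.const 1)))
      (.mul (.const 2) (.sub (.load (.const 2)) (.const 1))))) (State.init x)
      (by simp only [Exp.Fits, Exp.eval, m1, m2]; omega)
    simp only [Exp.eval, m1, m2, Exp.cost] at this
    rwa [hb0, hF, add_assoc]
  have e2 : Exec B (.set 100 (.load (.const 2)))
      { State.init x with reg := Function.update (State.init x).reg 0 (bp 0) } 3
      { State.init x with reg := Function.update (Function.update (State.init x).reg 0 (bp 0)) 100 N } := by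
    have := Exec.set (B := B) 100 (.load (.const 2))
      { State.init x with reg := Function.update (State.init x).reg 0 (bp 0) }
      (by simp only [Exp.Fits, Exp.eval, m2]; omega)
    simpa only [Exp.eval, m2, Exp.cost] using this
  obtain ⟨t, s', a1, a2, a3, a4, a5⟩ := loop N 0 (by omega) { State.init x with
    reg := Function.update (Function.update (State.init x).reg 0 (bp 0)) 100 N } rfl (by simp)
    (by simp) (by intro r hr0 hr1; simp [hr0, hr1, State.init])
  exact ⟨_, s', .seq e1 (.seq e2 a1), by omega, a3, a4, a5⟩

/-- The target range may overlap the arrays. Copying upwards is safe: cell `j` of `OUT` has an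
address larger than `j`, so writing to address `i` destroys no cell beyond `i`. -/
theorem copyOut_spec {E : Env} {s : St} {r : State} {B : ℕ}
    (hB : E.len + (E.B * arrays + arrays) ≤ B) (hr : Rel E s r) (hs : Bounded E s) :
    ∃ t r', Exec B copyOut r t r' ∧ t ≤ 6 + 20 * s.v .cnt ∧ ∀ i < s.v .cnt, r'.mem i = s.a .OUT i := by
  have hBB : E.B ≤ B := by
    have : E.B ≤ E.B * arrays := Nat.le_mul_of_pos_right _ (by decide)
    omega
  have hcB := hs.v .cnt
  have ho : Arr.OUT.ctorIdx < arrays := by decide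
  have har : 0 < arrays := by decide
  have loop : ∀ d i, i + d = s.v .cnt → ∀ r : State, r.reg 0 = E.len → r.reg 100 = i →
      r.reg (Var.cnt.ctorIdx + 1) = s.v .cnt → (∀ j < i, r.mem j = s.a .OUT j) →
      (∀ j, i ≤ j → r.mem (E.len + (j * arrays + Arr.OUT.ctorIdx)) = s.a .OUT j) →
      ∃ t r', Exec B (.loop (.lt (.reg 100) (.reg (Var.cnt.ctorIdx + 1)))
      (.seq (.store (.reg 100) (.load (addr .OUT (.reg 100))))
        (.set 100 (.add (.reg 100) (.const 1))))) r t r' ∧ t ≤ 4 + 20 * d ∧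
        ∀ i < s.v .cnt, r'.mem i = s.a .OUT i := by
    intro d
    induction d with
    | zero =>
      intro i hi r h0 h1 h2 h3 h4
      refine ⟨_, r, .loop_done ?_ ?_, ?_, fun j hj => h3 j (by omega)⟩
      · simp only [Exp.Fits, h1, h2]; omega
      · simp only [Exp.eval, h1, h2]; rw [if_neg (by omega)]
      · simp [Exp.cost]
    | succ d ih =>
      intro i hi r h0 h1 h2 h3 h4
      have hm := Nat.mul_le_mul_right arrays (show i ≤ E.B by omega)
      have hval : (addr .OUT (.reg 100)).eval r = E.len + (i * arrays + Arr.OUT.ctorIdx) := by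
        simp [addr, Exp.eval, h0, h1]
      have e1 : Exec B (.store (.reg 100) (.load (addr .OUT (.reg 100)))) r 10
          { r with mem := Function.update r.mem i (s.a .OUT i) } := by
        have := Exec.store (B := B) (.reg 100) (.load (addr .OUT (.reg 100))) r
          (by simp only [Exp.Fits, h1]; omega) (by
            refine ⟨?_, ?_⟩
            · simp only [addr, Exp.Fits, Exp.eval, h0, h1]; omega
            · rw [hval, h4 i le_rfl]; exact (hs.a _ _).trans hBB)
        have e3 : (Exp.load (addr .OUT (.reg 100))).eval r = s.a .OUT i := by
          rw [Exp.eval, hval, h4 i le_rfl]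
        rw [e3] at this
        simpa only [Exp.eval, h1, Exp.cost, addr] using this
      have e2 : Exec B (.set 100 (.add (.reg 100) (.const 1)))
          { r with mem := Function.update r.mem i (s.a .OUT i) } 4
          ⟨Function.update r.reg 100 (i + 1), Function.update r.mem i (s.a .OUT i)⟩ := by
        have := Exec.set (B := B) 100 (.add (.reg 100) (.const 1))
          { r with mem := Function.update r.mem i (s.a .OUT i) }
          (by simp only [Exp.Fits, Exp.eval, h1]; omega)
        simpa only [Exp.eval, h1, Exp.cost] using this
      have hne : Var.cnt.ctorIdx + 1 ≠ 100 := by decide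
      obtain ⟨t, r', a1, a2, a3⟩ := ih (i + 1) (by omega)
        ⟨Function.update r.reg 100 (i + 1), Function.update r.mem i (s.a .OUT i)⟩
        (by simp [h0]) (by simp) (by simp [hne, h2])
        (by
          intro j hj
          by_cases h : j = i
          · subst h; simp
          · simp only [Function.update_of_ne h]; exact h3 j (by omega))
        (by
          intro j hj
          have : j ≤ j * arrays := Nat.le_mul_of_pos_right _ har
          simp only
          rw [Function.update_of_ne (by omega)]
          exact h4 j (by omega))
      refine ⟨_, r', .loop_step ?_ ?_ (.seq e1 e2) a1, ?_, a3⟩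
      · simp only [Exp.Fits, h1, h2]; omega
      · simp only [Exp.eval, h1, h2]; rw [if_pos (by omega)]; omega
      · simp only [Exp.cost]; omega
  have hset : Exec B (.set 100 (.const 0)) r 2 { r with reg := Function.update r.reg 100 0 } :=
    Exec.set 100 (.const 0) r (Nat.zero_le B)
  have hne : Var.cnt.ctorIdx + 1 ≠ 100 := by decide
  obtain ⟨t, r', a1, a2, a3⟩ := loop (s.v .cnt) 0 (by omega)
    { r with reg := Function.update r.reg 100 0 } (by simp [hr.off]) (by simp)
    (by simp [hne, hr.v]) (by simp) (fun j _ => hr.a .OUT j)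
  exact ⟨_, r', .seq hset a1, by omega, a3⟩

/-- The empty state. -/
def St.zero : St := ⟨fun _ => 0, fun _ _ => 0⟩

open BinTree in
theorem program_spec {n N : ℕ} {L : List (Fin n × Fin n)} {F : List (Fin N × Fin N)}
    {X : Fin N → List (Fin n)} {bp : ℕ → ℕ} {x : List ℕ} {B : ℕ} {E : Env} {p : Cmd}
    (hE : E.inp = fun i => x.getD i 0) (hlen : E.len = x.length)
    (hv : InputView E.inp E.len L F X bp) (hF : F.length = N - 1) (hN : 0 < N)
    (hNB : N + 3 ≤ E.B) (hB : E.len + (E.B * arrays + arrays) ≤ B) (hin : ∀ i, E.inp i ≤ E.B)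
    (hwf : p.wf = true) {Q : St → Prop} (hp : Cmd.Spec E p St.zero Q) :
    ∃ t s' s, Exec B (program p) (State.init x) t s' ∧
      t ≤ p.time E.lim + (26 + 20 * N + 20 * s.v .cnt) ∧ Q s ∧ ∀ i < s.v .cnt, s'.mem i = s.a .OUT i := by
  have h1 : 1 ≤ E.B := by omega
  have hBB := bound_le hB (fun i _ => hin i) h1
  have har : 0 < arrays := by decide
  have hBm : E.B ≤ E.B * arrays := Nat.le_mul_of_pos_right _ har
  obtain ⟨t1, s1, a1, a2, a3, a4, a5⟩ := scan_spec (B := B) (x := x) (by rwa [← hE, ← hlen]) hF hN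
    (by omega)
  have hrel : Rel E St.zero s1 := by
    refine ⟨a4.trans hlen.symm, fun y => a5 _ (by omega) ?_, fun i _ => ?_, fun a i => ?_⟩
    · have : y.ctorIdx + 1 < 100 := by cases y <;> decide
      omega
    · rw [a3, hE]; rfl
    · rw [a3]
      simp only [State.init, St.zero]
      rw [List.getD_eq_getElem?_getD, List.getElem?_eq_none (by omega)]
      rfl
  obtain ⟨t2, s2, b1, b2, b3, b4⟩ := p.comp_spec hB (fun i _ => hin i) h1 hwf hrel
    ⟨fun _ => Nat.zero_le _, fun _ _ => Nat.zero_le _⟩ hp.1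
  obtain ⟨t3, s3, c1, c2, c3⟩ := copyOut_spec hB b3 b4
  exact ⟨_, s3, _, .seq a1 (.seq b1 c1), by omega, hp.2, c3⟩

end RAM

/-! ## The program: merging two states -/

namespace RAM
open BinTree Cmd

/-- The bounds for the tables of the layout `I`. -/
structure Sizes (E : Env) (I : Layout) : Prop where
  K_pos : 0 < I.K
  M_pos : 0 < I.M
  K_lim : I.K ≤ E.lim .K
  S_lim : I.S ≤ E.lim .S
  B : I.M * I.S ≤ E.B
  B8 : 8 ≤ E.B

/-- The variables with the sizes of the tables of the layout `I`. -/
structure SizeVars (I : Layout) (s : St) : Prop where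
  K : s.v .K = I.K
  D : s.v .D = 4 * I.K
  S : s.v .S = I.S
  M1 : s.v .M1 = I.M - 1

theorem SizeVars.of_frame {I : Layout} {s s' : St} {p : Cmd} (h : SizeVars I s) (hf : p.Frame s s')
    (hK : p.mods .K = false) (hD : p.mods .D = false) (hS : p.mods .S = false)
    (hM : p.mods .M1 = false) : SizeVars I s' :=
  ⟨(hf.v _ hK).trans h.K, (hf.v _ hD).trans h.D, (hf.v _ hS).trans h.S, (hf.v _ hM).trans h.M1⟩

section
variable {E : Env} {I : Layout} (hE : Sizes E I)
include hE

theorem Sizes.K_le_S : 4 * I.K ≤ I.S := by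
  have := hE.K_pos
  exact Nat.le_self_pow (by omega) _

theorem Sizes.S_pos : 0 < I.S := by
  have := hE.K_le_S; have := hE.K_pos; omega

theorem Sizes.S_le : I.S ≤ E.B :=
  (Nat.le_mul_of_pos_left _ hE.M_pos).trans hE.B

theorem Sizes.idx_S {a s : ℕ} (ha : a < I.M) (hs : s < I.S) : a * I.S + s < E.B := by
  refine lt_of_lt_of_le ?_ hE.B
  calc a * I.S + s < a * I.S + I.S := by omega
    _ = (a + 1) * I.S := by ring
    _ ≤ I.M * I.S := Nat.mul_le_mul_right _ ha

theorem Sizes.idx_K {a j : ℕ} (ha : a < I.M) (hj : j < I.K) : a * I.K + j < E.B := by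
  have := hE.K_le_S
  have h1 := hE.idx_S ha (s := j) (by omega)
  have h2 : a * I.K ≤ a * I.S := Nat.mul_le_mul_left _ (by omega)
  omega

end

theorem idx_inj {w a b x y : ℕ} (hx : x < w) (hy : y < w) (h : a * w + x = b * w + y) :
    a = b ∧ x = y := by
  have h1 : (a * w + x) / w = (b * w + y) / w := by rw [h]
  have h2 : (a * w + x) % w = (b * w + y) % w := by rw [h]
  rw [Nat.mul_add_mod_self_right, Nat.mul_add_mod_self_right, Nat.mod_eq_of_lt hx,
    Nat.mod_eq_of_lt hy] at h2
  have h3 : 0 < w := by omega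
  rw [mul_comm, mul_comm b, Nat.mul_add_div h3, Nat.mul_add_div h3, Nat.div_eq_of_lt hx,
    Nat.div_eq_of_lt hy] at h1
  exact ⟨h1, h2⟩

/-- Writes the entries of the state in `sv` to the arrays `d` and `b`. -/
def decode (d b : Arr) (sv : Var) : Cmd :=
  .set .x sv ;; .for_ .j .K
    (.set .y (.v .x % .v .D) ;; .st d (.v .j) (.v .y / .v .K) ;; .st b (.v .j) (.v .y % .v .K) ;;
      .set .x (.v .x / .v .D))

/-- Reads a state from the arrays `D1` and `L1`. -/
def encode : Cmd :=
  .set .s (.c 0) ;; .for_ .j .K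
    (.set .x (.v .K - .c 1 - .v .j) ;;
      .set .s (.v .s * .v .D + (.ld .D1 (.v .x) * .v .K + .ld .L1 (.v .x))))

theorem decode_spec {E : Env} {I : Layout} (hE : Sizes E I) {s : St} (hs : SizeVars I s)
    {d b : Arr} {sv : Var} (hdb : d ≠ b) :
    Spec E (decode d b sv) s fun s' => ∀ j < I.K, s'.a d j = I.dg (s.v sv) j ∧
      s'.a b j = I.lb (s.v sv) j := by
  unfold decode
  rw [spec_set_seq]
  refine ⟨trivial, ?_⟩
  simp only [Ex.ev_v]
  refine spec_for (fun i s' => s'.v .x = s.v sv / (4 * I.K) ^ i ∧ ∀ j < i,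
    s'.a d j = I.dg (s.v sv) j ∧ s'.a b j = I.lb (s.v sv) j) rfl ?_ ?_ ?_ ?_
  · simpa [hs.K] using hE.K_lim
  · simp
  · intro i hi s' hf hj ⟨hx, hprev⟩
    simp only [St.setv_v, reduceCtorEq, if_false, hs.K] at hi
    have hK : s'.v .K = I.K := by rw [hf.v _ rfl]; simp [hs.K]
    have hD : s'.v .D = 4 * I.K := by rw [hf.v _ rfl]; simp [hs.D]
    simp [hj, hx, hK, hD]
    refine ⟨?_, ?_⟩
    · rw [Nat.div_div_eq_div_mul, pow_succ]
    · intro j hj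
      rw [if_neg hdb, if_neg hdb.symm]
      rcases Nat.lt_or_eq_of_le hj with h | rfl
      · simp only [Function.update_of_ne h.ne]
        exact hprev j h
      · simp [Layout.dg, Layout.lb]
  · intro s' hf hj ⟨hx, hprev⟩
    simpa [hs.K] using hprev

/-- Horner's scheme from the last position to the first, so that position `0` becomes the lowest
digit in base `4 * I.K`. -/
theorem encode_spec {E : Env} {I : Layout} (hE : Sizes E I) {s : St} (hs : SizeVars I s)
    (h1 : ∀ j < I.K, s.a .D1 j < 4) (h2 : ∀ j < I.K, s.a .L1 j < I.K) :
    Spec E encode s fun s' => s'.v .s < I.S ∧ ∀ j < I.K, I.dg (s'.v .s) j = s.a .D1 j ∧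
      I.lb (s'.v .s) j = s.a .L1 j := by
  have h4 : ∀ j < I.K, s.a .D1 j * I.K + s.a .L1 j < 4 * I.K := by
    intro j hj
    have := Nat.mul_le_mul_right I.K (show s.a .D1 j ≤ 3 by have := h1 j hj; omega)
    have := h2 j hj
    omega
  unfold encode
  rw [spec_set_seq]
  refine ⟨Nat.zero_le _, ?_⟩
  simp only [Ex.ev_c]
  -- After `i` rounds the last `i` positions have been read, and digit `j` belongs to position `I.K
  -- - i + j`.
  refine spec_for (fun i s' => s'.v .s < (4 * I.K) ^ i ∧ ∀ j < i,
    s'.v .s / (4 * I.K) ^ j % (4 * I.K) = s.a .D1 (I.K - i + j) * I.K + s.a .L1 (I.K - i + j))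
    rfl ?_ ?_ ?_ ?_
  · simpa [hs.K] using hE.K_lim
  · simp
  · intro i hi s' hf hj ⟨hlt, hprev⟩
    simp only [St.setv_v, reduceCtorEq, if_false, hs.K] at hi
    have hK : s'.v .K = I.K := by rw [hf.v _ rfl]; simp [hs.K]
    have hD : s'.v .D = 4 * I.K := by rw [hf.v _ rfl]; simp [hs.D]
    have hD1 : s'.a .D1 = s.a .D1 := by rw [hf.a _ rfl]; simp
    have hL1 : s'.a .L1 = s.a .L1 := by rw [hf.a _ rfl]; simp
    have h5 := h4 (I.K - 1 - i) (by omega)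
    have h6 : s'.v .s * (4 * I.K) + (s.a .D1 (I.K - 1 - i) * I.K + s.a .L1 (I.K - 1 - i)) <
        (4 * I.K) ^ (i + 1) := by
      rw [pow_succ]
      calc _ < s'.v .s * (4 * I.K) + 4 * I.K := by omega
        _ = (s'.v .s + 1) * (4 * I.K) := by ring
        _ ≤ _ := Nat.mul_le_mul_right _ hlt
    have h7 : (4 * I.K) ^ (i + 1) ≤ E.B := le_trans (Nat.pow_le_pow_right
      (by have := hE.K_pos; omega) (by omega)) hE.S_le
    have h8 : 1 ≤ E.B := by have := hE.B8; omega
    simp [hj, hK, hD, hD1, hL1]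
    refine ⟨h8, ⟨by omega, by omega, by omega⟩, h6, ?_⟩
    intro j hj
    have hpos : 0 < 4 * I.K := by have := hE.K_pos; omega
    rcases j with _ | j
    · rw [pow_zero, Nat.div_one, Nat.mul_add_mod_self_right, Nat.mod_eq_of_lt h5]
      rw [show I.K - (i + 1) + 0 = I.K - 1 - i by omega]
    · rw [pow_succ', ← Nat.div_div_eq_div_mul, mul_comm (s'.v .s), Nat.mul_add_div hpos,
        Nat.div_eq_of_lt h5, add_zero, hprev j (by omega),
        show I.K - (i + 1) + (j + 1) = I.K - i + j by omega]
  · intro s' hf hj ⟨hlt, hprev⟩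
    simp only [St.setv_v, reduceCtorEq, if_false, hs.K] at hlt hprev
    refine ⟨hlt, fun j hj => ?_⟩
    have := hprev j hj
    rw [Nat.sub_self, zero_add] at this
    have h5 := h2 j hj
    rw [Layout.dg, Layout.lb, this, mul_comm, Nat.mul_add_div hE.K_pos, Nat.mul_add_mod,
      Nat.div_eq_of_lt h5, Nat.mod_eq_of_lt h5]
    exact ⟨rfl, rfl⟩

/-- Equality of the labels is the equivalence relation generated by `R`. -/
def LabEq (K : ℕ) (L : ℕ → ℕ) (R : ℕ → ℕ → Prop) : Prop :=
  ∀ x < K, ∀ y < K, L x = L y ↔ Relation.EqvGen R x y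

theorem LabEq.congr {K : ℕ} {L : ℕ → ℕ} {R R' : ℕ → ℕ → Prop} (h : LabEq K L R)
    (hR : ∀ x y, R x y ↔ R' x y) : LabEq K L R' := by
  have : R = R' := by ext x y; exact hR x y
  rwa [← this]

/-- Replacing the label of `w` everywhere by that of `u` unites their classes, which is the effect
of adding the pair `(u, w)` to the generating relation. -/
theorem LabEq.relabel {K : ℕ} {L L' : ℕ → ℕ} {R R' : ℕ → ℕ → Prop} (h : LabEq K L R) {u w : ℕ}
    (hu : u < K) (hw : w < K) (hR : ∀ x y, R x y → x < K ∧ y < K)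
    (hR' : ∀ x y, R' x y ↔ R x y ∨ (x = u ∧ y = w))
    (hL : ∀ l < K, L' l = if L l = L w then L u else L l) : LabEq K L' R' := by
  have hgen : ∀ x y, Relation.EqvGen R x y → Relation.EqvGen R' x y := fun x y =>
    Layout.eqvGen_le (Relation.EqvGen.is_equivalence _)
      fun x y hxy => Relation.EqvGen.rel _ _ ((hR' x y).2 (Or.inl hxy))
  have huw : Relation.EqvGen R' u w := Relation.EqvGen.rel _ _ ((hR' u w).2 (Or.inr ⟨rfl, rfl⟩))
  have hwu := huw.symm
  intro x hx y hy
  constructor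
  · intro he
    rw [hL x hx, hL y hy] at he
    split_ifs at he with h1 h2 h2
    · exact hgen _ _ ((h x hx y hy).1 (h1.trans h2.symm))
    · exact (hgen _ _ ((h x hx w hw).1 h1)).trans _ _ _
        ((hwu).trans _ _ _ (hgen _ _ ((h u hu y hy).1 he)))
    · exact (hgen _ _ ((h x hx u hu).1 he)).trans _ _ _
        (huw.trans _ _ _ (hgen _ _ ((h w hw y hy).1 h2.symm)))
    · exact hgen _ _ ((h x hx y hy).1 he)
  · intro he
    have hP : Equivalence fun x y => x = y ∨ (x < K ∧ y < K ∧ L' x = L' y) := by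
      refine ⟨fun x => Or.inl rfl, ?_, ?_⟩
      · rintro x y (h | ⟨h, h', h''⟩)
        · exact Or.inl h.symm
        · exact Or.inr ⟨h', h, h''.symm⟩
      · rintro x y w (rfl | ⟨h, h', h''⟩) (rfl | ⟨k, k', k''⟩)
        · exact Or.inl rfl
        · exact Or.inr ⟨k, k', k''⟩
        · exact Or.inr ⟨h, h', h''⟩
        · exact Or.inr ⟨h, k', h''.trans k''⟩
    have hle : ∀ x y, R' x y → x = y ∨ (x < K ∧ y < K ∧ L' x = L' y) := by
      intro x y hxy
      right
      rcases (hR' x y).1 hxy with hxy | ⟨rfl, rfl⟩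
      · obtain ⟨hx, hy⟩ := hR x y hxy
        refine ⟨hx, hy, ?_⟩
        rw [hL x hx, hL y hy, (h x hx y hy).2 (Relation.EqvGen.rel _ _ hxy)]
      · refine ⟨hu, hw, ?_⟩
        rw [hL x hu, hL y hw, if_pos rfl, ite_eq_left_iff.2 fun _ => rfl]
    rcases Layout.eqvGen_le hP hle he with rfl | ⟨_, _, h⟩
    · rfl
    · exact h

/-- Replaces the label `b` by `a` in `L1`. -/
def relabel : Cmd :=
  .for_ .l .K (.ite (.eq (.ld .L1 (.v .l)) (.v .b)) (.st .L1 (.v .l) (.v .a)) .skip)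

theorem relabel_spec {E : Env} {I : Layout} (hE : Sizes E I) {s : St} (hs : SizeVars I s) :
    Spec E relabel s fun s' => ∀ l < I.K, s'.a .L1 l = if s.a .L1 l = s.v .b then s.v .a
      else s.a .L1 l := by
  unfold relabel
  refine spec_for (fun i s' => ∀ l, s'.a .L1 l = if l < i ∧ s.a .L1 l = s.v .b then s.v .a
      else s.a .L1 l) rfl ?_ ?_ ?_ ?_
  · simpa [hs.K] using hE.K_lim
  · simp
  · intro i hi s' hf hj hprev
    have ha : s'.v .a = s.v .a := hf.v _ rfl
    have hb : s'.v .b = s.v .b := hf.v _ rfl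
    have hcur : s'.a .L1 i = s.a .L1 i := by rw [hprev, if_neg (by omega)]
    rw [spec_ite]
    refine ⟨by simp, ?_⟩
    by_cases h : s.a .L1 i = s.v .b
    · simp [hj, hb, hcur, h, ha]
      intro l
      by_cases hl : l = i
      · subst hl; simp [h]
      · rw [Function.update_of_ne hl, hprev l]
        grind
    · simp [hj, hb, hcur, h]
      intro l
      rw [hprev l]
      by_cases hl : l = i
      · subst hl; simp [h]
      · grind
  · intro s' hf hj hprev l hl
    rw [hprev l]
    simp [hs.K, hl]

/-- Joins the label of the position `y` with that of all positions matched to positions of the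
second state with the same label as `j`. -/
def unite : Cmd :=
  .for_ .j2 .K (.ite (.ld .TR (.v .j2)) (.ite (.eq (.ld .L2 (.v .j2)) (.ld .L2 (.v .j)))
    (.set .a (.ld .L1 (.v .y)) ;; .set .b (.ld .L1 (.ld .TR (.v .j2) - .c 1)) ;; relabel) .skip) .skip)

/-- In `LabRel` a fixed `j` allows only its own match as first component. So the pairs starting at
`y` are all that `j` contributes, and the outer loop over `j` collects the whole relation. -/
theorem unite_spec {E : Env} {I : Layout} (hE : Sizes E I) {s : St} (hs : SizeVars I s)
    (hy : s.v .y < I.K) (hTR : ∀ j < I.K, s.a .TR j ≤ I.K) {R : ℕ → ℕ → Prop}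
    (hR : ∀ x y, R x y → x < I.K ∧ y < I.K) (hL : LabEq I.K (s.a .L1) R)
    (hb : ∀ l < I.K, s.a .L1 l < I.K) :
    Spec E unite s fun s' => (∀ l < I.K, s'.a .L1 l < I.K) ∧ LabEq I.K (s'.a .L1) fun x y => R x y ∨
      (x = s.v .y ∧ ∃ j2 < I.K, s.a .TR j2 = y + 1 ∧ s.a .L2 j2 = s.a .L2 (s.v .j)) := by
  unfold unite
  refine spec_for (fun i s' => (∀ l < I.K, s'.a .L1 l < I.K) ∧ LabEq I.K (s'.a .L1) fun x y =>
    R x y ∨ (x = s.v .y ∧ ∃ j2 < i, s.a .TR j2 = y + 1 ∧ s.a .L2 j2 = s.a .L2 (s.v .j)))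
    rfl ?_ ?_ ?_ ?_
  · simpa [hs.K] using hE.K_lim
  · exact ⟨hb, hL.congr fun x y => by simp⟩
  · intro i hi s' hf hj2 ⟨hb', hlab⟩
    rw [hs.K] at hi
    have eTR : s'.a .TR = s.a .TR := hf.a _ rfl
    have eL2 : s'.a .L2 = s.a .L2 := hf.a _ rfl
    have ej : s'.v .j = s.v .j := hf.v _ rfl
    have ey : s'.v .y = s.v .y := hf.v _ rfl
    have hs' : SizeVars I s' := hs.of_frame hf rfl rfl rfl rfl
    have hTi := hTR i hi
    rw [spec_ite]
    refine ⟨by simp, ?_⟩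
    by_cases h0 : s.a .TR i = 0
    · simp [hj2, eTR, h0]
      refine ⟨hb', hlab.congr fun x y => or_congr_right (and_congr_right fun _ => ?_)⟩
      constructor
      · rintro ⟨j2, h, h'⟩; exact ⟨j2, by omega, h'⟩
      · rintro ⟨j2, h, h'⟩
        refine ⟨j2, ?_, h'⟩
        by_contra hc
        obtain rfl : j2 = i := by omega
        omega
    · simp only [Ex.ev_ld, Ex.ev_v, hj2, eTR, h0, if_false]
      rw [spec_ite]
      refine ⟨by simp, ?_⟩
      by_cases h1 : s.a .L2 i = s.a .L2 (s.v .j)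
      · simp only [Ex.ev_eq, Ex.ev_ld, Ex.ev_v, hj2, eL2, ej, h1, if_true, one_ne_zero, if_false]
        simp only [spec_set_seq, Ex.ok_ld, Ex.ok_v, Ex.ok_sub, Ex.ok_c, true_and]
        refine ⟨by have := hE.B8; omega, ?_⟩
        refine (relabel_spec hE (I := I) ⟨?_, ?_, ?_, ?_⟩).mono ?_
        · simp [hs'.K]
        · simp [hs'.D]
        · simp [hs'.S]
        · simp [hs'.M1]
        intro s'' hf' hrel
        simp only [Ex.ev_ld, Ex.ev_v, Ex.ev_sub, Ex.ev_c, St.setv_v, St.setv_a, reduceCtorEq,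
          if_true, if_false, hj2, eTR, ey] at hrel
        simp only [St.setv_a]
        refine ⟨fun l hl => ?_, ?_⟩
        · rw [hrel l hl]; split_ifs
          · exact hb' _ hy
          · exact hb' _ hl
        · refine hlab.relabel (u := s.v .y) (w := s.a .TR i - 1) hy (by omega) ?_ ?_ hrel
          · rintro x y (h | ⟨rfl, j2, hj2, h, _⟩)
            · exact hR x y h
            · have := hTR j2 (by omega)
              exact ⟨hy, by omega⟩
          · intro x y
            constructor
            · rintro (h | ⟨hx, j2, hj2, h, h'⟩)
              · exact Or.inl (Or.inl h)
              · by_cases hji : j2 = i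
                · subst hji; exact Or.inr ⟨hx, by omega⟩
                · exact Or.inl (Or.inr ⟨hx, j2, by omega, h, h'⟩)
            · rintro ((h | ⟨hx, j2, hj2, h, h'⟩) | ⟨hx, hy⟩)
              · exact Or.inl h
              · exact Or.inr ⟨hx, j2, by omega, h, h'⟩
              · exact Or.inr ⟨hx, i, by omega, by omega, h1⟩
      · simp [hj2, eL2, ej, h1]
        refine ⟨hb', hlab.congr fun x y => or_congr_right (and_congr_right fun _ => ?_)⟩
        constructor
        · rintro ⟨j2, h, h'⟩; exact ⟨j2, by omega, h'⟩
        · rintro ⟨j2, h, h', h''⟩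
          refine ⟨j2, ?_, h', h''⟩
          by_contra hc
          obtain rfl : j2 = i := by omega
          exact h1 h''
  · intro s' hf hj h
    rwa [hs.K] at h

/-- Sets `f` to `1` if some matched position of the second state has the same label as `j`. -/
def findMatch : Cmd :=
  .set .f (.c 0) ;; .for_ .j2 .K (.ite (.ld .TR (.v .j2)) (.ite (.eq (.ld .L2 (.v .j2)) (.ld .L2 (.v .j)))
    (.set .f (.c 1)) .skip) .skip)

theorem findMatch_spec {E : Env} {I : Layout} (hE : Sizes E I) {s : St} (hs : SizeVars I s) :
    Spec E findMatch s fun s' => s'.v .f = 0 ↔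
      ¬ ∃ j2 < I.K, s.a .TR j2 ≠ 0 ∧ s.a .L2 j2 = s.a .L2 (s.v .j) := by
  unfold findMatch
  rw [spec_set_seq]
  refine ⟨Nat.zero_le _, ?_⟩
  refine spec_for (fun i s' => s'.v .f = 0 ↔
      ¬ ∃ j2 < i, s.a .TR j2 ≠ 0 ∧ s.a .L2 j2 = s.a .L2 (s.v .j)) rfl ?_ ?_ ?_ ?_
  · simpa [hs.K] using hE.K_lim
  · simp
  · intro i hi s' hf hj2 hinv
    have eTR : s'.a .TR = s.a .TR := hf.a _ rfl
    have eL2 : s'.a .L2 = s.a .L2 := hf.a _ rfl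
    have ej : s'.v .j = s.v .j := (hf.v _ rfl).trans (by simp)
    have h1 : 1 ≤ E.B := by have := hE.B8; omega
    simp only [spec_ite, spec_set, spec_skip]
    simp [hj2, eTR, eL2, ej, hinv, h1]
    grind
  · intro s' hf hj h
    simpa [hs.K] using h

/-- `tr` maps the positions of `c` to those of `p` with the same code, plus one. -/
def Translates (I : Layout) (p c : ℕ) (tr : ℕ → ℕ) : Prop :=
  ∀ j < I.K, tr j ≤ I.K ∧ ∀ x < I.K, tr j = x + 1 ↔ I.Matched p c j x

theorem dg_lt {I : Layout} (hK : 0 < I.K) (s j : ℕ) : I.dg s j < 4 := by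
  refine Nat.div_lt_of_lt_mul ?_
  rw [mul_comm]
  exact Nat.mod_lt _ (by omega)

/-- The position `j` of the second state occurs in the first one. -/
def matchBlock : Cmd :=
  .set .y (.ld .TR (.v .j) - .c 1) ;;
  .st .D1 (.v .y) (.ld .D1 (.v .y) + .ld .D2 (.v .j)) ;;
  .ite (.v .y) (.set .x (.c 3)) (.set .x (.c 1)) ;;
  .ite (.lt (.v .x) (.ld .D1 (.v .y))) (.set .ok (.c 0)) .skip ;;
  unite

/-- The position `j` of the second state does not occur in the first one, and is used. -/
def forgetBlock : Cmd :=
  .set .g (.v .g + .c 2) ;; findMatch ;; .ite (.v .f) .skip (.set .ok (.c 0))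

def mergeLoop : Cmd :=
  .for_ .j .K (.ite (.ld .TR (.v .j)) matchBlock
    (.ite (.ld .SL (.v .c * .v .K + .v .j)) (.ite (.ld .D2 (.v .j)) forgetBlock .skip) .skip))

/-- The invariant of the loop over the positions of `c` after the first `i`. In `lab` only `j` is
restricted to `j < i`, because `unite` treats all `j2` at once. The degrees are added even if a cap
is exceeded; `ok` records the violation. -/
structure Merged (I : Layout) (p c σ₁ σ₂ : ℕ) (i : ℕ) (s : St) : Prop where
  matched : ∀ j < i, ∀ x < I.K, I.Matched p c j x → s.a .D1 x = I.dg σ₁ x + I.dg σ₂ j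
  other : ∀ x < I.K, (∀ j < i, ¬ I.Matched p c j x) → s.a .D1 x = I.dg σ₁ x
  L1_lt : ∀ l < I.K, s.a .L1 l < I.K
  lab : LabEq I.K (s.a .L1) fun x y => x < I.K ∧ y < I.K ∧ (I.lb σ₁ x = I.lb σ₁ y ∨
    ∃ j < i, ∃ j2 < I.K, I.Matched p c j x ∧ I.Matched p c j2 y ∧ I.lb σ₂ j = I.lb σ₂ j2)
  ok : s.v .ok ≠ 0 ↔ ∀ j < i,
    (∀ x < I.K, I.Matched p c j x → I.dg σ₁ x + I.dg σ₂ j ≤ Layout.cap (I.slot p x)) ∧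
    (I.slot c j ≠ 0 → (∀ x < I.K, ¬ I.Matched p c j x) → I.dg σ₂ j ≠ 0 →
      ∃ j2 < I.K, (∃ x < I.K, I.Matched p c j2 x) ∧ I.lb σ₂ j2 = I.lb σ₂ j)
  g : s.v .g = 2 * ((I.forgotten p c σ₂).filter (· < i)).card

theorem filter_lt_succ (A : Finset ℕ) (i : ℕ) :
    (A.filter (· < i + 1)).card = (A.filter (· < i)).card + if i ∈ A then 1 else 0 := by
  split_ifs with h
  · rw [← Finset.card_insert_of_notMem (a := i) (s := A.filter (· < i)) (by simp)]
    congr 1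
    ext x
    simp only [Finset.mem_filter, Finset.mem_insert]
    grind
  · rw [add_zero]
    congr 1
    ext x
    simp only [Finset.mem_filter]
    grind

section
variable {E : Env} {I : Layout} (hE : Sizes E I) (hI : I.Valid) {p c σ₁ σ₂ : ℕ}
  {s : St} (hs : SizeVars I s) (hp : p < I.M) (hc : c < I.M) {i : ℕ} (hi : i < I.K)
  (hj : s.v .j = i) (hTR : Translates I p c (s.a .TR))
  (hD2 : ∀ j < I.K, s.a .D2 j = I.dg σ₂ j) (hL2 : ∀ j < I.K, s.a .L2 j = I.lb σ₂ j)
  (h : Merged I p c σ₁ σ₂ i s)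
include hE hI hs hp hc hi hj hTR hD2 hL2 h

theorem matchBlock_spec (h0 : s.a .TR i ≠ 0) :
    Spec E matchBlock s fun s' => Merged I p c σ₁ σ₂ (i + 1) s' := by
  obtain ⟨y, hy⟩ : ∃ y, s.a .TR i = y + 1 := ⟨s.a .TR i - 1, by omega⟩
  have hyK : y < I.K := by have := (hTR i hi).1; omega
  have hm : I.Matched p c i y := ((hTR i hi).2 y hyK).1 hy
  have huniq : ∀ j < I.K, I.Matched p c j y → j = i := fun j hj' hj => by
    refine hI.slot_inj c hc j hj' i hi hj.1 ?_
    rw [← hj.2, ← hm.2]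
  have huniq' : ∀ x < I.K, I.Matched p c i x → x = y := fun x hx hm' => by
    have := ((hTR i hi).2 x hx).2 hm'
    omega
  -- Codes in a bag are distinct, so no earlier position was matched to `y`.
  have hold : s.a .D1 y = I.dg σ₁ y := h.other y hyK fun j hj hmj => by
    have := huniq j (by omega) hmj; omega
  -- The apex sits at position `0` and nowhere else, so the program can read the cap off the
  -- position.
  have hcap : Layout.cap (I.slot p y) = if y = 0 then 1 else 3 := by
    rw [Layout.cap]
    refine if_congr ?_ rfl rfl
    have h00 := hI.slot_zero p hp
    constructor
    · intro h1
      exact hI.slot_inj p hp y hyK 0 hE.K_pos (by omega) (by omega)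
    · rintro rfl; exact h00
  have d1 := dg_lt hE.K_pos σ₁ y
  have d2 := dg_lt hE.K_pos σ₂ i
  have hB := hE.B8
  unfold matchBlock
  simp only [spec_set_seq, spec_st_seq]
  simp only [Ex.ok_ld, Ex.ok_v, Ex.ok_sub, Ex.ok_c, Ex.ok_add, Ex.ev_ld, Ex.ev_v, Ex.ev_sub, Ex.ev_c,
    Ex.ev_add, St.setv_v, St.setv_a, reduceCtorEq, if_true, if_false, hj, hy, Nat.add_sub_cancel,
    hold, hD2 i hi, true_and]
  refine ⟨by omega, by omega, ?_⟩
  refine Spec.seq (R := fun s' => s'.v .x = if y = 0 then 1 else 3) ?_ ?_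
  · rw [spec_ite]
    by_cases hy0 : y = 0 <;> simp [hy0] <;> omega
  intro s₁ hf₁ hx
  refine Spec.seq (R := fun s' => s'.v .ok ≠ 0 ↔ s.v .ok ≠ 0 ∧ I.dg σ₁ y + I.dg σ₂ i ≤
    if y = 0 then 1 else 3) ?_ ?_
  · have e1 : s₁.v .y = y := by rw [hf₁.v _ rfl]; simp
    have e2 : s₁.v .ok = s.v .ok := by rw [hf₁.v _ rfl]; simp
    have e3 : s₁.a .D1 y = I.dg σ₁ y + I.dg σ₂ i := by rw [hf₁.a _ rfl]; simp
    rw [spec_ite]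
    by_cases hlt : s₁.v .x < I.dg σ₁ y + I.dg σ₂ i
    · simp [e1, e3, hlt]; omega
    · simp [e1, e3, hlt, e2]; omega
  intro s₂ hf₂ hok
  have hv : ∀ z, z ≠ .y → z ≠ .x → z ≠ .ok → s₂.v z = s.v z := by
    intro z h1 h2 h3
    rw [hf₂.v, hf₁.v]
    · simp [h1]
    · cases z <;> first | rfl | contradiction
    · cases z <;> first | rfl | contradiction
  have e1 : s₂.v .y = y := by rw [hf₂.v _ rfl, hf₁.v _ rfl]; simp
  have e3 : s₂.a .D1 = Function.update (s.a .D1) y (I.dg σ₁ y + I.dg σ₂ i) := by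
    rw [hf₂.a _ rfl, hf₁.a _ rfl]; simp
  have e4 : s₂.a .L1 = s.a .L1 := by rw [hf₂.a _ rfl, hf₁.a _ rfl]; simp
  have e5 : s₂.a .TR = s.a .TR := by rw [hf₂.a _ rfl, hf₁.a _ rfl]; simp
  have e6 : s₂.a .L2 = s.a .L2 := by rw [hf₂.a _ rfl, hf₁.a _ rfl]; simp
  have hs₂ : SizeVars I s₂ := by
    refine ⟨?_, ?_, ?_, ?_⟩ <;> rw [hv _ (by decide) (by decide) (by decide)]
    exacts [hs.K, hs.D, hs.S, hs.M1]
  refine (unite_spec hE hs₂ (by rw [e1]; exact hyK) (by rw [e5]; exact fun j hj => (hTR j hj).1)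
    (fun x y (hxy : _ ∧ _ ∧ _) => ⟨hxy.1, hxy.2.1⟩) (e4 ▸ h.lab) (e4 ▸ h.L1_lt)).mono ?_
  rintro s₃ hf₃ ⟨hlt, hlab⟩
  have ej : s₂.v .j = i := by rw [hv _ (by decide) (by decide) (by decide), hj]
  have e7 : s₃.a .D1 = Function.update (s.a .D1) y (I.dg σ₁ y + I.dg σ₂ i) := by
    rw [hf₃.a _ rfl, e3]
  have e8 : s₃.v .ok = s₂.v .ok := hf₃.v _ rfl
  have e9 : s₃.v .g = s.v .g := by rw [hf₃.v _ rfl, hv _ (by decide) (by decide) (by decide)]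
  refine ⟨?_, ?_, hlt, ?_, ?_, ?_⟩
  · intro j hj x hx hmx
    rw [e7]
    by_cases hxy : x = y
    · subst hxy
      rw [huniq j (by omega) hmx, Function.update_self]
    · rw [Function.update_of_ne hxy]
      refine h.matched j ?_ x hx hmx
      by_contra hc'
      obtain rfl : j = i := by omega
      exact hxy (huniq' x hx hmx)
  · intro x hx hnm
    have hxy : x ≠ y := by rintro rfl; exact hnm i (by omega) hm
    rw [e7, Function.update_of_ne hxy]
    exact h.other x hx fun j hj => hnm j (by omega)
  · refine hlab.congr fun x y' => ?_
    rw [e1, e5, e6, ej]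
    constructor
    · rintro (⟨hx, hy', h1 | ⟨j, hj, h1⟩⟩ | ⟨rfl, j2, hj2, h1, h2⟩)
      · exact ⟨hx, hy', Or.inl h1⟩
      · exact ⟨hx, hy', Or.inr ⟨j, by omega, h1⟩⟩
      · have hyy : y' < I.K := by have := (hTR j2 hj2).1; omega
        refine ⟨hyK, hyy, Or.inr ⟨i, by omega, j2, hj2, hm, ((hTR j2 hj2).2 y' hyy).1 h1, ?_⟩⟩
        rw [← hL2 i hi, ← hL2 j2 hj2, h2]
    · rintro ⟨hx, hy', h1 | ⟨j, hj, j2, hj2, h1, h2, h3⟩⟩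
      · exact Or.inl ⟨hx, hy', Or.inl h1⟩
      · by_cases hji : j = i
        · subst hji
          exact Or.inr ⟨huniq' x hx h1, j2, hj2, ((hTR j2 hj2).2 y' hy').2 h2,
            by rw [hL2 j hi, hL2 j2 hj2, h3]⟩
        · exact Or.inl ⟨hx, hy', Or.inr ⟨j, by omega, j2, hj2, h1, h2, h3⟩⟩
  · rw [e8, hok, h.ok]
    rw [← hcap]
    constructor
    · rintro ⟨h1, h2⟩ j hj
      by_cases hji : j = i
      · subst hji
        refine ⟨fun x hx hmx => ?_, fun _ h3 => absurd hm (h3 y hyK)⟩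
        rw [huniq' x hx hmx]; exact h2
      · exact h1 j (by omega)
    · intro h1
      exact ⟨fun j hj => h1 j (by omega), (h1 i (by omega)).1 y hyK hm⟩
  · rw [e9, h.g, filter_lt_succ, if_neg, add_zero]
    simp only [Layout.forgotten, Finset.mem_filter, not_and]
    intro _ _ h3
    exact absurd hm (h3 y hyK)

omit hI hp hc in
theorem forgetBlock_spec (h0 : s.a .TR i = 0) (h1 : I.slot c i ≠ 0) (h2 : I.dg σ₂ i ≠ 0) :
    Spec E forgetBlock s fun s' => Merged I p c σ₁ σ₂ (i + 1) s' := by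
  have hnm : ∀ x < I.K, ¬ I.Matched p c i x := fun x hx hm => by
    have := ((hTR i hi).2 x hx).2 hm; omega
  have hmem : i ∈ I.forgotten p c σ₂ := by
    simp only [Layout.forgotten, Finset.mem_filter, Finset.mem_range]
    exact ⟨hi, h1, hnm, h2⟩
  have hB := hE.B8
  have hg : s.v .g + 2 ≤ E.B := by
    have hle : (I.forgotten p c σ₂).card ≤ I.K := by
      rw [← Finset.card_range I.K]
      refine Finset.card_le_card fun j hj => ?_
      simp only [Layout.forgotten, Finset.mem_filter] at hj
      exact hj.1
    have h3 := filter_lt_succ (I.forgotten p c σ₂) i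
    rw [if_pos hmem] at h3
    have h4 := Finset.card_filter_le (I.forgotten p c σ₂) (· < i + 1)
    have := hE.K_le_S; have := hE.S_le; have := h.g
    omega
  unfold forgetBlock
  simp only [spec_set_seq]
  simp only [Ex.ok_v, Ex.ok_c, Ex.ok_add, Ex.ev_v, Ex.ev_c, Ex.ev_add, true_and]
  refine ⟨⟨by omega, hg⟩, ?_⟩
  have hs' : SizeVars I (s.setv .g (s.v .g + 2)) := by
    refine ⟨?_, ?_, ?_, ?_⟩ <;> simp only [St.setv_v, reduceCtorEq, if_false]
    exacts [hs.K, hs.D, hs.S, hs.M1]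
  refine (findMatch_spec hE hs').seq fun s₁ hf₁ hfm => ?_
  simp only [St.setv_v, St.setv_a, reduceCtorEq, if_false, hj] at hfm
  have hfm' : s₁.v .f ≠ 0 ↔
      ∃ j2 < I.K, (∃ x < I.K, I.Matched p c j2 x) ∧ I.lb σ₂ j2 = I.lb σ₂ i := by
    rw [Ne, hfm, not_not]
    refine exists_congr fun j2 => and_congr_right fun hj2 => ?_
    rw [hL2 j2 hj2, hL2 i hi]
    refine and_congr_left fun _ => ?_
    obtain ⟨h5, h6⟩ := hTR j2 hj2
    constructor
    · intro h7
      exact ⟨s.a .TR j2 - 1, by omega, (h6 _ (by omega)).1 (by omega)⟩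
    · rintro ⟨x, hx, hm⟩
      rw [(h6 x hx).2 hm]; omega
  have e2 : s₁.a .D1 = s.a .D1 := hf₁.a _ rfl
  have e3 : s₁.a .L1 = s.a .L1 := hf₁.a _ rfl
  have e4 : s₁.v .g = s.v .g + 2 := by rw [hf₁.v _ rfl]; simp
  have e5 : s₁.v .ok = s.v .ok := by rw [hf₁.v _ rfl]; simp
  have key : ∀ s' : St, s'.a .D1 = s.a .D1 → s'.a .L1 = s.a .L1 → s'.v .g = s.v .g + 2 →
      (s'.v .ok ≠ 0 ↔ s.v .ok ≠ 0 ∧ s₁.v .f ≠ 0) → Merged I p c σ₁ σ₂ (i + 1) s' := by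
    intro s' k1 k2 k3 k4
    refine ⟨?_, ?_, by rw [k2]; exact h.L1_lt, ?_, ?_, ?_⟩
    · intro j hj x hx hm
      rw [k1]
      refine h.matched j ?_ x hx hm
      by_contra hc
      obtain rfl : j = i := by omega
      exact hnm x hx hm
    · intro x hx hm
      rw [k1]
      exact h.other x hx fun j hj => hm j (by omega)
    · rw [k2]
      refine h.lab.congr fun x y => and_congr_right fun hx => and_congr_right fun hy =>
        or_congr_right ?_
      constructor
      · rintro ⟨j, hj, h3⟩; exact ⟨j, by omega, h3⟩
      · rintro ⟨j, hj, j2, hj2, h3, h4⟩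
        refine ⟨j, ?_, j2, hj2, h3, h4⟩
        by_contra hc
        obtain rfl : j = i := by omega
        exact hnm x hx h3
    · rw [k4, h.ok, hfm']
      constructor
      · rintro ⟨h3, h4⟩ j hj
        by_cases hji : j = i
        · subst hji
          exact ⟨fun x hx hm => absurd hm (hnm x hx), fun _ _ _ => h4⟩
        · exact h3 j (by omega)
      · intro h3
        exact ⟨fun j hj => h3 j (by omega), (h3 i (by omega)).2 h1 hnm h2⟩
    · rw [k3, h.g, filter_lt_succ, if_pos hmem]; ring
  rw [spec_ite]
  refine ⟨trivial, ?_⟩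
  by_cases hf0 : s₁.v .f = 0
  · simp only [Ex.ev_v, hf0, if_true, spec_set]
    refine ⟨by simp, key _ ?_ ?_ ?_ ?_⟩ <;> simp [e2, e3, e4, hf0]
  · simp only [Ex.ev_v, hf0, if_false, spec_skip]
    exact key _ e2 e3 e4 (by rw [e5]; simp [hf0])

omit hE hI hs hp hc hj hD2 hL2 in
theorem Merged.skip (h0 : s.a .TR i = 0) (h1 : I.slot c i = 0 ∨ I.dg σ₂ i = 0) :
    Merged I p c σ₁ σ₂ (i + 1) s := by
  have hnm : ∀ x < I.K, ¬ I.Matched p c i x := fun x hx hm => by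
    have := ((hTR i hi).2 x hx).2 hm; omega
  refine ⟨?_, ?_, h.L1_lt, ?_, ?_, ?_⟩
  · intro j hj x hx hm
    refine h.matched j ?_ x hx hm
    by_contra hc
    obtain rfl : j = i := by omega
    exact hnm x hx hm
  · intro x hx hm
    exact h.other x hx fun j hj => hm j (by omega)
  · refine h.lab.congr fun x y => and_congr_right fun hx => and_congr_right fun hy =>
      or_congr_right ?_
    constructor
    · rintro ⟨j, hj, h3⟩; exact ⟨j, by omega, h3⟩
    · rintro ⟨j, hj, j2, hj2, h3, h4⟩
      refine ⟨j, ?_, j2, hj2, h3, h4⟩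
      by_contra hc
      obtain rfl : j = i := by omega
      exact hnm x hx h3
  · rw [h.ok]
    constructor
    · intro h3 j hj
      by_cases hji : j = i
      · subst hji
        refine ⟨fun x hx hm => absurd hm (hnm x hx), fun h4 _ h5 => ?_⟩
        rcases h1 with h1 | h1 <;> contradiction
      · exact h3 j (by omega)
    · exact fun h3 j hj => h3 j (by omega)
  · rw [h.g, filter_lt_succ, if_neg, add_zero]
    simp only [Layout.forgotten, Finset.mem_filter, not_and]
    intro _ h4 _ h5
    rcases h1 with h1 | h1 <;> contradiction

end

/-- Decodes the states `s1` and `s2` and merges them, if possible (`ok`). -/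
def mergeStates : Cmd :=
  decode .D1 .L1 .s1 ;; decode .D2 .L2 .s2 ;; .set .ok (.c 1) ;; .set .g (.c 0) ;; mergeLoop

theorem mergeStates_spec {E : Env} {I : Layout} (hE : Sizes E I) (hI : I.Valid) {p : ℕ}
    {s : St} (hs : SizeVars I s) (hp : p < I.M) (hc : s.v .c < I.M)
    (hSL : ∀ j < I.K, s.a .SL (s.v .c * I.K + j) = I.slot (s.v .c) j)
    (hTR : Translates I p (s.v .c) (s.a .TR)) :
    Spec E mergeStates s fun s' => Merged I p (s.v .c) (s.v .s1) (s.v .s2) I.K s' := by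
  have hB := hE.B8
  unfold mergeStates
  refine (decode_spec hE hs (by decide)).seq fun s₁ hf₁ h1 => ?_
  have hs₁ : SizeVars I s₁ := hs.of_frame hf₁ rfl rfl rfl rfl
  refine (decode_spec hE hs₁ (by decide)).seq fun s₂ hf₂ h2 => ?_
  have hs₂ : SizeVars I s₂ := hs₁.of_frame hf₂ rfl rfl rfl rfl
  simp only [spec_set_seq]
  refine ⟨by simp; omega, by simp, ?_⟩
  have e1 : s₁.v .s2 = s.v .s2 := hf₁.v _ rfl
  have e2 : s₂.v .c = s.v .c := (hf₂.v _ rfl).trans (hf₁.v _ rfl)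
  have e3 : s₂.a .D1 = s₁.a .D1 := hf₂.a _ rfl
  have e4 : s₂.a .L1 = s₁.a .L1 := hf₂.a _ rfl
  have e5 : s₂.a .TR = s.a .TR := (hf₂.a _ rfl).trans (hf₁.a _ rfl)
  have e6 : s₂.a .SL = s.a .SL := (hf₂.a _ rfl).trans (hf₁.a _ rfl)
  rw [e1] at h2
  unfold mergeLoop
  refine spec_for (fun i s' => Merged I p (s.v .c) (s.v .s1) (s.v .s2) i s') rfl ?_ ?_ ?_ ?_
  · simpa [hs₂.K] using hE.K_lim
  · refine ⟨by simp, ?_, ?_, ?_, by simp, by simp⟩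
    · intro x hx _
      simp only [St.setv_a, e3]
      exact (h1 x hx).1
    · intro x hx
      simp only [St.setv_a, e4]
      rw [(h1 x hx).2]
      exact Nat.mod_lt _ hE.K_pos
    · intro x hx y hy
      simp only [St.setv_a, e4]
      rw [(h1 x hx).2, (h1 y hy).2]
      constructor
      · intro h
        exact Relation.EqvGen.rel _ _ ⟨hx, hy, Or.inl h⟩
      · have heq : Equivalence fun x y => I.lb (s.v .s1) x = I.lb (s.v .s1) y :=
          ⟨fun _ => rfl, Eq.symm, Eq.trans⟩
        refine Layout.eqvGen_le heq fun x y hxy => ?_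
        obtain ⟨_, _, h | ⟨j, hj, _⟩⟩ := hxy
        · exact h
        · omega
  · intro i hi s' hf hj hm
    have hi' : i < I.K := by simpa [hs₂.K] using hi
    have f1 : s'.a .TR = s.a .TR := by rw [hf.a _ rfl]; simpa using e5
    have f2 : s'.a .SL = s.a .SL := by rw [hf.a _ rfl]; simpa using e6
    have f3 : s'.v .c = s.v .c := by rw [hf.v _ rfl]; simpa using e2
    have f4 : s'.a .D2 = s₂.a .D2 := by rw [hf.a _ rfl]; simp
    have f5 : s'.a .L2 = s₂.a .L2 := by rw [hf.a _ rfl]; simp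
    have hs' : SizeVars I s' := by
      refine ⟨?_, ?_, ?_, ?_⟩ <;> rw [hf.v _ rfl] <;> simp
      exacts [hs₂.K, hs₂.D, hs₂.S, hs₂.M1]
    have hTR' : Translates I p (s.v .c) (s'.a .TR) := by rw [f1]; exact hTR
    have hD2 : ∀ j < I.K, s'.a .D2 j = I.dg (s.v .s2) j := by rw [f4]; exact fun j hj => (h2 j hj).1
    have hL2 : ∀ j < I.K, s'.a .L2 j = I.lb (s.v .s2) j := by rw [f5]; exact fun j hj => (h2 j hj).2
    refine Spec.mono (R := fun s'' => Merged I p (s.v .c) (s.v .s1) (s.v .s2) (i + 1) s'') ?_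
      fun s'' _ h => ⟨h.matched, h.other, h.L1_lt, h.lab, by simpa using h.ok, by simpa using h.g⟩
    rw [spec_ite]
    refine ⟨trivial, ?_⟩
    simp only [Ex.ev_ld, Ex.ev_v, hj]
    split_ifs with h0
    · have hSL' : s'.a .SL (s'.v .c * s'.v .K + i) = I.slot (s.v .c) i := by
        rw [f2, f3, hs'.K]; exact hSL i hi'
      have hidx := hE.idx_K hc hi'
      rw [spec_ite]
      refine ⟨?_, ?_⟩
      · simp only [Ex.ok_ld, Ex.ok_v, Ex.ok_add, Ex.ok_mul, Ex.ev_mul, Ex.ev_v, true_and, f3, hs'.K, hj]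
        omega
      simp only [Ex.ev_ld, Ex.ev_v, Ex.ev_add, Ex.ev_mul, hj, hSL']
      split_ifs with h3
      · exact spec_skip.2 (hm.skip hi' hTR' h0 (Or.inl h3))
      · rw [spec_ite]
        refine ⟨trivial, ?_⟩
        simp only [Ex.ev_ld, Ex.ev_v, hj, hD2 i hi']
        split_ifs with h4
        · exact spec_skip.2 (hm.skip hi' hTR' h0 (Or.inr h4))
        · exact forgetBlock_spec hE hs' hi' hj hTR' hD2 hL2 hm h0 h3 h4
    · exact matchBlock_spec hE hI hs' hp hc hi' hj hTR' hD2 hL2 hm h0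
  · intro s' hf hj hm
    simpa [hs₂.K] using hm

theorem Merged.mergeOK_iff {I : Layout} {p c σ₁ σ₂ : ℕ} {s : St}
    (h : Merged I p c σ₁ σ₂ I.K s) : s.v .ok ≠ 0 ↔ I.MergeOK p c σ₁ σ₂ := by
  rw [h.ok]
  exact ⟨fun h => ⟨fun j hj => (h j hj).2, fun j hj => (h j hj).1⟩,
    fun h j hj => ⟨h.cap_le j hj, h.forget j hj⟩⟩

theorem Merged.g_eq {I : Layout} {p c σ₁ σ₂ : ℕ} {s : St}
    (h : Merged I p c σ₁ σ₂ I.K s) : s.v .g = 2 * (I.forgotten p c σ₂).card := by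
  rw [h.g, Finset.filter_true_of_mem]
  intro j hj
  simp only [Layout.forgotten, Finset.mem_filter, Finset.mem_range] at hj
  exact hj.1

/-- Admissible sums are at most three and thus are valid degree digits again; this is needed before
encoding. -/
theorem Merged.D1_lt {I : Layout} (hK : 0 < I.K) {p c σ₁ σ₂ : ℕ} {s : St}
    (h : Merged I p c σ₁ σ₂ I.K s) (hok : I.MergeOK p c σ₁ σ₂) {x : ℕ} (hx : x < I.K) :
    s.a .D1 x < 4 := by
  by_cases hm : ∀ j < I.K, ¬ I.Matched p c j x
  · rw [h.other x hx hm]; exact dg_lt hK _ _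
  · push Not at hm
    obtain ⟨j, hj, hm⟩ := hm
    rw [h.matched j hj x hx hm]
    have := hok.cap_le j hj x hx hm
    rw [Layout.cap] at this
    split_ifs at this <;> omega

theorem Merged.mergeRes {I : Layout} {p c σ₁ σ₂ : ℕ} {s : St}
    (h : Merged I p c σ₁ σ₂ I.K s) {σ : ℕ} (hσ : σ < I.S)
    (hdec : ∀ j < I.K, I.dg σ j = s.a .D1 j ∧ I.lb σ j = s.a .L1 j) :
    I.MergeRes p c σ₁ σ₂ σ := by
  refine ⟨hσ, fun j hj x hx hm => ?_, fun x hx hm => ?_, fun x hx y hy => ?_⟩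
  · rw [(hdec x hx).1, h.matched j hj x hx hm]
  · rw [(hdec x hx).1, h.other x hx hm]
  · rw [(hdec x hx).2, (hdec y hy).2]
    exact h.lab x hx y hy

end RAM

/-! ## The program: the tables -/

namespace RAM
open BinTree Cmd

/-- The table of the node `a` in the array `X`. -/
def tab (I : Layout) (X : Arr) (s : St) (a σ : ℕ) : ℕ := s.a X (a * I.S + σ)

theorem tab_congr {I : Layout} {X : Arr} {s s' : St} (h : s'.a X = s.a X) :
    tab I X s' = tab I X s := by
  funext a σ; rw [tab, tab, h]

/-- The merged tables after the pairs of states with `P` have been considered. -/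
structure Partial (I : Layout) (p c : ℕ) (Tp Tc : ℕ → ℕ) (P : ℕ → ℕ → Prop) (tmp c₁ c₂ : ℕ → ℕ) :
    Prop where
  sound : ∀ σ < I.S, tmp σ ≠ 0 → c₁ σ < I.S ∧ c₂ σ < I.S ∧ Tp (c₁ σ) ≠ 0 ∧ Tc (c₂ σ) ≠ 0 ∧
    I.MergeOK p c (c₁ σ) (c₂ σ) ∧ I.MergeRes p c (c₁ σ) (c₂ σ) σ ∧
    tmp σ - 1 = (Tp (c₁ σ) - 1) + (Tc (c₂ σ) - 1) + 2 * (I.forgotten p c (c₂ σ)).card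
  complete : ∀ a < I.S, ∀ b < I.S, P a b → Tp a ≠ 0 → Tc b ≠ 0 → I.MergeOK p c a b →
    ∃ σ, I.MergeRes p c a b σ ∧ tmp σ ≠ 0 ∧
      (Tp a - 1) + (Tc b - 1) + 2 * (I.forgotten p c b).card ≤ tmp σ - 1

theorem Partial.mono {I : Layout} {p c : ℕ} {Tp Tc : ℕ → ℕ} {P P' : ℕ → ℕ → Prop}
    {tmp c₁ c₂ : ℕ → ℕ} (h : Partial I p c Tp Tc P tmp c₁ c₂)
    (hP : ∀ a < I.S, ∀ b < I.S, P' a b → P a b ∨ Tp a = 0 ∨ Tc b = 0 ∨ ¬ I.MergeOK p c a b) :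
    Partial I p c Tp Tc P' tmp c₁ c₂ := by
  refine ⟨h.sound, fun a ha b hb hab h1 h2 h3 => h.complete a ha b hb ?_ h1 h2 h3⟩
  rcases hP a ha b hb hab with h | h | h | h
  · exact h
  all_goals contradiction

/-- A table keeps the best candidate for each state, and entries only grow, so earlier pairs remain
dominated. The candidate carries `- 1` because the sum of two entries contains the shift by one
twice. -/
theorem Partial.step {I : Layout} {p c : ℕ} {Tp Tc : ℕ → ℕ} {P : ℕ → ℕ → Prop}
    {tmp c₁ c₂ tmp' c₁' c₂' : ℕ → ℕ} (h : Partial I p c Tp Tc P tmp c₁ c₂) {a b σ : ℕ}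
    (ha : a < I.S) (hb : b < I.S) (hTa : Tp a ≠ 0) (hTb : Tc b ≠ 0) (hok : I.MergeOK p c a b)
    (hr : I.MergeRes p c a b σ)
    (hlt : tmp σ < Tp a + Tc b + 2 * (I.forgotten p c b).card - 1 →
      tmp' σ = Tp a + Tc b + 2 * (I.forgotten p c b).card - 1 ∧ c₁' σ = a ∧ c₂' σ = b)
    (hge : ¬ tmp σ < Tp a + Tc b + 2 * (I.forgotten p c b).card - 1 →
      tmp' σ = tmp σ ∧ c₁' σ = c₁ σ ∧ c₂' σ = c₂ σ)
    (hne : ∀ σ' < I.S, σ' ≠ σ → tmp' σ' = tmp σ' ∧ c₁' σ' = c₁ σ' ∧ c₂' σ' = c₂ σ') :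
    Partial I p c Tp Tc (fun x y => P x y ∨ (x = a ∧ y = b)) tmp' c₁' c₂' := by
  set val := Tp a + Tc b + 2 * (I.forgotten p c b).card - 1 with hval
  have hle : ∀ σ' < I.S, tmp σ' ≤ tmp' σ' := by
    intro σ' hσ'
    by_cases hs : σ' = σ
    · subst hs
      by_cases hv : tmp σ' < val
      · rw [(hlt hv).1]; omega
      · rw [(hge hv).1]
    · rw [(hne σ' hσ' hs).1]
  refine ⟨fun σ' hσ' => ?_, fun x hx y hy hxy k1 k2 k3 => ?_⟩
  · by_cases hs : σ' = σ
    · subst hs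
      by_cases hv : tmp σ' < val
      · obtain ⟨h1, h2, h3⟩ := hlt hv
        rw [h1, h2, h3]
        exact fun _ => ⟨ha, hb, hTa, hTb, hok, hr, by omega⟩
      · obtain ⟨h1, h2, h3⟩ := hge hv
        rw [h1, h2, h3]; exact h.sound _ hσ'
    · obtain ⟨h1, h2, h3⟩ := hne σ' hσ' hs
      rw [h1, h2, h3]; exact h.sound _ hσ'
  · rcases hxy with hxy | ⟨rfl, rfl⟩
    · obtain ⟨σ', hr', h0, h1⟩ := h.complete x hx y hy hxy k1 k2 k3
      have := hle σ' hr'.lt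
      exact ⟨σ', hr', by omega, by omega⟩
    · refine ⟨σ, hr, ?_⟩
      by_cases hv : tmp σ < val
      · rw [(hlt hv).1]; omega
      · rw [(hge hv).1]; omega

/-- Considers the pair of the states `s1` of `p` and `s2` of `c`. -/
def mergePair : Cmd :=
  mergeStates ;; .ite (.v .ok) (encode ;;
    .set .val (.ld .T (.v .p * .v .S + .v .s1) + .ld .T (.v .c * .v .S + .v .s2) + .v .g - .c 1) ;;
    .ite (.lt (.ld .TMP (.v .s)) (.v .val)) (.st .TMP (.v .s) (.v .val) ;;
      .st .C1 (.v .c * .v .S + .v .s) (.v .s1) ;; .st .C2 (.v .c * .v .S + .v .s) (.v .s2)) .skip)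
    .skip

def mergePairs : Cmd :=
  .for_ .s1 .S (.ite (.ld .T (.v .p * .v .S + .v .s1))
    (.for_ .s2 .S (.ite (.ld .T (.v .c * .v .S + .v .s2)) mergePair .skip)) .skip)

/-- The situation in the loops over the pairs of states. -/
structure Pairing (I : Layout) (p c : ℕ) (s : St) : Prop where
  vars : SizeVars I s
  p_eq : s.v .p = p
  c_eq : s.v .c = c
  SL : ∀ j < I.K, s.a .SL (c * I.K + j) = I.slot c j
  TR : Translates I p c (s.a .TR)

/-- The rows of the tables of choices other than `c` are equal. -/
def RowsEq (I : Layout) (c : ℕ) (s s' : St) : Prop :=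
  ∀ a ≠ c, ∀ σ < I.S, tab I .C1 s' a σ = tab I .C1 s a σ ∧ tab I .C2 s' a σ = tab I .C2 s a σ

theorem RowsEq.trans {I : Layout} {c : ℕ} {s s' s'' : St} (h : RowsEq I c s s')
    (h' : RowsEq I c s' s'') : RowsEq I c s s'' := fun a ha σ hσ =>
  ⟨(h' a ha σ hσ).1.trans (h a ha σ hσ).1, (h' a ha σ hσ).2.trans (h a ha σ hσ).2⟩

theorem RowsEq.of_eq {I : Layout} {c : ℕ} {s s' : St} (h1 : s'.a .C1 = s.a .C1)
    (h2 : s'.a .C2 = s.a .C2) : RowsEq I c s s' := fun a _ σ _ => by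
  rw [tab_congr h1, tab_congr h2]; exact ⟨rfl, rfl⟩

section
variable {E : Env} {I : Layout} (hE : Sizes E I) (hI : I.Valid) {p c : ℕ} (hp : p < I.M)
  (hc : c < I.M)
include hE hI hp hc

theorem mergePair_spec {s : St} (hs : Pairing I p c s) {a b : ℕ} (h1 : s.v .s1 = a)
    (h2 : s.v .s2 = b) (ha : a < I.S) (hb : b < I.S) (hTa : tab I .T s p a ≠ 0)
    (hTb : tab I .T s c b ≠ 0) (hB : tab I .T s p a + tab I .T s c b + 2 * I.K ≤ E.B)
    {P : ℕ → ℕ → Prop}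
    (h : Partial I p c (tab I .T s p) (tab I .T s c) P (s.a .TMP) (tab I .C1 s c) (tab I .C2 s c)) :
    Spec E mergePair s fun s' => Partial I p c (tab I .T s p) (tab I .T s c)
      (fun x y => P x y ∨ (x = a ∧ y = b)) (s'.a .TMP) (tab I .C1 s' c) (tab I .C2 s' c) ∧
      RowsEq I c s s' := by
  have hSL := hs.SL; have hTR := hs.TR
  rw [← hs.c_eq] at hSL hTR
  have hB8 := hE.B8
  unfold mergePair
  refine (mergeStates_spec hE hI hs.vars hp (by rw [hs.c_eq]; exact hc) hSL hTR).seq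
    fun s₁ hf₁ hm => ?_
  rw [hs.c_eq, h1, h2] at hm
  have t1 : s₁.a .TMP = s.a .TMP := hf₁.a _ rfl
  have t2 : s₁.a .C1 = s.a .C1 := hf₁.a _ rfl
  have t3 : s₁.a .C2 = s.a .C2 := hf₁.a _ rfl
  have hs₁ : SizeVars I s₁ := hs.vars.of_frame hf₁ rfl rfl rfl rfl
  rw [spec_ite]
  refine ⟨trivial, ?_⟩
  rw [Ex.ev_v]
  by_cases hok : s₁.v .ok = 0
  · rw [if_pos hok]
    have hno : ¬ I.MergeOK p c a b := by rw [← hm.mergeOK_iff]; exact not_not.2 hok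
    rw [spec_skip, t1, tab_congr t2, tab_congr t3]
    refine ⟨h.mono ?_, RowsEq.of_eq t2 t3⟩
    rintro x _ y _ (h | ⟨rfl, rfl⟩)
    · exact Or.inl h
    · exact Or.inr (Or.inr (Or.inr hno))
  rw [if_neg hok]
  have hOK := hm.mergeOK_iff.1 hok
  refine (encode_spec hE hs₁ (fun j hj => hm.D1_lt hE.K_pos hOK hj) hm.L1_lt).seq
    fun s₂ hf₂ ⟨hlt, hdec⟩ => ?_
  have hr := hm.mergeRes hlt hdec
  set σ := s₂.v .s with hσ
  have u1 : s₂.a .TMP = s.a .TMP := (hf₂.a _ rfl).trans t1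
  have u2 : s₂.a .C1 = s.a .C1 := (hf₂.a _ rfl).trans t2
  have u3 : s₂.a .C2 = s.a .C2 := (hf₂.a _ rfl).trans t3
  have u4 : s₂.a .T = s.a .T := (hf₂.a _ rfl).trans (hf₁.a _ rfl)
  have v1 : s₂.v .p = p := ((hf₂.v _ rfl).trans (hf₁.v _ rfl)).trans hs.p_eq
  have v2 : s₂.v .c = c := ((hf₂.v _ rfl).trans (hf₁.v _ rfl)).trans hs.c_eq
  have v3 : s₂.v .s1 = a := ((hf₂.v _ rfl).trans (hf₁.v _ rfl)).trans h1
  have v4 : s₂.v .s2 = b := ((hf₂.v _ rfl).trans (hf₁.v _ rfl)).trans h2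
  have v5 : s₂.v .S = I.S := ((hf₂.v _ rfl).trans (hf₁.v _ rfl)).trans hs.vars.S
  have v6 : s₂.v .g = 2 * (I.forgotten p c b).card := (hf₂.v _ rfl).trans hm.g_eq
  have hcard : (I.forgotten p c b).card ≤ I.K := by
    rw [← Finset.card_range I.K]
    refine Finset.card_le_card fun j hj => ?_
    simp only [Layout.forgotten, Finset.mem_filter] at hj
    exact hj.1
  have i1 := hE.idx_S hp ha
  have i2 := hE.idx_S hc hb
  have i3 := hE.idx_S hc hlt
  have w1 : s.a .T (p * I.S + a) = tab I .T s p a := rfl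
  have w2 : s.a .T (c * I.S + b) = tab I .T s c b := rfl
  rw [spec_set_seq]
  simp only [Ex.ok_ld, Ex.ok_v, Ex.ok_sub, Ex.ok_c, Ex.ok_add, Ex.ok_mul, Ex.ev_ld, Ex.ev_v,
    Ex.ev_sub, Ex.ev_c, Ex.ev_add, Ex.ev_mul, v1, v2, v3, v4, v5, v6, u4, w1, w2, true_and]
  refine ⟨by omega, ?_⟩
  rw [spec_ite]
  refine ⟨by simp, ?_⟩
  set val := tab I .T s p a + tab I .T s c b + 2 * (I.forgotten p c b).card - 1 with hval
  simp only [Ex.ev_lt, Ex.ev_ld, Ex.ev_v, St.setv_v, St.setv_a, reduceCtorEq, if_true, if_false,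
    ← hσ, u1]
  by_cases hlt' : s.a .TMP σ < val
  · simp only [hlt', if_true, one_ne_zero, if_false, spec_st_seq, spec_st, Ex.ok_v,
      Ex.ok_add, Ex.ok_mul, Ex.ev_v, Ex.ev_add, Ex.ev_mul, true_and, and_true, St.setv_v, St.seta_v,
      reduceCtorEq, v2, v3, v4, v5, ← hσ]
    refine ⟨by omega, by omega, ?_, ?_⟩
    · refine h.step ha hb hTa hTb hOK hr ?_ (fun h => absurd hlt' h) ?_
      · intro _
        simp [tab]
        exact hval
      · intro σ' hσ' hne
        have hne' : c * I.S + σ' ≠ c * I.S + σ := by omega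
        simp [tab, u1, u2, u3, Function.update_of_ne hne, Function.update_of_ne hne']
    · intro a' ha' σ' hσ'
      have hne : a' * I.S + σ' ≠ c * I.S + σ := fun h => ha' (idx_inj hσ' hlt h).1
      simp [tab, u2, u3, Function.update_of_ne hne]
  · simp only [hlt', if_false, if_true, spec_skip, St.setv_a, u1]
    rw [show tab I .C1 (s₂.setv .val val) = _ from tab_congr u2,
      show tab I .C2 (s₂.setv .val val) = _ from tab_congr u3]
    exact ⟨h.step ha hb hTa hTb hOK hr (fun h => absurd h hlt') (fun _ => ⟨rfl, rfl, rfl⟩)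
      fun _ _ _ => ⟨rfl, rfl, rfl⟩, RowsEq.of_eq u2 u3⟩

theorem Pairing.of_frame {s s' : St} (hs : Pairing I p c s) (hK : s'.v .K = s.v .K)
    (hD : s'.v .D = s.v .D) (hS : s'.v .S = s.v .S) (hM : s'.v .M1 = s.v .M1) (hp : s'.v .p = s.v .p)
    (hc : s'.v .c = s.v .c) (hSL : s'.a .SL = s.a .SL) (hTR : s'.a .TR = s.a .TR) :
    Pairing I p c s' :=
  ⟨⟨hK.trans hs.vars.K, hD.trans hs.vars.D, hS.trans hs.vars.S, hM.trans hs.vars.M1⟩,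
    hp.trans hs.p_eq, hc.trans hs.c_eq, by rw [hSL]; exact hs.SL, by rw [hTR]; exact hs.TR⟩

theorem mergePairs_spec {s : St} (hs : Pairing I p c s)
    (hB : ∀ a < I.S, ∀ b < I.S, tab I .T s p a + tab I .T s c b + 2 * I.K ≤ E.B)
    (h0 : ∀ σ < I.S, s.a .TMP σ = 0) :
    Spec E mergePairs s fun s' => Partial I p c (tab I .T s p) (tab I .T s c)
      (fun _ _ => True) (s'.a .TMP) (tab I .C1 s' c) (tab I .C2 s' c) ∧ RowsEq I c s s' := by
  unfold mergePairs
  refine spec_for (fun i s' => Partial I p c (tab I .T s p) (tab I .T s c)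
    (fun x _ => x < i) (s'.a .TMP) (tab I .C1 s' c) (tab I .C2 s' c) ∧ RowsEq I c s s')
    rfl ?_ ?_ ?_ ?_
  · rw [hs.vars.S]; exact hE.S_lim
  · refine ⟨⟨fun σ hσ h => absurd (h0 σ hσ) h, fun a _ b _ h => absurd h (by omega)⟩,
      RowsEq.of_eq rfl rfl⟩
  · intro i hi s₁ hf₁ hx₁ ⟨hP, hrow⟩
    rw [hs.vars.S] at hi
    have hs₁ : Pairing I p c s₁ := hs.of_frame hE hI hp hc (hf₁.v _ rfl) (hf₁.v _ rfl) (hf₁.v _ rfl)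
      (hf₁.v _ rfl) (hf₁.v _ rfl) (hf₁.v _ rfl) (hf₁.a _ rfl) (hf₁.a _ rfl)
    have hT₁ : s₁.a .T = s.a .T := hf₁.a _ rfl
    have i1 := hE.idx_S hp hi
    have w1 : s.a .T (p * I.S + i) = tab I .T s p i := rfl
    rw [spec_ite]
    simp only [Ex.ok_ld, Ex.ok_v, Ex.ok_add, Ex.ok_mul, Ex.ev_ld, Ex.ev_v, Ex.ev_add, Ex.ev_mul,
      hs₁.p_eq, hs₁.vars.S, hx₁, hT₁, w1, true_and]
    refine ⟨by omega, ?_⟩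
    split_ifs with hz
    · refine spec_skip.2 ⟨hP.mono ?_, hrow⟩
      intro x _ y _ hx
      by_cases hxi : x = i
      · subst hxi; exact Or.inr (Or.inl hz)
      · exact Or.inl (by omega)
    -- Inside the second loop the pairs considered so far are those lexicographically below `(i,
    -- k)`.
    refine spec_for (fun k s' => Partial I p c (tab I .T s p) (tab I .T s c)
      (fun x y => x < i ∨ (x = i ∧ y < k)) (s'.a .TMP) (tab I .C1 s' c) (tab I .C2 s' c) ∧
      RowsEq I c s s') rfl ?_ ?_ ?_ ?_
    · rw [hs₁.vars.S]; exact hE.S_lim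
    · exact ⟨hP.mono fun x _ y _ h => Or.inl (by omega), hrow⟩
    · intro k hk s₂ hf₂ hx₂ ⟨hP₂, hrow₂⟩
      rw [hs₁.vars.S] at hk
      have hs₂ : Pairing I p c s₂ := hs₁.of_frame hE hI hp hc (hf₂.v _ rfl) (hf₂.v _ rfl)
        (hf₂.v _ rfl) (hf₂.v _ rfl) (hf₂.v _ rfl) (hf₂.v _ rfl) (hf₂.a _ rfl) (hf₂.a _ rfl)
      have hT₂ : s₂.a .T = s.a .T := (hf₂.a _ rfl).trans hT₁
      have i2 := hE.idx_S hc hk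
      have w2 : s.a .T (c * I.S + k) = tab I .T s c k := rfl
      rw [spec_ite]
      simp only [Ex.ok_ld, Ex.ok_v, Ex.ok_add, Ex.ok_mul, Ex.ev_ld, Ex.ev_v, Ex.ev_add, Ex.ev_mul,
        hs₂.c_eq, hs₂.vars.S, hx₂, hT₂, w2, true_and]
      refine ⟨by omega, ?_⟩
      have hP' : ∀ x y, (x < i ∨ x = i ∧ y < k + 1) → (x < i ∨ x = i ∧ y < k) ∨ (x = i ∧ y = k) := by
        omega
      split_ifs with hz₂
      · refine spec_skip.2 ⟨hP₂.mono ?_, hrow₂⟩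
        intro x _ y _ hxy
        rcases hP' x y hxy with h | ⟨rfl, rfl⟩
        · exact Or.inl h
        · exact Or.inr (Or.inr (Or.inl hz₂))
      have e1 : tab I .T s₂ = tab I .T s := tab_congr hT₂
      refine (mergePair_spec hE hI hp hc hs₂ (a := i) (b := k) ((hf₂.v _ rfl).trans hx₁) hx₂ hi hk
        (by rw [e1]; exact hz) (by rw [e1]; exact hz₂) (by rw [e1]; exact hB i hi k hk)
        (by rw [e1]; exact hP₂)).mono ?_
      rintro s₃ hf₃ ⟨hP₃, hrow₃⟩
      rw [e1] at hP₃
      exact ⟨hP₃.mono fun x _ y _ h => Or.inl (hP' x y h), hrow₂.trans hrow₃⟩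
    · rintro s₂ hf₂ hx₂ ⟨hP₂, hrow₂⟩
      rw [hs₁.vars.S] at hP₂
      refine ⟨hP₂.mono fun x _ y hy h => Or.inl (by omega), hrow₂⟩
  · rintro s' hf hx ⟨hP, hrow⟩
    rw [hs.vars.S] at hP
    exact ⟨hP.mono fun x hx y _ _ => Or.inl hx, hrow⟩

end

/-- Computes the correspondence of the positions of `c` and `p`. -/
def translate : Cmd :=
  .for_ .j .K (.st .TR (.v .j) (.c 0) ;; .ite (.ld .SL (.v .c * .v .K + .v .j))
    (.for_ .l .K (.ite (.eq (.ld .SL (.v .p * .v .K + .v .l)) (.ld .SL (.v .c * .v .K + .v .j)))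
      (.st .TR (.v .j) (.v .l + .c 1)) .skip)) .skip)

theorem translate_spec {E : Env} {I : Layout} (hE : Sizes E I) (hI : I.Valid) {p c : ℕ} {s : St}
    (hs : SizeVars I s) (hp : p < I.M) (hc : c < I.M) (hpv : s.v .p = p) (hcv : s.v .c = c)
    (hSLp : ∀ j < I.K, s.a .SL (p * I.K + j) = I.slot p j)
    (hSLc : ∀ j < I.K, s.a .SL (c * I.K + j) = I.slot c j) :
    Spec E translate s fun s' => Translates I p c (s'.a .TR) := by
  have hB := hE.B8
  have hKB : I.K + 1 ≤ E.B := by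
    have := hE.K_le_S; have := hE.S_le; have := hE.K_pos; omega
  unfold translate
  refine spec_for (fun i s' => ∀ j < i, s'.a .TR j ≤ I.K ∧
    ∀ x < I.K, s'.a .TR j = x + 1 ↔ I.Matched p c j x) rfl ?_ ?_ ?_ ?_
  · rw [hs.K]; exact hE.K_lim
  · intro j hj; omega
  · intro i hi s₁ hf₁ hx₁ hT
    rw [hs.K] at hi
    have e1 : s₁.a .SL = s.a .SL := hf₁.a _ rfl
    have e2 : s₁.v .c = c := (hf₁.v _ rfl).trans hcv
    have e3 : s₁.v .p = p := (hf₁.v _ rfl).trans hpv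
    have e4 : s₁.v .K = I.K := (hf₁.v _ rfl).trans hs.K
    have i1 := hE.idx_K hc hi
    simp only [spec_st_seq, spec_ite, Ex.ok_ld, Ex.ok_v, Ex.ok_add, Ex.ok_mul, Ex.ok_c, Ex.ev_ld,
      Ex.ev_v, Ex.ev_add, Ex.ev_mul, Ex.ev_c, St.seta_v, St.seta_a, reduceCtorEq, if_false, e1, e2,
      e4, hx₁, hSLc i hi, true_and]
    refine ⟨by omega, by omega, ?_⟩
    have hother : ∀ s' : St, (∀ j ≠ i, s'.a .TR j = s₁.a .TR j) → (s'.a .TR i ≤ I.K ∧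
        ∀ x < I.K, s'.a .TR i = x + 1 ↔ I.Matched p c i x) → ∀ j < i + 1, s'.a .TR j ≤ I.K ∧
        ∀ x < I.K, s'.a .TR j = x + 1 ↔ I.Matched p c j x := by
      intro s' h1 h2 j hj
      by_cases hji : j = i
      · subst hji; exact h2
      · rw [h1 j hji]; exact hT j (by omega)
    split_ifs with hz
    · rw [spec_skip]
      refine hother _ (fun j hj => by simp [Function.update_of_ne hj]) ?_
      simp only [St.setv_a, St.seta_a, if_true, Function.update_self]
      refine ⟨by omega, fun x _ => ⟨fun h => by omega, fun h => absurd hz h.1⟩⟩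
    refine spec_for (fun k s' => (∀ j ≠ i, s'.a .TR j = s₁.a .TR j) ∧ s'.a .TR i ≤ I.K ∧
      (s'.a .TR i ≠ 0 → I.Matched p c i (s'.a .TR i - 1)) ∧
      ∀ x < k, I.Matched p c i x → s'.a .TR i = x + 1) rfl ?_ ?_ ?_ ?_
    · simp only [St.seta_v, e4]; exact hE.K_lim
    · refine ⟨fun j hj => by simp [Function.update_of_ne hj], ?_⟩
      simp
    · intro k hk s₂ hf₂ hx₂ ⟨k1, k2, k3, k4⟩
      simp only [St.seta_v, e4] at hk
      have g1 : s₂.a .SL = s.a .SL := by rw [hf₂.a _ rfl]; simpa using e1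
      have g2 : s₂.v .c = c := by rw [hf₂.v _ rfl]; simpa using e2
      have g3 : s₂.v .p = p := by rw [hf₂.v _ rfl]; simpa using e3
      have g4 : s₂.v .K = I.K := by rw [hf₂.v _ rfl]; simpa using e4
      have g5 : s₂.v .j = i := by rw [hf₂.v _ rfl]; simpa using hx₁
      have i2 := hE.idx_K hp hk
      simp only [spec_ite, spec_st, spec_skip, Ex.ok_ld, Ex.ok_v, Ex.ok_add, Ex.ok_mul, Ex.ok_c, Ex.ok_eq, Ex.ev_eq, Ex.ev_ld,
        Ex.ev_v, Ex.ev_add, Ex.ev_mul, Ex.ev_c, g1, g2, g3, g4, g5, hx₂, hSLc i hi, hSLp k hk,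
        true_and]
      refine ⟨by omega, ?_⟩
      by_cases heq : I.slot p k = I.slot c i
      · simp only [heq, if_true, one_ne_zero, if_false]
        refine ⟨by omega, fun j hj => ?_, ?_⟩
        · simpa [Function.update_of_ne hj] using k1 j hj
        simp only [St.setv_a, St.seta_a, if_true, Function.update_self]
        refine ⟨by omega, fun _ => ⟨hz, heq⟩, fun x hx hm => ?_⟩
        rw [hI.slot_inj p hp x (by omega) k hk (by rw [hm.2]; exact hz) (by rw [hm.2, heq])]
      · simp only [heq, if_true, if_false]
        refine ⟨k1, k2, k3, fun x hx hm => ?_⟩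
        refine k4 x ?_ hm
        by_contra hc
        obtain rfl : x = k := by omega
        exact heq hm.2
    · intro s₂ hf₂ hx₂ ⟨k1, k2, k3, k4⟩
      simp only [St.seta_v, e4] at k4
      refine hother _ (fun j hj => by simpa using k1 j hj) ?_
      simp only [St.setv_a]
      refine ⟨k2, fun x hx => ⟨fun h => ?_, fun h => k4 x hx h⟩⟩
      have := k3 (by omega)
      rwa [h, Nat.add_sub_cancel] at this
  · intro s' hf hx h
    rwa [hs.K] at h

/-- Merges the table of `c` into that of its parent. -/
def mergeNode : Cmd :=
  -- The result is collected in `TMP`, because the old table of the parent is read until the last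
  -- pair has been considered.
  .set .p (.ld .PAR (.v .c)) ;; translate ;; .for_ .s .S (.st .TMP (.v .s) (.c 0)) ;; mergePairs ;;
    .for_ .s .S (.st .T (.v .p * .v .S + .v .s) (.ld .TMP (.v .s)))

/-- The arrays hold the layout `I`. -/
structure Holds (I : Layout) (s : St) : Prop where
  SL : ∀ a < I.M, ∀ j < I.K, s.a .SL (a * I.K + j) = I.slot a j
  PAR : ∀ c, 0 < c → c < I.M → s.a .PAR c = I.par c
  TY : ∀ a < I.M, s.a .TY a = I.ty a

theorem Holds.of_frame {I : Layout} {s s' : St} {p : Cmd} (h : Holds I s) (hf : p.Frame s s')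
    (h1 : p.modsA .SL = false) (h2 : p.modsA .PAR = false) (h3 : p.modsA .TY = false) :
    Holds I s' :=
  ⟨by rw [hf.a _ h1]; exact h.SL, by rw [hf.a _ h2]; exact h.PAR, by rw [hf.a _ h3]; exact h.TY⟩

theorem mergeNode_spec {E : Env} {I : Layout} (hE : Sizes E I) (hI : I.Valid) {c : ℕ} {s : St}
    (hs : SizeVars I s) (hh : Holds I s) (hc0 : 0 < c) (hc : c < I.M) (hcv : s.v .c = c)
    (hB : ∀ a < I.S, ∀ b < I.S, tab I .T s (I.par c) a + tab I .T s c b + 2 * I.K ≤ E.B) :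
    Spec E mergeNode s fun s' =>
      I.Step c (tab I .T s) (tab I .T s') (tab I .C1 s') (tab I .C2 s') ∧ RowsEq I c s s' := by
  have hpM : I.par c < I.M := (hI.par_lt c hc0 hc).trans hc
  set p := I.par c with hp
  have h0 : 0 ≤ E.B := Nat.zero_le _
  unfold mergeNode
  rw [spec_set_seq]
  simp only [Ex.ok_ld, Ex.ok_v, Ex.ev_ld, Ex.ev_v, hcv, hh.PAR c hc0 hc, ← hp, true_and]
  have hs₀ : SizeVars I (s.setv .p p) := by
    refine ⟨?_, ?_, ?_, ?_⟩ <;> simp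
    exacts [hs.K, hs.D, hs.S, hs.M1]
  refine (translate_spec hE hI hs₀ hpM hc (by simp) (by simpa using hcv)
    (by simpa using hh.SL p hpM) (by simpa using hh.SL c hc)).seq fun s₁ hf₁ hTR => ?_
  have hs₁ : SizeVars I s₁ := hs₀.of_frame hf₁ rfl rfl rfl rfl
  refine Spec.seq (R := fun s' => ∀ σ < I.S, s'.a .TMP σ = 0) ?_ ?_
  · refine spec_for (fun i s' => ∀ σ < i, s'.a .TMP σ = 0) rfl ?_ ?_ ?_ ?_
    · rw [hs₁.S]; exact hE.S_lim
    · intro σ h; omega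
    · intro i hi s' hf hx h
      simp only [spec_st, Ex.ok_v, Ex.ok_c, Ex.ev_v, Ex.ev_c, hx, true_and]
      refine ⟨h0, fun σ hσ => ?_⟩
      simp only [St.setv_a, St.seta_a, if_true]
      by_cases hσi : σ = i
      · subst hσi; simp
      · rw [Function.update_of_ne hσi]; exact h σ (by omega)
    · intro s' hf hx h
      rwa [hs₁.S] at h
  intro s₂ hf₂ hz
  have hs₂ : SizeVars I s₂ := hs₁.of_frame hf₂ rfl rfl rfl rfl
  have v1 : s₂.v .p = p := by rw [hf₂.v _ rfl, hf₁.v _ rfl]; simp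
  have v2 : s₂.v .c = c := by rw [hf₂.v _ rfl, hf₁.v _ rfl]; simpa using hcv
  have u1 : s₂.a .SL = s.a .SL := by rw [hf₂.a _ rfl, hf₁.a _ rfl]; simp
  have u2 : s₂.a .TR = s₁.a .TR := by rw [hf₂.a _ rfl]
  have u3 : s₂.a .T = s.a .T := by rw [hf₂.a _ rfl, hf₁.a _ rfl]; simp
  have u4 : s₂.a .C1 = s.a .C1 := by rw [hf₂.a _ rfl, hf₁.a _ rfl]; simp
  have u5 : s₂.a .C2 = s.a .C2 := by rw [hf₂.a _ rfl, hf₁.a _ rfl]; simp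
  have e1 : tab I .T s₂ = tab I .T s := tab_congr u3
  refine (mergePairs_spec hE hI hpM hc ⟨hs₂, v1, v2, by rw [u1]; exact hh.SL c hc,
    by rw [u2]; exact hTR⟩ (by rw [e1]; exact hB) hz).seq fun s₃ hf₃ ⟨hP, hrow⟩ => ?_
  rw [e1] at hP
  have hs₃ : SizeVars I s₃ := hs₂.of_frame hf₃ rfl rfl rfl rfl
  have v3 : s₃.v .p = p := (hf₃.v _ rfl).trans v1
  have u6 : s₃.a .T = s.a .T := (hf₃.a _ rfl).trans u3
  refine spec_for (fun i s' => (∀ a ≠ p, ∀ σ < I.S, tab I .T s' a σ = tab I .T s a σ) ∧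
    ∀ σ < i, tab I .T s' p σ = s₃.a .TMP σ) rfl ?_ ?_ ?_ ?_
  · rw [hs₃.S]; exact hE.S_lim
  · exact ⟨fun a _ σ _ => by rw [tab, tab, St.setv_a, u6], fun σ h => absurd h (by omega)⟩
  · intro i hi s' hf hx ⟨h1, h2⟩
    rw [hs₃.S] at hi
    have w1 : s'.v .p = p := (hf.v _ rfl).trans v3
    have w2 : s'.v .S = I.S := (hf.v _ rfl).trans hs₃.S
    have w3 : s'.a .TMP = s₃.a .TMP := hf.a _ rfl
    have i1 := hE.idx_S hpM hi
    simp only [spec_st, Ex.ok_v, Ex.ok_ld, Ex.ok_add, Ex.ok_mul, Ex.ev_v, Ex.ev_add, Ex.ev_mul,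
      Ex.ev_ld, hx, w1, w2, w3, true_and, and_true]
    refine ⟨by omega, fun a ha σ hσ => ?_, fun σ hσ => ?_⟩
    · have hne : a * I.S + σ ≠ p * I.S + i := fun h => ha (idx_inj hσ hi h).1
      rw [← h1 a ha σ hσ]
      simp [tab, Function.update_of_ne hne]
    · by_cases hσi : σ = i
      · subst hσi; simp [tab]
      · have hne : p * I.S + σ ≠ p * I.S + i := by omega
        rw [← h2 σ (by omega)]
        simp [tab, Function.update_of_ne hne]
  · intro s' hf hx ⟨h1, h2⟩
    rw [hs₃.S] at h2
    have w1 : s'.a .C1 = s₃.a .C1 := hf.a _ rfl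
    have w2 : s'.a .C2 = s₃.a .C2 := hf.a _ rfl
    have e2 := tab_congr (I := I) w1
    have e3 := tab_congr (I := I) w2
    refine ⟨⟨fun i _ hip σ hσ => h1 i hip σ hσ, ?_, ?_⟩,
      ((RowsEq.of_eq u4 u5).trans hrow).trans (RowsEq.of_eq w1 w2)⟩
    · intro σ hσ
      rw [← hp, h2 σ hσ, e2, e3]
      exact hP.sound σ hσ
    · intro a ha b hb hTa hTb hok
      obtain ⟨σ, hr, h3⟩ := hP.complete a ha b hb trivial hTa hTb hok
      rw [← h2 σ hr.lt] at h3
      exact ⟨σ, hr, h3⟩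

end RAM

/-! ## The program: all merges -/

namespace RAM
open BinTree Cmd

/-- Computes the codes of the states of the nodes before all merges. -/
def initCodes : Cmd :=
  .for_ .t .K (.for_ .j .K (.st .D1 (.v .j) (.eq (.v .j + .c 1) (.v .t) +
      .eq (.v .j) (.v .t) * .lt (.c 0) (.v .t)) ;;
    -- For `t = 0` the truncated subtraction leaves the label `0` of position `0` as it is, so all
    -- labels are distinct.
    .st .L1 (.v .j) (.v .j - .eq (.v .j) (.v .t))) ;; encode ;; .st .CODE (.v .t) (.v .s))

theorem initCodes_spec {E : Env} {I : Layout} (hE : Sizes E I) {s : St} (hs : SizeVars I s) :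
    Spec E initCodes s fun s' => I.Codes (s'.a .CODE) := by
  have hB := hE.B8
  have hKB : I.K + 1 ≤ E.B := by
    have := hE.K_le_S; have := hE.S_le; have := hE.K_pos; omega
  unfold initCodes
  refine spec_for (fun i s' => ∀ t < i, s'.a .CODE t < I.S ∧ ∀ x < I.K,
    I.dg (s'.a .CODE t) x = (if x + 1 = t ∨ (x = t ∧ 0 < t) then 1 else 0) ∧
    I.lb (s'.a .CODE t) x = if x = t then t - 1 else x) rfl ?_ ?_ ?_ ?_
  · rw [hs.K]; exact hE.K_lim
  · intro t ht; omega
  · intro t ht s₁ hf₁ hx₁ hprev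
    rw [hs.K] at ht
    have hs₁ : SizeVars I s₁ := hs.of_frame hf₁ rfl rfl rfl rfl
    refine Spec.seq (R := fun s' => ∀ x < I.K,
      s'.a .D1 x = (if x + 1 = t ∨ (x = t ∧ 0 < t) then 1 else 0) ∧
      s'.a .L1 x = if x = t then t - 1 else x) ?_ ?_
    · refine spec_for (fun k s' => ∀ x < k,
        s'.a .D1 x = (if x + 1 = t ∨ (x = t ∧ 0 < t) then 1 else 0) ∧
        s'.a .L1 x = if x = t then t - 1 else x) rfl ?_ ?_ ?_ ?_
      · rw [hs₁.K]; exact hE.K_lim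
      · intro x hx; omega
      · intro k hk s₂ hf₂ hx₂ h₂
        rw [hs₁.K] at hk
        have e1 : s₂.v .t = t := (hf₂.v _ rfl).trans hx₁
        simp only [spec_st_seq, spec_st, Ex.ok_add, Ex.ok_mul, Ex.ok_eq, Ex.ok_lt, Ex.ok_v, Ex.ok_c,
          Ex.ok_sub, Ex.ev_add, Ex.ev_mul, Ex.ev_eq, Ex.ev_lt, Ex.ev_v, Ex.ev_c, Ex.ev_sub, e1, hx₂,
          true_and, and_true, St.seta_v]
        refine ⟨by split_ifs <;> omega, fun x hx => ?_⟩
        simp only [St.setv_a, St.seta_a, reduceCtorEq, if_true, if_false]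
        by_cases hxk : x = k
        · subst hxk
          rw [Function.update_self, Function.update_self]
          constructor <;> split_ifs <;> omega
        · rw [Function.update_of_ne hxk, Function.update_of_ne hxk]
          exact h₂ x (by omega)
      · intro s₂ hf₂ hx₂ h₂
        rwa [hs₁.K] at h₂
    intro s₂ hf₂ h₂
    have hs₂ : SizeVars I s₂ := hs₁.of_frame hf₂ rfl rfl rfl rfl
    refine (encode_spec hE hs₂ (fun j hj => ?_) (fun j hj => ?_)).seq fun s₃ hf₃ ⟨hlt, hdec⟩ => ?_
    · rw [(h₂ j hj).1]; split_ifs <;> omega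
    · rw [(h₂ j hj).2]; split_ifs <;> omega
    have e1 : s₃.v .t = t := ((hf₃.v _ rfl).trans (hf₂.v _ rfl)).trans hx₁
    have e2 : s₃.a .CODE = s₁.a .CODE := (hf₃.a _ rfl).trans (hf₂.a _ rfl)
    simp only [spec_st, Ex.ok_v, Ex.ev_v, e1, true_and]
    intro t' ht'
    simp only [St.setv_a, St.seta_a, if_true]
    by_cases htt : t' = t
    · subst htt
      rw [Function.update_self]
      refine ⟨hlt, fun x hx => ?_⟩
      rw [(hdec x hx).1, (hdec x hx).2]
      exact h₂ x hx
    · rw [Function.update_of_ne htt, e2]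
      exact hprev t' (by omega)
  · intro s' hf hx h
    rw [hs.K] at h
    refine ⟨fun t ht => (h t ht).1, fun x hx => ?_, fun x hx => ?_, fun t h0 ht x hx => ?_,
      fun t _ ht x hx => ((h t ht).2 x hx).2⟩
    · rw [((h 0 hE.K_pos).2 x hx).1, if_neg (by omega)]
    · rw [((h 0 hE.K_pos).2 x hx).2]; split_ifs <;> omega
    · rw [((h t ht).2 x hx).1]
      refine if_congr ?_ rfl rfl
      omega

/-- Computes the tables before all merges. -/
def initTables : Cmd :=
  .for_ .i .M (.st .T (.v .i * .v .S + .ld .CODE (.ld .TY (.v .i))) (.c 1) ;;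
    -- This write must come second: for a node without an edge both addresses coincide.
    .st .T (.v .i * .v .S + .ld .CODE (.c 0)) (.c 1 + .lt (.c 0) (.ld .TY (.v .i))))

theorem initTables_spec {E : Env} {I : Layout} (hE : Sizes E I) (hI : I.Valid) {s : St}
    (hs : SizeVars I s) (hh : Holds I s) (hM : s.v .M = I.M) (hlim : I.M ≤ E.lim .M) {z : ℕ → ℕ}
    (hz : I.Codes z) (hzs : s.a .CODE = z) (h0 : ∀ i, s.a .T i = 0) :
    Spec E initTables s fun s' => ∀ a < I.M, ∀ σ < I.S, tab I .T s' a σ = I.initTable z a σ := by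
  have hB := hE.B8
  unfold initTables
  refine spec_for (fun i s' => ∀ a < I.M, ∀ σ < I.S, tab I .T s' a σ =
    if a < i then I.initTable z a σ else 0) rfl ?_ ?_ ?_ ?_
  · rw [hM]; exact hlim
  · intro a _ σ _
    rw [if_neg (by omega)]; exact h0 _
  · intro i hi s₁ hf₁ hx₁ hprev
    rw [hM] at hi
    have e1 : s₁.a .CODE = z := (hf₁.a _ rfl).trans hzs
    have e2 : s₁.a .TY i = I.ty i := by rw [hf₁.a _ rfl]; exact hh.TY i hi
    have e3 : s₁.v .S = I.S := (hf₁.v _ rfl).trans hs.S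
    have hty : I.ty i < I.K := by
      by_cases h : I.ty i = 0
      · rw [h]; exact hE.K_pos
      · exact (hI.ty_lt i hi h).1
    have l1 := hz.lt _ hty
    have l2 := hz.lt 0 hE.K_pos
    have i1 := hE.idx_S hi l1
    have i2 := hE.idx_S hi l2
    simp only [spec_st_seq, spec_st, Ex.ok_add, Ex.ok_mul, Ex.ok_lt, Ex.ok_v, Ex.ok_c, Ex.ok_ld,
      Ex.ev_add, Ex.ev_mul, Ex.ev_lt, Ex.ev_v, Ex.ev_c, Ex.ev_ld, e1, e2, e3, hx₁,
      true_and, and_true, St.seta_v, St.seta_a, reduceCtorEq, if_false]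
    refine ⟨by omega, by split_ifs <;> omega, ?_⟩
    intro a ha σ hσ
    simp only [tab, St.setv_a, St.seta_a, if_true]
    have hp := hprev a ha σ hσ
    rw [tab] at hp
    by_cases hai : a = i
    · subst hai
      rw [if_pos (Nat.lt_succ_self _), Layout.initTable]
      rw [if_neg (lt_irrefl _)] at hp
      by_cases h1 : σ = z 0
      · rw [h1, Function.update_self, if_pos rfl]
        split_ifs <;> omega
      · have hne : a * I.S + σ ≠ a * I.S + z 0 := by omega
        rw [Function.update_of_ne hne, if_neg h1]
        by_cases h2 : σ = z (I.ty a)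
        · have h3 : I.ty a ≠ 0 := fun h => h1 (by rw [h2, h])
          rw [if_pos (And.intro h3 h2), h2, Function.update_self]
        · have hne' : a * I.S + σ ≠ a * I.S + z (I.ty a) := by omega
          rw [Function.update_of_ne hne', if_neg (fun h : _ ∧ _ => h2 h.2), hp]
    · rw [Function.update_of_ne fun h => hai (idx_inj hσ l2 h).1,
        Function.update_of_ne fun h => hai (idx_inj hσ l1 h).1, hp]
      exact if_congr (by omega) rfl rfl
  · intro s' hf hx h a ha σ hσ
    rw [hM] at h
    rw [h a ha σ hσ, if_pos ha]

/-- Merges the tables of all nodes except the first. -/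
def mergeAll : Cmd := .for_ .i .M1 (.set .c (.v .M1 - .v .i) ;; mergeNode)

theorem step_congr {I : Layout} {c : ℕ} {T T' : ℕ → ℕ → ℕ} {C₁ C₂ C₁' C₂' : ℕ → ℕ → ℕ}
    (h : I.Step c T T' C₁ C₂) (h1 : ∀ σ < I.S, C₁' c σ = C₁ c σ) (h2 : ∀ σ < I.S, C₂' c σ = C₂ c σ) :
    I.Step c T T' C₁' C₂' :=
  ⟨h.other, fun σ hσ => by rw [h1 σ hσ, h2 σ hσ]; exact h.sound σ hσ, h.complete⟩

/-- Each table carries a slack of `2 * I.K` above its entries. A merge forgets at most `I.K`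
vertices, so the slack of one table pays for them and that of the other remains; the budgets simply
add. -/
theorem step_bound {I : Layout} (hS : 0 < I.S) {c : ℕ} {T T' : ℕ → ℕ → ℕ} {C₁ C₂ : ℕ → ℕ → ℕ}
    (h : I.Step c T T' C₁ C₂) {B₁ B₂ : ℕ} (h1 : ∀ σ < I.S, T (I.par c) σ + 2 * I.K ≤ B₁)
    (h2 : ∀ σ < I.S, T c σ + 2 * I.K ≤ B₂) {σ : ℕ} (hσ : σ < I.S) :
    T' (I.par c) σ + 2 * I.K ≤ B₁ + B₂ := by
  by_cases h0 : T' (I.par c) σ = 0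
  · have := h1 0 hS
    omega
  obtain ⟨k1, k2, k3, k4, -, -, k5⟩ := h.sound σ hσ h0
  have h3 := h1 _ k1
  have h4 := h2 _ k2
  have hcard : (I.forgotten (I.par c) c (C₂ c σ)).card ≤ I.K := by
    rw [← Finset.card_range I.K]
    refine Finset.card_le_card fun j hj => ?_
    simp only [Layout.forgotten, Finset.mem_filter] at hj
    exact hj.1
  omega

/-- `T t` is the content of the table array after all nodes from `t` on have been merged. The merge
of `c` writes the choices in row `c` only, so the final arrays of choices witness all steps
simultaneously. -/
theorem mergeAll_spec {E : Env} {I : Layout} (hE : Sizes E I) (hI : I.Valid) {s : St}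
    (hs : SizeVars I s) (hh : Holds I s) (hlim : I.M ≤ E.lim .M1) {z : ℕ → ℕ}
    (hinit : ∀ a < I.M, ∀ σ < I.S, tab I .T s a σ = I.initTable z a σ) :
    Spec E mergeAll s fun s' => ∃ T : ℕ → ℕ → ℕ → ℕ,
      (∀ a < I.M, ∀ σ < I.S, T I.M a σ = I.initTable z a σ) ∧
      (∀ c, 0 < c → c < I.M → I.Step c (T (c + 1)) (T c) (tab I .C1 s') (tab I .C2 s')) ∧
      T 1 = tab I .T s' := by
  have hB := hE.B8
  have hM := hE.M_pos
  have hK := hE.K_pos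
  unfold mergeAll
  refine spec_for (fun i s' => ∃ T : ℕ → ℕ → ℕ → ℕ,
    (∀ a < I.M, ∀ σ < I.S, T I.M a σ = I.initTable z a σ) ∧
    (∀ c, I.M - i ≤ c → 0 < c → c < I.M →
      I.Step c (T (c + 1)) (T c) (tab I .C1 s') (tab I .C2 s')) ∧
    -- The budgets bound the entries of the tables that are left. Their sum never grows, and at the
    -- start it is at most `I.M * (2 + 2 * I.K)`, which is at most `I.M * I.S`.
    T (I.M - i) = tab I .T s' ∧ ∃ b : ℕ → ℕ, (∀ a < I.M - i, ∀ σ < I.S,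
      tab I .T s' a σ + 2 * I.K ≤ b a) ∧ ∑ a ∈ Finset.range (I.M - i), b a ≤ E.B) rfl ?_ ?_ ?_ ?_
  · rw [hs.M1]; omega
  · refine ⟨fun _ => tab I .T s, hinit, fun c h1 h2 h3 => by omega, rfl,
      fun _ => 2 + 2 * I.K, fun a ha σ hσ => ?_, ?_⟩
    · have : tab I .T (s.setv .i 0) a σ = _ := hinit a (by omega) σ hσ
      rw [this, Layout.initTable]
      dsimp only
      split_ifs <;> omega
    · rw [Finset.sum_const, Finset.card_range, smul_eq_mul]
      have := hE.K_le_S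
      calc (I.M - 0) * (2 + 2 * I.K) ≤ I.M * I.S := Nat.mul_le_mul (by omega) (by omega)
        _ ≤ E.B := hE.B
  · intro i hi s₁ hf₁ hx₁ ⟨T, hT0, hT, hT1, b, hb, hsum⟩
    rw [hs.M1] at hi
    obtain ⟨c, hc⟩ : ∃ c, c = I.M - 1 - i := ⟨_, rfl⟩
    have hc0 : 0 < c := by omega
    have hcM : c < I.M := by omega
    have hMi : I.M - i = c + 1 := by omega
    have hMi' : I.M - (i + 1) = c := by omega
    rw [hMi] at hT hT1 hb hsum
    rw [hMi']
    have hs₁ : SizeVars I s₁ := hs.of_frame hf₁ rfl rfl rfl rfl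
    have hp := hI.par_lt c hc0 hcM
    have hbb : b (I.par c) + b c ≤ E.B := by
      rw [Finset.sum_range_succ] at hsum
      have := Finset.single_le_sum (f := b) (fun _ _ => Nat.zero_le _) (Finset.mem_range.2 hp)
      omega
    rw [spec_set_seq]
    simp only [Ex.ok_sub, Ex.ok_v, Ex.ev_sub, Ex.ev_v, hs₁.M1, hx₁, ← hc, true_and]
    have e0 : tab I .T (s₁.setv .c c) = tab I .T s₁ := tab_congr rfl
    have hs₁' : SizeVars I (s₁.setv .c c) := by
      refine ⟨?_, ?_, ?_, ?_⟩ <;> simp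
      exacts [hs₁.K, hs₁.D, hs₁.S, hs₁.M1]
    have hh₁ : Holds I (s₁.setv .c c) := by
      have := hh.of_frame hf₁ rfl rfl rfl
      exact ⟨this.SL, this.PAR, this.TY⟩
    refine (mergeNode_spec hE hI hs₁' hh₁ hc0 hcM (by simp) ?_).mono ?_
    · intro a ha b' hb'
      rw [e0]
      have := hb (I.par c) (by omega) a ha
      have := hb c (by omega) b' hb'
      omega
    rintro s₂ hf₂ ⟨hstep, hrow⟩
    rw [e0, ← hT1] at hstep
    refine ⟨Function.update T c (tab I .T s₂), ?_, ?_, ?_, ?_⟩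
    · rw [Function.update_of_ne (by omega)]; exact hT0
    · intro c' h1 h2 h3
      by_cases hcc : c' = c
      · subst hcc
        rw [Function.update_of_ne (by omega), Function.update_self]
        exact hstep
      · rw [Function.update_of_ne (by omega), Function.update_of_ne hcc]
        exact step_congr (hT c' (by omega) h2 h3) (fun σ hσ => (hrow c' hcc σ hσ).1)
          fun σ hσ => (hrow c' hcc σ hσ).2
    · rw [Function.update_self]; rfl
    · refine ⟨fun a => if a = I.par c then b (I.par c) + b c else b a, fun a ha σ hσ => ?_, ?_⟩
      · change tab I .T s₂ a σ + _ ≤ _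
        dsimp only
        split_ifs with h
        · subst h
          rw [hT1] at hstep
          exact step_bound hE.S_pos hstep (hb _ (by omega)) (hb c (by omega)) hσ
        · rw [hstep.other a ha h σ hσ, hT1]
          exact hb a (by omega) σ hσ
      · rw [Layout.sum_merge (f := b) (k := 0) hp (fun a _ h => if_neg h) (by rw [if_pos rfl, add_zero])]
        exact hsum
  · rintro s' hf hx ⟨T, hT0, hT, hT1, -⟩
    rw [hs.M1] at hT hT1
    rw [show I.M - (I.M - 1) = 1 by omega] at hT hT1
    exact ⟨T, hT0, fun c h1 h2 => hT c h1 h1 h2, hT1⟩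

end RAM

/-! ## The program: backtracking -/

namespace RAM
open BinTree Cmd

/-- Finds a best state of the root. -/
def findBest : Cmd :=
  .set .best (.c 0) ;; .set .val (.c 0) ;; .for_ .s .S (.ite (.v .s % .v .D / .v .K)
    (.ite (.lt (.v .val) (.ld .T (.v .s))) (.set .val (.ld .T (.v .s)) ;; .set .best (.v .s)) .skip)
    .skip) ;; .st .CUR (.c 0) (.v .best)

theorem findBest_spec {E : Env} {I : Layout} (hE : Sizes E I) {s : St} (hs : SizeVars I s) :
    Spec E findBest s fun s' => s'.a .CUR 0 < I.S ∧ ∀ σ < I.S, tab I .T s 0 σ ≠ 0 → I.dg σ 0 ≠ 0 →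
      I.dg (s'.a .CUR 0) 0 ≠ 0 ∧ tab I .T s 0 σ ≤ tab I .T s 0 (s'.a .CUR 0) := by
  have h0 : 0 ≤ E.B := Nat.zero_le _
  have htab : ∀ σ, tab I .T s 0 σ = s.a .T σ := fun σ => by rw [tab, zero_mul, zero_add]
  unfold findBest
  rw [spec_set_seq, spec_set_seq]
  refine ⟨h0, h0, ?_⟩
  simp only [htab, Ex.ev_c]
  refine Spec.seq (R := fun s' => s'.v .best < I.S ∧ ∀ σ < I.S, s.a .T σ ≠ 0 → I.dg σ 0 ≠ 0 →
      I.dg (s'.v .best) 0 ≠ 0 ∧ s.a .T σ ≤ s.a .T (s'.v .best)) ?_ ?_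
  · refine spec_for (fun i s' => s'.v .best < I.S ∧
      -- The value zero means that no admissible state has been found yet; attained entries are
      -- positive, so any of them replaces it.
      (s'.v .val ≠ 0 → I.dg (s'.v .best) 0 ≠ 0 ∧ s'.v .val = s.a .T (s'.v .best)) ∧
      ∀ σ < i, s.a .T σ ≠ 0 → I.dg σ 0 ≠ 0 → s'.v .val ≠ 0 ∧ s.a .T σ ≤ s'.v .val) rfl ?_ ?_ ?_ ?_
    · simpa [hs.S] using hE.S_lim
    · simpa using hE.S_pos
    · intro i hi s₁ hf₁ hx₁ ⟨h1, h2, h3⟩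
      have hi' : i < I.S := by simpa [hs.S] using hi
      have e1 : s₁.v .D = 4 * I.K := by rw [hf₁.v _ rfl]; simpa using hs.D
      have e2 : s₁.v .K = I.K := by rw [hf₁.v _ rfl]; simpa using hs.K
      have e3 : s₁.a .T = s.a .T := by rw [hf₁.a _ rfl]; simp
      have hdg : I.dg i 0 = i % (4 * I.K) / I.K := by rw [Layout.dg, pow_zero, Nat.div_one]
      have hlast : (s.a .T i = 0 ∨ I.dg i 0 = 0 ∨ s.a .T i ≤ s₁.v .val) →
          ∀ σ < i + 1, s.a .T σ ≠ 0 → I.dg σ 0 ≠ 0 → s₁.v .val ≠ 0 ∧ s.a .T σ ≤ s₁.v .val := by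
        intro h σ hσ k1 k2
        by_cases hσi : σ = i
        · subst hσi
          rcases h with h | h | h
          · contradiction
          · contradiction
          · exact ⟨by omega, h⟩
        · exact h3 σ (by omega) k1 k2
      rw [spec_ite]
      refine ⟨by simp, ?_⟩
      simp only [Ex.ev_div, Ex.ev_mod, Ex.ev_v, hx₁, e1, e2, ← hdg]
      split_ifs with hz
      · exact spec_skip.2 ⟨h1, h2, hlast (Or.inr (Or.inl hz))⟩
      rw [spec_ite]
      refine ⟨by simp, ?_⟩
      simp only [Ex.ev_lt, Ex.ev_ld, Ex.ev_v, hx₁, e3]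
      by_cases hlt : s₁.v .val < s.a .T i
      · simp only [hlt, if_true, one_ne_zero, if_false, spec_set_seq, spec_set, Ex.ok_ld, Ex.ok_v,
          Ex.ev_ld, Ex.ev_v, St.setv_v, reduceCtorEq, hx₁, e3, true_and]
        refine ⟨hi', fun _ => ⟨hz, trivial⟩, fun σ hσ k1 k2 => ⟨by omega, ?_⟩⟩
        by_cases hσi : σ = i
        · rw [hσi]
        · exact ((h3 σ (by omega) k1 k2).2.trans_lt hlt).le
      · simp only [hlt, if_false, if_true, spec_skip]
        exact ⟨h1, h2, hlast (Or.inr (Or.inr (by omega)))⟩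
    · intro s₁ hf₁ hx₁ ⟨h1, h2, h3⟩
      refine ⟨h1, fun σ hσ k1 k2 => ?_⟩
      obtain ⟨k3, k4⟩ := h3 σ (by simpa [hs.S] using hσ) k1 k2
      obtain ⟨k5, k6⟩ := h2 k3
      exact ⟨k5, k6 ▸ k4⟩
  · intro s₁ hf₁ ⟨h1, h2⟩
    simp only [spec_st, Ex.ok_c, Ex.ok_v, Ex.ev_c, Ex.ev_v, St.seta_a, if_true, Function.update_self,
      and_true]
    exact ⟨h0, h1, h2⟩

/-- Finds the states of all nodes from that of the root. -/
def backtrack : Cmd :=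
  .for_ .i .M1 (.set .c (.v .i + .c 1) ;; .set .p (.ld .PAR (.v .c)) ;; .set .s (.ld .CUR (.v .p)) ;;
    -- The reduction modulo the number of states keeps all addresses in range without knowing that
    -- the choices read here are meaningful.
    .st .CUR (.v .p) (.ld .C1 (.v .c * .v .S + .v .s) % .v .S) ;;
    .st .CUR (.v .c) (.ld .C2 (.v .c * .v .S + .v .s) % .v .S))

theorem backtrack_spec {E : Env} {I : Layout} (hE : Sizes E I) (hI : I.Valid) {s : St}
    (hs : SizeVars I s) (hh : Holds I s) (hlim : I.M ≤ E.lim .M1) (h0 : s.a .CUR 0 < I.S) :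
    Spec E backtrack s fun s' => ∃ cu : ℕ → ℕ → ℕ, cu 1 = s.a .CUR ∧ cu I.M = s'.a .CUR ∧
      ∀ c, 0 < c → c < I.M →
        cu (c + 1) (I.par c) = tab I .C1 s c (cu c (I.par c)) % I.S ∧
        cu (c + 1) c = tab I .C2 s c (cu c (I.par c)) % I.S ∧
        ∀ i < c, i ≠ I.par c → cu (c + 1) i = cu c i := by
  have hM := hE.M_pos
  have hS := hE.S_pos
  unfold backtrack
  refine spec_for (fun t s' => ∃ cu : ℕ → ℕ → ℕ, cu 1 = s.a .CUR ∧ cu (t + 1) = s'.a .CUR ∧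
      (∀ i < t + 1, s'.a .CUR i < I.S) ∧ ∀ c, 0 < c → c < t + 1 →
        cu (c + 1) (I.par c) = tab I .C1 s c (cu c (I.par c)) % I.S ∧
        cu (c + 1) c = tab I .C2 s c (cu c (I.par c)) % I.S ∧
        ∀ i < c, i ≠ I.par c → cu (c + 1) i = cu c i) rfl ?_ ?_ ?_ ?_
  · rw [hs.M1]; omega
  · refine ⟨fun _ => s.a .CUR, rfl, rfl, fun i hi => ?_, fun c h1 h2 => by omega⟩
    obtain rfl : i = 0 := by omega
    exact h0
  · intro t ht s₁ hf₁ hx₁ ⟨cu, hcu1, hcu, hlt, hcus⟩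
    rw [hs.M1] at ht
    have hc : t + 1 < I.M := by omega
    have hp := hI.par_lt (t + 1) (by omega) hc
    have hpS := hlt _ hp
    have e1 : s₁.a .PAR (t + 1) = I.par (t + 1) := by
      rw [hf₁.a _ rfl]; exact hh.PAR _ (by omega) hc
    have e2 : s₁.a .C1 = s.a .C1 := hf₁.a _ rfl
    have e3 : s₁.a .C2 = s.a .C2 := hf₁.a _ rfl
    have e4 : s₁.v .S = I.S := (hf₁.v _ rfl).trans hs.S
    have hlim' : t + 1 ≤ E.B := by
      have := hE.idx_S hc hS
      have := Nat.le_mul_of_pos_right (t + 1) hS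
      omega
    have i1 := hE.idx_S hc hpS
    simp only [spec_set_seq, spec_st_seq, spec_st, Ex.ok_add, Ex.ok_mul, Ex.ok_mod, Ex.ok_v, Ex.ok_c,
      Ex.ok_ld, Ex.ev_add, Ex.ev_mul, Ex.ev_mod, Ex.ev_v, Ex.ev_c, Ex.ev_ld, St.setv_v, St.setv_a,
      St.seta_v, St.seta_a, reduceCtorEq, if_true, if_false, hx₁, e1, e2, e3, e4, true_and, and_true]
    refine ⟨by omega, by omega, by omega, ?_⟩
    set p := I.par (t + 1) with hpd
    set σ := s₁.a .CUR p with hσ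
    refine ⟨Function.update cu (t + 1 + 1) _, ?_, Function.update_self .., fun i hi => ?_,
      fun c hc0 hct => ?_⟩
    · rw [Function.update_of_ne (by omega)]; exact hcu1
    · by_cases h1 : i = t + 1
      · rw [h1, Function.update_self]; exact Nat.mod_lt _ hS
      · rw [Function.update_of_ne h1]
        by_cases h2 : i = p
        · rw [h2, Function.update_self]; exact Nat.mod_lt _ hS
        · rw [Function.update_of_ne h2]; exact hlt i (by omega)
    · by_cases hct' : c = t + 1
      · subst hct'
        rw [Function.update_self, Function.update_of_ne (by omega : t + 1 ≠ t + 1 + 1), hcu, ← hpd,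
          ← hσ]
        refine ⟨?_, ?_, fun i hi hip => ?_⟩
        · rw [Function.update_of_ne hp.ne, Function.update_self]; rfl
        · rw [Function.update_self]; rfl
        · rw [Function.update_of_ne hi.ne, Function.update_of_ne hip]
      · rw [Function.update_of_ne (by omega), Function.update_of_ne (by omega)]
        exact hcus c hc0 (by omega)
  · rintro s' hf hx ⟨cu, hcu1, hcu, -, hcus⟩
    rw [hs.M1, Nat.sub_add_cancel hM] at hcu hcus
    exact ⟨cu, hcu1, hcu, hcus⟩

/-- At nonzero entries the choices are smaller than `I.S`, and the reduction does not change them;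
nothing is claimed elsewhere. -/
theorem step_mod {I : Layout} {c : ℕ} {T T' : ℕ → ℕ → ℕ} {C₁ C₂ : ℕ → ℕ → ℕ}
    (h : I.Step c T T' C₁ C₂) :
    I.Step c T T' (fun c σ => C₁ c σ % I.S) (fun c σ => C₂ c σ % I.S) := by
  refine ⟨h.other, fun σ hσ h0 => ?_, h.complete⟩
  have h1 := h.sound σ hσ h0
  rw [Nat.mod_eq_of_lt h1.1, Nat.mod_eq_of_lt h1.2.1]
  exact h1

/-- Computes the states of the nodes of a best solution. -/
def solve : Cmd := initCodes ;; initTables ;; mergeAll ;; findBest ;; backtrack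

theorem solve_spec {E : Env} {I : Layout} (hE : Sizes E I) (hI : I.Valid) {s : St}
    (hs : SizeVars I s) (hh : Holds I s) (hM : s.v .M = I.M) (hlim : I.M ≤ E.lim .M)
    (hlim1 : I.M ≤ E.lim .M1) (hT : ∀ i, s.a .T i = 0) (hex : ∃ F, I.Feasible F) :
    Spec E solve s fun s' => I.Feasible (I.picks (s'.a .CODE) (s'.a .CUR)) ∧
      ∀ F, I.Feasible F → I.gain F ≤ I.gain (I.picks (s'.a .CODE) (s'.a .CUR)) := by
  unfold solve
  refine (initCodes_spec hE hs).seq fun s₁ hf₁ hz => ?_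
  have hs₁ := hs.of_frame hf₁ rfl rfl rfl rfl
  have hh₁ := hh.of_frame hf₁ rfl rfl rfl
  refine (initTables_spec hE hI hs₁ hh₁ ((hf₁.v _ rfl).trans hM) hlim hz rfl
    (fun i => by rw [hf₁.a _ rfl]; exact hT i)).seq fun s₂ hf₂ hinit => ?_
  have hs₂ := hs₁.of_frame hf₂ rfl rfl rfl rfl
  have hh₂ := hh₁.of_frame hf₂ rfl rfl rfl
  refine (mergeAll_spec hE hI hs₂ hh₂ hlim1 hinit).seq fun s₃ hf₃ ⟨T, hT0, hstep, hT1⟩ => ?_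
  have hs₃ := hs₂.of_frame hf₃ rfl rfl rfl rfl
  have hh₃ := hh₂.of_frame hf₃ rfl rfl rfl
  refine (findBest_spec hE hs₃).seq fun s₄ hf₄ ⟨h1, h2⟩ => ?_
  have hs₄ := hs₃.of_frame hf₄ rfl rfl rfl rfl
  have hh₄ := hh₃.of_frame hf₄ rfl rfl rfl
  refine (backtrack_spec hE hI hs₄ hh₄ hlim1 h1).mono ?_
  rintro s₅ hf₅ ⟨cu, hcu1, hcuM, hcu⟩
  have e1 : s₅.a .CODE = s₁.a .CODE :=
    (((hf₅.a _ rfl).trans (hf₄.a _ rfl)).trans (hf₃.a _ rfl)).trans (hf₂.a _ rfl)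
  have e2 : tab I .C1 s₄ = tab I .C1 s₃ := tab_congr (hf₄.a _ rfl)
  have e3 : tab I .C2 s₄ = tab I .C2 s₃ := tab_congr (hf₄.a _ rfl)
  rw [e2, e3] at hcu
  rw [e1, ← hcuM]
  refine Layout.optimal hI hz hT0 (fun c h1 h2 => step_mod (hstep c h1 h2))
    (fun c h1 h2 => (hcu c h1 h2).1) (fun c h1 h2 => (hcu c h1 h2).2.1)
    (fun c h1 h2 => (hcu c h1 h2).2.2) ?_ ?_ hex
  · rw [hcu1]; exact h1
  · rw [hcu1, hT1]; exact h2

end RAM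

/-! ## The program: output -/

namespace RAM
open BinTree Cmd

/-- Marks the codes of the ends of all chosen edge nodes. -/
def mark : Cmd :=
  .for_ .i .M (.ite (.ld .TY (.v .i)) (.ite (.eq (.ld .CUR (.v .i)) (.ld .CODE (.c 0))) .skip
    (.st .MARK (.ld .SL (.v .i * .v .K + .ld .TY (.v .i))) (.c 1) ;;
      .st .MARK (.ld .SL (.v .i * .v .K + (.ld .TY (.v .i) - .c 1))) (.c 1))) .skip)

theorem mark_spec {E : Env} {I : Layout} (hE : Sizes E I) (hI : I.Valid) {s : St}
    (hs : SizeVars I s) (hh : Holds I s) (hM : s.v .M = I.M) (hlim : I.M ≤ E.lim .M)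
    (h0 : ∀ i, s.a .MARK i = 0) :
    Spec E mark s fun s' => ∀ x, s'.a .MARK x ≠ 0 ↔ x ∈ I.used (I.picks (s.a .CODE) (s.a .CUR)) := by
  have hB := hE.B8
  unfold mark
  refine spec_for (fun i s' => ∀ x, s'.a .MARK x ≠ 0 ↔
    ∃ a ∈ I.picks (s.a .CODE) (s.a .CUR), a < i ∧ (I.ea a = x ∨ I.eb a = x)) rfl ?_ ?_ ?_ ?_
  · rw [hM]; exact hlim
  · intro x; simp [h0]
  · intro i hi s₁ hf₁ hx₁ hmk
    rw [hM] at hi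
    have e1 : s₁.a .TY i = I.ty i := by rw [hf₁.a _ rfl]; exact hh.TY i hi
    have e2 : s₁.a .CUR = s.a .CUR := hf₁.a _ rfl
    have e3 : s₁.a .CODE = s.a .CODE := hf₁.a _ rfl
    have e4 : s₁.a .SL = s.a .SL := hf₁.a _ rfl
    have e5 : s₁.v .K = I.K := (hf₁.v _ rfl).trans hs.K
    have hmem : i ∈ I.picks (s.a .CODE) (s.a .CUR) ↔ I.ty i ≠ 0 ∧ s.a .CUR i ≠ s.a .CODE 0 := by
      simp [Layout.picks, hi]
    have hskip : i ∉ I.picks (s.a .CODE) (s.a .CUR) → ∀ x, s₁.a .MARK x ≠ 0 ↔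
        ∃ a ∈ I.picks (s.a .CODE) (s.a .CUR), a < i + 1 ∧ (I.ea a = x ∨ I.eb a = x) := by
      intro hni x
      rw [hmk x]
      refine exists_congr fun a => and_congr_right fun ha => and_congr_left fun _ => ?_
      have : a ≠ i := by rintro rfl; exact hni ha
      omega
    simp only [spec_ite, spec_st_seq, spec_st, spec_skip, Ex.ok_v, Ex.ok_ld, Ex.ok_eq, Ex.ok_c,
      Ex.ok_add, Ex.ok_mul, Ex.ok_sub, Ex.ev_v, Ex.ev_ld, Ex.ev_eq, Ex.ev_c, Ex.ev_add, Ex.ev_mul,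
      Ex.ev_sub, hx₁, e1, e2, e3, e4, e5, St.seta_v, St.seta_a, reduceCtorEq, if_false, true_and]
    by_cases hty : I.ty i = 0
    · simp only [hty, if_true]
      refine hskip ?_
      rw [hmem]; tauto
    by_cases hcur : s.a .CUR i = s.a .CODE 0
    · simp only [hty, hcur, if_true, one_ne_zero, if_false]
      refine ⟨Nat.zero_le _, hskip ?_⟩
      rw [hmem]; tauto
    · have hK := (hI.ty_lt i hi hty).1
      have i1 := hE.idx_K hi hK
      have i2 := hE.idx_K hi (show I.ty i - 1 < I.K by omega)
      have s1 : s.a .SL (i * I.K + I.ty i) = I.eb i := hh.SL i hi _ hK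
      have s2 : s.a .SL (i * I.K + (I.ty i - 1)) = I.ea i := hh.SL i hi _ (by omega)
      simp only [hty, hcur, s1, s2, if_true, if_false]
      refine ⟨by omega, by omega, by omega, ?_⟩
      intro x
      have hi' := hmem.2 ⟨hty, hcur⟩
      simp only [St.setv_a, St.seta_a, if_true]
      constructor
      · intro h
        by_cases h1 : x = I.ea i
        · exact ⟨i, hi', by omega, Or.inl h1.symm⟩
        by_cases h2 : x = I.eb i
        · exact ⟨i, hi', by omega, Or.inr h2.symm⟩
        rw [Function.update_of_ne h1, Function.update_of_ne h2] at h
        obtain ⟨a, ha, hai, h3⟩ := (hmk x).1 h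
        exact ⟨a, ha, by omega, h3⟩
      · rintro ⟨a, ha, hai, h3⟩
        by_cases h1 : x = I.ea i
        · rw [h1, Function.update_self]; exact one_ne_zero
        rw [Function.update_of_ne h1]
        by_cases h2 : x = I.eb i
        · rw [h2, Function.update_self]; exact one_ne_zero
        rw [Function.update_of_ne h2]
        refine (hmk x).2 ⟨a, ha, ?_, h3⟩
        have : a ≠ i := by rintro rfl; tauto
        omega
  · intro s' hf hx h x
    rw [hM] at h
    rw [h x, Layout.mem_used]
    refine exists_congr fun a => and_congr_right fun ha => ?_
    rw [and_iff_right]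
    simp only [Layout.picks, Finset.mem_filter, Finset.mem_range] at ha
    exact ha.1

/-- Writes the number of the marked vertices and these vertices to `OUT`. -/
def writeVertices : Cmd :=
  .set .q (.c 0) ;; .for_ .v .n (.ite (.ld .MARK (.v .v + .c 2))
    (.set .q (.v .q + .c 1) ;; .st .OUT (.v .q) (.v .v)) .skip) ;; .st .OUT (.c 0) (.v .q)

/-- `OUT` holds the list `l` from the address `p` on. -/
def Out (s : St) (p : ℕ) (l : List ℕ) : Prop := ∀ (i : ℕ) (h : i < l.length), s.a .OUT (p + i) = l[i]

theorem Out.snoc {s s' : St} {p : ℕ} {l : List ℕ} (h : Out s p l) {k : ℕ}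
    (hs : s'.a .OUT = Function.update (s.a .OUT) (p + l.length) k) : Out s' p (l ++ [k]) := by
  intro i hi
  rw [List.length_append, List.length_singleton] at hi
  rw [hs]
  by_cases hil : i = l.length
  · subst hil
    rw [Function.update_self, List.getElem_append_right le_rfl]
    simp
  · rw [Function.update_of_ne (by omega), h i (by omega), List.getElem_append_left]

theorem Out.congr {s s' : St} {p : ℕ} {l : List ℕ} (h : Out s p l)
    (hs : ∀ i < l.length, s'.a .OUT (p + i) = s.a .OUT (p + i)) : Out s' p l :=
  fun i hi => (hs i hi).trans (h i hi)

theorem Out.append {s : St} {p : ℕ} {l l' : List ℕ} (h : Out s p l) (h' : Out s (p + l.length) l') :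
    Out s p (l ++ l') := by
  intro i hi
  rw [List.length_append] at hi
  by_cases hil : i < l.length
  · rw [List.getElem_append_left hil]; exact h i hil
  · rw [List.getElem_append_right (by omega), ← h' (i - l.length) (by omega)]
    congr 1; omega

theorem Out.cons {s : St} {p k : ℕ} {l : List ℕ} (h0 : s.a .OUT p = k) (h : Out s (p + 1) l) :
    Out s p (k :: l) := by
  intro i hi
  rcases i with _ | i
  · exact h0
  · rw [List.getElem_cons_succ, ← h i (by simpa using hi)]
    congr 1; omega

/-- The codes of the marked vertices, without the shift. -/
def marked (s : St) (n : ℕ) : List ℕ := (List.range n).filter fun v => s.a .MARK (v + 2) ≠ 0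

theorem marked_succ (s : St) (i : ℕ) :
    marked s (i + 1) = marked s i ++ if s.a .MARK (i + 2) ≠ 0 then [i] else [] := by
  rw [marked, List.range_succ, List.filter_append, marked]
  congr 1
  split_ifs with h <;> simp [h]

theorem length_marked (s : St) (n : ℕ) : (marked s n).length ≤ n :=
  (List.length_filter_le _ _).trans (by simp)

theorem writeVertices_spec {E : Env} {s : St} {n : ℕ} (hn : s.v .n = n) (hlim : n ≤ E.lim .n)
    (hB : n + 2 ≤ E.B) :
    Spec E writeVertices s fun s' => s'.v .q = (marked s n).length ∧
      Out s' 0 ((marked s n).length :: marked s n) := by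
  unfold writeVertices
  rw [spec_set_seq]
  refine ⟨Nat.zero_le _, ?_⟩
  refine Spec.seq (R := fun s' => s'.v .q = (marked s n).length ∧ Out s' 1 (marked s n)) ?_ ?_
  · refine spec_for (fun i s' => s'.v .q = (marked s i).length ∧ Out s' 1 (marked s i)) rfl ?_ ?_ ?_ ?_
    · simpa [hn] using hlim
    · refine ⟨by simp [marked], fun i hi => ?_⟩
      simp [marked] at hi
    · intro i hi s₁ hf₁ hx₁ ⟨hq, hout⟩
      have hi' : i < n := by simpa [hn] using hi
      have e1 : s₁.a .MARK = s.a .MARK := by rw [hf₁.a _ rfl]; simp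
      have hl := length_marked s i
      have hs := marked_succ s i
      rw [spec_ite]
      simp only [Ex.ok_ld, Ex.ok_add, Ex.ok_v, Ex.ok_c, Ex.ev_ld, Ex.ev_add, Ex.ev_v, Ex.ev_c, hx₁,
        e1, true_and]
      refine ⟨by omega, ?_⟩
      split_ifs with hz
      · rw [if_neg (not_not.2 hz), List.append_nil] at hs
        rw [spec_skip, hs]
        exact ⟨hq, hout⟩
      · rw [if_pos hz] at hs
        rw [hs]
        simp only [spec_set_seq, spec_st, Ex.ok_add, Ex.ok_v, Ex.ok_c, Ex.ev_add, Ex.ev_v, Ex.ev_c,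
          St.setv_v, St.seta_v, reduceCtorEq, if_true, if_false, hx₁, hq, true_and, and_true]
        refine ⟨by omega, by simp, hout.snoc ?_⟩
        simp [add_comm]
    · intro s' hf hx h
      simpa [hn] using h
  · intro s₁ hf₁ ⟨hq, hout⟩
    simp only [spec_st, Ex.ok_v, Ex.ok_c, Ex.ev_v, Ex.ev_c, St.seta_v, and_true]
    refine ⟨Nat.zero_le _, hq, Out.cons ?_ (hout.congr fun i hi => ?_)⟩
    · simp [hq]
    · simp

/-- Writes the number of the chosen edges and these edges to `OUT`. -/
def writeEdges : Cmd :=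
  .set .w (.c 0) ;; .for_ .e .m (.ite (.eq (.ld .CUR (.v .N1 + .v .e)) (.ld .CODE (.c 0))) .skip
    -- The edges start behind the vertex count, the `q` vertices and the edge count, hence the
    -- offset `q + 2`.
    (.st .OUT (.v .q + .c 2 + .c 2 * .v .w) (.inp (.c 3 + .c 2 * .v .e)) ;;
      .st .OUT (.v .q + .c 2 + .c 2 * .v .w + .c 1) (.inp (.c 3 + .c 2 * .v .e + .c 1)) ;;
      .set .w (.v .w + .c 1))) ;;
    .st .OUT (.v .q + .c 1) (.v .w) ;; .set .cnt (.v .q + .c 2 + .c 2 * .v .w)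

/-- The indices of the chosen edges. -/
def chosen (s : St) (N m : ℕ) : List ℕ :=
  (List.range m).filter fun e => s.a .CUR (N + 1 + e) ≠ s.a .CODE 0

theorem chosen_succ (s : St) (N i : ℕ) : chosen s N (i + 1) =
    chosen s N i ++ if s.a .CUR (N + 1 + i) ≠ s.a .CODE 0 then [i] else [] := by
  rw [chosen, List.range_succ, List.filter_append, chosen]
  congr 1
  split_ifs with h <;> simp [h]

theorem length_chosen (s : St) (N m : ℕ) : (chosen s N m).length ≤ m :=
  (List.length_filter_le _ _).trans (by simp)

theorem length_edgeWords (inp : ℕ → ℕ) (l : List ℕ) :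
    (l.flatMap fun e => [inp (3 + 2 * e), inp (3 + 2 * e + 1)]).length = 2 * l.length := by
  induction l with
  | nil => rfl
  | cons e l ih => rw [List.flatMap_cons, List.length_append, ih]; simp; ring

theorem writeEdges_spec {E : Env} {s : St} {N m q : ℕ} {l : List ℕ} (hN1 : s.v .N1 = N + 1)
    (hm : s.v .m = m) (hq : s.v .q = q) (hout : Out s 0 l) (hl : l.length = q + 1)
    (hlim : m ≤ E.lim .m) (hlen : 3 + 2 * m ≤ E.len) (hB : N + q + 2 * m + 8 ≤ E.B) :
    Spec E writeEdges s fun s' => s'.v .cnt = (l ++ ((chosen s N m).length ::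
        (chosen s N m).flatMap fun e => [E.inp (3 + 2 * e), E.inp (3 + 2 * e + 1)])).length ∧
      Out s' 0 (l ++ ((chosen s N m).length ::
        (chosen s N m).flatMap fun e => [E.inp (3 + 2 * e), E.inp (3 + 2 * e + 1)])) := by
  have hW := length_edgeWords E.inp
  unfold writeEdges
  rw [spec_set_seq]
  refine ⟨Nat.zero_le _, ?_⟩
  refine Spec.seq (R := fun s' => s'.v .w = (chosen s N m).length ∧ Out s' 0 l ∧ Out s' (q + 2)
    ((chosen s N m).flatMap fun e => [E.inp (3 + 2 * e), E.inp (3 + 2 * e + 1)])) ?_ ?_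
  · refine spec_for (fun i s' => s'.v .w = (chosen s N i).length ∧ Out s' 0 l ∧ Out s' (q + 2)
      ((chosen s N i).flatMap fun e => [E.inp (3 + 2 * e), E.inp (3 + 2 * e + 1)])) rfl ?_ ?_ ?_ ?_
    · simpa [hm] using hlim
    · refine ⟨by simp [chosen], hout, fun i hi => ?_⟩
      simp [chosen] at hi
    · intro i hi s₁ hf₁ hx₁ ⟨hw, hl₁, hout₁⟩
      have hi' : i < m := by simpa [hm] using hi
      have e1 : s₁.a .CUR = s.a .CUR := by rw [hf₁.a _ rfl]; simp
      have e2 : s₁.a .CODE = s.a .CODE := by rw [hf₁.a _ rfl]; simp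
      have e3 : s₁.v .N1 = N + 1 := by rw [hf₁.v _ rfl]; simpa using hN1
      have e4 : s₁.v .q = q := by rw [hf₁.v _ rfl]; simpa using hq
      have hlc := length_chosen s N i
      have hs := chosen_succ s N i
      rw [spec_ite]
      simp only [Ex.ok_ld, Ex.ok_add, Ex.ok_v, Ex.ok_c, Ex.ok_eq, Ex.ev_eq, Ex.ev_ld, Ex.ev_add,
        Ex.ev_v, Ex.ev_c, hx₁, e1, e2, e3, true_and]
      refine ⟨by omega, ?_⟩
      by_cases hz : s.a .CUR (N + 1 + i) = s.a .CODE 0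
      · rw [if_neg (not_not.2 hz), List.append_nil] at hs
        simp only [hz, if_true, one_ne_zero, if_false]
        rw [spec_skip, hs]
        exact ⟨hw, hl₁, hout₁⟩
      · rw [if_pos hz] at hs
        have hlen1 : (chosen s N (i + 1)).length = (chosen s N i).length + 1 := by rw [hs]; simp
        simp only [hz, if_true, if_false]
        rw [hlen1, hs, List.flatMap_append]
        have hone : ([i].flatMap fun e => [E.inp (3 + 2 * e), E.inp (3 + 2 * e + 1)]) =
          [E.inp (3 + 2 * i)] ++ [E.inp (3 + 2 * i + 1)] := by simp
        rw [hone, ← List.append_assoc]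
        simp only [spec_st_seq, spec_set, Ex.ok_add, Ex.ok_mul, Ex.ok_inp, Ex.ok_v, Ex.ok_c,
          Ex.ev_add, Ex.ev_mul, Ex.ev_inp, Ex.ev_v, Ex.ev_c, St.seta_v, hx₁, hw, e4, true_and]
        refine ⟨by omega, by omega, by omega, by simp, ?_, ?_⟩
        · refine hl₁.congr fun k hk => ?_
          have k1 : 0 + k ≠ q + 2 + 2 * (chosen s N i).length + 1 := by omega
          have k2 : 0 + k ≠ q + 2 + 2 * (chosen s N i).length := by omega
          simp only [St.setv_a, St.seta_a, if_true]
          rw [Function.update_of_ne k1, Function.update_of_ne k2]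
        · refine Out.snoc (s := s₁.seta .OUT (q + 2 + 2 * (chosen s N i).length)
            (E.inp (3 + 2 * i))) (hout₁.snoc ?_) ?_
          · simp [hW]
          · simp [add_assoc, mul_comm]
    · intro s' hf hx h
      simpa [hm] using h
  · intro s₁ hf₁ ⟨hw, hl₁, hout₁⟩
    have e4 : s₁.v .q = q := by rw [hf₁.v _ rfl]; simpa using hq
    have hlc := length_chosen s N m
    simp only [spec_st_seq, spec_set, Ex.ok_add, Ex.ok_mul, Ex.ok_v, Ex.ok_c,
      Ex.ev_add, Ex.ev_mul, Ex.ev_v, Ex.ev_c, St.seta_v, hw, e4, true_and, and_true]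
    refine ⟨by omega, by omega, ?_, ?_⟩
    · simp [hW, hl]; omega
    · refine Out.append (hl₁.congr fun k hk => ?_) (Out.cons ?_ ?_)
      · have k1 : 0 + k ≠ q + 1 := by omega
        simp only [St.setv_a, St.seta_a, if_true, Function.update_of_ne k1]
      · simp [hl]
      · rw [hl, show 0 + (q + 1) + 1 = q + 2 by ring]
        refine hout₁.congr fun k hk => ?_
        have k1 : q + 2 + k ≠ q + 1 := by omega
        simp only [St.setv_a, St.seta_a, if_true, Function.update_of_ne k1]

/-- Writes the chosen subgraph to `OUT`. -/
def output : Cmd := mark ;; writeVertices ;; writeEdges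

theorem output_spec {E : Env} {I : Layout} (hE : Sizes E I) (hI : I.Valid) {s : St}
    (hs : SizeVars I s) (hh : Holds I s) {n N : ℕ} {G : SimpleGraph (Fin n)}
    {L : List (Fin n × Fin n)} {F : List (Fin N × Fin N)} {X : Fin N → List (Fin n)} {bp : ℕ → ℕ}
    (hR : I.Represents G L N) (hv : InputView E.inp E.len L F X bp)
    (hlen : 3 + 2 * L.length ≤ E.len) (hM : s.v .M = I.M) (hn : s.v .n = n) (hN1 : s.v .N1 = N + 1)
    (hm : s.v .m = L.length) (hlim : I.M ≤ E.lim .M) (hlimn : n ≤ E.lim .n)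
    (hlimm : L.length ≤ E.lim .m) (hB : N + n + 2 * L.length + 8 ≤ E.B)
    (h0 : ∀ i, s.a .MARK i = 0) :
    Spec E output s fun s' => ∃ y, IsOutput (I.toSubgraph hR.edges N hR
      (I.picks (s.a .CODE) (s.a .CUR))) y ∧ s'.v .cnt = y.length ∧ Out s' 0 y := by
  unfold output
  refine (mark_spec hE hI hs hh hM hlim h0).seq fun s₁ hf₁ hmk => ?_
  refine (writeVertices_spec (s := s₁) (n := n) ((hf₁.v _ rfl).trans hn) hlimn (by omega)).seq
    fun s₂ hf₂ ⟨hq, hout⟩ => ?_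
  have hlm := length_marked s₁ n
  refine (writeEdges_spec (s := s₂) (N := N) (m := L.length) (q := (marked s₁ n).length)
    (((hf₂.v _ rfl).trans (hf₁.v _ rfl)).trans hN1) (((hf₂.v _ rfl).trans (hf₁.v _ rfl)).trans hm)
    hq hout (by simp) hlimm hlen (by omega)).mono ?_
  rintro s₃ hf₃ ⟨hcnt, hout₃⟩
  refine ⟨_, ?_, hcnt, hout₃⟩
  have e1 : s₂.a .CUR = s.a .CUR := (hf₂.a _ rfl).trans (hf₁.a _ rfl)
  have e2 : s₂.a .CODE = s.a .CODE := (hf₂.a _ rfl).trans (hf₁.a _ rfl)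
  set P := I.picks (s.a .CODE) (s.a .CUR) with hP
  have hpick : ∀ e : Fin L.length, s₂.a .CUR (N + 1 + e) ≠ s₂.a .CODE 0 ↔ N + 1 + (e : ℕ) ∈ P := by
    intro e
    rw [e1, e2, hP, Layout.picks, Finset.mem_filter, Finset.mem_range]
    have h1 := hR.M_eq
    have h2 := hR.ty_edge e
    constructor
    · exact fun h => ⟨by omega, h2, h⟩
    · exact fun h => h.2.2
  have hnat : ∀ k (p : ℕ → Prop) [DecidablePred p],
      (List.range k).filter p = ((List.finRange k).filter fun i : Fin k => p (i : ℕ)).map Fin.val := by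
    intro k p _
    rw [← List.map_coe_finRange_eq_range, List.filter_map]
    rfl
  refine ⟨(List.finRange n).filter fun v : Fin n => s₁.a .MARK ((v : ℕ) + 2) ≠ 0,
    ((List.finRange L.length).filter fun e : Fin L.length => s₂.a .CUR (N + 1 + (e : ℕ)) ≠ s₂.a .CODE 0).map
      fun e : Fin L.length => L[e], ?_, ?_, ?_⟩
  · refine ⟨(List.nodup_finRange n).filter _, fun v => ?_⟩
    rw [List.mem_filter, decide_eq_true_iff, hmk]
    exact and_iff_right (List.mem_finRange v)
  · rw [ListsEdges, List.map_map]
    refine ⟨((List.nodup_finRange _).filter _).map fun e e' h => Layout.edge_inj hR.edges h,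
      fun a => ?_⟩
    induction a with
    | h u v =>
    rw [SimpleGraph.Subgraph.mem_edgeSet]
    simp only [List.mem_map, List.mem_filter, List.mem_finRange, true_and, decide_eq_true_iff,
      hpick, Layout.toSubgraph, Layout.chosenEdges, Finset.mem_filter, Finset.mem_univ]
    rfl
  · rw [vertexWords_eq, ← hnat n fun v => s₁.a .MARK (v + 2) ≠ 0]
    have h1 : (marked s₁ n).length =
        ((List.finRange n).filter fun v : Fin n => s₁.a .MARK ((v : ℕ) + 2) ≠ 0).length := by
      rw [marked, hnat, List.length_map]
    have h2 : (chosen s₂ N L.length).length = (((List.finRange L.length).filter fun e : Fin L.length =>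
        s₂.a .CUR (N + 1 + (e : ℕ)) ≠ s₂.a .CODE 0).map fun e : Fin L.length => L[e]).length := by
      rw [chosen, hnat, List.length_map, List.length_map]
    rw [← h1, ← h2, chosen, hnat, marked, List.cons_append]
    congr 3
    rw [pairWords, List.flatMap_map, List.flatMap_map]
    congr 1
    funext e
    have k1 := hv.E_fst e
    have k2 := hv.E_snd e
    rw [k1, k2]

end RAM

/-! ## The program: input -/

namespace RAM
open BinTree Cmd

section
variable {inp : ℕ → ℕ} {len n N : ℕ} {L : List (Fin n × Fin n)} {F : List (Fin N × Fin N)}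
  {X : Fin N → List (Fin n)} {bp : ℕ → ℕ} (hv : InputView inp len L F X bp)
include hv

theorem _root_.BinTree.InputView.bp_mono {i j : ℕ} (hij : i ≤ j) (hj : j ≤ N) : bp i ≤ bp j := by
  induction j, hij using Nat.le_induction with
  | base => exact le_rfl
  | succ j hij ih =>
    have := hv.bp_succ ⟨j, by omega⟩
    have := ih (by omega)
    simp only at *
    omega

theorem _root_.BinTree.InputView.bp_lt (i : Fin N) {j : ℕ} (hj : j ≤ (X i).length) : bp i + j < len := by
  have h1 := hv.bp_mono (i := i + 1) (j := N) (by omega) le_rfl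
  have h2 := hv.bp_succ i
  have h3 := hv.bp_last
  omega

theorem _root_.BinTree.InputView.bp_zero_le : 3 + 2 * L.length + 2 * F.length ≤ len := by
  have h1 := hv.bp_mono (i := 0) (j := N) (by omega) le_rfl
  have h2 := hv.bp_zero
  have h3 := hv.bp_last
  omega

end

/-- The maximum size of a bag. -/
def bagMax {n N : ℕ} (X : Fin N → List (Fin n)) : ℕ := Finset.univ.sup fun i => (X i).length

theorem le_bagMax {n N : ℕ} (X : Fin N → List (Fin n)) (i : Fin N) : (X i).length ≤ bagMax X :=
  Finset.le_sup (f := fun i => (X i).length) (Finset.mem_univ i)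

/-- The bounds suffice for a graph with `n` vertices and `m` edges and a tree decomposition with
`N` bags of at most `k` vertices. -/
structure Suffices (E : Env) (n m N k : ℕ) : Prop where
  n_lim : n ≤ E.lim .n
  m_lim : m ≤ E.lim .m
  N_lim : N ≤ E.lim .N
  M_lim : N + 1 + m + n ≤ E.lim .M
  M1_lim : N + 1 + m + n ≤ E.lim .M1
  K_lim : k + 2 ≤ E.lim .K
  S_lim : (4 * (k + 2)) ^ (k + 2) ≤ E.lim .S
  B_ge : (N + 1 + m + n) * (4 * (k + 2)) ^ (k + 2) ≤ E.B
  len_le : E.len ≤ E.B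

theorem Suffices.S_ge {E : Env} {n m N k : ℕ} (_ : Suffices E n m N k) :
    8 * (4 * (k + 2)) ≤ (4 * (k + 2)) ^ (k + 2) := by
  calc 8 * (4 * (k + 2)) ≤ (4 * (k + 2)) * (4 * (k + 2)) := Nat.mul_le_mul_right _ (by omega)
    _ = (4 * (k + 2)) ^ 2 := (sq _).symm
    _ ≤ _ := Nat.pow_le_pow_right (by omega) (by omega)

theorem Suffices.M_le {E : Env} {n m N k : ℕ} (h : Suffices E n m N k) :
    (N + 1 + m + n) * (8 * (4 * (k + 2))) ≤ E.B :=
  (Nat.mul_le_mul_left _ h.S_ge).trans h.B_ge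

theorem Suffices.M_le' {E : Env} {n m N k : ℕ} (h : Suffices E n m N k) :
    64 * (N + 1 + m + n) ≤ E.B := by
  refine le_trans ?_ h.M_le
  rw [mul_comm]
  exact Nat.mul_le_mul_left _ (by omega)

theorem Suffices.S_le {E : Env} {n m N k : ℕ} (h : Suffices E n m N k) :
    (4 * (k + 2)) ^ (k + 2) ≤ E.B :=
  (Nat.le_mul_of_pos_left _ (by omega)).trans h.B_ge

/-- The variables after parsing. -/
structure Parsed (n m N k : ℕ) (s : St) : Prop where
  n_eq : s.v .n = n
  m_eq : s.v .m = m
  N_eq : s.v .N = N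
  N1_eq : s.v .N1 = N + 1
  M_eq : s.v .M = N + 1 + m + n
  M1_eq : s.v .M1 = N + m + n
  K_eq : s.v .K = k + 2
  D_eq : s.v .D = 4 * (k + 2)
  S_eq : s.v .S = (4 * (k + 2)) ^ (k + 2)

theorem Parsed.of_frame {n m N k : ℕ} {s s' : St} {p : Cmd} (h : Parsed n m N k s) (hf : p.Frame s s')
    (hp : ∀ x ∈ [Var.n, .m, .N, .N1, .M, .M1, .K, .D, .S], p.mods x = false) : Parsed n m N k s' := by
  simp only [List.mem_cons, List.not_mem_nil, or_false, forall_eq_or_imp, forall_eq] at hp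
  obtain ⟨h1, h2, h3, h4, h5, h6, h7, h8, h9⟩ := hp
  exact ⟨(hf.v _ h1).trans h.n_eq, (hf.v _ h2).trans h.m_eq, (hf.v _ h3).trans h.N_eq, (hf.v _ h4).trans h.N1_eq,
    (hf.v _ h5).trans h.M_eq, (hf.v _ h6).trans h.M1_eq, (hf.v _ h7).trans h.K_eq, (hf.v _ h8).trans h.D_eq,
    (hf.v _ h9).trans h.S_eq⟩

/-- Reads the numbers in the input and finds the bags. -/
def parse : Cmd :=
  .set .n (.inp (.c 0)) ;; .set .m (.inp (.c 1)) ;; .set .N (.inp (.c 2)) ;;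
  .set .N1 (.v .N + .c 1) ;; .set .M (.v .N1 + .v .m + .v .n) ;; .set .M1 (.v .M - .c 1) ;;
  -- The number of tree edges is not stored in the input; it is `N - 1`.
  .set .pos (.c 3 + .c 2 * .v .m + .c 2 * (.v .N - .c 1)) ;;
  .for_ .i .N (.st .BP (.v .i) (.v .pos) ;; .set .u (.inp (.v .pos)) ;;
    .ite (.lt (.v .kmax) (.v .u)) (.set .kmax (.v .u)) .skip ;;
    .set .pos (.v .pos + .c 1 + .v .u)) ;;
  -- One position for the apex, `kmax` for a bag and one in reserve, so that there are always the
  -- three positions of an edge row, even when all bags are singletons.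
  .set .K (.v .kmax + .c 2) ;; .set .D (.c 4 * .v .K) ;; .set .S (.c 1) ;;
  .for_ .j .K (.set .S (.v .S * .v .D))

theorem parse_spec {E : Env} {n N : ℕ} {L : List (Fin n × Fin n)} {F : List (Fin N × Fin N)}
    {X : Fin N → List (Fin n)} {bp : ℕ → ℕ} (hv : InputView E.inp E.len L F X bp) (hN : 0 < N)
    (hF : F.length = N - 1) (hE : Suffices E n L.length N (bagMax X)) :
    Spec E parse St.zero fun s => Parsed n L.length N (bagMax X) s ∧ ∀ i < N, s.a .BP i = bp i := by
  have hlen := hv.bp_zero_le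
  have hM := hE.M_le'
  have hMk := hE.M_le
  have hl := hE.len_le
  have hS := hE.S_le
  set m := L.length with hm
  set k := bagMax X with hk
  have hkB : 32 * (k + 2) ≤ E.B := by
    refine le_trans ?_ (le_trans hE.S_ge hS); omega
  unfold parse
  simp only [spec_set_seq, Ex.ok_inp, Ex.ok_c, Ex.ok_v, Ex.ok_add, Ex.ok_sub, Ex.ok_mul, Ex.ev_inp,
    Ex.ev_c, Ex.ev_v, Ex.ev_add, Ex.ev_sub, Ex.ev_mul, St.setv_v, reduceCtorEq, if_true, if_false,
    hv.n_eq, hv.m_eq, hv.N_eq, ← hm, true_and]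
  refine ⟨by omega, by omega, by omega, by omega, by omega, by omega, by omega, ?_⟩
  refine Spec.seq (R := fun s => s.v .kmax = k ∧ ∀ i < N, s.a .BP i = bp i) ?_ ?_
  · refine spec_for (fun i s => s.v .pos = bp i ∧ s.v .kmax ≤ k ∧
      (∀ i' : Fin N, (i' : ℕ) < i → (X i').length ≤ s.v .kmax) ∧ ∀ i' < i, s.a .BP i' = bp i')
      rfl ?_ ?_ ?_ ?_
    · simpa using hE.N_lim
    · refine ⟨?_, by simp [St.zero], fun i' h => absurd h (by omega), fun i' h => absurd h (by omega)⟩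
      simp [hv.bp_zero, hF, hm]
    · intro i hi s₁ hf₁ hx₁ ⟨h1, h2, h3, h4⟩
      have hi' : i < N := by simpa using hi
      have hsz := hv.size ⟨i, hi'⟩
      have hlt := hv.bp_lt ⟨i, hi'⟩ (j := (X ⟨i, hi'⟩).length) le_rfl
      have hsucc := hv.bp_succ ⟨i, hi'⟩
      have hmax := le_bagMax X ⟨i, hi'⟩
      simp only at hsz hlt hsucc
      have hle : bp (i + 1) ≤ E.len := by rw [← hv.bp_last]; exact hv.bp_mono (by omega) le_rfl
      simp only [spec_st_seq, spec_set_seq, Ex.ok_inp, Ex.ok_v, Ex.ev_inp, Ex.ev_v, St.seta_v, hx₁, h1,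
        true_and, hsz]
      refine ⟨by omega, ?_⟩
      refine Spec.seq (R := fun s => (s.v .kmax ≤ k ∧ s₁.v .kmax ≤ s.v .kmax ∧
        (X ⟨i, hi'⟩).length ≤ s.v .kmax)) ?_ ?_
      · rw [spec_ite]
        refine ⟨by simp, ?_⟩
        by_cases hc : s₁.v .kmax < (X ⟨i, hi'⟩).length
        · simp [hc, hmax, hc.le, hk]
        · simp [hc]; omega
      intro s₂ hf₂ ⟨k1, k2, k3⟩
      have e1 : s₂.v .pos = bp i := by rw [hf₂.v _ rfl]; simpa using h1
      have e2 : s₂.v .u = (X ⟨i, hi'⟩).length := by rw [hf₂.v _ rfl]; simp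
      have e3 : s₂.a .BP = Function.update (s₁.a .BP) i (bp i) := by rw [hf₂.a _ rfl]; simp
      simp only [spec_set, Ex.ok_add, Ex.ok_v, Ex.ok_c, Ex.ev_add, Ex.ev_v, Ex.ev_c, St.setv_v,
        St.setv_a, reduceCtorEq, if_true, if_false, e1, e2, e3, true_and]
      refine ⟨by omega, by omega, k1, fun i' hi'' => ?_, fun i' hi'' => ?_⟩
      · by_cases hc : (i' : ℕ) = i
        · have : i' = ⟨i, hi'⟩ := Fin.ext hc
          rw [this]; exact k3
        · exact (h3 i' (by omega)).trans k2
      · by_cases hc : i' = i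
        · subst hc; simp
        · rw [Function.update_of_ne hc]; exact h4 i' (by omega)
    · intro s₁ hf₁ hx₁ ⟨h1, h2, h3, h4⟩
      simp only [St.setv_v, reduceCtorEq, if_true, if_false] at h3 h4
      refine ⟨le_antisymm h2 (Finset.sup_le fun i _ => h3 i i.2), h4⟩
  intro s₁ hf₁ ⟨hkm, hBP⟩
  simp only [spec_set_seq, Ex.ok_c, Ex.ok_v, Ex.ok_add, Ex.ok_mul,
    Ex.ev_c, Ex.ev_v, Ex.ev_add, Ex.ev_mul, St.setv_v, reduceCtorEq, if_true, if_false, hkm, true_and]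
  refine ⟨by omega, by omega, by omega, ?_⟩
  refine spec_for (fun j s => s.v .S = (4 * (k + 2)) ^ j) rfl ?_ ?_ ?_ ?_
  · simpa using hE.K_lim
  · simp
  · intro j hj s₂ hf₂ hx₂ h1
    have hj' : j < k + 2 := by simpa using hj
    have e1 : s₂.v .D = 4 * (k + 2) := by rw [hf₂.v _ rfl]; simp
    have h3 : (4 * (k + 2)) ^ (j + 1) ≤ E.B :=
      le_trans (Nat.pow_le_pow_right (by omega) (by omega)) hS
    simp only [spec_set, Ex.ok_mul, Ex.ok_v, Ex.ev_mul, Ex.ev_v, St.setv_v, reduceCtorEq, if_true,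
      if_false, h1, e1, true_and, ← pow_succ]
    exact ⟨h3, trivial⟩
  · intro s₂ hf₂ hx₂ h1
    simp only [St.setv_v, reduceCtorEq, if_true, if_false] at h1
    refine ⟨⟨?_, ?_, ?_, ?_, ?_, ?_, ?_, ?_, h1⟩, fun i hi => ?_⟩
    · rw [hf₂.v _ rfl]
      simp only [St.setv_v, reduceCtorEq, if_true, if_false]
      rw [hf₁.v _ rfl]; simp
    · rw [hf₂.v _ rfl]
      simp only [St.setv_v, reduceCtorEq, if_true, if_false]
      rw [hf₁.v _ rfl]; simp
    · rw [hf₂.v _ rfl]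
      simp only [St.setv_v, reduceCtorEq, if_true, if_false]
      rw [hf₁.v _ rfl]; simp
    · rw [hf₂.v _ rfl]
      simp only [St.setv_v, reduceCtorEq, if_true, if_false]
      rw [hf₁.v _ rfl]; simp
    · rw [hf₂.v _ rfl]
      simp only [St.setv_v, reduceCtorEq, if_true, if_false]
      rw [hf₁.v _ rfl]; simp
    · rw [hf₂.v _ rfl]
      simp only [St.setv_v, reduceCtorEq, if_true, if_false]
      rw [hf₁.v _ rfl]
      simp only [St.setv_v, reduceCtorEq, if_true, if_false]
      omega
    · rw [hf₂.v _ rfl]; simp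
    · rw [hf₂.v _ rfl]; simp
    · rw [hf₂.a _ rfl]; simpa using hBP i hi

end RAM

/-! ## Elimination orders of trees -/

namespace BinTree

open Classical in
/-- The set `R` of vertices induces a connected graph with `R.card - 1` edges; `deg` and `sum`
are the numbers and the sums modulo `N` of the neighbours in `R`. -/
structure Remaining (adj : ℕ → ℕ → Prop) (N : ℕ) (R : Finset ℕ) (deg sum : ℕ → ℕ) : Prop where
  lt : ∀ v ∈ R, v < N
  deg_eq : ∀ v ∈ R, deg v = (R.filter (adj v)).card
  sum_eq : ∀ v ∈ R, sum v = (∑ w ∈ R.filter (adj v), w) % N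
  cut : ∀ A ⊆ R, A.Nonempty → A ≠ R → ∃ a ∈ A, ∃ b ∈ R, b ∉ A ∧ adj a b
  total : R.Nonempty → ∑ v ∈ R, deg v + 2 = 2 * R.card

namespace Remaining

variable {adj : ℕ → ℕ → Prop} {N : ℕ} {R : Finset ℕ} {deg sum : ℕ → ℕ}

/-- The sum of the degrees is `2 * R.card - 2`, so they cannot all be at least two. -/
theorem exists_leaf (h : Remaining adj N R deg sum) (hR : R.Nonempty) : ∃ v ∈ R, deg v < 2 := by
  by_contra hc
  push Not at hc
  have h1 := Finset.card_nsmul_le_sum R deg 2 hc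
  have h2 : R.sum deg + 2 = 2 * R.card := h.total hR
  rw [smul_eq_mul] at h1
  omega

theorem eq_singleton (h : Remaining adj N R deg sum) {u : ℕ} (hu : u ∈ R) (hd : deg u = 0) :
    R = {u} := by
  classical
  by_contra hne
  obtain ⟨a, ha, b, hb, hba, hab⟩ := h.cut {u} (Finset.singleton_subset_iff.2 hu)
    (Finset.singleton_nonempty u) (Ne.symm hne)
  rw [Finset.mem_singleton] at ha
  subst ha
  rw [h.deg_eq a hu, Finset.card_eq_zero, Finset.filter_eq_empty_iff] at hd
  exact hd hb hab

/-- The sum over a single neighbour is that neighbour, and the reduction modulo `N` is harmless for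
a number below `N`. This replaces adjacency lists. -/
theorem neighbour (h : Remaining adj N R deg sum) {u : ℕ} (hu : u ∈ R) (hd : deg u = 1) :
    sum u ∈ R ∧ ∀ w ∈ R, adj u w ↔ w = sum u := by
  classical
  rw [h.deg_eq u hu, Finset.card_eq_one] at hd
  obtain ⟨p, hp⟩ := hd
  have hpm : p ∈ R ∧ adj u p := by
    rw [← Finset.mem_filter]
    convert Finset.mem_singleton_self p
  have hs : sum u = p := by
    rw [h.sum_eq u hu, hp, Finset.sum_singleton, Nat.mod_eq_of_lt (h.lt p hpm.1)]
  rw [hs]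
  refine ⟨hpm.1, fun w hw => ⟨fun h => ?_, fun h => h ▸ hpm.2⟩⟩
  rw [← Finset.mem_singleton, ← hp, Finset.mem_filter]
  exact ⟨hw, h⟩

/-- Removing a leaf changes the data of its neighbour only. Connectedness survives because the only
edge at the leaf leads to that neighbour. -/
theorem erase (h : Remaining adj N R deg sum) (hsymm : ∀ u v, adj u v → adj v u)
    (hirr : ∀ u, ¬ adj u u) {u : ℕ} (hu : u ∈ R) (hd : deg u = 1) :
    Remaining adj N (R.erase u) (Function.update deg (sum u) (deg (sum u) - 1))
      (Function.update sum (sum u) ((sum (sum u) + N - u) % N)) := by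
  classical
  obtain ⟨hp, hadj⟩ := h.neighbour hu hd
  set p := sum u with hpd
  have hpu : adj p u := hsymm _ _ ((hadj p hp).2 rfl)
  have hne : p ≠ u := by rintro h; rw [h] at hpu; exact hirr _ hpu
  have hf : ∀ v ∈ R, v ≠ p → (R.erase u).filter (adj v) = R.filter (adj v) := by
    intro v hv hvp
    ext w
    simp only [Finset.mem_filter, Finset.mem_erase]
    constructor
    · exact fun h => ⟨h.1.2, h.2⟩
    · rintro ⟨h1, h2⟩
      refine ⟨⟨?_, h1⟩, h2⟩
      rintro rfl
      exact hvp ((hadj v hv).1 (hsymm _ _ h2))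
  have hfp : insert u ((R.erase u).filter (adj p)) = R.filter (adj p) := by
    ext w
    simp only [Finset.mem_insert, Finset.mem_filter, Finset.mem_erase]
    constructor
    · rintro (rfl | h)
      · exact ⟨hu, hpu⟩
      · exact ⟨h.1.2, h.2⟩
    · rintro ⟨h1, h2⟩
      by_cases hwu : w = u
      · exact Or.inl hwu
      · exact Or.inr ⟨⟨hwu, h1⟩, h2⟩
  have hnm : u ∉ (R.erase u).filter (adj p) := by simp
  have hcard : deg p = ((R.erase u).filter (adj p)).card + 1 := by
    rw [← Finset.card_insert_of_notMem hnm, hfp, h.deg_eq p hp]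
  have hsum : sum p = (u + ∑ w ∈ (R.erase u).filter (adj p), w) % N := by
    rw [← Finset.sum_insert (f := fun w => w) hnm, hfp, h.sum_eq p hp]
  have hN : u < N := h.lt u hu
  refine ⟨fun v hv => h.lt v (Finset.mem_of_mem_erase hv), fun v hv => ?_, fun v hv => ?_, ?_, ?_⟩
  · by_cases hvp : v = p
    · subst hvp
      rw [Function.update_self, hcard, Nat.add_sub_cancel]
    · rw [Function.update_of_ne hvp, h.deg_eq v (Finset.mem_of_mem_erase hv)]
      have := hf v (Finset.mem_of_mem_erase hv) hvp
      rw [← this]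
  · by_cases hvp : v = p
    · subst hvp
      rw [Function.update_self, hsum]
      -- The summand `N` keeps the subtraction of `u` from being truncated.
      set t := ∑ w ∈ (R.erase u).filter (adj p), w with ht
      have h1 : ((u + t) % N + N - u) % N = t % N := by
        rw [Nat.add_sub_assoc hN.le, Nat.mod_add_mod, show u + t + (N - u) = t + N by omega,
          Nat.add_mod_right]
      rw [h1]
    · rw [Function.update_of_ne hvp, h.sum_eq v (Finset.mem_of_mem_erase hv)]
      have := hf v (Finset.mem_of_mem_erase hv) hvp
      rw [← this]
  · intro A hA hne' hAR
    have huA : u ∉ A := fun h => Finset.notMem_erase u R (hA h)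
    -- The leaf `u` is put on the side of its neighbour `p`, so that no crossing edge ends in `u`.
    by_cases hpA : p ∈ A
    · obtain ⟨a, ha, b, hb, hba, hab⟩ := h.cut (insert u A)
        (Finset.insert_subset hu (hA.trans (Finset.erase_subset _ _))) (Finset.insert_nonempty _ _)
        (by rintro rfl; rw [Finset.erase_insert huA] at hAR; exact hAR rfl)
      rw [Finset.mem_insert, not_or] at hba
      rw [Finset.mem_insert] at ha
      refine ⟨a, ?_, b, Finset.mem_erase.2 ⟨hba.1, hb⟩, hba.2, hab⟩
      rcases ha with rfl | ha
      · rw [hadj b hb] at hab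
        exact absurd (hab ▸ hpA) hba.2
      · exact ha
    · obtain ⟨a, ha, b, hb, hba, hab⟩ := h.cut A (hA.trans (Finset.erase_subset _ _)) hne'
        (by rintro rfl; exact huA hu)
      refine ⟨a, ha, b, Finset.mem_erase.2 ⟨?_, hb⟩, hba, hab⟩
      rintro rfl
      have := (hadj a (Finset.mem_of_mem_erase (hA ha))).1 (hsymm _ _ hab)
      exact hpA (this ▸ ha)
  · intro _
    have h1 := h.total ⟨u, hu⟩
    have hpe : p ∈ R.erase u := Finset.mem_erase.2 ⟨hne, hp⟩
    rw [← Finset.add_sum_erase _ deg hu, ← Finset.add_sum_erase _ deg hpe] at h1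
    rw [← Finset.add_sum_erase _ _ hpe, Function.update_self, Finset.card_erase_of_mem hu,
      Finset.sum_congr rfl fun v hv => Function.update_of_ne (Finset.mem_erase.1 hv).1 _ _]
    have h2 : 0 < R.card := Finset.card_pos.2 ⟨u, hu⟩
    omega

end Remaining

/-- `qu 0, …, qu (N - 1)` lists the vertices of a tree such that every vertex except for the last
has exactly one later neighbour, its parent `pr`. -/
structure ElimOrder (adj : ℕ → ℕ → Prop) (N : ℕ) (qu pr : ℕ → ℕ) : Prop where
  lt : ∀ h < N, qu h < N
  inj : ∀ h < N, ∀ k < N, qu h = qu k → h = k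
  adj_iff : ∀ h k, h < k → k < N → (adj (qu h) (qu k) ↔ qu k = pr (qu h))
  par : ∀ h, h + 1 < N → ∃ k, h < k ∧ k < N ∧ pr (qu h) = qu k

theorem exists_index {N : ℕ} {qu : ℕ → ℕ} (lt : ∀ h < N, qu h < N)
    (inj : ∀ h < N, ∀ k < N, qu h = qu k → h = k) {v : ℕ} (hv : v < N) : ∃ h < N, qu h = v := by
  have hi : Set.InjOn qu (Finset.range N) := fun a ha b hb h =>
    inj a (Finset.mem_range.1 ha) b (Finset.mem_range.1 hb) h
  have : (Finset.range N).image qu = Finset.range N := by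
    refine Finset.eq_of_subset_of_card_le (fun x hx => ?_) ?_
    · obtain ⟨h, hh, rfl⟩ := Finset.mem_image.1 hx
      exact Finset.mem_range.2 (lt h (Finset.mem_range.1 hh))
    · rw [Finset.card_image_of_injOn hi]
  have hv' := Finset.mem_range.2 hv
  rw [← this, Finset.mem_image] at hv'
  obtain ⟨h, hh, e⟩ := hv'
  exact ⟨h, Finset.mem_range.1 hh, e⟩

/-- The situation after the vertices `qu 0, …, qu (h - 1)` have been removed from a tree; the queue
ends at `tail`. -/
structure Stripped (adj : ℕ → ℕ → Prop) (N h tail : ℕ) (qu pr deg sum : ℕ → ℕ) : Prop where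
  le_tail : h ≤ tail
  lt : ∀ k < tail, qu k < N
  inj : ∀ k < tail, ∀ l < tail, qu k = qu l → k = l
  remaining : Remaining adj N (Finset.range N \ (Finset.range h).image qu) deg sum
  leaf_iff : ∀ v ∈ Finset.range N \ (Finset.range h).image qu, deg v < 2 ↔ ∃ k < tail, qu k = v
  adj_iff : ∀ k < h, ∀ w ∈ Finset.range N \ (Finset.range (k + 1)).image qu,
    adj (qu k) w ↔ w = pr (qu k)
  par : ∀ k < h, k + 1 < N → pr (qu k) ∈ Finset.range N \ (Finset.range (k + 1)).image qu

namespace Stripped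

variable {adj : ℕ → ℕ → Prop} {N h tail : ℕ} {qu pr deg sum : ℕ → ℕ}

theorem tail_le (hs : Stripped adj N h tail qu pr deg sum) : tail ≤ N := by
  have : ((Finset.range tail).image qu) ⊆ Finset.range N := by
    intro x hx
    obtain ⟨k, hk, rfl⟩ := Finset.mem_image.1 hx
    exact Finset.mem_range.2 (hs.lt k (Finset.mem_range.1 hk))
  have h1 := Finset.card_le_card this
  rwa [Finset.card_image_of_injOn, Finset.card_range, Finset.card_range] at h1
  exact fun a ha b hb hab => hs.inj a (Finset.mem_range.1 ha) b (Finset.mem_range.1 hb) hab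

theorem card (hs : Stripped adj N h tail qu pr deg sum) :
    (Finset.range N \ (Finset.range h).image qu).card = N - h := by
  rw [Finset.card_sdiff_of_subset, Finset.card_image_of_injOn, Finset.card_range, Finset.card_range]
  · intro a ha b hb hab
    have ha := Finset.mem_range.1 ha
    have hb := Finset.mem_range.1 hb
    have := hs.le_tail
    exact hs.inj a (by omega) b (by omega) hab
  · intro x hx
    obtain ⟨k, hk, rfl⟩ := Finset.mem_image.1 hx
    have hk := Finset.mem_range.1 hk
    have := hs.le_tail
    exact Finset.mem_range.2 (hs.lt k (by omega))

/-- The queue never runs dry: what remains has a vertex of degree below two, and every such vertex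
has been queued. -/
theorem lt_tail (hs : Stripped adj N h tail qu pr deg sum) (hN : h < N) : h < tail := by
  have hne : (Finset.range N \ (Finset.range h).image qu).Nonempty := by
    rw [← Finset.card_pos, hs.card]; omega
  obtain ⟨v, hv, hd⟩ := hs.remaining.exists_leaf hne
  obtain ⟨k, hk, rfl⟩ := (hs.leaf_iff v hv).1 hd
  by_contra hc
  rw [Finset.mem_sdiff] at hv
  exact hv.2 (Finset.mem_image.2 ⟨k, Finset.mem_range.2 (by omega), rfl⟩)

theorem mem (hs : Stripped adj N h tail qu pr deg sum) (hN : h < N) :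
    qu h ∈ Finset.range N \ (Finset.range h).image qu := by
  have ht := hs.lt_tail hN
  rw [Finset.mem_sdiff, Finset.mem_range]
  refine ⟨hs.lt h ht, fun hm => ?_⟩
  obtain ⟨k, hk, e⟩ := Finset.mem_image.1 hm
  have hk := Finset.mem_range.1 hk
  have := hs.inj k (by omega) h ht e
  omega

theorem deg_lt (hs : Stripped adj N h tail qu pr deg sum) (hN : h < N) : deg (qu h) < 2 :=
  (hs.leaf_iff _ (hs.mem hN)).2 ⟨h, hs.lt_tail hN, rfl⟩

theorem sdiff_succ : Finset.range N \ (Finset.range (h + 1)).image qu =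
    (Finset.range N \ (Finset.range h).image qu).erase (qu h) := by
  ext w
  simp only [Finset.mem_sdiff, Finset.mem_erase, Finset.mem_image, Finset.mem_range]
  constructor
  · rintro ⟨h1, h2⟩
    exact ⟨fun e => h2 ⟨h, by omega, e.symm⟩, h1, fun ⟨k, hk, e⟩ => h2 ⟨k, by omega, e⟩⟩
  · rintro ⟨h1, h2, h3⟩
    refine ⟨h2, fun ⟨k, hk, e⟩ => ?_⟩
    by_cases hkh : k = h
    · subst hkh; exact h1 e.symm
    · exact h3 ⟨k, by omega, e⟩

theorem elimOrder (hs : Stripped adj N N tail qu pr deg sum) : ElimOrder adj N qu pr := by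
  have ht : tail = N := le_antisymm hs.tail_le hs.le_tail
  have hlt := hs.lt
  have hinj := hs.inj
  rw [ht] at hlt hinj
  refine ⟨hlt, hinj, fun k l hkl hl => ?_, fun k hk => ?_⟩
  · refine hs.adj_iff k (by omega) _ ?_
    rw [Finset.mem_sdiff, Finset.mem_range]
    refine ⟨hlt l hl, fun hm => ?_⟩
    obtain ⟨i, hi, e⟩ := Finset.mem_image.1 hm
    have hi := Finset.mem_range.1 hi
    have := hinj i (by omega) l hl e
    omega
  · have h1 := hs.par k (by omega) hk
    rw [Finset.mem_sdiff, Finset.mem_range] at h1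
    obtain ⟨l, hl, e⟩ := exists_index hlt hinj h1.1
    refine ⟨l, ?_, hl, e.symm⟩
    by_contra hc
    exact h1.2 (Finset.mem_image.2 ⟨l, Finset.mem_range.2 (by omega), e⟩)

/-- The removal of the last vertex. -/
theorem last (hs : Stripped adj N h tail qu pr deg sum) (hN : h < N) (hd : deg (qu h) = 0) :
    Stripped adj N (h + 1) tail qu pr deg sum := by
  have h0 := hs.remaining.eq_singleton (hs.mem hN) hd
  have hcard := hs.card
  rw [h0, Finset.card_singleton] at hcard
  have hemp : Finset.range N \ (Finset.range (h + 1)).image qu = ∅ := by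
    rw [sdiff_succ, h0, Finset.erase_singleton]
  refine ⟨hs.lt_tail hN, hs.lt, hs.inj, ?_, ?_, ?_, ?_⟩
  · rw [hemp]
    refine ⟨by simp, by simp, by simp, fun A hA hne _ => ?_, by simp⟩
    rw [Finset.subset_empty.1 hA] at hne
    exact absurd hne Finset.not_nonempty_empty
  · rw [hemp]; simp
  · intro k hk w hw
    by_cases hkh : k = h
    · subst hkh
      rw [hemp] at hw
      exact absurd hw (Finset.notMem_empty _)
    · exact hs.adj_iff k (by omega) w hw
  · intro k hk hkN
    exact hs.par k (by omega) hkN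

/-- The removal of a leaf, if its neighbour does not become a new leaf. -/
theorem step (hs : Stripped adj N h tail qu pr deg sum) (hsymm : ∀ u v, adj u v → adj v u)
    (hirr : ∀ u, ¬ adj u u) (hN : h < N) (hd : deg (qu h) = 1) {tail' : ℕ} {qu' : ℕ → ℕ}
    (hqu : ∀ k < tail, qu' k = qu k)
    (hpush : deg (sum (qu h)) - 1 = 1 → tail' = tail + 1 ∧ qu' tail = sum (qu h))
    (hnot : deg (sum (qu h)) - 1 ≠ 1 → tail' = tail) :
    Stripped adj N (h + 1) tail' qu' (Function.update pr (qu h) (sum (qu h)))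
      (Function.update deg (sum (qu h)) (deg (sum (qu h)) - 1))
      (Function.update sum (sum (qu h)) ((sum (sum (qu h)) + N - qu h) % N)) := by
  have ht := hs.lt_tail hN
  have hm := hs.mem hN
  have hrem := hs.remaining.erase hsymm hirr hm hd
  obtain ⟨hp, hadj⟩ := hs.remaining.neighbour hm hd
  set u := qu h with hu
  set p := sum u with hpd
  have hpu : p ≠ u := by
    intro e
    have := (hadj p hp).2 rfl
    rw [e] at this
    exact hirr _ this
  have himg : ∀ k ≤ tail, (Finset.range k).image qu' = (Finset.range k).image qu := fun k hk =>
    Finset.image_congr fun i hi => hqu i (by have := Finset.mem_range.1 hi; omega)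
  -- If `p` becomes a leaf now, its degree was two, so it is not in the queue yet.
  have hnew : deg p - 1 = 1 → ∀ k < tail, qu k ≠ p := by
    intro h1 k hk e
    have := (hs.leaf_iff p hp).2 ⟨k, hk, e⟩
    omega
  have htail : tail ≤ tail' := by
    by_cases h1 : deg p - 1 = 1
    · rw [(hpush h1).1]; omega
    · rw [hnot h1]
  have hcase : ∀ k < tail', k < tail ∨ (deg p - 1 = 1 ∧ k = tail ∧ qu' k = p) := by
    intro k hk
    by_cases h1 : deg p - 1 = 1
    · obtain ⟨h2, h3⟩ := hpush h1
      by_cases h4 : k = tail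
      · subst h4; exact Or.inr ⟨h1, rfl, h3⟩
      · left; omega
    · rw [hnot h1] at hk
      exact Or.inl hk
  have hpN := hs.remaining.lt p hp
  refine ⟨by omega, ?_, ?_, ?_, ?_, ?_, ?_⟩
  · intro k hk
    rcases hcase k hk with h1 | ⟨-, -, h1⟩
    · rw [hqu k h1]; exact hs.lt k h1
    · rw [h1]; exact hpN
  · intro k hk l hl e
    rcases hcase k hk with h1 | ⟨h1, h2, h3⟩ <;> rcases hcase l hl with h4 | ⟨h4, h5, h6⟩
    · rw [hqu k h1, hqu l h4] at e
      exact hs.inj k h1 l h4 e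
    · rw [hqu k h1, h6] at e
      exact absurd e (hnew h4 k h1)
    · rw [hqu l h4, h3] at e
      exact absurd e.symm (hnew h1 l h4)
    · omega
  · rw [himg _ (by omega), sdiff_succ, ← hu]
    exact hrem
  · rw [himg _ (by omega), sdiff_succ, ← hu]
    intro v hv
    have hv' := Finset.mem_of_mem_erase hv
    by_cases hvp : v = p
    · subst hvp
      rw [Function.update_self]
      constructor
      · intro h1
        by_cases h2 : deg p - 1 = 1
        · obtain ⟨h3, h4⟩ := hpush h2
          exact ⟨tail, by omega, h4⟩
        -- The degree of `p` falls to zero; then `p` was a leaf already and is in the queue.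
        · have h3 : deg p < 2 := by omega
          obtain ⟨k, hk, e⟩ := (hs.leaf_iff p hp).1 h3
          exact ⟨k, by omega, by rw [hqu k hk, e]⟩
      · rintro ⟨k, hk, e⟩
        rcases hcase k hk with h1 | ⟨h1, -, -⟩
        · rw [hqu k h1] at e
          have := (hs.leaf_iff p hp).2 ⟨k, h1, e⟩
          omega
        · omega
    · rw [Function.update_of_ne hvp, hs.leaf_iff v hv']
      constructor
      · rintro ⟨k, hk, e⟩; exact ⟨k, by omega, by rw [hqu k hk, e]⟩
      · rintro ⟨k, hk, e⟩
        rcases hcase k hk with h1 | ⟨-, -, h1⟩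
        · exact ⟨k, h1, by rw [← hqu k h1, e]⟩
        · exact absurd (e.symm.trans h1) hvp
  · intro k hk w hw
    rw [himg _ (by omega)] at hw
    rw [hqu k (by omega)]
    by_cases hkh : k = h
    · subst hkh
      rw [← hu, Function.update_self]
      rw [sdiff_succ, ← hu] at hw
      exact hadj w (Finset.mem_of_mem_erase hw)
    · have hne : qu k ≠ u := fun e => hkh (hs.inj k (by omega) h ht e)
      rw [Function.update_of_ne hne]
      exact hs.adj_iff k (by omega) w hw
  · intro k hk hkN
    rw [himg _ (by omega), hqu k (by omega)]
    by_cases hkh : k = h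
    · subst hkh
      rw [← hu, Function.update_self, sdiff_succ, ← hu]
      exact Finset.mem_erase.2 ⟨hpu, hp⟩
    · have hne : qu k ≠ u := fun e => hkh (hs.inj k (by omega) h ht e)
      rw [Function.update_of_ne hne]
      exact hs.par k (by omega) hkN

end Stripped
end BinTree

/-! ## The program: an elimination order of the tree -/

namespace BinTree

/-- The adjacency relation of a graph on `0, …, N - 1`. -/
def natAdj {N : ℕ} (T : SimpleGraph (Fin N)) (u v : ℕ) : Prop :=
  ∃ (hu : u < N) (hv : v < N), T.Adj ⟨u, hu⟩ ⟨v, hv⟩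

theorem natAdj_symm {N : ℕ} (T : SimpleGraph (Fin N)) (u v : ℕ) (h : natAdj T u v) : natAdj T v u := by
  obtain ⟨hu, hv, h⟩ := h
  exact ⟨hv, hu, h.symm⟩

theorem natAdj_irrefl {N : ℕ} (T : SimpleGraph (Fin N)) (u : ℕ) : ¬ natAdj T u u := by
  rintro ⟨hu, hv, h⟩
  exact T.loopless.irrefl _ h

/-- One of the first `i` pairs consists of `u` and `v`. -/
def adjUpto (q : ℕ → ℕ × ℕ) (i u v : ℕ) : Prop := ∃ f < i, q f = (u, v) ∨ q f = (v, u)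

theorem adjUpto_succ {q : ℕ → ℕ × ℕ} {i u v : ℕ} :
    adjUpto q (i + 1) u v ↔ adjUpto q i u v ∨ q i = (u, v) ∨ q i = (v, u) := by
  constructor
  · rintro ⟨f, hf, h⟩
    rcases Nat.lt_succ_iff_lt_or_eq.1 hf with hf | rfl
    · exact Or.inl ⟨f, hf, h⟩
    · exact Or.inr h
  · rintro (⟨f, hf, h⟩ | h)
    · exact ⟨f, by omega, h⟩
    · exact ⟨i, by omega, h⟩

theorem adjUpto_symm {q : ℕ → ℕ × ℕ} {i u v : ℕ} (h : adjUpto q i u v) : adjUpto q i v u := by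
  obtain ⟨f, hf, h⟩ := h
  exact ⟨f, hf, h.symm⟩

open Classical in
/-- `deg` and `sum` are the numbers and the sums modulo `N` of the neighbours along the first `i`
edges. -/
structure Counts (q : ℕ → ℕ × ℕ) (N i : ℕ) (deg sum : ℕ → ℕ) : Prop where
  deg_eq : ∀ v < N, deg v = ((Finset.range N).filter (adjUpto q i v)).card
  sum_eq : ∀ v < N, sum v = (∑ w ∈ (Finset.range N).filter (adjUpto q i v), w) % N
  total : (Finset.range N).sum deg = 2 * i

theorem Counts.deg_le {q : ℕ → ℕ × ℕ} {N i : ℕ} {deg sum : ℕ → ℕ} (h : Counts q N i deg sum) {v : ℕ}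
    (hv : v < N) : deg v ≤ N := by
  classical
  rw [h.deg_eq v hv]
  exact (Finset.card_le_card (Finset.filter_subset _ _)).trans_eq (Finset.card_range N)

theorem Counts.sum_lt {q : ℕ → ℕ × ℕ} {N i : ℕ} {deg sum : ℕ → ℕ} (h : Counts q N i deg sum) {v : ℕ}
    (hv : v < N) : sum v < N := by
  rw [h.sum_eq v hv]
  exact Nat.mod_lt _ (by omega)

theorem Counts.zero {q : ℕ → ℕ × ℕ} {N : ℕ} {deg sum : ℕ → ℕ} (hd : ∀ v, deg v = 0)
    (hs : ∀ v, sum v = 0) : Counts q N 0 deg sum := by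
  classical
  have h : ∀ v, (Finset.range N).filter (adjUpto q 0 v) = ∅ := by
    intro v
    refine Finset.filter_eq_empty_iff.2 fun w _ => ?_
    rintro ⟨f, hf, -⟩
    exact absurd hf (Nat.not_lt_zero _)
  exact ⟨fun v _ => by rw [hd, h]; rfl, fun v _ => by rw [hs, h]; simp, by simp [hd]⟩

theorem Counts.succ {q : ℕ → ℕ × ℕ} {N i a b : ℕ} {deg sum deg' sum' : ℕ → ℕ}
    (h : Counts q N i deg sum) (hq : q i = (a, b)) (ha : a < N) (hb : b < N) (hab : a ≠ b)
    (hnew : ¬ adjUpto q i a b)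
    (hd : ∀ v, deg' v = if v = a ∨ v = b then deg v + 1 else deg v)
    (hs : ∀ v, sum' v = if v = a then (sum a + b) % N else if v = b then (sum b + a) % N else sum v) :
    Counts q N (i + 1) deg' sum' := by
  classical
  have hnew' : ¬ adjUpto q i b a := fun h => hnew (adjUpto_symm h)
  have fa : (Finset.range N).filter (adjUpto q (i + 1) a) =
      insert b ((Finset.range N).filter (adjUpto q i a)) := by
    ext w
    simp only [Finset.mem_filter, Finset.mem_range, Finset.mem_insert, adjUpto_succ, hq, Prod.mk.injEq]
    constructor
    · rintro ⟨h1, h2 | ⟨-, h2⟩ | ⟨-, h2⟩⟩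
      · exact Or.inr ⟨h1, h2⟩
      · exact Or.inl h2.symm
      · exact absurd h2.symm hab
    · rintro (rfl | ⟨h1, h2⟩)
      · exact ⟨hb, Or.inr (Or.inl ⟨trivial, rfl⟩)⟩
      · exact ⟨h1, Or.inl h2⟩
  have fb : (Finset.range N).filter (adjUpto q (i + 1) b) =
      insert a ((Finset.range N).filter (adjUpto q i b)) := by
    ext w
    simp only [Finset.mem_filter, Finset.mem_range, Finset.mem_insert, adjUpto_succ, hq, Prod.mk.injEq]
    constructor
    · rintro ⟨h1, h2 | ⟨h2, -⟩ | ⟨h2, -⟩⟩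
      · exact Or.inr ⟨h1, h2⟩
      · exact absurd h2 hab
      · exact Or.inl h2.symm
    · rintro (rfl | ⟨h1, h2⟩)
      · exact ⟨ha, Or.inr (Or.inr ⟨rfl, trivial⟩)⟩
      · exact ⟨h1, Or.inl h2⟩
  have fo : ∀ v, v ≠ a → v ≠ b → (Finset.range N).filter (adjUpto q (i + 1) v) =
      (Finset.range N).filter (adjUpto q i v) := by
    intro v h1 h2
    refine Finset.filter_congr fun w _ => ?_
    simp only [adjUpto_succ, hq, Prod.mk.injEq, Ne.symm h1, Ne.symm h2, false_and, and_false, or_false]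
  have na : b ∉ (Finset.range N).filter (adjUpto q i a) := fun h => hnew (Finset.mem_filter.1 h).2
  have nb : a ∉ (Finset.range N).filter (adjUpto q i b) := fun h => hnew' (Finset.mem_filter.1 h).2
  refine ⟨fun v hv => ?_, fun v hv => ?_, ?_⟩
  · rw [hd]
    by_cases h1 : v = a
    · rw [if_pos (Or.inl h1), h1, fa, Finset.card_insert_of_notMem na, h.deg_eq a ha]
    · by_cases h2 : v = b
      · rw [if_pos (Or.inr h2), h2, fb, Finset.card_insert_of_notMem nb, h.deg_eq b hb]
      · rw [if_neg (by tauto), fo v h1 h2, h.deg_eq v hv]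
  · rw [hs]
    by_cases h1 : v = a
    · rw [if_pos h1, h1, fa, Finset.sum_insert na, h.sum_eq a ha, Nat.mod_add_mod, add_comm]
    · by_cases h2 : v = b
      · rw [if_neg h1, if_pos h2, h2, fb, Finset.sum_insert nb, h.sum_eq b hb, Nat.mod_add_mod, add_comm]
      · rw [if_neg h1, if_neg h2, fo v h1 h2, h.sum_eq v hv]
  · have h1 : ∀ v ∈ Finset.range N, deg' v = deg v + ((if v = a then 1 else 0) + if v = b then 1 else 0) := by
      intro v _
      rw [hd]
      split_ifs <;> omega
    rw [Finset.sum_congr rfl h1, Finset.sum_add_distrib, Finset.sum_add_distrib, h.total,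
      Finset.sum_ite_eq', Finset.sum_ite_eq', if_pos (Finset.mem_range.2 ha), if_pos (Finset.mem_range.2 hb)]
    omega

/-! ### Edge lists of trees -/

section
variable {N : ℕ} {T : SimpleGraph (Fin N)} {F : List (Fin N × Fin N)}

/-- The ends of the pairs in a list as numbers. -/
def natPairs (F : List (Fin N × Fin N)) (f : ℕ) : ℕ × ℕ :=
  if h : f < F.length then ((F[f].1 : ℕ), (F[f].2 : ℕ)) else (0, 0)

theorem natPairs_of_lt {f : ℕ} (h : f < F.length) : natPairs F f = ((F[f].1 : ℕ), (F[f].2 : ℕ)) :=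
  dif_pos h

theorem adj_of_listsEdges (hF : ListsEdges F T.edgeSet) {f : ℕ} (h : f < F.length) :
    T.Adj F[f].1 F[f].2 := by
  have := (hF.2 s(F[f].1, F[f].2)).1 (List.mem_map.2 ⟨F[f], List.getElem_mem h, rfl⟩)
  exact this

theorem adjUpto_iff (hF : ListsEdges F T.edgeSet) (u v : ℕ) :
    adjUpto (natPairs F) F.length u v ↔ natAdj T u v := by
  constructor
  · rintro ⟨f, hf, h⟩
    rw [natPairs_of_lt hf, Prod.mk.injEq, Prod.mk.injEq] at h
    rcases h with ⟨rfl, rfl⟩ | ⟨rfl, rfl⟩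
    · exact ⟨Fin.is_lt _, Fin.is_lt _, adj_of_listsEdges hF hf⟩
    · exact ⟨Fin.is_lt _, Fin.is_lt _, (adj_of_listsEdges hF hf).symm⟩
  · rintro ⟨hu, hv, h⟩
    obtain ⟨e, he, heq⟩ := List.mem_map.1 ((hF.2 s(⟨u, hu⟩, ⟨v, hv⟩)).2 h)
    obtain ⟨f, hf, rfl⟩ := List.getElem_of_mem he
    refine ⟨f, hf, ?_⟩
    rw [natPairs_of_lt hf]
    rw [Sym2.eq_iff] at heq
    rcases heq with ⟨h1, h2⟩ | ⟨h1, h2⟩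
    · left; rw [h1, h2]
    · right; rw [h1, h2]

theorem not_adjUpto (hF : ListsEdges F T.edgeSet) {f : ℕ} (hf : f < F.length) :
    ¬ adjUpto (natPairs F) f F[f].1 F[f].2 := by
  rintro ⟨g, hg, h⟩
  rw [natPairs_of_lt (hg.trans hf), Prod.mk.injEq, Prod.mk.injEq] at h
  have h1 : s(F[g].1, F[g].2) = s(F[f].1, F[f].2) := by
    rw [Sym2.eq_iff]
    rcases h with ⟨h1, h2⟩ | ⟨h1, h2⟩
    · exact Or.inl ⟨Fin.ext h1, Fin.ext h2⟩
    · exact Or.inr ⟨Fin.ext h1, Fin.ext h2⟩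
  have h2 := (hF.1.getElem_inj_iff (i := g) (hi := by simpa using hg.trans hf) (j := f)
    (hj := by simpa using hf)).1 (by simpa using h1)
  omega

theorem length_of_listsEdges (hT : T.IsTree) (hF : ListsEdges F T.edgeSet) : F.length + 1 = N := by
  classical
  have h1 := hT.card_edgeFinset
  rw [Fintype.card_fin] at h1
  refine Eq.trans ?_ h1
  rw [← List.length_map (f := fun e : Fin N × Fin N => s(e.1, e.2)) (as := F),
    ← List.toFinset_card_of_nodup hF.1]
  congr 2
  ext e
  rw [List.mem_toFinset, hF.2, SimpleGraph.mem_edgeFinset]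

/-- A connected graph has an edge between any two parts of its vertex set. -/
theorem exists_boundary (hT : T.Connected) (A : Finset ℕ) (hA : A ⊆ Finset.range N) (hne : A.Nonempty)
    (hA' : A ≠ Finset.range N) : ∃ a ∈ A, ∃ b ∈ Finset.range N, b ∉ A ∧ natAdj T a b := by
  obtain ⟨a, ha⟩ := hne
  obtain ⟨b, hb, hbA⟩ : ∃ b ∈ Finset.range N, b ∉ A := by
    by_contra hc
    push Not at hc
    exact hA' (hA.antisymm hc)
  have ha' := Finset.mem_range.1 (hA ha)
  have hb' := Finset.mem_range.1 hb
  obtain ⟨p⟩ := hT.preconnected ⟨a, ha'⟩ ⟨b, hb'⟩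
  obtain ⟨d, -, h1, h2⟩ := p.exists_boundary_dart {i | (i : ℕ) ∈ A} ha hbA
  exact ⟨d.fst, h1, d.snd, Finset.mem_range.2 d.snd.2, h2, d.fst.2, d.snd.2, d.adj⟩

theorem Counts.stripped {deg sum qu pr : ℕ → ℕ} {tail : ℕ} (hT : T.IsTree) (hF : ListsEdges F T.edgeSet)
    (h : Counts (natPairs F) N F.length deg sum) (lt : ∀ k < tail, qu k < N)
    (inj : ∀ k < tail, ∀ l < tail, qu k = qu l → k = l)
    (leaf : ∀ v < N, deg v < 2 ↔ ∃ k < tail, qu k = v) :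
    Stripped (natAdj T) N 0 tail qu pr deg sum := by
  classical
  have hN := length_of_listsEdges hT hF
  have hR : Finset.range N \ (Finset.range 0).image qu = Finset.range N := by simp
  have hfil : ∀ v, (Finset.range N).filter (natAdj T v) =
      (Finset.range N).filter (adjUpto (natPairs F) F.length v) := fun v =>
    Finset.filter_congr fun w _ => (adjUpto_iff hF v w).symm
  refine ⟨Nat.zero_le _, lt, inj, ?_, ?_, fun k hk => absurd hk (Nat.not_lt_zero _),
    fun k hk => absurd hk (Nat.not_lt_zero _)⟩
  · rw [hR]
    refine ⟨fun v hv => Finset.mem_range.1 hv, fun v hv => ?_, fun v hv => ?_,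
      exists_boundary hT.connected, fun _ => ?_⟩
    · rw [h.deg_eq v (Finset.mem_range.1 hv)]
      congr 1
      convert (hfil v).symm
    · rw [h.sum_eq v (Finset.mem_range.1 hv)]
      congr 2
      convert (hfil v).symm
    · have := h.total
      change (Finset.range N).sum deg + 2 = _
      rw [this, Finset.card_range]
      omega
  · rw [hR]
    exact fun v hv => leaf v (Finset.mem_range.1 hv)

end
end BinTree

namespace RAM
open BinTree Cmd

/-- Counts the neighbours of the tree nodes. -/
def countNeighbours : Cmd :=
  -- Loop limits are variables and none holds `N - 1`, so the last round is left idle.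
  .for_ .f .N (.ite (.lt (.v .f + .c 1) (.v .N))
    (.set .x (.c 3 + .c 2 * .v .m + .c 2 * .v .f) ;;
      .set .u (.inp (.v .x)) ;; .set .v (.inp (.v .x + .c 1)) ;;
      .st .DEG (.v .u) (.ld .DEG (.v .u) + .c 1) ;; .st .DEG (.v .v) (.ld .DEG (.v .v) + .c 1) ;;
      .st .SUM (.v .u) ((.ld .SUM (.v .u) + .v .v) % .v .N) ;;
      .st .SUM (.v .v) ((.ld .SUM (.v .v) + .v .u) % .v .N)) .skip)

/-- Collects the leaves of the tree. -/
def collectLeaves : Cmd :=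
  .set .tail (.c 0) ;;
  .for_ .v .N (.ite (.lt (.ld .DEG (.v .v)) (.c 2))
    (.st .QU (.v .tail) (.v .v) ;; .set .tail (.v .tail + .c 1)) .skip)

/-- Repeatedly removes a leaf of the tree. -/
def removeLeaves : Cmd :=
  .for_ .h .N (.set .u (.ld .QU (.v .h)) ;;
    -- The degree is zero only for the last vertex, which has no parent.
    .ite (.ld .DEG (.v .u))
      (.set .p (.ld .SUM (.v .u)) ;; .st .PR (.v .u) (.v .p) ;;
        .st .DEG (.v .p) (.ld .DEG (.v .p) - .c 1) ;;
        .st .SUM (.v .p) ((.ld .SUM (.v .p) + .v .N - .v .u) % .v .N) ;;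
        .ite (.eq (.ld .DEG (.v .p)) (.c 1))
          (.st .QU (.v .tail) (.v .p) ;; .set .tail (.v .tail + .c 1)) .skip) .skip)

section
variable {E : Env} {n N k : ℕ} {L : List (Fin n × Fin n)} {F : List (Fin N × Fin N)}
  {X : Fin N → List (Fin n)} {bp : ℕ → ℕ} {T : SimpleGraph (Fin N)} {s : St}

theorem countNeighbours_spec (hv : InputView E.inp E.len L F X bp) (hE : Suffices E n L.length N k)
    (hs : Parsed n L.length N k s) (hT : T.IsTree) (hF : ListsEdges F T.edgeSet)
    (hd : ∀ v, s.a .DEG v = 0) (hsum : ∀ v, s.a .SUM v = 0) :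
    Spec E countNeighbours s fun s' => Counts (natPairs F) N F.length (s'.a .DEG) (s'.a .SUM) := by
  have hlen := hv.bp_zero_le
  have hM := hE.M_le'
  have hl := hE.len_le
  have hN := length_of_listsEdges hT hF
  refine spec_for (fun i s => Counts (natPairs F) N (min i F.length) (s.a .DEG) (s.a .SUM)) rfl ?_ ?_ ?_ ?_
  · rw [hs.N_eq]; exact hE.N_lim
  · rw [Nat.zero_min]
    exact Counts.zero hd hsum
  · intro i hi s₁ hf₁ hx₁ hc
    rw [hs.N_eq] at hi
    have eN : s₁.v .N = N := (hf₁.v _ rfl).trans hs.N_eq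
    have em : s₁.v .m = L.length := (hf₁.v _ rfl).trans hs.m_eq
    rw [spec_ite]
    simp only [Ex.ok_lt, Ex.ok_add, Ex.ok_v, Ex.ok_c, Ex.ev_lt, Ex.ev_add, Ex.ev_v, Ex.ev_c, hx₁, eN,
      true_and, and_true]
    refine ⟨by omega, ?_⟩
    by_cases hiN : i + 1 < N
    · have hif : i < F.length := by omega
      have h1 : E.inp (3 + 2 * L.length + 2 * i) = (F[i].1 : ℕ) := hv.F_fst ⟨i, hif⟩
      have h2 : E.inp (3 + 2 * L.length + 2 * i + 1) = (F[i].2 : ℕ) := hv.F_snd ⟨i, hif⟩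
      have hq := natPairs_of_lt hif
      have hne : (F[i].1 : ℕ) ≠ F[i].2 := fun e => (adj_of_listsEdges hF hif).ne (Fin.ext e)
      have hnew := not_adjUpto hF hif
      have ha := F[i].1.2
      have hb := F[i].2.2
      rw [min_eq_left hif.le] at hc
      rw [min_eq_left (by omega)]
      generalize (F[i].1 : ℕ) = a at *
      generalize (F[i].2 : ℕ) = b at *
      have hda := hc.deg_le ha
      have hdb := hc.deg_le hb
      have hsa := hc.sum_lt ha
      have hsb := hc.sum_lt hb
      simp only [hiN, if_true, one_ne_zero, if_false, spec_set_seq, spec_st_seq, spec_st, Ex.ok_add, Ex.ok_mul,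
        Ex.ok_c, Ex.ok_v, Ex.ok_inp, Ex.ok_ld, Ex.ok_mod, Ex.ev_add, Ex.ev_mul, Ex.ev_c, Ex.ev_v,
        Ex.ev_inp, Ex.ev_ld, Ex.ev_mod, St.setv_v, St.seta_v, St.setv_a, St.seta_a, reduceCtorEq, hx₁,
        eN, em, h1, h2, true_and, and_true, Function.update_of_ne hne, Function.update_of_ne hne.symm]
      refine ⟨by omega, by omega, by omega, by omega, by omega, by omega, by omega, ?_⟩
      refine hc.succ hq ha hb hne hnew (fun v => ?_) (fun v => ?_)
      · simp only [Function.update_apply]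
        by_cases h3 : v = a
        · subst h3; simp [hne]
        · by_cases h4 : v = b
          · subst h4; simp
          · simp [h3, h4]
      · simp only [Function.update_apply]
        by_cases h3 : v = a
        · subst h3; simp [hne]
        · by_cases h4 : v = b
          · subst h4; simp [h3]
          · simp [h3, h4]
    · simp only [hiN, if_false, if_true, spec_skip, St.setv_a]
      rwa [min_eq_right (by omega)] at hc ⊢
  · intro s₁ _ _ hc
    rw [hs.N_eq, min_eq_right (by omega)] at hc
    exact hc

/-- The queue holds the leaves of the tree. -/
structure Leaves (N : ℕ) (s : St) : Prop where
  lt : ∀ k < s.v .tail, s.a .QU k < N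
  inj : ∀ k < s.v .tail, ∀ l < s.v .tail, s.a .QU k = s.a .QU l → k = l
  leaf : ∀ v < N, s.a .DEG v < 2 ↔ ∃ k < s.v .tail, s.a .QU k = v

theorem collectLeaves_spec (hE : Suffices E n L.length N k) (hs : Parsed n L.length N k s) :
    Spec E collectLeaves s (Leaves N) := by
  have hM := hE.M_le'
  unfold collectLeaves
  simp only [spec_set_seq, Ex.ok_c, Ex.ev_c, Nat.zero_le, true_and]
  refine spec_for (fun i s => s.v .tail ≤ i ∧ Leaves i s) rfl ?_ ?_ ?_ ?_
  · simpa [hs.N_eq] using hE.N_lim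
  · refine ⟨by simp, by simp, by simp, fun v hv => absurd hv (Nat.not_lt_zero _)⟩
  · intro i hi s₁ hf₁ hx₁ ⟨ht, h1, h2, h3⟩
    simp only [St.setv_v, reduceCtorEq, if_false, hs.N_eq] at hi
    rw [spec_ite]
    simp only [Ex.ok_lt, Ex.ok_ld, Ex.ok_v, Ex.ok_c, Ex.ev_lt, Ex.ev_ld, Ex.ev_v, Ex.ev_c, hx₁, true_and]
    refine ⟨by omega, ?_⟩
    by_cases hd : s₁.a .DEG i < 2
    · simp only [hd, if_true, one_ne_zero, if_false, spec_set, spec_st_seq, Ex.ok_add, Ex.ok_c, Ex.ok_v,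
        Ex.ev_add, Ex.ev_c, Ex.ev_v, St.setv_v, St.seta_v, reduceCtorEq, hx₁, true_and]
      refine ⟨by omega, by omega, ?_, ?_, ?_⟩
      · simp only [St.setv_v, St.seta_v, St.setv_a, St.seta_a, reduceCtorEq, if_true, if_false]
        intro k hk
        by_cases hkt : k = s₁.v .tail
        · subst hkt; rw [Function.update_self]; omega
        · rw [Function.update_of_ne hkt]; have := h1 k (by omega); omega
      · simp only [St.setv_v, St.seta_v, St.setv_a, St.seta_a, reduceCtorEq, if_true, if_false]
        intro k hk l hl
        by_cases hkt : k = s₁.v .tail <;> by_cases hlt : l = s₁.v .tail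
        · omega
        · subst hkt; rw [Function.update_self, Function.update_of_ne hlt]
          have := h1 l (by omega); omega
        · subst hlt; rw [Function.update_self, Function.update_of_ne hkt]
          have := h1 k (by omega); omega
        · rw [Function.update_of_ne hlt, Function.update_of_ne hkt]
          exact h2 k (by omega) l (by omega)
      · simp only [St.setv_v, St.seta_v, St.setv_a, St.seta_a, reduceCtorEq, if_true, if_false]
        intro v hv
        by_cases hvi : v = i
        · rw [hvi]
          exact ⟨fun _ => ⟨s₁.v .tail, by omega, Function.update_self ..⟩, fun _ => hd⟩
        · rw [h3 v (by omega)]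
          constructor
          · rintro ⟨k, hk, e⟩
            exact ⟨k, by omega, by rw [Function.update_of_ne (by omega), e]⟩
          · rintro ⟨k, hk, e⟩
            by_cases hkt : k = s₁.v .tail
            · subst hkt; rw [Function.update_self] at e; exact absurd e.symm hvi
            · rw [Function.update_of_ne hkt] at e; exact ⟨k, by omega, e⟩
    · simp only [hd, if_false, if_true, spec_skip, St.setv_v, St.setv_a, reduceCtorEq]
      refine ⟨by omega, ?_, by simpa using h2, ?_⟩
      · intro k hk
        have := h1 k (by simpa using hk)
        simp only [St.setv_a]
        omega
      · simp only [St.setv_v, St.setv_a, reduceCtorEq, if_false]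
        intro v hv
        by_cases hvi : v = i
        · rw [hvi]
          refine ⟨fun h => absurd h hd, ?_⟩
          rintro ⟨k, hk, e⟩
          have := h1 k hk
          omega
        · exact h3 v (by omega)
  · intro s₁ _ _ ⟨_, h⟩
    simpa [hs.N_eq] using h

theorem removeLeaves_spec (hE : Suffices E n L.length N k) (hs : Parsed n L.length N k s)
    (h : Stripped (natAdj T) N 0 (s.v .tail) (s.a .QU) (s.a .PR) (s.a .DEG) (s.a .SUM)) :
    Spec E removeLeaves s fun s' => ElimOrder (natAdj T) N (s'.a .QU) (s'.a .PR) := by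
  have hM := hE.M_le'
  refine spec_for (fun i s => Stripped (natAdj T) N i (s.v .tail) (s.a .QU) (s.a .PR) (s.a .DEG) (s.a .SUM))
    rfl ?_ ?_ ?_ ?_
  · simpa [hs.N_eq] using hE.N_lim
  · simpa using h
  · intro i hi s₁ hf₁ hx₁ h
    rw [hs.N_eq] at hi
    have eN : s₁.v .N = N := (hf₁.v _ rfl).trans hs.N_eq
    have hdl := h.deg_lt hi
    have hR := h.remaining
    have hmem := h.mem hi
    have htl := h.tail_le
    simp only [spec_set_seq, Ex.ok_ld, Ex.ok_v, Ex.ev_ld, Ex.ev_v, hx₁, true_and]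
    rw [spec_ite]
    simp only [Ex.ok_ld, Ex.ok_v, Ex.ev_ld, Ex.ev_v, St.setv_v, St.setv_a, if_true, true_and]
    by_cases hd : s₁.a .DEG (s₁.a .QU i) = 0
    · simp only [hd, if_true, spec_skip, St.setv_v, St.setv_a, reduceCtorEq, if_false]
      exact h.last hi hd
    have hd1 : s₁.a .DEG (s₁.a .QU i) = 1 := by omega
    have hstep := fun tail' qu' => h.step (natAdj_symm T) (natAdj_irrefl T) hi hd1 (tail' := tail') (qu' := qu')
    obtain ⟨hp, -⟩ := hR.neighbour hmem hd1
    have hpN := hR.lt _ hp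
    have hsp := hR.sum_eq _ hp
    have hsp' : s₁.a .SUM (s₁.a .SUM (s₁.a .QU i)) < N := by rw [hsp]; exact Nat.mod_lt _ (by omega)
    have huN := hR.lt _ hmem
    rw [if_neg hd]
    simp only [spec_set_seq, spec_st_seq, Ex.ok_ld, Ex.ok_v, Ex.ok_c, Ex.ok_add, Ex.ok_sub, Ex.ok_mod,
      Ex.ev_ld, Ex.ev_v, Ex.ev_c, Ex.ev_add, Ex.ev_sub, Ex.ev_mod, St.setv_v, St.setv_a, St.seta_v,
      St.seta_a, reduceCtorEq, if_true, if_false, eN, true_and, and_true]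
    refine ⟨by omega, by omega, ?_⟩
    set u := s₁.a .QU i with hu
    set p := s₁.a .SUM u with hpd
    rw [spec_ite]
    simp only [Ex.ok_ld, Ex.ok_v, Ex.ok_c, Ex.ok_eq, Ex.ev_ld, Ex.ev_v, Ex.ev_c, Ex.ev_eq, St.setv_v,
      St.setv_a, St.seta_v, St.seta_a, reduceCtorEq, if_true, if_false, true_and, Function.update_self]
    refine ⟨by omega, ?_⟩
    by_cases hd2 : s₁.a .DEG p - 1 = 1
    · simp only [hd2, if_true, one_ne_zero, if_false, spec_set, spec_st_seq, Ex.ok_add, Ex.ok_c, Ex.ok_v,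
        Ex.ev_add, Ex.ev_c, Ex.ev_v, St.setv_v, St.setv_a, St.seta_v, St.seta_a, reduceCtorEq, true_and]
      refine ⟨by omega, ?_⟩
      have := hstep (s₁.v .tail + 1) (Function.update (s₁.a .QU) (s₁.v .tail) p)
        (fun k hk => Function.update_of_ne (by omega) ..) (fun _ => ⟨rfl, Function.update_self ..⟩)
        (fun h => absurd hd2 h)
      rw [hd2] at this
      exact this
    · simp only [hd2, if_false, if_true, spec_skip, St.setv_v, St.setv_a, St.seta_v, St.seta_a, reduceCtorEq]
      exact hstep (s₁.v .tail) (s₁.a .QU) (fun k hk => rfl) (fun h => absurd h hd2) (fun _ => rfl)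
  · intro s₁ _ _ h
    rw [hs.N_eq] at h
    exact h.elimOrder

end
end RAM

/-! ## The layout of a tree decomposition -/

namespace BinTree

variable {n N : ℕ} {G : SimpleGraph (Fin n)}

/-- The vertex `x` lies in the bag of the tree node `i`. -/
def TreeDecomposition.BagAt (D : TreeDecomposition G (Fin N)) (i x : ℕ) : Prop :=
  ∃ (hi : i < N) (hx : x < n), (⟨x, hx⟩ : Fin n) ∈ D.bag ⟨i, hi⟩

/-- The tree nodes `node 1, …, node N` are in an order in which every node except for the first
comes after its parent. -/
structure Rooted (D : TreeDecomposition G (Fin N)) (node par : ℕ → ℕ) : Prop where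
  surj : ∀ i < N, ∃ a, 0 < a ∧ a ≤ N ∧ node a = i
  par_one : 0 < N → par 1 = 0
  par_lt : ∀ a, 1 < a → a ≤ N → 0 < par a ∧ par a < a
  par_mem : ∀ a b x, 1 < a → a ≤ N → 0 < b → b < a → D.BagAt (node a) x → D.BagAt (node b) x →
    D.BagAt (node (par a)) x

/-- `top x` is the first node with the vertex `x` in its bag. -/
structure Tops (D : TreeDecomposition G (Fin N)) (node top : ℕ → ℕ) : Prop where
  pos : ∀ x < n, 0 < top x
  le : ∀ x < n, top x ≤ N
  mem : ∀ x < n, D.BagAt (node (top x)) x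
  min : ∀ a x, 0 < a → a ≤ N → D.BagAt (node a) x → top x ≤ a

/-- In the reversed order parents come first. For the running intersection property, consider the
tree path from `a` to an earlier node `b`: it has to leave the set of descendants of `a`, and the
only edge leaving this set joins `a` to its parent. So the parent lies on the path, and `path_mem`
applies. -/
theorem Rooted.of_elimOrder {D : TreeDecomposition G (Fin N)} {qu pr par : ℕ → ℕ}
    (h : ElimOrder (natAdj D.tree) N qu pr) (h1 : 0 < N → par 1 = 0)
    (hpar : ∀ a k, 1 < a → a ≤ N → k < N → pr (qu (N - a)) = qu k → par a = N - k) :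
    Rooted D (fun a => qu (N - a)) par := by
  have hsurj : ∀ i < N, ∃ a, 0 < a ∧ a ≤ N ∧ qu (N - a) = i := by
    intro i hi
    obtain ⟨k, hk, rfl⟩ := exists_index h.lt h.inj hi
    exact ⟨N - k, by omega, by omega, by congr 1; omega⟩
  have hp : ∀ a, 1 < a → a ≤ N → 0 < par a ∧ par a < a ∧ qu (N - par a) = pr (qu (N - a)) := by
    intro a ha haN
    obtain ⟨k, h2, h3, h4⟩ := h.par (N - a) (by omega)
    rw [hpar a k ha haN h3 h4, h4]
    exact ⟨by omega, by omega, by congr 1; omega⟩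
  refine ⟨hsurj, h1, fun a ha haN => ⟨(hp a ha haN).1, (hp a ha haN).2.1⟩, ?_⟩
  intro a b x ha haN hb hba ⟨hia, hx, hma⟩ ⟨hib, _, hmb⟩
  -- `Relation.ReflTransGen R c a` says that `c` is a descendant of `a`; descendants have numbers at
  -- least `a`, so `b` is none.
  let R : ℕ → ℕ → Prop := fun c d => 1 < c ∧ c ≤ N ∧ par c = d
  have hge : ∀ c, Relation.ReflTransGen R c a → a ≤ c := by
    intro c hc
    induction hc using Relation.ReflTransGen.head_induction_on with
    | refl => exact le_rfl
    | head h1 _ ih =>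
      obtain ⟨h2, h3, rfl⟩ := h1
      have := (hp _ h2 h3).2.1
      omega
  obtain ⟨p, hpath⟩ : ∃ p : D.tree.Walk ⟨_, hia⟩ ⟨_, hib⟩, p.IsPath :=
    (D.isTree.connected.preconnected _ _).exists_isPath
  obtain ⟨d, hd, hd1, hd2⟩ := p.exists_boundary_dart
    {i | ∃ c, 0 < c ∧ c ≤ N ∧ qu (N - c) = i ∧ Relation.ReflTransGen R c a}
    ⟨a, by omega, haN, rfl, Relation.ReflTransGen.refl⟩ (by
      rintro ⟨c, hc, hcN, he, hr⟩
      have := h.inj _ (by omega) _ (by omega) he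
      have := hge c hr
      omega)
  obtain ⟨c, hc, hcN, hce, hr⟩ := hd1
  obtain ⟨e, he, heN, hee⟩ := hsurj d.snd d.snd.2
  have hadj : natAdj D.tree (qu (N - c)) (qu (N - e)) := by
    rw [hce, hee]; exact ⟨d.fst.2, d.snd.2, d.adj⟩
  have hne : c ≠ e := by
    rintro rfl
    exact natAdj_irrefl _ _ hadj
  rcases lt_or_gt_of_ne hne with hlt | hlt
  -- Here `e` is the later end, so `c` is its parent and `e` is a descendant of `a` as well, which
  -- it is not.
  · exfalso
    have h2 := (h.adj_iff (N - e) (N - c) (by omega) (by omega)).1 (natAdj_symm _ _ _ hadj)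
    rw [← (hp e (by omega) heN).2.2] at h2
    have h3 := (hp e (by omega) heN).2.1
    have h4 := (hp e (by omega) heN).1
    have h5 := h.inj _ (by omega) _ (by omega) h2
    exact hd2 ⟨e, he, heN, hee, Relation.ReflTransGen.head (b := c) ⟨by omega, heN, by omega⟩ hr⟩
  -- Now `e` is the parent of `c`. If `c` were not `a` itself, its parent would be a descendant of
  -- `a` too.
  · have h2 := (h.adj_iff (N - c) (N - e) (by omega) (by omega)).1 hadj
    rw [← (hp c (by omega) hcN).2.2] at h2
    have h3 := (hp c (by omega) hcN).2.1
    have h4 := (hp c (by omega) hcN).1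
    have h5 := h.inj _ (by omega) _ (by omega) h2
    have hep : e = par c := by omega
    rcases Relation.ReflTransGen.cases_head hr with rfl | ⟨f, ⟨-, -, hf⟩, hrf⟩
    · refine ⟨by rw [← hep, hee]; exact d.snd.2, hx, ?_⟩
      have h6 := D.path_mem ⟨x, hx⟩ _ _ p hpath hma hmb d.snd (p.dart_snd_mem_support_of_mem_darts hd)
      convert h6
      rw [← hep, hee]
    · exact absurd ⟨e, he, heN, hee, by rw [hep, hf]; exact hrf⟩ hd2

section
variable {D : TreeDecomposition G (Fin N)} {node par top : ℕ → ℕ}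

/-- Climb from a common bag. Until `top v` is reached, the current node is later than both tops, so
the running intersection property keeps both vertices in the bag. The case `top u ≤ top v` tells
where the two ends of an edge certainly meet. -/
theorem Rooted.mem_top (hR : Rooted D node par) (hT : Tops D node top) {b u v : ℕ} (hb : 0 < b)
    (hbN : b ≤ N) (hu : D.BagAt (node b) u) (hv : D.BagAt (node b) v) (huv : top u ≤ top v) :
    D.BagAt (node (top v)) u := by
  induction b using Nat.strong_induction_on with
  | _ b ih =>
    have hvn : v < n := hv.2.1
    have hun : u < n := hu.2.1
    have h1 := hT.min b v hb hbN hv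
    rcases h1.eq_or_lt with h1 | h1
    · rw [h1]; exact hu
    · have h2 := hT.pos v hvn
      have h3 := hT.pos u hun
      obtain ⟨h4, h5⟩ := hR.par_lt b (by omega) hbN
      exact ih (par b) h5 h4 (by omega)
        (hR.par_mem b (top u) u (by omega) hbN h3 (by omega) hu (hT.mem u hun))
        (hR.par_mem b (top v) v (by omega) hbN h2 (by omega) hv (hT.mem v hvn))

/-- The layout of the tree decomposition `D`: a root, the tree nodes, the edges, and an edge from
the apex to every vertex. -/
structure LaidOut (I : Layout) (D : TreeDecomposition G (Fin N)) (L : List (Fin n × Fin n))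
    (node : ℕ → ℕ) : Prop where
  M_eq : I.M = N + 1 + L.length + n
  K_ge : 3 ≤ I.K
  slot_zero : ∀ a < I.M, I.slot a 0 = 1
  root : ∀ j, 0 < j → j < I.K → I.slot 0 j = 0
  ne_one : ∀ a, 0 < a → a ≤ N → ∀ j, 0 < j → j < I.K → I.slot a j ≠ 1
  mem_iff : ∀ a, 0 < a → a ≤ N → ∀ x, (∃ j < I.K, I.slot a j = x + 2) ↔ D.BagAt (node a) x
  inj : ∀ a, 0 < a → a ≤ N → ∀ j < I.K, ∀ j' < I.K, 0 < j → 0 < j' → I.slot a j ≠ 0 →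
    I.slot a j = I.slot a j' → j = j'
  edge_fst : ∀ e : Fin L.length, I.slot (N + 1 + e) 1 = L[e].1 + 2
  edge_snd : ∀ e : Fin L.length, I.slot (N + 1 + e) 2 = L[e].2 + 2
  edge_rest : ∀ e < L.length, ∀ j, 2 < j → j < I.K → I.slot (N + 1 + e) j = 0
  star : ∀ v < n, I.slot (N + 1 + L.length + v) 1 = v + 2
  star_rest : ∀ v < n, ∀ j, 1 < j → j < I.K → I.slot (N + 1 + L.length + v) j = 0
  ty_node : ∀ a < N + 1, I.ty a = 0
  ty_edge : ∀ e < L.length, I.ty (N + 1 + e) = 2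
  ty_star : ∀ v < n, I.ty (N + 1 + L.length + v) = 1
  rooted : Rooted D node I.par
  par_edge : ∀ e : Fin L.length, I.par (N + 1 + e) = max (I.top (L[e].1 + 2)) (I.top (L[e].2 + 2))
  par_star : ∀ v < n, I.par (N + 1 + L.length + v) = I.top (v + 2)
  top_one : I.top 1 = 0
  tops : Tops D node fun v => I.top (v + 2)

theorem LaidOut.represents {I : Layout} {L : List (Fin n × Fin n)} (h : LaidOut I D L node)
    (hL : ListsEdges L G.edgeSet) : I.Represents G L N where
  edges := hL
  M_eq := h.M_eq
  ty_node := h.ty_node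
  ty_edge e := by rw [h.ty_edge e e.2]; decide
  ea_edge e := by rw [Layout.ea, h.ty_edge e e.2]; exact h.edge_fst e
  eb_edge e := by rw [Layout.eb, h.ty_edge e e.2]; exact h.edge_snd e
  ty_star v := by rw [h.ty_star v v.2]; decide
  ea_star v := by
    rw [Layout.ea, h.ty_star v v.2]
    have := v.2
    exact h.slot_zero _ (by rw [h.M_eq]; omega)
  eb_star v := by rw [Layout.eb, h.ty_star v v.2]; exact h.star v v.2

theorem LaidOut.cases {I : Layout} {L : List (Fin n × Fin n)} (h : LaidOut I D L node) {a : ℕ}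
    (ha : a < I.M) : a = 0 ∨ (0 < a ∧ a ≤ N) ∨ (∃ e : Fin L.length, a = N + 1 + e) ∨
      ∃ v < n, a = N + 1 + L.length + v := by
  rw [h.M_eq] at ha
  by_cases h1 : a ≤ N
  · omega
  · by_cases h2 : a < N + 1 + L.length
    · exact Or.inr (Or.inr (Or.inl ⟨⟨a - (N + 1), by omega⟩, by simp only; omega⟩))
    · exact Or.inr (Or.inr (Or.inr ⟨a - (N + 1 + L.length), by omega, by omega⟩))

/-- The rows of edges are leaves whose parent bag contains their vertices already: by `mem_top` for
an edge of `G`, and by the choice of the top for an apex edge. So they neither change the tops nor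
disturb the running intersection property. -/
theorem LaidOut.valid {I : Layout} {L : List (Fin n × Fin n)} (h : LaidOut I D L node)
    (hL : ListsEdges L G.edgeSet) : I.Valid := by
  have hK := h.K_ge
  have hM := h.M_eq
  have hT := h.tops
  have hpos : ∀ x < n, 0 < I.top (x + 2) := hT.pos
  have hle : ∀ x < n, I.top (x + 2) ≤ N := hT.le
  have hadj : ∀ e : Fin L.length, G.Adj L[e].1 L[e].2 := fun e => Layout.edge_adj hL e
  have hone : ∀ a < I.M, I.InBag a 1 := fun a ha => ⟨one_ne_zero, 0, by omega, h.slot_zero a ha⟩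
  have hcode : ∀ a v, I.InBag a v → v = 1 ∨ ∃ x, v = x + 2 := by
    rintro a v ⟨h1, -⟩
    by_cases h2 : v = 1
    · exact Or.inl h2
    · exact Or.inr ⟨v - 2, by omega⟩
  have hnode : ∀ a, 0 < a → a ≤ N → ∀ x, I.InBag a (x + 2) ↔ D.BagAt (node a) x := fun a h1 h2 x => by
    rw [← h.mem_iff a h1 h2]
    exact ⟨fun h => h.2, fun h => ⟨by omega, h⟩⟩
  have hedge : ∀ (e : Fin L.length) x, I.InBag (N + 1 + e) (x + 2) → x = L[e].1 ∨ x = L[e].2 := by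
    rintro e x ⟨-, j, hj, hs⟩
    have h0 := h.slot_zero (N + 1 + e) (by have := e.2; omega)
    have h1 := h.edge_fst e
    have h2 := h.edge_snd e
    have h3 := h.edge_rest e e.2 j
    rcases Nat.lt_or_ge 2 j with h4 | h4
    · rw [h3 h4 hj] at hs; omega
    · interval_cases j <;> omega
  have hstar : ∀ v < n, ∀ x, I.InBag (N + 1 + L.length + v) (x + 2) → x = v := by
    rintro v hv x ⟨-, j, hj, hs⟩
    have h0 := h.slot_zero (N + 1 + L.length + v) (by omega)
    have h1 := h.star v hv
    have h3 := h.star_rest v hv j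
    rcases Nat.lt_or_ge 1 j with h4 | h4
    · rw [h3 h4 hj] at hs; omega
    · interval_cases j <;> omega
  -- Both ends of the edge lie in some bag, hence in the bag of the later of their two tops.
  have hpe : ∀ e : Fin L.length, ∀ x : Fin n, (x = L[e].1 ∨ x = L[e].2) →
      I.InBag (I.par (N + 1 + e)) (x + 2) := by
    intro e x hx
    obtain ⟨i, hi1, hi2⟩ := D.edge_mem _ _ (hadj e)
    obtain ⟨b, hb, hbN, hbi⟩ := h.rooted.surj i i.2
    have hb1 : D.BagAt (node b) L[e].1 := ⟨hbi ▸ i.2, Fin.is_lt _, by convert hi1⟩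
    have hb2 : D.BagAt (node b) L[e].2 := ⟨hbi ▸ i.2, Fin.is_lt _, by convert hi2⟩
    have m1 := hT.mem L[e].1 (Fin.is_lt _)
    have m2 := hT.mem L[e].2 (Fin.is_lt _)
    have p1 := hpos L[e].1 (Fin.is_lt _)
    have p2 := hpos L[e].2 (Fin.is_lt _)
    have l1 := hle L[e].1 (Fin.is_lt _)
    have l2 := hle L[e].2 (Fin.is_lt _)
    rw [h.par_edge e]
    rcases le_total (I.top (L[e].1 + 2)) (I.top (L[e].2 + 2)) with hle | hle
    · rw [max_eq_right hle, hnode _ p2 l2]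
      rcases hx with rfl | rfl
      · exact h.rooted.mem_top hT hb hbN hb1 hb2 hle
      · exact m2
    · rw [max_eq_left hle, hnode _ p1 l1]
      rcases hx with rfl | rfl
      · exact m1
      · exact h.rooted.mem_top hT hb hbN hb2 hb1 hle
  refine ⟨by omega, by omega, ?_, ?_, h.slot_zero, ?_, ?_, ?_, ?_⟩
  · intro c hc hcM
    rcases h.cases hcM with rfl | ⟨h1, h2⟩ | ⟨e, rfl⟩ | ⟨v, hv, rfl⟩
    · omega
    · by_cases hc1 : c = 1
      · subst hc1; rw [h.rooted.par_one (by omega)]; omega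
      · exact (h.rooted.par_lt c (by omega) h2).2
    · rw [h.par_edge e]
      have l1 := hle L[e].1 (Fin.is_lt _)
      have l2 := hle L[e].2 (Fin.is_lt _)
      exact (max_le l1 l2).trans_lt (by omega)
    · rw [h.par_star v hv]
      have := hle v hv
      omega
  · intro a ha j hj j' hj' hne heq
    have h0 := h.slot_zero a ha
    rcases h.cases ha with rfl | ⟨h1, h2⟩ | ⟨e, rfl⟩ | ⟨v, hv, rfl⟩
    · have r1 := h.root j
      have r2 := h.root j'
      rcases Nat.eq_zero_or_pos j with rfl | h3 <;> rcases Nat.eq_zero_or_pos j' with rfl | h4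
      · rfl
      · rw [r2 h4 hj'] at heq; omega
      · exact absurd (r1 h3 hj) hne
      · exact absurd (r1 h3 hj) hne
    · have r1 := h.ne_one a h1 h2 j
      have r2 := h.ne_one a h1 h2 j'
      rcases Nat.eq_zero_or_pos j with rfl | h3 <;> rcases Nat.eq_zero_or_pos j' with rfl | h4
      · rfl
      · exact absurd (heq.symm.trans h0) (r2 h4 hj')
      · exact absurd (heq.trans h0) (r1 h3 hj)
      · exact h.inj a h1 h2 j hj j' hj' h3 h4 hne heq
    · have e1 := h.edge_fst e
      have e2 := h.edge_snd e
      have h3 : (L[e].1 : ℕ) ≠ L[e].2 := fun h => (hadj e).ne (Fin.ext h)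
      have r1 := h.edge_rest e e.2 j
      have r2 := h.edge_rest e e.2 j'
      have hj2 : j ≤ 2 := by by_contra hc; exact hne (r1 (by omega) hj)
      have hj2' : j' ≤ 2 := by by_contra hc; exact hne (heq.trans (r2 (by omega) hj'))
      interval_cases j <;> interval_cases j' <;> omega
    · have e1 := h.star v hv
      have r1 := h.star_rest v hv j
      have r2 := h.star_rest v hv j'
      have hj2 : j ≤ 1 := by by_contra hc; exact hne (r1 (by omega) hj)
      have hj2' : j' ≤ 1 := by by_contra hc; exact hne (heq.trans (r2 (by omega) hj'))
      interval_cases j <;> interval_cases j' <;> omega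
  · intro a ha v hv
    rcases hcode a v hv with rfl | ⟨x, rfl⟩
    · rw [h.top_one]; omega
    rcases h.cases ha with rfl | ⟨h1, h2⟩ | ⟨e, rfl⟩ | ⟨v, hvn, rfl⟩
    · obtain ⟨-, j, hj, hs⟩ := hv
      rcases Nat.eq_zero_or_pos j with rfl | h3
      · rw [h.slot_zero 0 ha] at hs; omega
      · rw [h.root j h3 hj] at hs; omega
    · exact hT.min a x h1 h2 ((hnode a h1 h2 x).1 hv)
    · have l1 := hle L[e].1 (Fin.is_lt _)
      have l2 := hle L[e].2 (Fin.is_lt _)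
      rcases hedge e x hv with rfl | rfl <;> omega
    · have := hle v hvn
      rw [hstar v hvn x hv]; omega
  · intro a ha v hv hne
    rcases hcode a v hv with rfl | ⟨x, rfl⟩
    · rw [h.top_one] at hne
      refine ⟨by omega, hone _ ?_⟩
      rcases h.cases ha with rfl | ⟨h1, h2⟩ | ⟨e, rfl⟩ | ⟨v, hvn, rfl⟩
      · exact absurd rfl hne
      · by_cases hc1 : a = 1
        · subst hc1; rw [h.rooted.par_one (by omega)]; omega
        · have := (h.rooted.par_lt a (by omega) h2).2; omega
      · rw [h.par_edge e]
        have l1 := hle L[e].1 (Fin.is_lt _)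
        have l2 := hle L[e].2 (Fin.is_lt _)
        exact (max_le l1 l2).trans_lt (by omega)
      · rw [h.par_star v hvn]
        have := hle v hvn
        omega
    rcases h.cases ha with rfl | ⟨h1, h2⟩ | ⟨e, rfl⟩ | ⟨v, hvn, rfl⟩
    · obtain ⟨-, j, hj, hs⟩ := hv
      rcases Nat.eq_zero_or_pos j with rfl | h3
      · rw [h.slot_zero 0 ha] at hs; omega
      · rw [h.root j h3 hj] at hs; omega
    · have hb := (hnode a h1 h2 x).1 hv
      have hx := hb.2.1
      have h3 := hT.min a x h1 h2 hb
      have h4 := hpos x hx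
      obtain ⟨h5, h6⟩ := h.rooted.par_lt a (by omega) h2
      refine ⟨h1, (hnode _ h5 (by omega) x).2 ?_⟩
      exact h.rooted.par_mem a (I.top (x + 2)) x (by omega) h2 h4 (by omega) hb (hT.mem x hx)
    · refine ⟨by omega, ?_⟩
      rcases hedge e x hv with rfl | rfl
      · exact hpe e _ (Or.inl rfl)
      · exact hpe e _ (Or.inr rfl)
    · refine ⟨by omega, ?_⟩
      rw [hstar v hvn x hv, h.par_star v hvn, hnode _ (hpos v hvn) (hle v hvn)]
      exact hT.mem v hvn
  · rintro v hv
    rcases hcode 0 v hv with rfl | ⟨x, rfl⟩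
    · rfl
    · obtain ⟨-, j, hj, hs⟩ := hv
      rcases Nat.eq_zero_or_pos j with rfl | h3
      · rw [h.slot_zero 0 (by omega)] at hs; omega
      · rw [h.root j h3 hj] at hs; omega
  · intro a ha hne
    rcases h.cases ha with rfl | ⟨h1, h2⟩ | ⟨e, rfl⟩ | ⟨v, hvn, rfl⟩
    · exact absurd (h.ty_node 0 (by omega)) hne
    · exact absurd (h.ty_node a (by omega)) hne
    · have e1 := h.edge_fst e
      have e2 := h.edge_snd e
      rw [h.ty_edge e e.2]
      refine ⟨by omega, ?_, by omega⟩
      show I.slot _ 1 ≠ 0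
      omega
    · have e1 := h.star v hvn
      rw [h.ty_star v hvn]
      refine ⟨by omega, ?_, by omega⟩
      show I.slot _ 0 ≠ 0
      rw [h.slot_zero _ ha]
      omega

end
end BinTree

/-! ## The program: the layout -/

namespace RAM
open BinTree Cmd

theorem Suffices.row_le {E : Env} {n m N k a j : ℕ} (h : Suffices E n m N k) (ha : a < N + 1 + m + n)
    (hj : j < k + 2) : a * (k + 2) + j ≤ E.B := by
  refine le_trans ?_ h.M_le
  have h1 := Nat.mul_le_mul_right (k + 2) (Nat.succ_le_of_lt ha)
  rw [Nat.succ_mul] at h1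
  have h2 : (N + 1 + m + n) * (k + 2) ≤ (N + 1 + m + n) * (8 * (4 * (k + 2))) :=
    Nat.mul_le_mul_left _ (by omega)
  omega

/-- The array `A` holds the entries of the matrix `f` with `K` columns where `P` holds, and zeros
elsewhere. -/
def Filled (f : ℕ → ℕ → ℕ) (M K : ℕ) (P : ℕ → ℕ → Prop) (A : ℕ → ℕ) : Prop :=
  ∀ a < M, ∀ j < K, (P a j → A (a * K + j) = f a j) ∧ (¬ P a j → A (a * K + j) = 0)

section
variable {f : ℕ → ℕ → ℕ} {M K : ℕ} {P Q : ℕ → ℕ → Prop} {A : ℕ → ℕ}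

theorem Filled.set (h : Filled f M K P A) {a j v : ℕ} (hj : j < K) (hv : v = f a j) :
    Filled f M K (fun a' j' => P a' j' ∨ a' = a ∧ j' = j) (Function.update A (a * K + j) v) := by
  intro a' ha' j' hj'
  by_cases he : a' = a ∧ j' = j
  · obtain ⟨rfl, rfl⟩ := he
    rw [Function.update_self]
    exact ⟨fun _ => hv, fun h => absurd (Or.inr ⟨rfl, rfl⟩) h⟩
  · rw [Function.update_of_ne (fun h => he (idx_inj hj' hj h))]
    exact ⟨fun h' => (h a' ha' j' hj').1 (h'.resolve_right he),
      fun h' => (h a' ha' j' hj').2 fun h => h' (Or.inl h)⟩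

theorem Filled.extend (h : Filled f M K P A) (h1 : ∀ a < M, ∀ j < K, P a j → Q a j)
    (h2 : ∀ a < M, ∀ j < K, Q a j → P a j ∨ f a j = 0) : Filled f M K Q A := by
  intro a ha j hj
  refine ⟨fun hq => ?_, fun hq => (h a ha j hj).2 fun hp => hq (h1 a ha j hj hp)⟩
  by_cases hp : P a j
  · exact (h a ha j hj).1 hp
  · rw [(h a ha j hj).2 hp, (h2 a ha j hj hq).resolve_left hp]

/-- `A x` is the first row of `f` with the entry `x + 2`, among the entries where `P` holds. -/
def Topped (f : ℕ → ℕ → ℕ) (P : ℕ → ℕ → Prop) (A : ℕ → ℕ) : Prop :=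
  ∀ a j x, P a j → f a j = x + 2 → A x ≤ a ∧ ∃ j', P (A x) j' ∧ f (A x) j' = x + 2

/-- Rows are filled in decreasing order, so the latest write for a vertex is its smallest row;
overwriting replaces a comparison. -/
theorem Topped.set (h : Topped f P A) {a j x : ℕ} (ha : ∀ a' j', P a' j' → a ≤ a')
    (hx : f a j = x + 2) :
    Topped f (fun a' j' => P a' j' ∨ a' = a ∧ j' = j) (Function.update A x a) := by
  intro a' j' y hP hy
  by_cases hxy : y = x
  · subst hxy
    rw [Function.update_self]
    refine ⟨?_, j, Or.inr ⟨rfl, rfl⟩, hx⟩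
    rcases hP with hP | ⟨rfl, -⟩
    · exact ha a' j' hP
    · exact le_rfl
  · rw [Function.update_of_ne hxy]
    have hP' : P a' j' := by
      rcases hP with hP | ⟨rfl, rfl⟩
      · exact hP
      · omega
    obtain ⟨h1, j'', h2, h3⟩ := h a' j' y hP' hy
    exact ⟨h1, j'', Or.inl h2, h3⟩

theorem Topped.extend (h : Topped f P A) (h1 : ∀ a j, P a j → Q a j)
    (h2 : ∀ a j, Q a j → P a j ∨ f a j < 2) : Topped f Q A := by
  intro a j x hq hx
  obtain ⟨h3, j', h4, h5⟩ := h a j x ((h2 a j hq).resolve_right (by omega)) hx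
  exact ⟨h3, j', h1 _ _ h4, h5⟩

end

/-- The entries of the bags of the layout. -/
def slotAt (inp bp qu : ℕ → ℕ) (N m a j : ℕ) : ℕ :=
  if j = 0 then 1
  else if a = 0 then 0
  else if a < N + 1 then
    -- The word at the start of a bag is its size, so its elements occupy the offsets from `1` on,
    -- like the positions of the row. The shift by two frees the codes `0` for an empty position and
    -- `1` for the apex.
    if j ≤ inp (bp (qu (N - a))) then inp (bp (qu (N - a)) + j) + 2 else 0
  else if a < N + 1 + m then
    if j = 1 then inp (3 + 2 * (a - (N + 1))) + 2
    else if j = 2 then inp (3 + 2 * (a - (N + 1)) + 1) + 2 else 0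
  else if j = 1 then a - (N + 1 + m) + 2 else 0

section
variable {inp bp qu : ℕ → ℕ} {N m a j h : ℕ}

theorem slotAt_zero : slotAt inp bp qu N m a 0 = 1 := rfl

theorem slotAt_root (hj : 0 < j) : slotAt inp bp qu N m 0 j = 0 := by
  rw [slotAt, if_neg (by omega), if_pos rfl]

theorem slotAt_node (hj : 0 < j) (ha : 0 < a) (haN : a ≤ N) : slotAt inp bp qu N m a j =
    if j ≤ inp (bp (qu (N - a))) then inp (bp (qu (N - a)) + j) + 2 else 0 := by
  rw [slotAt, if_neg (by omega), if_neg (by omega), if_pos (by omega)]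

theorem slotAt_edge (hj : 0 < j) {e : ℕ} (he : e < m) : slotAt inp bp qu N m (N + 1 + e) j =
    if j = 1 then inp (3 + 2 * e) + 2 else if j = 2 then inp (3 + 2 * e + 1) + 2 else 0 := by
  rw [slotAt, if_neg (by omega), if_neg (by omega), if_neg (by omega), if_pos (by omega),
    Nat.add_sub_cancel_left]

theorem slotAt_star (hj : 0 < j) {v : ℕ} : slotAt inp bp qu N m (N + 1 + m + v) j =
    if j = 1 then v + 2 else 0 := by
  rw [slotAt, if_neg (by omega), if_neg (by omega), if_neg (by omega), if_neg (by omega),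
    Nat.add_sub_cancel_left]

end

/-- Numbers the tree nodes in reverse order of removal. -/
def numberNodes : Cmd := .for_ .h .N (.st .ORD (.ld .QU (.v .h)) (.v .N - .v .h))

/-- Copies the bag of a tree node into a row of the layout. -/
def fillNode : Cmd :=
  .for_ .j .K (.ite (.v .j) (.ite (.lt (.v .j) (.v .y + .c 1))
    (.set .x (.inp (.v .b + .v .j)) ;; .st .SL (.v .z + .v .j) (.v .x + .c 2) ;;
      .st .TOP (.v .x) (.v .a)) .skip) (.st .SL (.v .z + .v .j) (.c 1)))

/-- Fills the rows of the tree nodes. -/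
def fillNodes : Cmd :=
  .for_ .h .N (.set .u (.ld .QU (.v .h)) ;; .set .a (.v .N - .v .h) ;;
    -- The vertex removed last becomes node `1`; its parent is the added root `0`, which the zero
    -- memory holds already.
    .ite (.lt (.v .h + .c 1) (.v .N)) (.st .PAR (.v .a) (.ld .ORD (.ld .PR (.v .u)))) .skip ;;
    .set .b (.ld .BP (.v .u)) ;; .set .y (.inp (.v .b)) ;; .set .z (.v .a * .v .K) ;; fillNode)

/-- Fills the rows of the edges. -/
def fillEdges : Cmd :=
  .for_ .e .m (.set .a (.v .N1 + .v .e) ;; .set .z (.v .a * .v .K) ;;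
    .set .x (.c 3 + .c 2 * .v .e) ;; .set .u (.inp (.v .x)) ;; .set .v (.inp (.v .x + .c 1)) ;;
    .st .SL (.v .z) (.c 1) ;; .st .SL (.v .z + .c 1) (.v .u + .c 2) ;;
    .st .SL (.v .z + .c 2) (.v .v + .c 2) ;; .st .TY (.v .a) (.c 2) ;;
    .st .PAR (.v .a) (.ld .TOP (.v .u)) ;;
    .ite (.lt (.ld .TOP (.v .u)) (.ld .TOP (.v .v))) (.st .PAR (.v .a) (.ld .TOP (.v .v))) .skip)

/-- Fills the rows of the edges from the apex. -/
def fillStars : Cmd :=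
  .for_ .v .n (.set .a (.v .N1 + .v .m + .v .v) ;; .set .z (.v .a * .v .K) ;;
    .st .SL (.v .z) (.c 1) ;; .st .SL (.v .z + .c 1) (.v .v + .c 2) ;;
    .st .TY (.v .a) (.c 1) ;; .st .PAR (.v .a) (.ld .TOP (.v .v)))

section
variable {E : Env} {n N : ℕ} {L : List (Fin n × Fin n)} {F : List (Fin N × Fin N)}
  {X : Fin N → List (Fin n)} {bp : ℕ → ℕ} {s : St} {adj : ℕ → ℕ → Prop}

/-- The entries of `slotAt` in the rows of the tree nodes that are filled after `h` nodes and
`j₀` entries of the next one. -/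
def NodesBelow (N K h j₀ a j : ℕ) : Prop := a ≤ N ∧ j < K ∧ (N - h < a ∨ a = N - h ∧ j < j₀)

theorem numberNodes_spec (hE : Suffices E n L.length N (bagMax X))
    (hs : Parsed n L.length N (bagMax X) s) (ho : ElimOrder adj N (s.a .QU) (s.a .PR)) :
    Spec E numberNodes s fun s' => ∀ h < N, s'.a .ORD (s.a .QU h) = N - h := by
  refine spec_for (fun i s' => ∀ h < i, s'.a .ORD (s.a .QU h) = N - h) rfl ?_ ?_ ?_ ?_
  · simpa [hs.N_eq] using hE.N_lim
  · intro h hh; exact absurd hh (Nat.not_lt_zero _)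
  · intro i hi s₁ hf₁ hx₁ h1
    rw [hs.N_eq] at hi
    have eN : s₁.v .N = N := (hf₁.v _ rfl).trans hs.N_eq
    have eQ : s₁.a .QU = s.a .QU := hf₁.a _ rfl
    simp only [spec_st, Ex.ok_ld, Ex.ok_v, Ex.ok_sub, Ex.ev_ld, Ex.ev_v, Ex.ev_sub, St.setv_a,
      St.seta_a, hx₁, eN, eQ, if_true, true_and]
    intro h hh
    by_cases hhi : h = i
    · rw [hhi, Function.update_self]
    · rw [Function.update_of_ne fun e => hhi (ho.inj _ (by omega) _ hi e)]
      exact h1 h (by omega)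
  · intro s₁ _ _ h
    rwa [hs.N_eq] at h

theorem fillNode_spec (hv : InputView E.inp E.len L F X bp) (hE : Suffices E n L.length N (bagMax X))
    (hs : Parsed n L.length N (bagMax X) s) {h : ℕ} {qu : ℕ → ℕ} (hh : h < N) (hu : qu h < N)
    (hb : s.v .b = bp (qu h)) (hy : s.v .y = E.inp (bp (qu h))) (ha : s.v .a = N - h)
    (hz : s.v .z = (N - h) * (bagMax X + 2))
    (hf : Filled (slotAt E.inp bp qu N L.length) (N + 1 + L.length + n) (bagMax X + 2)
      (NodesBelow N (bagMax X + 2) h 0) (s.a .SL))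
    (ht : Topped (slotAt E.inp bp qu N L.length) (NodesBelow N (bagMax X + 2) h 0) (s.a .TOP)) :
    Spec E fillNode s fun s' =>
      Filled (slotAt E.inp bp qu N L.length) (N + 1 + L.length + n) (bagMax X + 2)
        (NodesBelow N (bagMax X + 2) (h + 1) 0) (s'.a .SL) ∧
      Topped (slotAt E.inp bp qu N L.length) (NodesBelow N (bagMax X + 2) (h + 1) 0) (s'.a .TOP) := by
  have hM := hE.M_le'
  have hrow := fun j hj => hE.row_le (a := N - h) (j := j) (by omega) hj
  have hsize := hv.size ⟨qu h, hu⟩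
  have helt := hv.elt ⟨qu h, hu⟩
  have hlt := fun j => hv.bp_lt ⟨qu h, hu⟩ (j := j)
  have hnode : ∀ j, 0 < j → slotAt E.inp bp qu N L.length (N - h) j =
      if j ≤ E.inp (bp (qu h)) then E.inp (bp (qu h) + j) + 2 else 0 := by
    intro j hj
    rw [slotAt_node hj (by omega) (by omega), Nat.sub_sub_self hh.le]
  simp only at hsize helt hlt
  rw [hsize] at hy hnode
  set K := bagMax X + 2 with hK
  set f := slotAt E.inp bp qu N L.length with hfdef
  have hiff : ∀ i < K, ∀ a j, NodesBelow N K h (i + 1) a j ↔ NodesBelow N K h i a j ∨ a = N - h ∧ j = i := by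
    intro i hi a j
    unfold NodesBelow
    constructor
    · rintro ⟨h1, h2, h3 | ⟨h3, h4⟩⟩
      · exact Or.inl ⟨h1, h2, Or.inl h3⟩
      · by_cases hji : j = i
        · exact Or.inr ⟨h3, hji⟩
        · exact Or.inl ⟨h1, h2, Or.inr ⟨h3, by omega⟩⟩
    · rintro (⟨h1, h2, h3⟩ | ⟨h1, h2⟩)
      · exact ⟨h1, h2, h3.imp_right fun h => ⟨h.1, by omega⟩⟩
      · exact ⟨by omega, by omega, Or.inr ⟨h1, by omega⟩⟩
  have hiff' : ∀ i < K, NodesBelow N K h (i + 1) = fun a j => NodesBelow N K h i a j ∨ a = N - h ∧ j = i :=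
    fun i hi => by funext a j; exact propext (hiff i hi a j)
  refine spec_for (fun i s' => Filled f (N + 1 + L.length + n) K (NodesBelow N K h i) (s'.a .SL) ∧
    Topped f (NodesBelow N K h i) (s'.a .TOP)) rfl ?_ ?_ ?_ ?_
  · simpa [hs.K_eq] using hE.K_lim
  · exact ⟨hf, ht⟩
  · intro i hi s₁ hf₁ hx₁ ⟨h1, h2⟩
    rw [hs.K_eq] at hi
    have e1 : s₁.v .b = bp (qu h) := (hf₁.v _ rfl).trans hb
    have e2 : s₁.v .y = (X ⟨qu h, hu⟩).length := (hf₁.v _ rfl).trans hy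
    have e3 : s₁.v .a = N - h := (hf₁.v _ rfl).trans ha
    have e4 : s₁.v .z = (N - h) * K := (hf₁.v _ rfl).trans hz
    have hr := hrow i hi
    rw [hiff' i hi, spec_ite]
    simp only [Ex.ok_v, Ex.ev_v, hx₁, true_and]
    by_cases hi0 : i = 0
    · simp only [hi0, if_true, spec_st, Ex.ok_add, Ex.ok_v, Ex.ok_c, Ex.ev_add, Ex.ev_v, Ex.ev_c,
        St.setv_a, St.seta_a, reduceCtorEq, if_false, e4, hx₁, true_and]
      rw [hi0] at hr h1 h2
      refine ⟨⟨hr, by omega⟩, h1.set (by omega) slotAt_zero.symm, h2.extend (fun _ _ => Or.inl) ?_⟩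
      rintro a j (hP | ⟨rfl, rfl⟩)
      · exact Or.inl hP
      · right; rw [hfdef, slotAt_zero]; omega
    rw [if_neg hi0, spec_ite]
    simp only [Ex.ok_lt, Ex.ok_add, Ex.ok_v, Ex.ok_c, Ex.ev_lt, Ex.ev_add, Ex.ev_v, Ex.ev_c, hx₁, e2,
      true_and]
    have hm := le_bagMax X ⟨qu h, hu⟩
    have hr' := hrow (bagMax X + 1) (by omega)
    refine ⟨by omega, ?_⟩
    have hni := hnode i (by omega)
    by_cases hil : i < (X ⟨qu h, hu⟩).length + 1
    · have hxn : E.inp (bp (qu h) + i) < n := by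
        have h5 := helt ⟨i - 1, by omega⟩
        simp only at h5
        rw [show bp (qu h) + 1 + (i - 1) = bp (qu h) + i by omega] at h5
        rw [h5]
        exact Fin.is_lt _
      have hb := hlt i (by omega)
      have hlen := hE.len_le
      rw [if_pos (by omega)] at hni
      simp only [hil, if_true, one_ne_zero, if_false, spec_set_seq, spec_st_seq, spec_st, Ex.ok_add,
        Ex.ok_inp, Ex.ok_v, Ex.ok_c, Ex.ev_add, Ex.ev_inp, Ex.ev_v, Ex.ev_c, St.setv_v, St.setv_a,
        St.seta_v, St.seta_a, reduceCtorEq, hx₁, e1, e3, e4, true_and]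
      refine ⟨⟨by omega, hb⟩, ⟨hr, by omega, by omega⟩, h1.set hi hni.symm, h2.set ?_ hni⟩
      rintro a j ⟨-, -, h3⟩
      omega
    · rw [if_neg (by omega)] at hni
      simp only [hil, if_false, if_true, spec_skip, St.setv_a]
      refine ⟨h1.extend (fun _ _ _ _ => Or.inl) ?_, h2.extend (fun _ _ => Or.inl) ?_⟩
      · rintro a - j - (hP | ⟨rfl, rfl⟩)
        · exact Or.inl hP
        · exact Or.inr hni
      · rintro a j (hP | ⟨rfl, rfl⟩)
        · exact Or.inl hP
        · right; rw [hni]; omega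
  · intro s₁ _ _ ⟨h1, h2⟩
    rw [hs.K_eq] at h1 h2
    have hP : NodesBelow N K h (bagMax X + 2) = NodesBelow N K (h + 1) 0 := by
      funext a j
      refine propext ⟨fun ⟨h3, h4, h5⟩ => ⟨h3, h4, by omega⟩, fun ⟨h3, h4, h5⟩ => ⟨h3, h4, by omega⟩⟩
    rw [hP] at h1 h2
    exact ⟨h1, h2⟩

theorem fillNodes_spec (hv : InputView E.inp E.len L F X bp) (hE : Suffices E n L.length N (bagMax X))
    (hs : Parsed n L.length N (bagMax X) s) (hbp : ∀ i < N, s.a .BP i = bp i)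
    (ho : ElimOrder adj N (s.a .QU) (s.a .PR)) (hp : ∀ a, s.a .PAR a = 0) (hsl : ∀ i, s.a .SL i = 0) :
    Spec E fillNodes s fun s' =>
      Filled (slotAt E.inp bp (s.a .QU) N L.length) (N + 1 + L.length + n) (bagMax X + 2)
        (fun a _ => 0 < a ∧ a < N + 1) (s'.a .SL) ∧
      Topped (slotAt E.inp bp (s.a .QU) N L.length) (fun a j => 0 < a ∧ a ≤ N ∧ j < bagMax X + 2)
        (s'.a .TOP) ∧ s'.a .PAR 1 = 0 ∧
      ∀ h, h + 1 < N → s'.a .PAR (N - h) = s.a .ORD (s.a .PR (s.a .QU h)) := by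
  have hM := hE.M_le'
  refine spec_for (fun i s' =>
    (Filled (slotAt E.inp bp (s.a .QU) N L.length) (N + 1 + L.length + n) (bagMax X + 2)
        (NodesBelow N (bagMax X + 2) i 0) (s'.a .SL) ∧
      Topped (slotAt E.inp bp (s.a .QU) N L.length) (NodesBelow N (bagMax X + 2) i 0) (s'.a .TOP)) ∧
      s'.a .PAR 1 = 0 ∧
      ∀ h < i, h + 1 < N → s'.a .PAR (N - h) = s.a .ORD (s.a .PR (s.a .QU h))) rfl ?_ ?_ ?_ ?_
  · simpa [hs.N_eq] using hE.N_lim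
  · refine ⟨⟨?_, ?_⟩, by simpa using hp 1, fun h hh => absurd hh (Nat.not_lt_zero _)⟩
    · intro a _ j _
      refine ⟨?_, fun _ => by simpa using hsl _⟩
      rintro ⟨h1, h2, h3⟩
      omega
    · rintro a j x ⟨h1, h2, h3⟩
      omega
  · intro i hi s₁ hf₁ hx₁ ⟨h1, h2, h3⟩
    rw [hs.N_eq] at hi
    have hs₁ := hs.of_frame hf₁ (by decide)
    have eN := hs₁.N_eq
    have eQ : s₁.a .QU = s.a .QU := hf₁.a _ rfl
    have eO : s₁.a .ORD = s.a .ORD := hf₁.a _ rfl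
    have eR : s₁.a .PR = s.a .PR := hf₁.a _ rfl
    have hu := ho.lt i hi
    simp only [spec_set_seq, Ex.ok_ld, Ex.ok_v, Ex.ok_sub, Ex.ev_ld, Ex.ev_v, Ex.ev_sub, St.setv_v,
      St.setv_a, reduceCtorEq, if_true, if_false, hx₁, eN, eQ, true_and]
    refine Spec.seq (R := fun s' => s'.a .PAR 1 = 0 ∧
      ∀ h < i + 1, h + 1 < N → s'.a .PAR (N - h) = s.a .ORD (s.a .PR (s.a .QU h))) ?_ ?_
    · rw [spec_ite]
      simp only [Ex.ok_lt, Ex.ok_add, Ex.ok_v, Ex.ok_c, Ex.ev_lt, Ex.ev_add, Ex.ev_v, Ex.ev_c,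
        St.setv_v, reduceCtorEq, if_true, if_false, hx₁, eN, true_and, and_true]
      refine ⟨by omega, ?_⟩
      by_cases hiN : i + 1 < N
      · simp only [hiN, if_true, one_ne_zero, if_false, spec_st, Ex.ok_ld, Ex.ok_v, Ex.ev_ld, Ex.ev_v,
          St.setv_v, St.setv_a, St.seta_a, reduceCtorEq, true_and, eO, eR]
        refine ⟨by rw [Function.update_of_ne (by omega)]; exact h2, fun h hh hhN => ?_⟩
        by_cases hhi : h = i
        · rw [hhi, Function.update_self]
        · rw [Function.update_of_ne (by omega)]
          exact h3 h (by omega) hhN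
      · simp only [hiN, if_false, if_true, spec_skip, St.setv_a]
        exact ⟨h2, fun h hh hhN => h3 h (by omega) hhN⟩
    intro s₂ hf₂ ⟨k1, k2⟩
    have e1 : s₂.v .u = s.a .QU i := by rw [hf₂.v _ rfl]; simp
    have e2 : s₂.v .a = N - i := by rw [hf₂.v _ rfl]; simp
    have e3 : s₂.a .BP (s.a .QU i) = bp (s.a .QU i) := by
      rw [hf₂.a _ rfl]
      simp only [St.setv_a]
      rw [hf₁.a _ rfl]; exact hbp _ hu
    have hs₂ : Parsed n L.length N (bagMax X) s₂ := by
      have : Parsed n L.length N (bagMax X) ((s₁.setv .u (s.a .QU i)).setv .a (N - i)) :=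
        ⟨by simpa using hs₁.n_eq, by simpa using hs₁.m_eq, by simpa using hs₁.N_eq,
          by simpa using hs₁.N1_eq, by simpa using hs₁.M_eq, by simpa using hs₁.M1_eq,
          by simpa using hs₁.K_eq, by simpa using hs₁.D_eq, by simpa using hs₁.S_eq⟩
      exact this.of_frame hf₂ (by decide)
    have e4 : s₂.a .SL = s₁.a .SL := by rw [hf₂.a _ rfl]; rfl
    have e5 : s₂.a .TOP = s₁.a .TOP := by rw [hf₂.a _ rfl]; rfl
    have hlt := hv.bp_lt ⟨s.a .QU i, hu⟩ (j := 0) (Nat.zero_le _)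
    have hrow := hE.row_le (a := N - i) (j := 0) (by omega) (by omega)
    simp only [add_zero] at hlt hrow
    simp only [spec_set_seq, Ex.ok_ld, Ex.ok_v, Ex.ok_inp, Ex.ok_mul, Ex.ev_ld, Ex.ev_v, Ex.ev_inp,
      Ex.ev_mul, St.setv_v, St.setv_a, reduceCtorEq, if_true, if_false, e1, e2, e3, hs₂.K_eq, true_and]
    refine ⟨hlt, hrow, ?_⟩
    refine (fillNode_spec hv hE (h := i) (qu := s.a .QU) ?_ hi hu ?_ ?_ ?_ ?_ ?_ ?_).mono
      fun s₃ hf₃ hR => ⟨hR, ?_, ?_⟩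
    · exact ⟨by simpa using hs₂.n_eq, by simpa using hs₂.m_eq, by simpa using hs₂.N_eq,
          by simpa using hs₂.N1_eq, by simpa using hs₂.M_eq, by simpa using hs₂.M1_eq,
          by simpa using hs₂.K_eq, by simpa using hs₂.D_eq, by simpa using hs₂.S_eq⟩
    · simp
    · simp
    · simpa using e2
    · simp
    · simpa [e4] using h1.1
    · simpa [e5] using h1.2
    · rw [hf₃.a _ rfl]; exact k1
    · rw [hf₃.a _ rfl]; exact k2
  · intro s₁ _ _ ⟨⟨h1, h2⟩, h3, h4⟩
    rw [hs.N_eq] at h1 h2 h4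
    refine ⟨h1.extend ?_ ?_, h2.extend ?_ ?_, h3, fun h hh => h4 h (by omega) hh⟩
    · rintro a - j - ⟨k1, k2, k3⟩; omega
    · rintro a - j hj ⟨k1, k2⟩; exact Or.inl ⟨by omega, hj, by omega⟩
    · rintro a j ⟨k1, k2, k3⟩; omega
    · rintro a j ⟨k1, k2, k3⟩; exact Or.inl ⟨by omega, k3, by omega⟩

end
end RAM

/-! ### The rows of the edges and the finished layout -/

namespace RAM
open BinTree Cmd

theorem Filled.set_zero {f : ℕ → ℕ → ℕ} {M K : ℕ} {P : ℕ → ℕ → Prop} {A : ℕ → ℕ} (h : Filled f M K P A)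
    {a v : ℕ} (hK : 0 < K) (hv : v = f a 0) :
    Filled f M K (fun a' j' => P a' j' ∨ a' = a ∧ j' = 0) (Function.update A (a * K) v) :=
  h.set hK hv

section
variable {E : Env} {n N : ℕ} {L : List (Fin n × Fin n)} {F : List (Fin N × Fin N)}
  {X : Fin N → List (Fin n)} {bp : ℕ → ℕ} {s : St} {adj : ℕ → ℕ → Prop}

theorem fillEdges_spec (hv : InputView E.inp E.len L F X bp) (hE : Suffices E n L.length N (bagMax X))
    (hs : Parsed n L.length N (bagMax X) s) (hk : 0 < bagMax X) {qu : ℕ → ℕ}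
    (hf : Filled (slotAt E.inp bp qu N L.length) (N + 1 + L.length + n) (bagMax X + 2)
      (fun a _ => a < N + 1) (s.a .SL)) :
    Spec E fillEdges s fun s' =>
      Filled (slotAt E.inp bp qu N L.length) (N + 1 + L.length + n) (bagMax X + 2)
        (fun a _ => a < N + 1 + L.length) (s'.a .SL) ∧
      (∀ a < N + 1, s'.a .TY a = s.a .TY a ∧ s'.a .PAR a = s.a .PAR a) ∧
      ∀ e : Fin L.length, s'.a .TY (N + 1 + e) = 2 ∧
        s'.a .PAR (N + 1 + e) = max (s.a .TOP L[e].1) (s.a .TOP L[e].2) := by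
  have hM := hE.M_le'
  have hlen := hv.bp_zero_le
  have hl := hE.len_le
  set K := bagMax X + 2 with hK
  set f := slotAt E.inp bp qu N L.length with hfdef
  refine spec_for (fun i s' => Filled f (N + 1 + L.length + n) K (fun a _ => a < N + 1 + i) (s'.a .SL) ∧
      (∀ a < N + 1, s'.a .TY a = s.a .TY a ∧ s'.a .PAR a = s.a .PAR a) ∧
      ∀ e : Fin L.length, (e : ℕ) < i → s'.a .TY (N + 1 + e) = 2 ∧
        s'.a .PAR (N + 1 + e) = max (s.a .TOP L[e].1) (s.a .TOP L[e].2)) rfl ?_ ?_ ?_ ?_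
  · simpa [hs.m_eq] using hE.m_lim
  · exact ⟨hf, fun a _ => ⟨rfl, rfl⟩, fun e he => absurd he (Nat.not_lt_zero _)⟩
  · intro i hi s₁ hf₁ hx₁ ⟨h1, h2, h3⟩
    rw [hs.m_eq] at hi
    have hs₁ := hs.of_frame hf₁ (by decide)
    have eN := hs₁.N1_eq
    have eK : s₁.v .K = K := hs₁.K_eq
    have eT : s₁.a .TOP = s.a .TOP := hf₁.a _ rfl
    have e1 : E.inp (3 + 2 * i) = (L[i].1 : ℕ) := hv.E_fst ⟨i, hi⟩
    have e2 : E.inp (3 + 2 * i + 1) = (L[i].2 : ℕ) := hv.E_snd ⟨i, hi⟩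
    have ha := L[i].1.2
    have hb := L[i].2.2
    have hrow := fun j hj => hE.row_le (a := N + 1 + i) (j := j) (by omega) hj
    have r0 := hrow 0 (by omega)
    have r1 := hrow 1 (by omega)
    -- Position `2` exists because the bags are not all empty.
    have r2 := hrow 2 (by omega)
    rw [add_zero] at r0
    simp only [spec_set_seq, spec_st_seq, Ex.ok_ld, Ex.ok_v, Ex.ok_c, Ex.ok_inp, Ex.ok_add, Ex.ok_mul,
      Ex.ev_ld, Ex.ev_v, Ex.ev_c, Ex.ev_inp, Ex.ev_add, Ex.ev_mul, St.setv_v, St.setv_a, St.seta_v,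
      St.seta_a, reduceCtorEq, if_true, if_false, hx₁, eN, eK, e1, e2, eT, true_and, and_true]
    refine ⟨by omega, r0, by omega, by omega, by omega, by omega, ⟨⟨by omega, r1⟩, by omega, by omega⟩,
      ⟨⟨by omega, r2⟩, by omega, by omega⟩, by omega, ?_⟩
    rw [spec_ite]
    simp only [Ex.ok_lt, Ex.ok_ld, Ex.ok_v, Ex.ev_lt, Ex.ev_ld, Ex.ev_v, St.setv_v, St.setv_a, St.seta_v,
      St.seta_a, reduceCtorEq, if_true, if_false, eT, true_and]
    have hS : Filled f (N + 1 + L.length + n) K (fun a _ => a < N + 1 + (i + 1))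
        (Function.update (Function.update (Function.update (s₁.a .SL) ((N + 1 + i) * K) 1)
          ((N + 1 + i) * K + 1) (L[i].1 + 2)) ((N + 1 + i) * K + 2) (L[i].2 + 2)) := by
      have f1 : (L[i].1 : ℕ) + 2 = f (N + 1 + i) 1 := by
        rw [hfdef, slotAt_edge one_pos hi, if_pos rfl, e1]
      have f2 : (L[i].2 : ℕ) + 2 = f (N + 1 + i) 2 := by
        rw [hfdef, slotAt_edge two_pos hi, if_neg (by omega), if_pos rfl, e2]
      refine (((h1.set_zero (by omega) slotAt_zero.symm).set (by omega) f1).set (by omega) f2).extend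
        (fun a _ j _ => by omega) fun a _ j _ hlt => ?_
      by_cases hai : a = N + 1 + i
      · by_cases hj : j ≤ 2
        · left; omega
        · right
          rw [hai, hfdef, slotAt_edge (by omega) hi, if_neg (by omega), if_neg (by omega)]
      · left; omega
    have hlast : ∀ (A T : ℕ → ℕ) (v : ℕ), T = Function.update (s₁.a .TY) (N + 1 + i) 2 →
        (∀ a, a ≠ N + 1 + i → A a = s₁.a .PAR a) → A (N + 1 + i) = v →
        v = max (s.a .TOP L[i].1) (s.a .TOP L[i].2) →
        (∀ a < N + 1, T a = s.a .TY a ∧ A a = s.a .PAR a) ∧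
        ∀ e : Fin L.length, (e : ℕ) < i + 1 → T (N + 1 + e) = 2 ∧
          A (N + 1 + e) = max (s.a .TOP L[e].1) (s.a .TOP L[e].2) := by
      intro A T v hT hA hAi hv
      refine ⟨fun a ha => ?_, fun e he => ?_⟩
      · rw [hT, Function.update_of_ne (by omega), hA a (by omega)]
        exact h2 a ha
      · by_cases hei : (e : ℕ) = i
        · obtain rfl : e = ⟨i, hi⟩ := Fin.ext hei
          rw [hT, Function.update_self]
          exact ⟨rfl, hAi.trans hv⟩
        · rw [hT, Function.update_of_ne (by omega), hA _ (by omega)]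
          exact h3 e (by omega)
    by_cases hlt : s.a .TOP L[i].1 < s.a .TOP L[i].2
    · simp only [hlt, if_true, one_ne_zero, if_false, spec_st, Ex.ok_ld, Ex.ok_v, Ex.ev_ld, Ex.ev_v,
        St.setv_v, St.setv_a, St.seta_v, St.seta_a, reduceCtorEq, true_and, eT]
      refine ⟨hS, hlast _ _ (s.a .TOP L[i].2) rfl (fun a ha => ?_) (Function.update_self ..)
        (max_eq_right hlt.le).symm⟩
      rw [Function.update_of_ne ha, Function.update_of_ne ha]
    · simp only [hlt, if_false, if_true, spec_skip, St.setv_v, St.setv_a, St.seta_v, St.seta_a,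
        reduceCtorEq]
      refine ⟨hS, hlast _ _ (s.a .TOP L[i].1) rfl (fun a ha => ?_) (Function.update_self ..)
        (max_eq_left (by omega)).symm⟩
      rw [Function.update_of_ne ha]
  · intro s₁ _ _ ⟨h1, h2, h3⟩
    rw [hs.m_eq] at h1 h3
    exact ⟨h1, h2, fun e => h3 e e.2⟩

theorem fillStars_spec (hE : Suffices E n L.length N (bagMax X))
    (hs : Parsed n L.length N (bagMax X) s) {qu : ℕ → ℕ}
    (hf : Filled (slotAt E.inp bp qu N L.length) (N + 1 + L.length + n) (bagMax X + 2)
      (fun a _ => a < N + 1 + L.length) (s.a .SL)) :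
    Spec E fillStars s fun s' =>
      Filled (slotAt E.inp bp qu N L.length) (N + 1 + L.length + n) (bagMax X + 2)
        (fun _ _ => True) (s'.a .SL) ∧
      (∀ a < N + 1 + L.length, s'.a .TY a = s.a .TY a ∧ s'.a .PAR a = s.a .PAR a) ∧
      ∀ v < n, s'.a .TY (N + 1 + L.length + v) = 1 ∧
        s'.a .PAR (N + 1 + L.length + v) = s.a .TOP v := by
  have hM := hE.M_le'
  set K := bagMax X + 2 with hK
  set m := L.length with hm
  set f := slotAt E.inp bp qu N m with hfdef
  refine spec_for (fun i s' => Filled f (N + 1 + m + n) K (fun a _ => a < N + 1 + m + i) (s'.a .SL) ∧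
      (∀ a < N + 1 + m, s'.a .TY a = s.a .TY a ∧ s'.a .PAR a = s.a .PAR a) ∧
      ∀ v < i, s'.a .TY (N + 1 + m + v) = 1 ∧ s'.a .PAR (N + 1 + m + v) = s.a .TOP v) rfl ?_ ?_ ?_ ?_
  · simpa [hs.n_eq] using hE.n_lim
  · exact ⟨hf, fun a _ => ⟨rfl, rfl⟩, fun e he => absurd he (Nat.not_lt_zero _)⟩
  · intro i hi s₁ hf₁ hx₁ ⟨h1, h2, h3⟩
    rw [hs.n_eq] at hi
    have hs₁ := hs.of_frame hf₁ (by decide)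
    have eN := hs₁.N1_eq
    have em := hs₁.m_eq
    have eK : s₁.v .K = K := hs₁.K_eq
    have eT : s₁.a .TOP = s.a .TOP := hf₁.a _ rfl
    have hrow := fun j hj => hE.row_le (a := N + 1 + m + i) (j := j) (by omega) hj
    have r0 := hrow 0 (by omega)
    have r1 := hrow 1 (by omega)
    rw [add_zero] at r0
    simp only [spec_set_seq, spec_st_seq, spec_st, Ex.ok_ld, Ex.ok_v, Ex.ok_c, Ex.ok_add, Ex.ok_mul,
      Ex.ev_ld, Ex.ev_v, Ex.ev_c, Ex.ev_add, Ex.ev_mul, St.setv_v, St.setv_a, St.seta_v,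
      St.seta_a, reduceCtorEq, if_true, if_false, hx₁, eN, em, eK, eT, true_and, and_true]
    refine ⟨by omega, r0, by omega, ⟨⟨by omega, r1⟩, by omega, by omega⟩, by omega, ?_,
      fun a ha => ?_, fun v hv => ?_⟩
    · have f1 : i + 2 = f (N + 1 + m + i) 1 := by
        rw [hfdef, slotAt_star one_pos, if_pos rfl]
      refine ((h1.set_zero (by omega) slotAt_zero.symm).set (by omega) f1).extend
        (fun a _ j _ => by omega) fun a _ j _ hlt => ?_
      by_cases hai : a = N + 1 + m + i
      · by_cases hj : j ≤ 1
        · left; omega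
        · right
          rw [hai, hfdef, slotAt_star (by omega), if_neg (by omega)]
      · left; omega
    · rw [Function.update_of_ne (by omega), Function.update_of_ne (by omega)]
      exact h2 a ha
    · by_cases hvi : v = i
      · rw [hvi, Function.update_self, Function.update_self]
        exact ⟨rfl, rfl⟩
      · rw [Function.update_of_ne (by omega), Function.update_of_ne (by omega)]
        exact h3 v (by omega)
  · intro s₁ _ _ ⟨h1, h2, h3⟩
    rw [hs.n_eq] at h1 h3
    exact ⟨h1.extend (fun _ _ _ _ _ => trivial) fun a ha _ _ _ => Or.inl ha, h2, h3⟩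

theorem slotAt_bag (hv : InputView E.inp E.len L F X bp) {qu : ℕ → ℕ} {a j m : ℕ} {i : Fin N}
    (hi : qu (N - a) = i) (hj : 0 < j) (ha : 0 < a) (haN : a ≤ N) :
    slotAt E.inp bp qu N m a j =
      if h : j - 1 < (X i).length then ((X i)[j - 1] : ℕ) + 2 else 0 := by
  have hsz := hv.size i
  rw [slotAt_node hj ha haN, hi, hsz]
  by_cases h : j - 1 < (X i).length
  · have h' := hv.elt i ⟨j - 1, h⟩
    simp only at h'
    rw [dif_pos h, if_pos (by omega), show bp i + j = bp i + 1 + (j - 1) by omega, h']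
    rfl
  · rw [dif_neg h, if_neg (by omega)]

/-- Builds the layout. -/
def layOut : Cmd :=
  numberNodes ;; fillNodes ;; .st .SL (.c 0) (.c 1) ;; fillEdges ;; fillStars

/-- The layout in the memory. -/
def layoutOf (s : St) (M K : ℕ) : Layout where
  M := M
  K := K
  par := s.a .PAR
  slot a j := s.a .SL (a * K + j)
  ty := s.a .TY
  top v := if v < 2 then 0 else s.a .TOP (v - 2)

theorem layOut_spec {G : SimpleGraph (Fin n)} {D : TreeDecomposition G (Fin N)}
    (hv : InputView E.inp E.len L F X bp) (hE : Suffices E n L.length N (bagMax X))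
    (hs : Parsed n L.length N (bagMax X) s) (hbp : ∀ i < N, s.a .BP i = bp i) (hn : 0 < n)
    (hX : ∀ i, Lists (X i) (D.bag i : Set (Fin n)))
    (ho : ElimOrder (natAdj D.tree) N (s.a .QU) (s.a .PR)) (hp : ∀ a, s.a .PAR a = 0)
    (hsl : ∀ i, s.a .SL i = 0) (hty : ∀ a, s.a .TY a = 0) :
    Spec E layOut s fun s' =>
      LaidOut (layoutOf s' (N + 1 + L.length + n) (bagMax X + 2)) D L fun a => s.a .QU (N - a) := by
  have hM := hE.M_le'
  -- The graph has a vertex, so some bag is nonempty and `K` is at least three.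
  obtain ⟨i₀, hi₀⟩ := D.vertex_mem ⟨0, hn⟩
  have hk : 0 < bagMax X := by
    refine lt_of_lt_of_le ?_ (le_bagMax X i₀)
    rw [List.length_pos_iff]
    intro h
    have := ((hX i₀).2 ⟨0, hn⟩).2 hi₀
    rw [h] at this
    exact absurd this List.not_mem_nil
  set K := bagMax X + 2 with hK
  set qu := s.a .QU with hqu
  set f := slotAt E.inp bp qu N L.length with hfdef
  unfold layOut
  refine (numberNodes_spec hE hs ho).seq fun s₁ hf₁ hord => ?_
  have hs₁ := hs.of_frame hf₁ (by decide)
  have eQ₁ : s₁.a .QU = qu := hf₁.a _ rfl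
  have eR₁ : s₁.a .PR = s.a .PR := hf₁.a _ rfl
  refine (fillNodes_spec (adj := natAdj D.tree) hv hE hs₁ (by rw [hf₁.a _ rfl]; exact hbp)
    (by rw [eQ₁, eR₁]; exact ho) (by rw [hf₁.a _ rfl]; exact hp) (by rw [hf₁.a _ rfl]; exact hsl)).seq
    fun s₂ hf₂ ⟨h1, h2, h3, h4⟩ => ?_
  rw [eQ₁] at h1 h2 h4
  rw [eR₁] at h4
  have hs₂ := hs₁.of_frame hf₂ (by decide)
  simp only [spec_st_seq, Ex.ok_c, Ex.ev_c]
  refine ⟨⟨by omega, by omega⟩, ?_⟩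
  have hroot : Filled f (N + 1 + L.length + n) K (fun a _ => a < N + 1) ((s₂.seta .SL 0 1).a .SL) := by
    have := (h1.set_zero (a := 0) (v := 1) (by omega) slotAt_zero.symm).extend
      (Q := fun a _ => a < N + 1) (fun a _ j _ => by omega) (fun a _ j hj ha => by
        by_cases ha0 : a = 0
        · by_cases hj0 : j = 0
          · exact Or.inl (Or.inr ⟨ha0, hj0⟩)
          · right; rw [ha0]; exact slotAt_root (by omega)
        · left; left; omega)
    simpa using this
  have hs₂' : Parsed n L.length N (bagMax X) (s₂.seta .SL 0 1) :=
    ⟨hs₂.n_eq, hs₂.m_eq, hs₂.N_eq, hs₂.N1_eq, hs₂.M_eq, hs₂.M1_eq, hs₂.K_eq, hs₂.D_eq, hs₂.S_eq⟩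
  refine (fillEdges_spec hv hE hs₂' hk hroot).seq fun s₃ hf₃ ⟨h5, h6, h7⟩ => ?_
  have hs₃ := hs₂'.of_frame hf₃ (by decide)
  refine (fillStars_spec hE hs₃ h5).mono fun s₄ hf₄ ⟨h8, h9, h10⟩ => ?_
  have eT₂ : (s₂.seta .SL 0 1).a .TOP = s₂.a .TOP := by simp
  have eT₃ : s₃.a .TOP = s₂.a .TOP := by rw [hf₃.a _ rfl, eT₂]
  have eT₄ : s₄.a .TOP = s₂.a .TOP := by rw [hf₄.a _ rfl, eT₃]
  have eP₂ : (s₂.seta .SL 0 1).a .PAR = s₂.a .PAR := by simp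
  have eY₂ : ∀ a, (s₂.seta .SL 0 1).a .TY a = 0 := by
    intro a
    simp only [St.seta_a, reduceCtorEq, if_false]
    rw [hf₂.a _ rfl, hf₁.a _ rfl]
    exact hty a
  have hslot : ∀ a < N + 1 + L.length + n, ∀ j < K, s₄.a .SL (a * K + j) = f a j :=
    fun a ha j hj => (h8 a ha j hj).1 trivial
  have hpar : ∀ a < N + 1, s₄.a .PAR a = s₂.a .PAR a := fun a ha =>
    ((h9 a (by omega)).2.trans (h6 a ha).2).trans (by rw [eP₂])
  have hq : ∀ a, 0 < a → a ≤ N → qu (N - a) < N := fun a ha haN => ho.lt _ (by omega)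
  have hbag : ∀ a, 0 < a → a ≤ N → ∀ x, (∃ j < K, f a j = x + 2) ↔ D.BagAt (qu (N - a)) x := by
    intro a ha haN x
    have hXi := hX ⟨_, hq a ha haN⟩
    have hmax := le_bagMax X ⟨_, hq a ha haN⟩
    have hf := fun j hj => slotAt_bag (m := L.length) hv (i := ⟨_, hq a ha haN⟩) rfl (j := j) hj ha haN
    constructor
    · rintro ⟨j, hj, he⟩
      rcases Nat.eq_zero_or_pos j with rfl | hj0
      · rw [hfdef, slotAt_zero] at he; omega
      rw [hfdef, hf j hj0] at he
      split_ifs at he with hjl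
      refine ⟨hq a ha haN, by omega, (hXi.2 _).1 ?_⟩
      convert List.getElem_mem hjl
      omega
    · rintro ⟨hi, hx, hm⟩
      obtain ⟨j, hj, he⟩ := List.getElem_of_mem ((hXi.2 ⟨x, hx⟩).2 hm)
      refine ⟨j + 1, by omega, ?_⟩
      rw [hfdef, hf _ (by omega)]
      simp only [Nat.add_sub_cancel]
      rw [dif_pos hj, he]
  have htop : ∀ v, (if v + 2 < 2 then 0 else s₄.a .TOP (v + 2 - 2)) = s₂.a .TOP v := by
    intro v
    rw [if_neg (by omega), Nat.add_sub_cancel, eT₄]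
  refine ⟨rfl, ?_, ?_, ?_, ?_, ?_, ?_, ?_, ?_, ?_, ?_, ?_, ?_, ?_, ?_, ?_, ?_, ?_, rfl, ?_⟩ <;>
    simp only [layoutOf, htop]
  · omega
  · intro a ha
    rw [hslot a ha 0 (by omega)]
    rfl
  · intro j hj0 hj
    rw [hslot 0 (by omega) j hj]
    exact slotAt_root hj0
  · intro a ha haN j hj0 hj
    rw [hslot a (by omega) j hj, hfdef, slotAt_node hj0 ha haN]
    split_ifs <;> omega
  · intro a ha haN x
    rw [← hbag a ha haN]
    exact exists_congr fun j => and_congr_right fun hj => by rw [hslot a (by omega) j hj]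
  · intro a ha haN j hj j' hj' hj0 hj0' hne heq
    have hXi := hX ⟨_, hq a ha haN⟩
    have hf := fun j hj => slotAt_bag (m := L.length) hv (i := ⟨_, hq a ha haN⟩) rfl (j := j) hj ha haN
    rw [hslot a (by omega) j hj, hfdef, hf j hj0] at hne heq
    rw [hslot a (by omega) j' hj', hfdef, hf j' hj0'] at heq
    have k1 : j - 1 < (X ⟨_, hq a ha haN⟩).length := by
      by_contra h
      rw [dif_neg h] at hne
      exact hne rfl
    have k2 : j' - 1 < (X ⟨_, hq a ha haN⟩).length := by
      by_contra h
      rw [dif_pos k1, dif_neg h] at heq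
      omega
    rw [dif_pos k1, dif_pos k2] at heq
    have := (hXi.1.getElem_inj_iff (hi := k1) (hj := k2)).1 (Fin.ext (Nat.add_right_cancel heq))
    omega
  · intro e
    rw [hslot _ (by omega) 1 (by omega), hfdef, slotAt_edge one_pos e.2, if_pos rfl]
    exact congrArg (· + 2) (hv.E_fst e)
  · intro e
    rw [hslot _ (by omega) 2 (by omega), hfdef, slotAt_edge two_pos e.2, if_neg (by omega), if_pos rfl]
    exact congrArg (· + 2) (hv.E_snd e)
  · intro e he j hj2 hj
    rw [hslot _ (by omega) j hj, hfdef, slotAt_edge (by omega) he, if_neg (by omega), if_neg (by omega)]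
  · intro v hv
    rw [hslot _ (by omega) 1 (by omega), hfdef, slotAt_star one_pos, if_pos rfl]
  · intro v hv j hj1 hj
    rw [hslot _ (by omega) j hj, hfdef, slotAt_star (by omega), if_neg (by omega)]
  · intro a ha
    rw [(h9 a (by omega)).1, (h6 a ha).1, eY₂]
  · intro e he
    rw [(h9 _ (by omega)).1, (h7 ⟨e, he⟩).1]
  · exact fun v hv => (h10 v hv).1
  · refine Rooted.of_elimOrder ho (fun h0 => by rw [hpar 1 (by omega), h3]) ?_
    intro a k ha haN hk hpr
    have := h4 (N - a) (by omega)
    rw [Nat.sub_sub_self haN] at this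
    rw [hpar a (by omega), this, hpr]
    exact hord k hk
  · intro e
    rw [(h9 _ (by omega)).2, (h7 e).2, eT₂]
  · intro v hv
    rw [(h10 v hv).2, eT₃]
  · have hmem : ∀ x < n, ∃ a, 0 < a ∧ a ≤ N ∧ D.BagAt (qu (N - a)) x := by
      intro x hx
      obtain ⟨i, hi⟩ := D.vertex_mem ⟨x, hx⟩
      obtain ⟨k, hk, hki⟩ := exists_index ho.lt ho.inj i.2
      refine ⟨N - k, by omega, by omega, ?_⟩
      rw [Nat.sub_sub_self hk.le, hki]
      exact ⟨i.2, hx, hi⟩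
    have hfirst : ∀ a x, 0 < a → a ≤ N → D.BagAt (qu (N - a)) x → s₂.a .TOP x ≤ a ∧
        0 < s₂.a .TOP x ∧ s₂.a .TOP x ≤ N ∧ D.BagAt (qu (N - s₂.a .TOP x)) x := by
      intro a x ha haN hx
      obtain ⟨j, hj, hf⟩ := (hbag a ha haN x).2 hx
      obtain ⟨k1, j', ⟨k2, k3, k4⟩, k5⟩ := h2 a j x ⟨ha, haN, hj⟩ hf
      exact ⟨k1, k2, k3, (hbag _ k2 k3 x).1 ⟨j', k4, k5⟩⟩
    refine ⟨fun x hx => ?_, fun x hx => ?_, fun x hx => ?_, fun a x ha haN hx => (hfirst a x ha haN hx).1⟩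
    all_goals
      obtain ⟨a, ha, haN, hb⟩ := hmem x hx
      have := hfirst a x ha haN hb
      simp only [this]

end
end RAM

/-! ## The whole program and its running time -/

namespace RAM
open BinTree Cmd

/-- Finds a maximum binary tree. -/
def maxBinaryTree : Cmd :=
  parse ;; countNeighbours ;; collectLeaves ;; removeLeaves ;; layOut ;; solve ;; output

section
variable {E : Env} {n N : ℕ} {L : List (Fin n × Fin n)} {F : List (Fin N × Fin N)}
  {X : Fin N → List (Fin n)} {bp : ℕ → ℕ} {G : SimpleGraph (Fin n)}
  {D : TreeDecomposition G (Fin N)}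

theorem maxBinaryTree_spec (hv : InputView E.inp E.len L F X bp)
    (hE : Suffices E n L.length N (bagMax X)) (hn : 0 < n) (hL : ListsEdges L G.edgeSet)
    (hF : ListsEdges F D.tree.edgeSet) (hX : ∀ i, Lists (X i) (D.bag i : Set (Fin n))) :
    Spec E maxBinaryTree St.zero fun s => ∃ (T : G.Subgraph) (y : List ℕ),
      IsMaximumBinaryTree T ∧ IsOutput T y ∧ s.v .cnt = y.length ∧ Out s 0 y := by
  have hM := hE.M_le'
  have hlen := hv.bp_zero_le
  have hNF := length_of_listsEdges D.isTree hF
  unfold maxBinaryTree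
  refine (parse_spec hv (by omega) (by omega) hE).seq fun s₁ hf₁ ⟨hs₁, hbp⟩ => ?_
  -- The tables, marks, parents and types rely on memory that is zero until their first use.
  have z₁ : ∀ A, parse.modsA A = false → ∀ i, s₁.a A i = 0 := fun A hA i => by rw [hf₁.a A hA]; rfl
  refine (countNeighbours_spec hv hE hs₁ D.isTree hF (z₁ .DEG rfl) (z₁ .SUM rfl)).seq
    fun s₂ hf₂ hc => ?_
  have hs₂ := hs₁.of_frame hf₂ (by decide)
  refine (collectLeaves_spec hE hs₂).seq fun s₃ hf₃ hl => ?_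
  have hs₃ := hs₂.of_frame hf₃ (by decide)
  have eD : s₃.a .DEG = s₂.a .DEG := hf₃.a _ rfl
  have eS : s₃.a .SUM = s₂.a .SUM := hf₃.a _ rfl
  refine (removeLeaves_spec (T := D.tree) hE hs₃ ?_).seq fun s₄ hf₄ ho => ?_
  · rw [eD, eS]
    exact hc.stripped D.isTree hF hl.lt hl.inj (eD ▸ hl.leaf)
  have hs₄ := hs₃.of_frame hf₄ (by decide)
  have z₄ : ∀ A, parse.modsA A = false → countNeighbours.modsA A = false →
      collectLeaves.modsA A = false → removeLeaves.modsA A = false → ∀ i, s₄.a A i = 0 :=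
    fun A h1 h2 h3 h4 i => by rw [hf₄.a A h4, hf₃.a A h3, hf₂.a A h2]; exact z₁ A h1 i
  refine (layOut_spec hv hE hs₄ (by rw [hf₄.a _ rfl, hf₃.a _ rfl, hf₂.a _ rfl]; exact hbp) hn hX ho
    (z₄ .PAR rfl rfl rfl rfl) (z₄ .SL rfl rfl rfl rfl) (z₄ .TY rfl rfl rfl rfl)).seq
    fun s₅ hf₅ hlo => ?_
  have hs₅ := hs₄.of_frame hf₅ (by decide)
  have hI := hlo.valid hL
  have hR := hlo.represents hL
  set I := layoutOf s₅ (N + 1 + L.length + n) (bagMax X + 2) with hIdef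
  have eM : I.M = N + 1 + L.length + n := rfl
  have eK : I.K = bagMax X + 2 := rfl
  have hsz : Sizes E I := ⟨by omega, by omega, hE.K_lim, hE.S_lim, hE.B_ge, by omega⟩
  have hsv : ∀ s, Parsed n L.length N (bagMax X) s → SizeVars I s := fun s h =>
    ⟨h.K_eq, h.D_eq, h.S_eq, by rw [h.M1_eq, eM]; omega⟩
  have hh : Holds I s₅ := ⟨fun _ _ _ _ => rfl, fun _ _ _ => rfl, fun _ _ => rfl⟩
  refine (solve_spec hsz hI (hsv _ hs₅) hh hs₅.M_eq hE.M_lim hE.M1_lim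
    (fun i => by rw [hf₅.a _ rfl]; exact z₄ .T rfl rfl rfl rfl i) (Layout.feasible_exists hR hn)).seq
    fun s₆ hf₆ ⟨hfe, hopt⟩ => ?_
  have hs₆ := hs₅.of_frame hf₆ (by decide)
  refine (output_spec hsz hI (hsv _ hs₆) (hh.of_frame hf₆ rfl rfl rfl) hR hv (by omega) hs₆.M_eq hs₆.n_eq
    hs₆.N1_eq hs₆.m_eq hE.M_lim hE.n_lim hE.m_lim (by omega)
    (fun i => by rw [hf₆.a _ rfl, hf₅.a _ rfl]; exact z₄ .MARK rfl rfl rfl rfl i)).mono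
    fun s₇ hf₇ ⟨y, h1, h2, h3⟩ => ?_
  exact ⟨_, y, Layout.isMaximumBinaryTree_of_optimal hR hfe hopt, h1, h2, h3⟩

end

/-- Is the variable a number that is linear in the size of the graph? -/
def large : Var → Bool
  | .n | .m | .N | .M | .M1 => true
  | _ => false

/-- This is the linearity of the algorithm: loops over vertices, edges or nodes contain only loops
over positions and states. -/
theorem depth_large : maxBinaryTree.depth large = 1 := by decide

theorem wf_maxBinaryTree : maxBinaryTree.wf = true := by decide

end RAM

/-! ### Numerical estimates -/

namespace BinTree

section
variable {n N : ℕ} {G : SimpleGraph (Fin n)} {D : TreeDecomposition G (Fin N)}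
  {L : List (Fin n × Fin n)} {X : Fin N → List (Fin n)}

theorem length_eq_card {α : Type*} {l : List α} {S : Finset α} (h : Lists l (S : Set α)) :
    l.length = S.card := by
  classical
  rw [← List.toFinset_card_of_nodup h.1]
  congr 1
  ext a
  rw [List.mem_toFinset, h.2, Finset.mem_coe]

/-- There is a vertex, so the largest bag is nonempty and the subtraction in the width is exact. -/
theorem bagMax_eq (hX : ∀ i, Lists (X i) (D.bag i : Set (Fin n))) (hn : 0 < n) :
    RAM.bagMax X = D.width + 1 := by
  have h : RAM.bagMax X = Finset.univ.sup fun i => (D.bag i).card :=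
    Finset.sup_congr rfl fun i _ => length_eq_card (hX i)
  obtain ⟨i, hi⟩ := D.vertex_mem ⟨0, hn⟩
  have h1 : (D.bag i).card ≤ Finset.univ.sup fun i => (D.bag i).card :=
    Finset.le_sup (f := fun i => (D.bag i).card) (Finset.mem_univ i)
  have h2 : 0 < (D.bag i).card := Finset.card_pos.2 ⟨_, hi⟩
  rw [h, TreeDecomposition.width]
  omega

/-- Every edge is an unordered pair within one of the bags. -/
theorem length_edges_le (hL : ListsEdges L G.edgeSet) (hX : ∀ i, Lists (X i) (D.bag i : Set (Fin n))) :
    L.length ≤ N * (RAM.bagMax X * RAM.bagMax X) := by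
  classical
  rw [← List.length_map (f := fun e : Fin n × Fin n => s(e.1, e.2)) (as := L),
    ← List.toFinset_card_of_nodup hL.1]
  have hsub : (L.map fun e : Fin n × Fin n => s(e.1, e.2)).toFinset ⊆
      Finset.univ.biUnion fun i => (D.bag i ×ˢ D.bag i).image fun e => s(e.1, e.2) := by
    intro e he
    rw [List.mem_toFinset, hL.2] at he
    induction e using Sym2.ind with
    | _ u v =>
      obtain ⟨i, h1, h2⟩ := D.edge_mem u v he
      exact Finset.mem_biUnion.2 ⟨i, Finset.mem_univ i,
        Finset.mem_image.2 ⟨(u, v), Finset.mem_product.2 ⟨h1, h2⟩, rfl⟩⟩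
  refine (Finset.card_le_card hsub).trans ?_
  refine (Finset.card_biUnion_le_card_mul _ _ (RAM.bagMax X * RAM.bagMax X) fun i _ => ?_).trans_eq
    (by rw [Finset.card_univ, Fintype.card_fin])
  refine Finset.card_image_le.trans ?_
  rw [Finset.card_product, ← length_eq_card (hX i)]
  exact Nat.mul_le_mul (RAM.le_bagMax X i) (RAM.le_bagMax X i)

theorem length_output_le {T : G.Subgraph} {y : List ℕ} (hL : ListsEdges L G.edgeSet) (hy : IsOutput T y) :
    y.length ≤ 2 + n + 2 * L.length := by
  obtain ⟨A, B, hA, hB, rfl⟩ := hy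
  have h1 : A.length ≤ n := by
    simpa using hA.1.length_le_card
  have h2 : B.length ≤ L.length := by
    have hsub : (B.map fun e : Fin n × Fin n => s(e.1, e.2)) ⊆ L.map fun e => s(e.1, e.2) := by
      intro e he
      exact (hL.2 e).2 (T.edgeSet_subset ((hB.2 e).1 he))
    simpa using (hB.1.subperm hsub).length_le
  simp only [List.length_append, List.length_cons, length_pairWords, vertexWords_eq, List.length_map]
  omega

/-- For `w ≥ 1` every factor is a power of `w + 1 ≥ 2` with exponent `O(w)`. For `w = 0` the power
on the right is one, and the constant has to do all the work. -/
theorem mul_pow_le (C d : ℕ) : ∃ c : ℕ, ∀ w Z M : ℕ, M ≤ 4 * (w + 1) ^ 2 * Z →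
    C * (M * ((4 * (w + 3)) ^ (w + 3)) ^ d) ≤ c * (w + 1) ^ (c * w) * Z := by
  -- The first summand settles `w = 0`, where `(4 * 3) ^ 3` states remain; the second is the
  -- exponent and the third the leading factor for `w ≥ 1`.
  refine ⟨C * 4 * (12 ^ 3) ^ d + (16 * d + 4) + C, fun w Z M hM => ?_⟩
  set c := C * 4 * (12 ^ 3) ^ d + (16 * d + 4) + C with hc
  rcases Nat.eq_zero_or_pos w with rfl | hw
  · simp only [zero_add, one_pow, mul_one, mul_zero, pow_zero] at hM ⊢
    calc C * (M * ((4 * 3) ^ 3) ^ d) ≤ C * (4 * Z * ((4 * 3) ^ 3) ^ d) := by gcongr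
      _ = C * 4 * (12 ^ 3) ^ d * Z := by norm_num; ring
      _ ≤ c * Z := Nat.mul_le_mul_right _ (by omega)
  · set b := w + 1 with hb
    have hb2 : 2 ≤ b := by omega
    have h1 : 4 * (w + 3) ≤ b ^ 4 := by
      have : 2 ^ 3 ≤ b ^ 3 := Nat.pow_le_pow_left hb2 3
      calc 4 * (w + 3) ≤ 2 ^ 3 * b := by omega
        _ ≤ b ^ 3 * b := Nat.mul_le_mul_right _ this
        _ = b ^ 4 := by ring
    have h2 : 4 * b ^ 2 ≤ b ^ (4 * w) := by
      have : 2 ^ 2 ≤ b ^ 2 := Nat.pow_le_pow_left hb2 2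
      calc 4 * b ^ 2 ≤ b ^ 2 * b ^ 2 := Nat.mul_le_mul_right _ this
        _ = b ^ 4 := by ring
        _ ≤ b ^ (4 * w) := Nat.pow_le_pow_right (by omega) (by omega)
    have h3 : ((4 * (w + 3)) ^ (w + 3)) ^ d ≤ b ^ (16 * d * w) := by
      calc ((4 * (w + 3)) ^ (w + 3)) ^ d ≤ ((b ^ 4) ^ (w + 3)) ^ d := by gcongr
        _ = b ^ (4 * (w + 3) * d) := by rw [← pow_mul, ← pow_mul, mul_assoc]
        -- For `w ≥ 1` one has `w + 3 ≤ 4 * w`.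
        _ ≤ b ^ (16 * d * w) := Nat.pow_le_pow_right (by omega) (by
          calc 4 * (w + 3) * d ≤ 16 * w * d := Nat.mul_le_mul_right _ (by omega)
            _ = 16 * d * w := by ring)
    calc C * (M * ((4 * (w + 3)) ^ (w + 3)) ^ d) ≤ C * (b ^ (4 * w) * Z * b ^ (16 * d * w)) := by
          gcongr
          exact hM.trans (Nat.mul_le_mul_right _ h2)
      _ = C * b ^ ((16 * d + 4) * w) * Z := by
          rw [show (16 * d + 4) * w = 4 * w + 16 * d * w by ring, pow_add]; ring
      _ ≤ c * b ^ (c * w) * Z := by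
          refine Nat.mul_le_mul_right _ (Nat.mul_le_mul (by omega) ?_)
          exact Nat.pow_le_pow_right (by omega) (Nat.mul_le_mul_right _ (by omega))

end

end BinTree

/-! ### The size of the input and the main theorem -/

namespace BinTree

theorem InputView.length_le {inp : ℕ → ℕ} {len n N : ℕ} {L : List (Fin n × Fin n)}
    {F : List (Fin N × Fin N)} {X : Fin N → List (Fin n)} {bp : ℕ → ℕ} (hv : InputView inp len L F X bp) :
    len ≤ 3 + 2 * L.length + 2 * F.length + N * (RAM.bagMax X + 1) := by
  have key : ∀ i ≤ N, bp i ≤ bp 0 + i * (RAM.bagMax X + 1) := by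
    intro i hi
    induction i with
    | zero => omega
    | succ i ih =>
      have h1 := hv.bp_succ ⟨i, hi⟩
      have h2 := RAM.le_bagMax X ⟨i, hi⟩
      have h3 := ih (by omega)
      simp only at h1
      rw [h1, Nat.succ_mul]
      omega
  have := key N le_rfl
  rwa [hv.bp_last, hv.bp_zero] at this

theorem lt_of_mem_pairWords {n : ℕ} {L : List (Fin n × Fin n)} {a : ℕ} (h : a ∈ pairWords L) : a < n := by
  obtain ⟨e, -, he⟩ := List.mem_flatMap.1 h
  simp only [List.mem_cons, List.not_mem_nil, or_false] at he
  rcases he with rfl | rfl <;> exact Fin.is_lt _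

theorem input_le {n N k b : ℕ} {L : List (Fin n × Fin n)} {F : List (Fin N × Fin N)}
    {X : Fin N → List (Fin n)} {x : List ℕ}
    (hx : x = [n, L.length, N] ++ pairWords L ++ pairWords F ++
      (List.finRange N).flatMap fun i => (X i).length :: vertexWords (X i))
    (hn : n ≤ b) (hL : L.length ≤ b) (hN : N ≤ b) (hX : ∀ i, (X i).length ≤ k) (hk : k ≤ b) (i : ℕ) :
    x.getD i 0 ≤ b := by
  have key : ∀ a ∈ x, a ≤ b := by
    intro a ha
    rw [hx] at ha
    simp only [List.mem_append, List.mem_cons, List.not_mem_nil, or_false, List.mem_flatMap,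
      List.mem_finRange, true_and, vertexWords_eq, List.mem_map] at ha
    rcases ha with (((rfl | rfl | rfl) | ha) | ha) | ⟨i, rfl | ⟨v, -, rfl⟩⟩
    · exact hn
    · exact hL
    · exact hN
    · exact (lt_of_mem_pairWords ha).le.trans hn
    · exact (lt_of_mem_pairWords ha).le.trans hN
    · exact (hX i).trans hk
    · exact v.2.le.trans hn
  rw [List.getD_eq_getElem?_getD]
  rcases lt_or_ge i x.length with h | h
  · rw [List.getElem?_eq_getElem h]
    exact key _ (List.getElem_mem h)
  · rw [List.getElem?_eq_none h]
    exact Nat.zero_le b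

end BinTree

theorem theorem4 :
    ∃ (P : RAM.Prog) (c : ℕ),
      ∀ (n N : ℕ) (G : SimpleGraph (Fin n)) (D : BinTree.TreeDecomposition G (Fin N)) (x : List ℕ),
        0 < n → BinTree.IsInput G D x →
        ∃ (t : ℕ) (s : RAM.State) (T : G.Subgraph) (y : List ℕ),
          RAM.Exec (c * (D.width + 1) ^ (c * D.width) * max n N) P (RAM.State.init x) t s ∧
          t ≤ c * (D.width + 1) ^ (c * D.width) * max n N ∧
          BinTree.IsMaximumBinaryTree T ∧ BinTree.IsOutput T y ∧ s.HasOutput y := by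
  set d := RAM.maxBinaryTree.depth fun x => !RAM.large x with hd
  -- The exponent `d + 1` makes the bound dominate the table size `M * S` as well as the time `M * S
  -- ^ d`. The additional `100` pays for the interleaved addresses, for reading the input length and
  -- for copying the output.
  obtain ⟨c, hc⟩ := BinTree.mul_pow_le (RAM.maxBinaryTree.coef + 100) (d + 1)
  refine ⟨RAM.program RAM.maxBinaryTree, c, fun n N G D x hn ⟨L, F, X, hL, hF, hX, hx⟩ => ?_⟩
  obtain ⟨bp, hv⟩ := BinTree.inputView L F X x hx
  have hNF := BinTree.length_of_listsEdges D.isTree hF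
  have hk := BinTree.bagMax_eq hX hn
  have hm := BinTree.length_edges_le hL hX
  set w := D.width with hw
  set M := N + 1 + L.length + n with hMdef
  set S := (4 * (w + 3)) ^ (w + 3) with hS
  have hN1 : 1 ≤ N := by omega
  -- Each of the four summands of `M` is at most `(w + 1) ^ 2 * max n N`; for the edges this is
  -- `length_edges_le`.
  have hM : M ≤ 4 * (w + 1) ^ 2 * max n N := by
    rw [hk] at hm
    have h1 : N * ((w + 1) * (w + 1)) ≤ max n N * (w + 1) ^ 2 := by
      rw [sq]; exact Nat.mul_le_mul_right _ (le_max_right n N)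
    have h2 : max n N * 1 ≤ max n N * (w + 1) ^ 2 := Nat.mul_le_mul_left _ (Nat.one_le_pow _ _ (by omega))
    have h3 := le_max_left n N
    have h4 := le_max_right n N
    rw [show 4 * (w + 1) ^ 2 * max n N = 4 * (max n N * (w + 1) ^ 2) by ring]
    omega
  have hS8 : 8 * (4 * (w + 3)) ≤ S := by
    calc 8 * (4 * (w + 3)) ≤ (4 * (w + 3)) * (4 * (w + 3)) := Nat.mul_le_mul_right _ (by omega)
      _ = (4 * (w + 3)) ^ 2 := (sq _).symm
      _ ≤ S := Nat.pow_le_pow_right (by omega) (by omega)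
  have hMS : M * (8 * (4 * (w + 3))) ≤ M * S := Nat.mul_le_mul_left _ hS8
  have hMS' : M * 96 ≤ M * S := Nat.mul_le_mul_left _ (by omega)
  have hSM : S ≤ M * S := Nat.le_mul_of_pos_left _ (by omega)
  have hpow : M * S ≤ M * S ^ (d + 1) := Nat.mul_le_mul_left _ (Nat.le_self_pow (by omega) _)
  have hlen : x.length ≤ M * S := by
    have h1 := hv.length_le
    rw [hk] at h1
    have h2 : N * (w + 1 + 1) ≤ M * (w + 1 + 1) := Nat.mul_le_mul_right _ (by omega)
    have h3 : M * (w + 1 + 1) + 3 * M ≤ M * (8 * (4 * (w + 3))) := by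
      rw [mul_comm 3 M, ← mul_add]
      exact Nat.mul_le_mul_left _ (by omega)
    omega
  have hin : ∀ i, x.getD i 0 ≤ M * S :=
    BinTree.input_le hx (by omega) (by omega) (by omega) (fun i => hk ▸ RAM.le_bagMax X i) (by omega)
  -- All contents of cells are bounded by the total table size; the limits are `M` for loops over
  -- the graph and `S` for all others.
  let E : RAM.Env := ⟨fun i => x.getD i 0, x.length, M * S, fun v => if RAM.large v then M else S⟩
  have hE : RAM.Suffices E n L.length N (RAM.bagMax X) := by
    rw [hk]
    refine ⟨?_, ?_, ?_, ?_, ?_, ?_, ?_, ?_, hlen⟩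
    · exact show n ≤ M by omega
    · exact show L.length ≤ M by omega
    · exact show N ≤ M by omega
    · exact show M ≤ M from le_rfl
    · exact show M ≤ M from le_rfl
    · exact show w + 3 ≤ S by omega
    · exact show S ≤ S from le_rfl
    · exact show M * S ≤ M * S from le_rfl
  have hbound := hc w (max n N) M hM
  rw [← hS, add_mul] at hbound
  have hB : x.length + (M * S * RAM.arrays + RAM.arrays) ≤ c * (w + 1) ^ (c * w) * max n N := by
    rw [RAM.arrays]
    omega
  obtain ⟨t, s', s, h1, h2, ⟨T, y, h3, h4, h5, h6⟩, h7⟩ := RAM.program_spec (E := E) rfl rfl hv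
    (by omega) (by omega) (show N + 3 ≤ M * S by omega) hB hin RAM.wf_maxBinaryTree
    (RAM.maxBinaryTree_spec hv hE hn hL hF hX)
  refine ⟨t, s', T, y, h1, ?_, h3, h4, fun i hi => ?_⟩
  · have h8 := RAM.Cmd.time_le RAM.large (X := M) (Y := S) (by omega) (by omega) RAM.maxBinaryTree
    rw [RAM.depth_large, pow_one, ← hd] at h8
    have h9 : RAM.maxBinaryTree.coef * (M * S ^ d) ≤ RAM.maxBinaryTree.coef * (M * S ^ (d + 1)) :=
      Nat.mul_le_mul_left _ (Nat.mul_le_mul_left _ (Nat.pow_le_pow_right (by omega) (by omega)))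
    have h10 := BinTree.length_output_le hL h4
    change t ≤ RAM.maxBinaryTree.time (fun v => if RAM.large v then M else S) + _ at h2
    omega
  · rw [h7 i (by omega)]
    simpa using h6 i hi
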